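/- **Setting.** Let $M$ be a closed (compact, Hausdorff, boundaryless) smooth 3-manifold with a fixed smooth frame $L_1,L_2,L_3$ of $TM$, let $\Omega=[0,\infty)\times M$ with coordinate $\tau$ on the first factor and $\partial_0=\partial_\tau$, and let $C^\infty=C^\infty(\Omega,\mathbb R)$; functions on $M$ are viewed as functions on $\Omega$ independent of $\tau$. Let $W=\bigoplus_{i=0}^3 C^\infty\theta_i$ with $\eta=\mathrm{diag}(-1,1,1,1)$, and let $\mathrm{CDer}(W)\subset\mathrm{Der}^0(\wedge W)$ be the derivations preserving the conformal class of $\eta$, with $C^\infty$-basis $\partial_0,L_1,L_2,L_3$ (annihilating the $\theta_a$), $\sigma_0$ ($\sigma_0\theta_a=\theta_a$) and $\sigma_i=\sigma_{0i},\ \sigma_{23},\sigma_{31},\sigma_{12}$ ($\sigma_{ab}\theta_c=\eta_{bc}\theta_a-\eta_{ac}\theta_b$). On $\mathcal L=\wedge W\otimes\mathrm{CDer}(W)$ use the bracket $[\omega\delta,\omega'\delta']=\omega\omega'[\delta,\delta']+\omega\,\delta(\omega')\delta'-\delta'(\omega)\omega'\delta$. Throughout, $(i,j,k)$ denotes cyclic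 permutations of $(1,2,3)$. Let $\mathcal I=(\wedge W)\,\mathcal I^2$, where $\mathcal I^2\subset\mathcal L^2$ is the $C^\infty$-span of $\mathrm{Re}\sum_{a,b=1}^3 S_{ab}(\theta_0\theta_a+\mathrm i\,\theta_{a'}\theta_{a''})(\sigma_b+\mathrm i\,\sigma_{b'b''})$ with $S$ complex symmetric traceless and $(a,a',a''),(b,b',b'')$ cyclic, and let $\mathcal E=\mathcal L/\mathcal I$. Let $\mathcal E_\Phi=\mathcal E\oplus\Phi$ with $\Phi^0=0$, $\Phi^1=W$ (basis $\underline{\theta_i}$), $\Phi^2=\wedge^2W\oplus\wedge^4W$ (only degrees $\le 2$ are used below), where $w\cdot\varphi=w\varphi\oplus w\varphi^*$ for $w\in W,\varphi\in\Phi^1$ (with $\theta_0^*=\theta_1\theta_2\theta_3$, $\theta_1^*=\theta_0\theta_2\theta_3$, $\theta_2^*=\theta_0\theta_3\theta_1$, $\theta_3^*=\theta_0\theta_1\theta_2$), $[\delta,\varphi]=\delta(\varphi)$ and $[\omega\delta,\varphi]=\omega\cdot\delta(\varphi)$ for $\delta\in\mathrm{CDer}(W),\ \omega\in W$, and, for $\varphi=a^i\underline{\theta_i}$,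 $[\varphi,\varphi]=(-6a^pa^q+\eta_{bc}a^ba^c\eta^{pq})\eta^{ij}\theta_i\theta_p\sigma_{jq}\in\mathcal E^2$. For a graded Lie algebra $\mathfrak g$, $\mathrm{MC}(\mathfrak g)=\{u\in\mathfrak g^1\mid[u,u]=0\}$. **Filtration.** The *gauge basis elements* of degree $\alpha\in\mathbb N^3$ (homological degrees $0,1,2$) are as follows, where $L_\mu$ runs over $\partial_0,L_1,L_2,L_3$ and $e_i$ is the $i$-th unit multi-index. - $\alpha=0$: $L_\mu$, $\sigma_0$; $\theta_0\sigma_0+\theta_i\sigma_i$, $\underline{\theta_0}$; $\sum_{(i,j,k)}(\theta_j\theta_k\sigma_{jk}+2\theta_0\theta_i\sigma_i)$. - $\alpha=2e_i$: $-\theta_i\sigma_{jk}+\theta_j\sigma_{ki}+\theta_k\sigma_{ij}$. - $\alpha=e_j+e_k$: $\sigma_i$, $\sigma_{jk}$; $\theta_iL_\mu$, $\theta_0\sigma_i+\theta_i\sigma_0$, $\theta_j\sigma_k+\theta_k\sigma_j$, $\theta_k\sigma_{ki}$, $\theta_j\sigma_{ij}$, $\underline{\theta_i}$; $\theta_0\theta_j\sigma_{ij}+\theta_i\theta_j\sigma_j$.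 - $\alpha=2e_i+e_j+e_k$: $\theta_j\sigma_k-\theta_k\sigma_j$; $\theta_j\theta_kL_\mu$, $\theta_0\theta_j\sigma_k-\theta_0\theta_k\sigma_j-2\theta_j\theta_k\sigma_0$, $\theta_0\theta_j\sigma_k+\theta_0\theta_k\sigma_j-2\theta_i\theta_j\sigma_{ki}$, $\underline{\theta_j\theta_k}$. - $\alpha=(2,2,2)$: $\sum_{(i,j,k)}(\theta_0\theta_i\sigma_{jk}-2\theta_j\theta_k\sigma_i)$. The *basis elements* of degree $\alpha$ are the gauge basis elements of degree $\alpha$ and $\theta_0$ times these. Let $G_\alpha$ be their $C^\infty$-span, $F_\alpha=\bigoplus_{\beta\le\alpha}G_\beta$, $\mathcal P=\{\sum_\alpha x_\alpha s^\alpha\mid x_\alpha\in F_\alpha\}$ (formal power series in $s=(s_1,s_2,s_3)$, the Rees algebra), and $\mathcal A=\mathcal P/s\mathcal P$ with $s\mathcal P=\sum_i s_i\mathcal P$ (associated graded algebra), with projection $\pi:\mathrm{MC}(\mathcal P)\to\mathrm{MC}(\mathcal A)$. One has $\mathcal A\simeq\bigoplus_\alpha G_\alpha s^\alpha$ as modules;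 setting $s_1=s_2=s_3=1$ turns an element of $\mathcal A^1$ into one of $\mathcal E_\Phi^1$. **Leading terms.** Let $\mathrm{MC}(\mathcal A)^+_{\mathrm{gauged}}$ be the set of $x\in\mathrm{MC}(\mathcal A)$ such that: (a) $x-\theta_0\partial_0$ is a $C^\infty$-linear combination of the gauge basis elements of homological degree one (times $s^\alpha$) other than $\theta_i\partial_0$, $\theta_j\sigma_k+\theta_k\sigma_j$, $\theta_j\sigma_k-\theta_k\sigma_j$; (b) writing the element of $\mathcal E_\Phi^1$ obtained at $s=1$ as $\sum_i\theta_i\delta_i\oplus\varphi$, the derivations $E_i=\delta_i|_{C^\infty}$, $i=0,\dots,3$, form a basis of $\mathrm{Der}(C^\infty)$; (c) if $w_i$ is the coefficient of $\theta_i\sigma_0$ and $\varphi_i$ that of $\underline{\theta_i}$, then there are $f,g\in C^\infty$ with $E_if=w_i$ and $E_ig=\varphi_i$ for all $i$; (d) the coefficients of $\theta_0\sigma_0+\theta_i\sigma_i$, $i=1,2,3$, are positive on $\Omega$. Consider tuples $T=(D_1,D_2,D_3,p_1,p_2,p_3,p_0,\zeta,\chi)$ of a frame $D_1,D_2,D_3$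 on $M$, with structure functions $[D_i,D_j]=\sum_kc_{ij}^kD_k$, and functions $p_1,p_2,p_3,p_0,\zeta,\chi\in C^\infty(M)$. Put $\bar s_i=s_ie^{-p_i\tau}$ and let $x_T\in\mathcal A^1$ be $$\theta_0\partial_0+p_0\underline{\theta_0}+\sum_{(i,j,k)}\Big(p_i(\theta_0\sigma_0+\theta_i\sigma_i)+\tfrac12\bar s_i^2c_{jk}^i(\theta_i\sigma_{jk}-\theta_j\sigma_{ki}-\theta_k\sigma_{ij})+\bar s_j\bar s_k\theta_iD_i-\bar s_j\bar s_k\big(D_i\zeta-\tau D_i(p_1+p_2+p_3)\big)(\theta_0\sigma_i+\theta_i\sigma_0)$$ $$+\bar s_j\bar s_k(D_i\zeta+c_{ki}^k-\tau D_ip_k)\theta_k\sigma_{ki}-\bar s_j\bar s_k(D_i\zeta-c_{ij}^j-\tau D_ip_j)\theta_j\sigma_{ij}+\bar s_j\bar s_k(D_i\chi+\tau D_ip_0)\underline{\theta_i}\Big).$$ Let $\mathcal U[\tau]$ be the linear combinations of basis elements with coefficients in $C^\infty(M)[\tau]$, and let $\mathcal P_p=\{\sum_\alpha x_\alpha\bar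 s^\alpha\mid x_\alpha\in F_\alpha\cap\mathcal U[\tau]\}\subset\mathcal P$ and $\bar s\mathcal P_p=\sum_i\bar s_i\mathcal P_p$. **Theorem.** Every $x\in\mathrm{MC}(\mathcal A)^+_{\mathrm{gauged}}$ is of the form $x=x_T$ for some tuple $T$. For every such $x$ and every $T$ with $x=x_T$: 1. there exists $\gamma=\sum_\alpha\gamma_\alpha\bar s^\alpha\in\mathrm{MC}(\mathcal P_p)$ with leading term $x$, that is, $\gamma$ is mapped to $x$ by $\pi$; 2. if $\gamma,\gamma'\in\mathrm{MC}(\mathcal P_p)$ both have leading term $x$, then $\gamma'=\exp([a,-])\gamma$ for some $a\in\bar s\mathcal P_p^0$. Moreover, the assignment $x\mapsto\gamma$ can be realized as a map $S_{\mathrm{formal}}:\mathrm{MC}(\mathcal A)^+_{\mathrm{gauged}}\to\mathrm{MC}(\mathcal P)$ with $\pi\circ S_{\mathrm{formal}}=\mathrm{id}$ such that, for all $x$ and all $T$ with $x=x_T$, one has $S_{\mathrm{formal}}(x)=\sum_\alpha\gamma_\alpha\bar s^\alpha\in\mathrm{MC}(\mathcal P_p)$ and: - (g1) for $\alpha\ne0$,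 $\gamma_\alpha$ is a linear combination of the gauge basis elements (of homological degree one) of degrees $\le\alpha$; - (g2) each coefficient in (g1) is a polynomial in $\tau$ whose coefficients are polynomials, independent of $x$ and $T$, in (i) the entries of $T$ (the $D_i$ through their components relative to $L_1,L_2,L_3$) and their derivatives of orders $\le|\alpha|$ along $D_1,D_2,D_3$, (ii) the structure functions $c_{ij}^k$ and their derivatives of orders $\le|\alpha|$ along $D_1,D_2,D_3$, (iii) $(n_1p_1+n_2p_2+n_3p_3)^{-1}$ with $n\in\mathbb N^3\setminus\{0\}$; - (g3) $\gamma_\alpha=0$ when $|\alpha|$ is odd. -/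

import Mathlib

open scoped Manifold ContDiff

noncomputable section

namespace BKL

/-! ## The graded Lie algebra in degrees 0, 1, 2, over a commutative `ℝ`-algebra `R`

Maurer-Cartan elements have degree one, the Maurer-Cartan equation lives in degree two, and gauge
transformations are generated by degree zero.  All module elements are written in the basis
`θ₀, …, θ₃` of the free module `W = R⁴`. -/

section Algebra

variable (R : Type*) [CommRing R] [Algebra ℝ R]

/-- `Der⁰(∧W) ≃ End_R(W) ⊕ Der(R)`.  The pair `(A, X)` is the derivation that acts as `X` on `R`
and maps `θ_c` to `∑ₐ A a c • θ_a`. -/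
abbrev Der0 : Type _ := Matrix (Fin 4) (Fin 4) R × Derivation ℝ R R

/-- `W ⊗ Der⁰(∧W)`: the array `γ` stands for `∑ᵢ θᵢ ⊗ γ i`. -/
abbrev L1 : Type _ := Fin 4 → Der0 R

/-- `∧²W ⊗ Der⁰(∧W)`, inside all arrays: `∑_{i<j} θᵢθⱼ ⊗ δᵢⱼ` is the skew array with entries
`δᵢⱼ` at `(i,j)` and `-δᵢⱼ` at `(j,i)`, for `i < j`. -/
abbrev L2 : Type _ := Fin 4 → Fin 4 → Der0 R

variable {R}

/-- The conformal inner product `η = diag(-1,1,1,1)`. -/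
def eta : Fin 4 → R := ![-1, 1, 1, 1]

/-- The basis element `θᵢ` of `W`. -/
def theta (i : Fin 4) : Fin 4 → R := Pi.single i 1

/-- The action of a degree zero derivation on `W`. -/
def Der0.act (δ : Der0 R) (w : Fin 4 → R) : Fin 4 → R :=
  δ.1.mulVec w + fun i => δ.2 (w i)

/-- The commutator of degree zero derivations. -/
def Der0.comm (δ ε : Der0 R) : Der0 R :=
  (δ.1 * ε.1 - ε.1 * δ.1 + ε.1.map δ.2 - δ.1.map ε.2, ⁅δ.2, ε.2⁆)

/-- The basis element `σ₀`, with `σ₀(θ_a) = θ_a`. -/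
def sigma0 : Der0 R := (1, 0)

/-- The element `σ_{ab}`, with `σ_{ab}(θ_c) = η_{bc} θ_a - η_{ac} θ_b`. -/
def sigma (a b : Fin 4) : Der0 R :=
  (Matrix.single a b (eta b) - Matrix.single b a (eta a), 0)

/-- The spatial index `1, 2, 3` that corresponds to `i = 0, 1, 2`.  Throughout, spatial indices
are elements of `Fin 3`, and the cyclic triples are `(i, i + 1, i + 2)`. -/
def sp (i : Fin 3) : Fin 4 := i.succ

/-- `σᵢ = σ_{0i}`. -/
def boost (i : Fin 3) : Der0 R := sigma 0 (sp i)

/-- `σ_{jk}`, where `(i,j,k)` is cyclic. -/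
def rot (i : Fin 3) : Der0 R := sigma (sp (i + 1)) (sp (i + 2))

/-- A derivation of `R`, extended to annihilate `θ₀, …, θ₃`. -/
def ofDer (X : Derivation ℝ R R) : Der0 R := (0, X)

/-- `w ⊗ δ` for `w ∈ W`. -/
def tens (w : Fin 4 → R) (δ : Der0 R) : L1 R := fun i => w i • δ

/-- `(w w') ⊗ δ` for `w, w' ∈ W`. -/
def wedge (w w' : Fin 4 → R) (δ : Der0 R) : L2 R :=
  fun i j => (w i * w' j - w j * w' i) • δ

/-- `θᵢ δ`. -/
def th1 (i : Fin 4) (δ : Der0 R) : L1 R := tens (theta i) δ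

/-- `θᵢ θⱼ δ`. -/
def th2 (i j : Fin 4) (δ : Der0 R) : L2 R := wedge (theta i) (theta j) δ

variable (R) in
/-- The degree two part of the ideal: the submodule generated by the elements
`Re [(θ₀θₖ + i θₗθₘ)ᵀ S (σₖ + i σₗₘ)]`, where `S` is a symmetric traceless complex matrix and
`(k,l,m)` denotes cyclic triples. -/
def I2 : Submodule R (L2 R) :=
  Submodule.span R {x | ∃ S : Matrix (Fin 3) (Fin 3) ℂ, S.IsSymm ∧ S.trace = 0 ∧
    x = ∑ k : Fin 3, ∑ l : Fin 3,
      (algebraMap ℝ R (S k l).re •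
          (th2 0 (sp k) (boost l) - th2 (sp (k + 1)) (sp (k + 2)) (rot l)) -
        algebraMap ℝ R (S k l).im •
          (th2 0 (sp k) (rot l) + th2 (sp (k + 1)) (sp (k + 2)) (boost l)))}

variable (R)

/-- Degree zero: `ℰ⁰ = CDer(W)` sits in `Der⁰(∧W)` as the span of the basis elements below, and
`Φ⁰ = 0`. -/
abbrev E0 : Type _ := Der0 R

/-- Degree one: `ℰ¹ ⊕ Φ¹ = (W ⊗ CDer(W)) ⊕ W`, inside `(W ⊗ Der⁰(∧W)) ⊕ W`. -/
abbrev E1 : Type _ := L1 R × (Fin 4 → R)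

/-- Degree two: `ℰ² ⊕ Φ² = (∧²W ⊗ CDer(W)) / I² ⊕ ∧²W ⊕ ∧⁴W`, with `CDer(W)` inside
`Der⁰(∧W)`, `∧²W` as skew arrays, and `∧⁴W` via its basis element `θ₀θ₁θ₂θ₃`. -/
abbrev E2 : Type _ := (L2 R ⧸ I2 R) × (Fin 4 → Fin 4 → R) × R

variable {R}

/-- Module multiplication `W × Φ¹ → Φ²`, that is, `(w, φ) ↦ wφ ⊕ wφ*` with `φ*` the basis Hodge
dual; one has `w φ* = -⟨w, φ⟩ θ₀θ₁θ₂θ₃`. -/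
def wPhi (w φ : Fin 4 → R) : (Fin 4 → Fin 4 → R) × R :=
  (fun i j => w i * φ j - w j * φ i, -∑ i, eta i * w i * φ i)

/-- Module multiplication by `θ₀`, from degree zero to degree one. -/
def theta0Mul0 (δ : E0 R) : E1 R := (th1 0 δ, 0)

/-- Module multiplication by `θ₀`, from degree one to degree two. -/
def theta0Mul1 (x : E1 R) : E2 R :=
  (Submodule.Quotient.mk (∑ i, th2 0 i (x.1 i)), wPhi (theta 0) x.2)

/-- The bracket `ℒ¹ × ℒ¹ → ℒ²`, given by
`[ωδ, ω'δ'] = ωω'[δ,δ'] + ωδ(ω')δ' - δ'(ω)ω'δ`. -/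
def brL (γ γ' : L1 R) : L2 R :=
  ∑ i, ∑ j, (th2 i j (Der0.comm (γ i) (γ' j)) +
    wedge (theta i) ((γ i).act (theta j)) (γ' j) -
    wedge ((γ' j).act (theta i)) (theta j) (γ i))

/-- The bracket `ℰ¹ × Φ¹ → Φ²`, given by `[ωδ, φ] = ω δ(φ)`. -/
def brLPhi (γ : L1 R) (φ : Fin 4 → R) : (Fin 4 → Fin 4 → R) × R :=
  ∑ i, wPhi (theta i) ((γ i).act φ)

/-- The symmetric bilinear bracket `Φ¹ × Φ¹ → ℰ²`, before taking the quotient by the ideal, with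
`[φ,φ] = (-6 aᵖaᵠ + ⟨a,a⟩ ηᵖᵠ) ηⁱʲ θᵢθₚσ_{jq}` for `φ` with components `a`. -/
def brPhi (a b : Fin 4 → R) : L2 R :=
  ∑ i, ∑ j, ∑ p, ∑ q,
    ((-3 * (a p * b q + a q * b p) +
        (∑ c, eta c * a c * b c) * Matrix.diagonal eta p q) * Matrix.diagonal eta i j) •
      th2 i p (sigma j q)

/-- The bracket of two elements of degree one. -/
def br11 (x y : E1 R) : E2 R :=
  (Submodule.Quotient.mk (brL x.1 y.1 + brPhi x.2 y.2), brLPhi x.1 y.2 + brLPhi y.1 x.2)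

/-- The bracket of an element of degree zero with an element of degree one. -/
def br01 (δ : E0 R) (x : E1 R) : E1 R :=
  (∑ j, (th1 j (Der0.comm δ (x.1 j)) + tens (δ.act (theta j)) (x.1 j)), δ.act x.2)

end Algebra

/-! ## The BKL grading: distinguished bases and their degrees -/

/-- The index monoid `ℕ³`. -/
abbrev Multi : Type := Fin 3 →₀ ℕ

/-- The multi-index with a one at position `i` and zeros elsewhere. -/
def unit (i : Fin 3) : Multi := Finsupp.single i 1

/-- Labels of the gauge basis in degree zero (which is a basis of degree zero). -/
inductive GB0 : Type
  | der (μ : Fin 4)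
  | conf
  | boost (i : Fin 3)
  | rot (i : Fin 3)
  deriving DecidableEq, Fintype

/-- Labels of the gauge basis in degree one. -/
inductive GB1 : Type
  | diag (i : Fin 3)
  | curv (i : Fin 3)
  | frame (i : Fin 3) (μ : Fin 4)
  | conf (i : Fin 3)
  | sym (i : Fin 3)
  | rotK (i : Fin 3)
  | rotJ (i : Fin 3)
  | asym (i : Fin 3)
  | scalar (i : Fin 4)
  deriving DecidableEq, Fintype

/-- Labels of the gauge basis in degree two. -/
inductive GB2 : Type
  | zero
  | mix (i : Fin 3)
  | frame (i : Fin 3) (μ : Fin 4)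
  | asym (i : Fin 3)
  | sym (i : Fin 3)
  | top
  | scalar (i : Fin 3)
  deriving DecidableEq, Fintype

/-- Labels of the full basis in degree one: gauge basis elements, and `θ₀` times gauge basis
elements of degree zero. -/
abbrev B1 : Type := GB1 ⊕ GB0

/-- Labels of the full basis in degree two: gauge basis elements, and `θ₀` times gauge basis
elements of degree one. -/
abbrev B2 : Type := GB2 ⊕ GB1

/-- The multi-index `011` (for `i` the first index), and its cyclic permutations. -/
def deg011 (i : Fin 3) : Multi := unit (i + 1) + unit (i + 2)

/-- The multi-index `211` (for `i` the first index), and its cyclic permutations. -/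
def deg211 (i : Fin 3) : Multi := 2 • unit i + deg011 i

def GB0.deg : GB0 → Multi
  | der _ => 0
  | conf => 0
  | boost i => deg011 i
  | rot i => deg011 i

def GB1.deg : GB1 → Multi
  | diag _ => 0
  | curv i => 2 • unit i
  | frame i _ => deg011 i
  | conf i => deg011 i
  | sym i => deg011 i
  | rotK i => deg011 i
  | rotJ i => deg011 i
  | asym i => deg211 i
  | scalar i => Fin.cases 0 deg011 i

def GB2.deg : GB2 → Multi
  | zero => 0
  | mix i => deg011 i
  | frame i _ => deg211 i
  | asym i => deg211 i
  | sym i => deg211 i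
  | top => 2 • (unit 0 + unit 1 + unit 2)
  | scalar i => deg211 i

def B1.deg : B1 → Multi := Sum.elim GB1.deg GB0.deg

def B2.deg : B2 → Multi := Sum.elim GB2.deg GB1.deg

section Basis

variable {R : Type*} [CommRing R] [Algebra ℝ R] (e : Fin 4 → Derivation ℝ R R)

/-- The gauge basis elements of degree zero; `e = (∂₀, L₁, L₂, L₃)` is the distinguished basis of
`Der(R)`. -/
def GB0.elt : GB0 → E0 R
  | der μ => ofDer (e μ)
  | conf => sigma0
  | boost i => BKL.boost i
  | rot i => BKL.rot i

/-- The gauge basis elements of degree one, with `(i,j,k)` cyclic: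
* `diag i` is `θ₀σ₀ + θᵢσᵢ`;
* `curv i` is `-θᵢσ_{jk} + θⱼσ_{ki} + θₖσ_{ij}`;
* `frame i μ` is `θᵢ e_μ`;
* `conf i` is `θ₀σᵢ + θᵢσ₀`;
* `sym i` is `θⱼσₖ + θₖσⱼ`;
* `rotK i` is `θₖσ_{ki}`;
* `rotJ i` is `θⱼσ_{ij}`;
* `asym i` is `θⱼσₖ - θₖσⱼ`;
* `scalar i` is the element `θᵢ` of `Φ¹`. -/
def GB1.elt : GB1 → E1 R
  | diag i => (th1 0 sigma0 + th1 (sp i) (boost i), 0)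
  | curv i => (-th1 (sp i) (rot i) + th1 (sp (i + 1)) (rot (i + 1)) +
      th1 (sp (i + 2)) (rot (i + 2)), 0)
  | frame i μ => (th1 (sp i) (ofDer (e μ)), 0)
  | conf i => (th1 0 (boost i) + th1 (sp i) sigma0, 0)
  | sym i => (th1 (sp (i + 1)) (boost (i + 2)) + th1 (sp (i + 2)) (boost (i + 1)), 0)
  | rotK i => (th1 (sp (i + 2)) (rot (i + 1)), 0)
  | rotJ i => (th1 (sp (i + 1)) (rot (i + 2)), 0)
  | asym i => (th1 (sp (i + 1)) (boost (i + 2)) - th1 (sp (i + 2)) (boost (i + 1)), 0)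
  | scalar i => (0, theta i)

/-- The gauge basis elements of degree two that lie in `ℰ²`, before taking the quotient, and those
that lie in `Φ²`, with `(i,j,k)` cyclic:
* `zero` is `θ₂θ₃σ₂₃ + θ₃θ₁σ₃₁ + θ₁θ₂σ₁₂ + 2θ₀θ₁σ₁ + 2θ₀θ₂σ₂ + 2θ₀θ₃σ₃`;
* `mix i` is `θ₀θⱼσ_{ij} + θᵢθⱼσⱼ`;
* `frame i μ` is `θⱼθₖ e_μ`;
* `asym i` is `θ₀θⱼσₖ - θ₀θₖσⱼ - 2θⱼθₖσ₀`;
* `sym i` is `θ₀θⱼσₖ + θ₀θₖσⱼ - 2θᵢθⱼσ_{ki}`;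
* `top` is `θ₀θ₁σ₂₃ + θ₀θ₂σ₃₁ + θ₀θ₃σ₁₂ - 2θ₂θ₃σ₁ - 2θ₃θ₁σ₂ - 2θ₁θ₂σ₃`;
* `scalar i` is the element `θⱼθₖ` of `∧²W ⊂ Φ²`. -/
def GB2.preElt : GB2 → L2 R × (Fin 4 → Fin 4 → R) × R
  | zero => (∑ i : Fin 3, (th2 (sp (i + 1)) (sp (i + 2)) (rot i) +
      (2 : R) • th2 0 (sp i) (boost i)), 0)
  | mix i => (th2 0 (sp (i + 1)) (rot (i + 2)) + th2 (sp i) (sp (i + 1)) (boost (i + 1)), 0)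
  | frame i μ => (th2 (sp (i + 1)) (sp (i + 2)) (ofDer (e μ)), 0)
  | asym i => (th2 0 (sp (i + 1)) (boost (i + 2)) - th2 0 (sp (i + 2)) (boost (i + 1)) -
      (2 : R) • th2 (sp (i + 1)) (sp (i + 2)) sigma0, 0)
  | sym i => (th2 0 (sp (i + 1)) (boost (i + 2)) + th2 0 (sp (i + 2)) (boost (i + 1)) -
      (2 : R) • th2 (sp i) (sp (i + 1)) (rot (i + 1)), 0)
  | top => (∑ i : Fin 3, (th2 0 (sp i) (rot i) -
      (2 : R) • th2 (sp (i + 1)) (sp (i + 2)) (boost i)), 0)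
  | scalar i => (0, (fun a b => theta (sp (i + 1)) a * theta (sp (i + 2)) b -
      theta (sp (i + 1)) b * theta (sp (i + 2)) a, 0))

def GB2.elt (b : GB2) : E2 R := (Submodule.Quotient.mk (b.preElt e).1, (b.preElt e).2)

def B1.elt : B1 → E1 R := Sum.elim (GB1.elt e) (fun b => theta0Mul0 (b.elt e))

def B2.elt : B2 → E2 R := Sum.elim (GB2.elt e) (fun b => theta0Mul1 (b.elt e))

end Basis

/-! ## Filtration, Rees algebra, associated graded -/

section Filtration

variable {R : Type*} [CommRing R] {E : Type*} [AddCommGroup E] [Module R E]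
  {ι : Type*} (deg : ι → Multi) (elt : ι → E)

/-- The graded piece of degree `α`: the `R`-span of the basis elements of degree `α`. -/
def grPiece (R : Type*) [CommRing R] [Module R E] (α : Multi) : Submodule R E :=
  Submodule.span R {x | ∃ b, deg b = α ∧ elt b = x}

/-- The filtration `F_α = ⨁_{β ≤ α} G_β`. -/
def filt (R : Type*) [CommRing R] [Module R E] (α : Multi) : Submodule R E :=
  ⨆ β ∈ Set.Iic α, grPiece deg elt R β

/-- The Rees construction: formal power series `∑_α x_α s^α` with `x_α ∈ F_α`.  A formal power
series is the family of its coefficients. -/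
def rees (R : Type*) [CommRing R] [Module R E] : Submodule R (Multi → E) :=
  Submodule.pi Set.univ (filt deg elt R)

/-- Multiplication of formal power series by the symbol `sᵢ`. -/
def sMul (R : Type*) [CommRing R] [Module R E] (i : Fin 3) : (Multi → E) →ₗ[R] (Multi → E) where
  toFun x α := if α i = 0 then 0 else x (α - unit i)
  map_add' x y := by
    funext α
    by_cases h : α i = 0 <;> simp [h]
  map_smul' c x := by
    funext α
    by_cases h : α i = 0 <;> simp [h]

/-- The subspace `s𝒫 = s₁𝒫 + s₂𝒫 + s₃𝒫`. -/
def sRees (R : Type*) [CommRing R] [Module R E] : Submodule R (Multi → E) :=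
  ⨆ i, (rees deg elt R).map (sMul R i)

/-- Linear combinations of the basis elements with coefficients in a given set of functions. -/
def combos (C : Set R) : Set E :=
  {x | ∃ (s : Finset ι) (f : ι → R), (∀ b, f b ∈ C) ∧ x = ∑ b ∈ s, f b • elt b}

/-- Formal power series `∑_α x_α s̄^α` with `x_α ∈ F_α` a linear combination of basis elements with
coefficients in `C`; here `s̄^α = wt α • s^α`. -/
def reesBar (C : Set R) (wt : Multi → R) : Set (Multi → E) :=
  {x | ∀ α, ∃ y ∈ filt deg elt R α, y ∈ combos elt C ∧ x α = wt α • y}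

/-- The subspace `s̄₁𝒫_p + s̄₂𝒫_p + s̄₃𝒫_p`. -/
def sReesBar (C : Set R) (wt : Multi → R) : Set (Multi → E) :=
  {x | ∃ y : Fin 3 → Multi → E, (∀ i, y i ∈ reesBar deg elt C wt) ∧
    x = ∑ i, wt (unit i) • sMul R i (y i)}

end Filtration

section Series

variable {R : Type*} [CommRing R] [Algebra ℝ R]

/-- The bracket of formal power series with coefficients of degree one. -/
def serBr11 (x y : Multi → E1 R) : Multi → E2 R :=
  fun α => ∑ q ∈ Finset.HasAntidiagonal.antidiagonal α, br11 (x q.1) (y q.2)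

/-- The bracket of formal power series with coefficients of degree zero and one. -/
def serBr01 (a : Multi → E0 R) (x : Multi → E1 R) : Multi → E1 R :=
  fun α => ∑ q ∈ Finset.HasAntidiagonal.antidiagonal α, br01 (a q.1) (x q.2)

/-- The gauge transformation `exp(a)`, acting as `∑ₖ [a, -]ᵏ / k!`.  It is only used for series `a`
without constant term; then `[a, -]ᵏ` has no coefficient at `s^α` for `k > |α|`, so that the
exponential series stops there. -/
def gaugeAct (a : Multi → E0 R) (x : Multi → E1 R) : Multi → E1 R :=
  fun α => ∑ k ∈ Finset.range (α.degree + 1),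
    algebraMap ℝ R ((k.factorial : ℝ)⁻¹) • ((serBr01 a)^[k] x) α

variable (e : Fin 4 → Derivation ℝ R R)

/-- The degree one part of the Rees algebra `𝒫`. -/
def P1 : Submodule R (Multi → E1 R) := rees B1.deg (B1.elt e) R

/-- The Maurer-Cartan elements of the Rees algebra. -/
def MCP : Set (Multi → E1 R) := {γ | γ ∈ P1 e ∧ serBr11 γ γ = 0}

/-- The quotient map by `s𝒫`, in degree one. -/
def toA : (Multi → E1 R) →ₗ[R] (Multi → E1 R) ⧸ sRees B1.deg (B1.elt e) R :=
  (sRees B1.deg (B1.elt e) R).mkQ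

/-- The degree one part of the associated graded algebra `𝒜 = 𝒫 / s𝒫`, realized as the image
of `𝒫¹` in the quotient of all series by `s𝒫¹`. -/
def A1 : Submodule R ((Multi → E1 R) ⧸ sRees B1.deg (B1.elt e) R) := (P1 e).map (toA e)

/-- The Maurer-Cartan elements of `𝒜`.  The bracket on `𝒜` is induced from `𝒫`, so that it
vanishes iff the bracket of representatives is in `s𝒫`. -/
def MCA : Set ((Multi → E1 R) ⧸ sRees B1.deg (B1.elt e) R) :=
  {x | x ∈ A1 e ∧ ∀ u ∈ P1 e, toA e u = x → serBr11 u u ∈ sRees B2.deg (B2.elt e) R}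

/-- The element `∑_b f_b s^{deg b} b` of `𝒫¹`. -/
def series (f : B1 → R) : Multi → E1 R :=
  fun α => ∑ b : B1, if b.deg = α then f b • b.elt e else 0

/-- The element of `𝒜¹` with given coefficients relative to the distinguished basis. -/
def ofCoeff (f : B1 → R) : (Multi → E1 R) ⧸ sRees B1.deg (B1.elt e) R := toA e (series e f)

/-- The element of `𝒜¹` with given coefficients, viewed as an element of degree one of the
original algebra by setting `s₁ = s₂ = s₃ = 1`. -/
def atOne (f : B1 → R) : E1 R := ∑ b : B1, f b • b.elt e

/-- The basis of the special subspace of the gauge subspace of `𝒜¹`. -/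
def IsSpecial : B1 → Prop
  | Sum.inl (.sym _) => False
  | Sum.inl (.asym _) => False
  | Sum.inl (.frame _ μ) => μ ≠ 0
  | Sum.inl _ => True
  | Sum.inr _ => False

/-- The affine gauge subspace: `θ₀∂₀` plus the special subspace. -/
def affineGauged : Set ((Multi → E1 R) ⧸ sRees B1.deg (B1.elt e) R) :=
  {x | ∃ f : B1 → R, x = ofCoeff e f ∧ f (Sum.inr (.der 0)) = 1 ∧
    ∀ b, b ≠ Sum.inr (.der 0) → ¬ IsSpecial b → f b = 0}

/-- The frame of an element of degree one: the element `∑ᵢ θᵢ δᵢ` restricts to the map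
`∑ᵢ θᵢ Eᵢ : R → W`, where `Eᵢ` is the action of `δᵢ` on `R`. -/
def frameOf (x : E1 R) (i : Fin 4) : Derivation ℝ R R := (x.1 i).2

/-- The coefficients of `θ₀σ₀, …, θ₃σ₀` in an element of `ℰ¹`: the `σ_{ab}` are traceless, and `σ₀`
is the identity matrix. -/
def confPart (x : E1 R) (i : Fin 4) : R := algebraMap ℝ R (1 / 4) * (x.1 i).1.trace

/-- Nondegeneracy: the frame is an isomorphism `Der(R)* ≃ W`, that is, `E₀, …, E₃` are a basis
of `Der(R)`. -/
def Nondegenerate (x : E1 R) : Prop :=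
  LinearIndependent R (frameOf x) ∧ Submodule.span R (Set.range (frameOf x)) = ⊤

/-- Exactness of a one-form that is given, via the frame of `x`, by the element `w` of `W`: it is
equal to `df` for some `f`, and `df` corresponds to `∑ᵢ Eᵢ(f) θᵢ`. -/
def ExactVia (x : E1 R) (w : Fin 4 → R) : Prop := ∃ f : R, ∀ i, frameOf x i f = w i

/-- Gauged Maurer-Cartan elements of `𝒜`: those in the affine gauge subspace that are nondegenerate
and for which the two associated one-forms are exact. -/
def MCGauged : Set ((Multi → E1 R) ⧸ sRees B1.deg (B1.elt e) R) :=
  MCA e ∩ affineGauged e ∩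
    {x | ∃ f, x = ofCoeff e f ∧ Nondegenerate (atOne e f)} ∩
    {x | ∃ f, x = ofCoeff e f ∧ ExactVia (atOne e f) (confPart (atOne e f)) ∧
      ExactVia (atOne e f) (atOne e f).2}

end Series

/-! ## Geometry of `Ω = [0,∞) × M` -/

section VectorFields

variable {E : Type*} [NormedAddCommGroup E] [NormedSpace ℝ E] {H : Type*} [TopologicalSpace H]
  {I : ModelWithCorners ℝ E H} {N : Type*} [TopologicalSpace N] [ChartedSpace H N]
  [IsManifold I ∞ N]

theorem contMDiff_fieldDeriv (V : (x : N) → TangentSpace I x)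
    (hV : ContMDiff I I.tangent ∞ (fun x => (⟨x, V x⟩ : TangentBundle I N)))
    (f : C^∞⟮I, N; ℝ⟯) : ContMDiff I 𝓘(ℝ, ℝ) ∞ (fun x => mvfderiv I f x (V x)) := by
  have h1 := (f.contMDiff.contMDiff_tangentMap (m := ∞) (by simp)).comp hV
  exact (contMDiff_snd_tangentBundle_modelSpace ℝ 𝓘(ℝ, ℝ)).comp h1

/-- The derivation `f ↦ df(V)` of the ring of smooth functions, for a smooth vector field `V`. -/
def fieldDeriv (V : (x : N) → TangentSpace I x)
    (hV : ContMDiff I I.tangent ∞ (fun x => (⟨x, V x⟩ : TangentBundle I N))) :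
    Derivation ℝ C^∞⟮I, N; ℝ⟯ C^∞⟮I, N; ℝ⟯ :=
  Derivation.mk'
    { toFun := fun f => ⟨fun x => mvfderiv I f x (V x), contMDiff_fieldDeriv V hV f⟩
      map_add' := fun f g => by
        ext x
        change mvfderiv I (⇑f + ⇑g) x (V x) = mvfderiv I f x (V x) + mvfderiv I g x (V x)
        rw [mvfderiv_add f.mdifferentiableAt g.mdifferentiableAt]; rfl
      map_smul' := fun c f => by
        ext x
        change mvfderiv I ((fun _ : N => c) * ⇑f) x (V x) = c * mvfderiv I f x (V x)
        rw [mvfderiv_mul mdifferentiableAt_const f.mdifferentiableAt]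
        simp [mvfderiv_const] }
    (fun f g => by
      ext x
      change mvfderiv I (⇑f * ⇑g) x (V x) =
        f x * mvfderiv I g x (V x) + g x * mvfderiv I f x (V x)
      rw [mvfderiv_mul f.mdifferentiableAt g.mdifferentiableAt]
      rfl)

end VectorFields

section Geometry

variable (M : Type*) [TopologicalSpace M] [ChartedSpace (EuclideanSpace ℝ (Fin 3)) M]

/-- `C^∞(M)`. -/
abbrev SmoothM : Type _ := C^∞⟮𝓡 3, M; ℝ⟯

/-- The manifold with boundary `Ω = [0,∞) × M`. -/
abbrev Omega : Type _ := EuclideanHalfSpace 1 × M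

/-- `C^∞(Ω)`. -/
abbrev SmoothOmega : Type _ := C^∞⟮(𝓡∂ 1).prod (𝓡 3), Omega M; ℝ⟯

variable {M}

/-- The coordinate `τ` on the first factor. -/
def tau (z : Omega M) : ℝ := z.1.val 0

theorem contMDiff_tau : ContMDiff ((𝓡∂ 1).prod (𝓡 3)) 𝓘(ℝ, ℝ) ∞ (tau (M := M)) := by
  have h1 : ContMDiff ((𝓡∂ 1).prod (𝓡 3)) 𝓘(ℝ, EuclideanSpace ℝ (Fin 1)) ∞
      (fun z : Omega M => (𝓡∂ 1) z.1) := (𝓡∂ 1).contMDiff.comp contMDiff_fst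
  exact (EuclideanSpace.proj (𝕜 := ℝ) (0 : Fin 1)).contMDiff.comp h1

/-- A smooth function on `M`, viewed as a function on `Ω` that does not depend on `τ`. -/
def pull (f : SmoothM M) : SmoothOmega M := ⟨fun z => f z.2, f.contMDiff.comp contMDiff_snd⟩

/-- `τ` as a smooth function. -/
def tauMap : SmoothOmega M := ⟨tau, contMDiff_tau⟩

/-- The function `e^{-pτ}`, where `p` is a function on `M`. -/
def expNeg (p : SmoothM M) : SmoothOmega M :=
  ⟨fun z => Real.exp (-(p z.2 * tau z)),
    Real.contDiff_exp.contMDiff.comp (pull p * tauMap).contMDiff.neg⟩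

/-- The factor in `s̄^α = e^{-(α₁p₁ + α₂p₂ + α₃p₃)τ} s^α`. -/
def weight (p : Fin 3 → SmoothM M) (α : Multi) : SmoothOmega M := expNeg (∑ i, α i • p i)

/-- `C^∞(M)[τ]`: the functions on `Ω` that are polynomial in `τ` with coefficients in `C^∞(M)`. -/
def polyTau : Set (SmoothOmega M) :=
  {f | ∃ q : Polynomial (SmoothM M), f = q.sum (fun k g => pull g * tauMap ^ k)}

variable [IsManifold (𝓡 3) ∞ M]

variable (M) in
/-- A smooth global frame `L₁, L₂, L₃` of the tangent bundle. -/
structure SmoothFrame where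
  field : Fin 3 → (x : M) → TangentSpace (𝓡 3) x
  smooth : ∀ a, ContMDiff (𝓡 3) (𝓡 3).tangent ∞
    (fun x => (⟨x, field a x⟩ : TangentBundle (𝓡 3) M))
  linearIndependent : ∀ x, LinearIndependent ℝ (fun a => field a x)

theorem contMDiff_lift (v : EuclideanSpace ℝ (Fin 1)) (V : (x : M) → TangentSpace (𝓡 3) x)
    (hV : ContMDiff (𝓡 3) (𝓡 3).tangent ∞ (fun x => (⟨x, V x⟩ : TangentBundle (𝓡 3) M))) :
    ContMDiff ((𝓡∂ 1).prod (𝓡 3)) ((𝓡∂ 1).prod (𝓡 3)).tangent ∞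
      (fun z : Omega M => (⟨z, ((v, V z.2) : EuclideanSpace ℝ (Fin 1) ×
        EuclideanSpace ℝ (Fin 3))⟩ : TangentBundle ((𝓡∂ 1).prod (𝓡 3)) (Omega M))) := by
  have h0 : ContMDiff (𝓡∂ 1) (𝓡∂ 1).tangent ∞ (fun t : EuclideanHalfSpace 1 =>
      (⟨t, v⟩ : TangentBundle (𝓡∂ 1) (EuclideanHalfSpace 1))) := by
    have h1 := contMDiff_tangentBundleModelSpaceHomeomorph_symm (n := ∞) (I := 𝓡∂ 1)
    have h3 := (contMDiff_id (I := 𝓡∂ 1) (n := ∞) (M := EuclideanHalfSpace 1)).prodMk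
      (contMDiff_const (I := 𝓡∂ 1) (I' := 𝓘(ℝ, EuclideanSpace ℝ (Fin 1))) (n := ∞)
        (M := EuclideanHalfSpace 1) (c := v))
    rw [chartedSpaceSelf_prod] at h3
    exact h1.comp h3
  exact (contMDiff_equivTangentBundleProd_symm (I := 𝓡∂ 1) (I' := 𝓡 3)
    (M := EuclideanHalfSpace 1) (M' := M)).comp
      ((h0.comp contMDiff_fst).prodMk (hV.comp contMDiff_snd))

/-- The derivation `∂₀` of `C^∞(Ω)`, along the first factor. -/
def partial0 : Derivation ℝ (SmoothOmega M) (SmoothOmega M) :=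
  fieldDeriv _ (contMDiff_lift (EuclideanSpace.single 0 1) (fun _ => 0)
    (Bundle.contMDiff_zeroSection ℝ (TangentSpace (𝓡 3) : M → Type _)))

variable (L : SmoothFrame M)

/-- The frame vector field `L_a`, as a derivation of `C^∞(M)`. -/
def SmoothFrame.derM (a : Fin 3) : Derivation ℝ (SmoothM M) (SmoothM M) :=
  fieldDeriv (L.field a) (L.smooth a)

/-- The frame vector field `L_a`, as a derivation of `C^∞(Ω)`, along the second factor. -/
def SmoothFrame.derOmega (a : Fin 3) : Derivation ℝ (SmoothOmega M) (SmoothOmega M) :=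
  fieldDeriv _ (contMDiff_lift 0 (L.field a) (L.smooth a))

/-- The distinguished basis `∂₀, L₁, L₂, L₃` of the derivations of `C^∞(Ω)`. -/
def SmoothFrame.der : Fin 4 → Derivation ℝ (SmoothOmega M) (SmoothOmega M) :=
  Fin.cons partial0 L.derOmega

/-! ## The theorem's objects -/

/-- Gauged Maurer-Cartan elements of `𝒜` with `p₁, p₂, p₃ > 0`, where `pᵢ` is the coefficient of
`θ₀σ₀ + θᵢσᵢ`. -/
def MCGaugedPos :
    Set ((Multi → E1 (SmoothOmega M)) ⧸ sRees B1.deg (B1.elt L.der) (SmoothOmega M)) :=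
  {x | x ∈ MCGauged L.der ∧ ∃ f, x = ofCoeff L.der f ∧ ∀ i z, 0 < f (Sum.inl (.diag i)) z}

/-- The degree one part of the subalgebra `𝒫_p` of `𝒫`. -/
def Pp1 (p : Fin 3 → SmoothM M) : Set (Multi → E1 (SmoothOmega M)) :=
  reesBar B1.deg (B1.elt L.der) polyTau (weight p)

/-- The degree zero part of `s̄𝒫_p`. -/
def sPp0 (p : Fin 3 → SmoothM M) : Set (Multi → E0 (SmoothOmega M)) :=
  sReesBar GB0.deg (GB0.elt L.der) polyTau (weight p)

/-- The Maurer-Cartan elements of `𝒫_p`. -/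
def MCPp (p : Fin 3 → SmoothM M) : Set (Multi → E1 (SmoothOmega M)) :=
  Pp1 L p ∩ MCP L.der

/-- The vector field `∑ₐ dᵃ L_a` on `M`, as a derivation. -/
def vecM (d : Fin 3 → SmoothM M) : Derivation ℝ (SmoothM M) (SmoothM M) :=
  ∑ a, d a • L.derM a

/-- Tuples `(D₁, D₂, D₃, p₁, p₂, p₃, p₀, ζ, χ)`, where `D₁, D₂, D₃` is a frame on `M` and the others
are functions on `M`.  The vector field `Dᵢ` is given by its components `d i a` relative to the
fixed frame.  The tuple comes with its structure functions `c i j k = c_{ij}^k`, determined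
by `[Dᵢ, Dⱼ] = ∑ₖ c_{ij}^k Dₖ`. -/
structure FinalData where
  d : Fin 3 → Fin 3 → SmoothM M
  p : Fin 3 → SmoothM M
  p0 : SmoothM M
  zeta : SmoothM M
  chi : SmoothM M
  c : Fin 3 → Fin 3 → Fin 3 → SmoothM M
  frame : ∀ x, (Matrix.of fun i a => d i a x).det ≠ 0
  bracket : ∀ i j, ⁅vecM L (d i), vecM L (d j)⁆ = ∑ k, c i j k • vecM L (d k)

variable {L}

namespace FinalData

variable (T : FinalData L)

/-- The vector field `Dᵢ`. -/
def D (i : Fin 3) : Derivation ℝ (SmoothM M) (SmoothM M) := vecM L (T.d i)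

/-- The coefficients, relative to the distinguished basis, of the element of `𝒜¹` associated to a
tuple: with `s̄ᵢ = e^{-pᵢτ} sᵢ` and `(i,j,k)` running over the cyclic triples, it is
`θ₀∂₀ + p₀ θ₀` plus the sum of
* `pᵢ (θ₀σ₀ + θᵢσᵢ)`,
* `½ s̄ᵢ² c_{jk}^i (θᵢσ_{jk} - θⱼσ_{ki} - θₖσ_{ij})`,
* `s̄ⱼs̄ₖ θᵢ Dᵢ`,
* `-s̄ⱼs̄ₖ (Dᵢζ - τ Dᵢ(p₁ + p₂ + p₃)) (θ₀σᵢ + θᵢσ₀)`,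
* `s̄ⱼs̄ₖ (Dᵢζ + c_{ki}^k - τ Dᵢpₖ) θₖσ_{ki}`,
* `-s̄ⱼs̄ₖ (Dᵢζ - c_{ij}^j - τ Dᵢpⱼ) θⱼσ_{ij}`,
* `s̄ⱼs̄ₖ (Dᵢχ + τ Dᵢp₀) θᵢ` in `Φ¹`. -/
def coeff : B1 → SmoothOmega M
  | Sum.inl (.diag i) => pull (T.p i)
  | Sum.inl (.curv i) =>
      -((1 / 2 : ℝ) • (weight T.p (2 • unit i) * pull (T.c (i + 1) (i + 2) i)))
  | Sum.inl (.frame i μ) => Fin.cases 0 (fun a => weight T.p (deg011 i) * pull (T.d i a)) μ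
  | Sum.inl (.conf i) => -(weight T.p (deg011 i) *
      (pull (T.D i T.zeta) - tauMap * pull (T.D i (∑ l, T.p l))))
  | Sum.inl (.sym _) => 0
  | Sum.inl (.rotK i) => weight T.p (deg011 i) *
      (pull (T.D i T.zeta) + pull (T.c (i + 2) i (i + 2)) - tauMap * pull (T.D i (T.p (i + 2))))
  | Sum.inl (.rotJ i) => -(weight T.p (deg011 i) *
      (pull (T.D i T.zeta) - pull (T.c i (i + 1) (i + 1)) - tauMap * pull (T.D i (T.p (i + 1)))))
  | Sum.inl (.asym _) => 0
  | Sum.inl (.scalar i) => Fin.cases (pull T.p0)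
      (fun i => weight T.p (deg011 i) * (pull (T.D i T.chi) + tauMap * pull (T.D i T.p0))) i
  | Sum.inr (.der μ) => if μ = 0 then 1 else 0
  | Sum.inr _ => 0

/-- The element of `𝒜¹` associated to a tuple. -/
def leading : (Multi → E1 (SmoothOmega M)) ⧸ sRees B1.deg (B1.elt L.der) (SmoothOmega M) :=
  ofCoeff L.der T.coeff

end FinalData

/-- The quantities that enter the coefficients of formal solutions.  A list of indices stands for
an iterated derivative along the frame `D₁, D₂, D₃`. -/
inductive Jet : Type
  | frame (w : List (Fin 3)) (i a : Fin 3)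
  | p (w : List (Fin 3)) (i : Fin 3)
  | p0 (w : List (Fin 3))
  | zeta (w : List (Fin 3))
  | chi (w : List (Fin 3))
  | c (w : List (Fin 3)) (i j k : Fin 3)
  | inv (n : Multi) (hn : n ≠ 0)

/-- The order of differentiation. -/
def Jet.order : Jet → ℕ
  | frame w _ _ => w.length
  | p w _ => w.length
  | p0 w => w.length
  | zeta w => w.length
  | chi w => w.length
  | c w _ _ _ => w.length
  | inv _ _ => 0

/-- The iterated derivative of a function along `D₁, D₂, D₃`. -/
def FinalData.iter (T : FinalData L) (w : List (Fin 3)) (f : SmoothM M) : SmoothM M :=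
  w.foldr (fun i g => T.D i g) f

/-- The value at a point of `M`; `inv n` is `(n₁p₁ + n₂p₂ + n₃p₃)⁻¹`. -/
def Jet.value (T : FinalData L) (y : M) : Jet → ℝ
  | frame w i a => T.iter w (T.d i a) y
  | p w i => T.iter w (T.p i) y
  | p0 w => T.iter w T.p0 y
  | zeta w => T.iter w T.zeta y
  | chi w => T.iter w T.chi y
  | c w i j k => T.iter w (T.c i j k) y
  | inv n _ => (∑ i, (n i : ℝ) * T.p i y)⁻¹

end Geometry

end BKL

end

open scoped Manifold ContDiff

noncomputable section

namespace BKL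

open Finset.HasAntidiagonal
open Finset (sum_congr sum_add_distrib sum_sub_distrib smul_sum sum_eq_zero sum_comm
  sum_eq_single mul_sum sum_neg_distrib sum_smul)
open Prod (fst_add snd_add fst_sum smul_fst snd_sum smul_snd fst_sub)
open List (sum_cons map_cons sum_nil map_nil)
open Derivation (leibniz commutator_apply leibniz_pow)
open Polynomial (X derivative eval₂_pow eval₂_eq_sum coeff_C_mul C_mul_X_pow_eq_monomial map_C
  map_X induction_on')
open Submodule (subset_span span_le mem_span_range_iff_exists_fun span_induction)
variable {R : Type*} [CommRing R] [Algebra ℝ R] {e : Fin 4 → Derivation ℝ R R}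
  {C : Fin 4 → Fin 4 → Fin 4 → R} {p : Fin 3 → R} {W : Multi → Submodule ℝ R} {M : Type*}
  [TopologicalSpace M] [ChartedSpace (EuclideanSpace ℝ (Fin 3)) M] [IsManifold (𝓡 3) ∞ M]
  {L : SmoothFrame M}

section Coordinates

/-- A matrix entry of a coefficient of an element of degree two. -/
def entry (a b p q : Fin 4) : L2 R →ₗ[R] R where
  toFun U := (U a b).1 p q
  map_add' _ _ := rfl
  map_smul' _ _ := rfl

/-- The coefficient of `θ₀θₖσₗ`. -/
def entX (k l : Fin 3) : L2 R →ₗ[R] R := entry 0 (sp k) 0 (sp l)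

/-- The coefficient of `θ₀θₖ` times the rotation with axis `l`. -/
def entZ (k l : Fin 3) : L2 R →ₗ[R] R := entry 0 (sp k) (sp (l + 1)) (sp (l + 2))

/-- The coefficient of the spatial two-form dual to `k` times the rotation with axis `l`. -/
def entY (k l : Fin 3) : L2 R →ₗ[R] R :=
  entry (sp (k + 1)) (sp (k + 2)) (sp (l + 1)) (sp (l + 2))

/-- The coefficient of the spatial two-form dual to `k` times the boost `σₗ`. -/
def entV (k l : Fin 3) : L2 R →ₗ[R] R := entry (sp (k + 1)) (sp (k + 2)) 0 (sp l)

/-- The coefficient of `θ₀θₖσ₀`. -/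
def entP (k : Fin 3) : L2 R →ₗ[R] R := entry 0 (sp k) 0 0

/-- The coefficient of the spatial two-form dual to `k` times `σ₀`. -/
def entQ (k : Fin 3) : L2 R →ₗ[R] R := entry (sp (k + 1)) (sp (k + 2)) 0 0

/-- Multiples of the coordinates, relative to the distinguished basis, of an element of `ℰ²`. -/
def coordL : B2 → L2 R →ₗ[R] R
  | .inl .zero => entY 0 0 + entY 1 1 + entY 2 2
  | .inl .top => -(entV 0 0 + entV 1 1 + entV 2 2)
  | .inl (.mix i) => entV (i + 2) (i + 1) - entV (i + 1) (i + 2)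
  | .inl (.sym i) => entY (i + 1) (i + 2) - entY (i + 2) (i + 1)
  | .inl (.asym i) => -entQ i
  | .inr (.diag i) => entX i i + entY i i - (entY 0 0 + entY 1 1 + entY 2 2)
  | .inr (.curv i) => entZ (i + 1) (i + 1) + entZ (i + 2) (i + 2) + entV i i
  | .inr (.conf i) => entP i
  | .inr (.sym i) => entX (i + 1) (i + 2) + entX (i + 2) (i + 1) +
      (entY (i + 1) (i + 2) + entY (i + 2) (i + 1))
  | .inr (.asym i) => entX (i + 1) (i + 2) - entX (i + 2) (i + 1) + entQ i
  | .inr (.rotJ i) => entZ (i + 1) (i + 2) - entV (i + 2) (i + 1)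
  | .inr (.rotK i) => entZ (i + 2) (i + 1) - entV (i + 1) (i + 2)
  | _ => 0

/-- The elements of the ideal that correspond to a real matrix. -/
def idealRe (S : Fin 3 → Fin 3 → R) : L2 R := ∑ k : Fin 3, ∑ l : Fin 3,
  S k l • (th2 0 (sp k) (boost l) - th2 (sp (k + 1)) (sp (k + 2)) (rot l))

/-- The elements of the ideal that correspond to an imaginary matrix. -/
def idealIm (S : Fin 3 → Fin 3 → R) : L2 R := ∑ k : Fin 3, ∑ l : Fin 3,
  S k l • (th2 0 (sp k) (rot l) + th2 (sp (k + 1)) (sp (k + 2)) (boost l))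

section Entries

variable (S : Fin 3 → Fin 3 → R) (a b : Fin 3)

theorem idealRe_zero_sp (p q : Fin 4) :
    (idealRe S 0 (sp a)).1 p q = ∑ l, S a l * (boost l : Der0 R).1 p q := by
  fin_cases a <;> simp [sp, idealRe, th2, wedge, theta, Fin.sum_univ_three]

theorem idealRe_sp_sp (p q : Fin 4) : (idealRe S (sp (a + 1)) (sp (a + 2))).1 p q =
    -∑ l, S a l * (rot l : Der0 R).1 p q := by
  fin_cases a <;> simp [sp, idealRe, th2, wedge, theta, Fin.sum_univ_three] <;> ring

theorem idealIm_zero_sp (p q : Fin 4) :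
    (idealIm S 0 (sp a)).1 p q = ∑ l, S a l * (rot l : Der0 R).1 p q := by
  fin_cases a <;> simp [sp, idealIm, th2, wedge, theta, Fin.sum_univ_three]

theorem idealIm_sp_sp (p q : Fin 4) : (idealIm S (sp (a + 1)) (sp (a + 2))).1 p q =
    ∑ l, S a l * (boost l : Der0 R).1 p q := by
  fin_cases a <;> simp [sp, idealIm, th2, wedge, theta, Fin.sum_univ_three]

theorem boost_entry (l : Fin 3) : (boost l : Der0 R).1 0 (sp a) = if l = a then 1 else 0 := by
  fin_cases l <;> fin_cases a <;> simp [sp, boost, sigma, eta]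

theorem rot_entry (l : Fin 3) :
    (rot l : Der0 R).1 (sp (a + 1)) (sp (a + 2)) = if l = a then 1 else 0 := by
  fin_cases l <;> fin_cases a <;> simp [sp, rot, sigma, eta]

theorem boost_entry' (l : Fin 3) : (boost l : Der0 R).1 (sp (a + 1)) (sp (a + 2)) = 0 := by
  fin_cases l <;> fin_cases a <;> simp [sp, boost, sigma, eta]

theorem rot_entry' (l : Fin 3) : (rot l : Der0 R).1 0 (sp a) = 0 := by
  fin_cases l <;> fin_cases a <;> simp [sp, rot, sigma, eta]

theorem boost_entry_zero (l : Fin 3) : (boost l : Der0 R).1 0 0 = 0 := by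
  fin_cases l <;> simp [sp, boost, sigma, eta]

theorem rot_entry_zero (l : Fin 3) : (rot l : Der0 R).1 0 0 = 0 := by
  fin_cases l <;> simp [sp, rot, sigma, eta]

theorem entX_idealRe : entX a b (idealRe S) = S a b := by
  change (idealRe S _ _).1 _ _ = _
  rw [idealRe_zero_sp]; simp only [boost_entry]; simp

theorem entY_idealRe : entY a b (idealRe S) = -S a b := by
  change (idealRe S _ _).1 _ _ = _
  rw [idealRe_sp_sp]; simp only [rot_entry]; simp

theorem entZ_idealRe : entZ a b (idealRe S) = 0 := by
  change (idealRe S _ _).1 _ _ = _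
  rw [idealRe_zero_sp]; simp only [boost_entry']; simp

theorem entV_idealRe : entV a b (idealRe S) = 0 := by
  change (idealRe S _ _).1 _ _ = _
  rw [idealRe_sp_sp]; simp only [rot_entry']; simp

theorem entP_idealRe : entP a (idealRe S) = 0 := by
  change (idealRe S _ _).1 _ _ = _
  rw [idealRe_zero_sp]; simp only [boost_entry_zero]; simp

theorem entQ_idealRe : entQ a (idealRe S) = 0 := by
  change (idealRe S _ _).1 _ _ = _
  rw [idealRe_sp_sp]; simp only [rot_entry_zero]; simp

theorem entX_idealIm : entX a b (idealIm S) = 0 := by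
  change (idealIm S _ _).1 _ _ = _
  rw [idealIm_zero_sp]; simp only [rot_entry']; simp

theorem entY_idealIm : entY a b (idealIm S) = 0 := by
  change (idealIm S _ _).1 _ _ = _
  rw [idealIm_sp_sp]; simp only [boost_entry']; simp

theorem entZ_idealIm : entZ a b (idealIm S) = S a b := by
  change (idealIm S _ _).1 _ _ = _
  rw [idealIm_zero_sp]; simp only [rot_entry]; simp

theorem entV_idealIm : entV a b (idealIm S) = S a b := by
  change (idealIm S _ _).1 _ _ = _
  rw [idealIm_sp_sp]; simp only [boost_entry]; simp

theorem entP_idealIm : entP a (idealIm S) = 0 := by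
  change (idealIm S _ _).1 _ _ = _
  rw [idealIm_zero_sp]; simp only [rot_entry_zero]; simp

theorem entQ_idealIm : entQ a (idealIm S) = 0 := by
  change (idealIm S _ _).1 _ _ = _
  rw [idealIm_sp_sp]; simp only [boost_entry_zero]; simp

end Entries

section

variable (S : Fin 3 → Fin 3 → R) (hS : ∀ a b, S a b = S b a) (htr : S 0 0 + S 1 1 + S 2 2 = 0)
include hS htr

theorem coordL_idealRe (c : B2) : coordL c (idealRe S) = 0 := by
  rcases c with c | c <;> cases c <;> simp only [coordL, LinearMap.add_apply, LinearMap.sub_apply,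
    LinearMap.neg_apply, LinearMap.zero_apply, entX_idealRe, entY_idealRe, entZ_idealRe,
    entV_idealRe, entP_idealRe, entQ_idealRe] <;> grind

theorem coordL_idealIm (c : B2) : coordL c (idealIm S) = 0 := by
  rcases c with c | c <;> cases c <;> simp only [coordL, LinearMap.add_apply, LinearMap.sub_apply,
    LinearMap.neg_apply, LinearMap.zero_apply, entX_idealIm, entY_idealIm, entZ_idealIm,
    entV_idealIm, entP_idealIm, entQ_idealIm]
  case inr.curv i => fin_cases i <;> simp <;> grind
  all_goals grind

end

theorem I2_generator_eq (S : Matrix (Fin 3) (Fin 3) ℂ) : (∑ k : Fin 3, ∑ l : Fin 3,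
      (algebraMap ℝ R (S k l).re •
          (th2 0 (sp k) (boost l) - th2 (sp (k + 1)) (sp (k + 2)) (rot l)) -
        algebraMap ℝ R (S k l).im •
          (th2 0 (sp k) (rot l) + th2 (sp (k + 1)) (sp (k + 2)) (boost l))) : L2 R) =
    idealRe (fun k l => algebraMap ℝ R (S k l).re) -
      idealIm (fun k l => algebraMap ℝ R (S k l).im) := by
  simp only [idealRe, idealIm, sum_sub_distrib]

theorem I2_le_ker_coordL (c : B2) : I2 R ≤ LinearMap.ker (coordL (R := R) c) := by
  rw [I2, span_le]
  rintro x ⟨S, hS, htr, rfl⟩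
  have htr' : S 0 0 + S 1 1 + S 2 2 = 0 := by
    simpa [Matrix.trace, Fin.sum_univ_three] using htr
  rw [I2_generator_eq, SetLike.mem_coe, LinearMap.mem_ker, map_sub, coordL_idealRe, coordL_idealIm,
    sub_zero]
  · intro a b; rw [hS.apply]
  · rw [← map_add, ← map_add, ← Complex.add_im, ← Complex.add_im, htr']; simp
  · intro a b; rw [hS.apply]
  · rw [← map_add, ← map_add, ← Complex.add_re, ← Complex.add_re, htr']; simp

/-- A symmetric traceless matrix over `R` is an `R`-combination of real ones. -/
theorem sum_symTraceless {N : Type*} [AddCommGroup N] [Module R N] (I : Submodule R N)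
    (φ : (Fin 3 → Fin 3 → R) →ₗ[R] N)
    (hφ : ∀ S : Matrix (Fin 3) (Fin 3) ℝ, S.IsSymm → S.trace = 0 →
      φ (fun k l => algebraMap ℝ R (S k l)) ∈ I)
    (S : Fin 3 → Fin 3 → R) (hS : ∀ a b, S a b = S b a) (htr : S 0 0 + S 1 1 + S 2 2 = 0) :
    φ S ∈ I := by
  have key : S = S 0 0 • (fun k l => algebraMap ℝ R (!![1, 0, 0; 0, 0, 0; 0, 0, -1] k l)) +
      S 1 1 • (fun k l => algebraMap ℝ R (!![0, 0, 0; 0, 1, 0; 0, 0, -1] k l)) +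
      S 0 1 • (fun k l => algebraMap ℝ R (!![0, 1, 0; 1, 0, 0; 0, 0, 0] k l)) +
      S 0 2 • (fun k l => algebraMap ℝ R (!![0, 0, 1; 0, 0, 0; 1, 0, 0] k l)) +
      S 1 2 • (fun k l => algebraMap ℝ R (!![0, 0, 0; 0, 0, 1; 0, 1, 0] k l)) := by
    funext k l
    fin_cases k <;> fin_cases l <;> simp [hS 1 0, hS 2 0, hS 2 1]
    linear_combination htr
  rw [key]
  simp only [map_add, map_smul]
  refine I.add_mem (I.add_mem (I.add_mem (I.add_mem ?_ ?_) ?_) ?_) ?_ <;>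
    refine I.smul_mem _ (hφ _ ?_ ?_)
  all_goals
    first
    | (ext a b; fin_cases a <;> fin_cases b <;> simp [Matrix.transpose_apply])
    | simp [Matrix.trace, Fin.sum_univ_three]

theorem idealRe_mem (S : Fin 3 → Fin 3 → R) (hS : ∀ a b, S a b = S b a)
    (htr : S 0 0 + S 1 1 + S 2 2 = 0) : idealRe S ∈ I2 R := by
  refine sum_symTraceless (I2 R)
    { toFun := idealRe
      map_add' := fun S S' => by simp only [idealRe, Pi.add_apply, add_smul, sum_add_distrib]
      map_smul' := fun c S => by
        simp only [idealRe, Pi.smul_apply, smul_eq_mul, mul_smul, smul_sum,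
          RingHom.id_apply] } ?_ S hS htr
  intro S hS htr
  refine subset_span ⟨S.map (fun x => (x : ℂ)), ?_, ?_, ?_⟩
  · ext a b; simp [hS.apply]
  · simp only [Matrix.trace, Fin.sum_univ_three, Matrix.diag_apply, Matrix.map_apply] at htr ⊢
    exact_mod_cast htr
  · rw [I2_generator_eq]; simp [idealIm]; rfl

theorem idealIm_mem (S : Fin 3 → Fin 3 → R) (hS : ∀ a b, S a b = S b a)
    (htr : S 0 0 + S 1 1 + S 2 2 = 0) : idealIm S ∈ I2 R := by
  refine sum_symTraceless (I2 R)
    { toFun := idealIm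
      map_add' := fun S S' => by simp only [idealIm, Pi.add_apply, add_smul, sum_add_distrib]
      map_smul' := fun c S => by
        simp only [idealIm, Pi.smul_apply, smul_eq_mul, mul_smul, smul_sum,
          RingHom.id_apply] } ?_ S hS htr
  intro S hS htr
  have h : -idealIm (fun k l => algebraMap ℝ R (S k l)) ∈ I2 R := by
    refine subset_span ⟨S.map (fun x => Complex.I * x), ?_, ?_, ?_⟩
    · ext a b; simp [hS.apply]
    · simp only [Matrix.trace, Fin.sum_univ_three, Matrix.diag_apply, Matrix.map_apply] at htr ⊢
      rw [← mul_add, ← mul_add]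
      exact_mod_cast congrArg (fun x : ℝ => Complex.I * (x : ℂ)) htr |>.trans (by simp)
    · rw [I2_generator_eq]; simp [idealRe]
  have := (I2 R).neg_mem h
  rwa [neg_neg] at this

/-- Multiples of the coordinates of an element of degree two, for the basis elements that do not
contain derivations of `R`. -/
def coord : B2 → E2 R →ₗ[R] R
  | .inl (.scalar i) =>
      { toFun := fun z => z.2.1 (sp (i + 1)) (sp (i + 2))
        map_add' := fun _ _ => rfl
        map_smul' := fun _ _ => rfl }
  | .inr (.scalar i) => Fin.cases
      { toFun := fun z => z.2.2
        map_add' := fun _ _ => rfl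
        map_smul' := fun _ _ => rfl }
      (fun i =>
        { toFun := fun z => z.2.1 0 (sp i)
          map_add' := fun _ _ => rfl
          map_smul' := fun _ _ => rfl }) i
  | c => ((I2 R).liftQ (coordL c) (I2_le_ker_coordL c)).comp (LinearMap.fst R _ _)

/-- The part of a coefficient of an element of degree two that acts on functions. -/
def anchorL (a b : Fin 4) : L2 R →ₗ[R] Derivation ℝ R R where
  toFun U := (U a b).2
  map_add' _ _ := rfl
  map_smul' _ _ := rfl

theorem anchorL_th2 (a b i j : Fin 4) (δ : Der0 R) :
    anchorL a b (th2 i j δ) = (theta i a * theta j b - theta j a * theta i b : R) • δ.2 := by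
  simp [anchorL, th2, wedge, mul_comm]

theorem I2_le_ker_anchorL (a b : Fin 4) : I2 R ≤ LinearMap.ker (anchorL (R := R) a b) := by
  rw [I2, span_le]
  rintro x ⟨S, -, -, rfl⟩
  simp [anchorL_th2, boost, rot, sigma]

/-- The part of a coefficient of an element of degree two that acts on functions. -/
def anchor (a b : Fin 4) : E2 R →ₗ[R] Derivation ℝ R R :=
  ((I2 R).liftQ (anchorL a b) (I2_le_ker_anchorL a b)).comp (LinearMap.fst R _ _)

end Coordinates

theorem sum_sum_ite_left {ι N : Type*} [Fintype ι] [DecidableEq ι] [AddCommMonoid N] (a : ι)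
    (f : ι → ι → N) : (∑ i, ∑ j, if a = i then f i j else 0) = ∑ j, f a j := by
  rw [sum_comm]; simp

section Bracket

theorem theta_apply (i a : Fin 4) : (theta i : Fin 4 → R) a = if a = i then 1 else 0 := by
  simp [theta, Pi.single_apply]

theorem act_theta (δ : Der0 R) (j a : Fin 4) : δ.act (theta j) a = δ.1 a j := by
  have : δ.2 ((theta j : Fin 4 → R) a) = 0 := by
    rw [theta_apply]; split_ifs <;> simp
  simp only [Der0.act, Pi.add_apply, this, add_zero]
  simp [theta]

/-- The coefficients of the bracket of `∑ θᵢ xᵢ` and `∑ θᵢ yᵢ`. -/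
theorem brL_apply (x y : L1 R) (a b : Fin 4) : brL x y a b =
    Der0.comm (x a) (y b) - Der0.comm (x b) (y a) +
      ∑ c, ((x a).1 b c - (x b).1 a c) • y c + ∑ c, ((y a).1 b c - (y b).1 a c) • x c := by
  simp only [brL, Finset.sum_apply, Pi.add_apply, Pi.sub_apply, th2, wedge, theta_apply, act_theta,
    sum_add_distrib, sum_sub_distrib, sub_smul, ite_mul, mul_ite, one_mul, zero_mul,
    mul_one, mul_zero, ite_smul, one_smul, zero_smul]
  simp only [sum_sum_ite_left, Fintype.sum_ite_eq]
  abel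

end Bracket

/-- The terms of a quadratic differential expression in functions indexed by the gauge basis in
degree one: products, derivatives along the frame that is part of the functions, linear terms, and
the terms with the structure functions of the distinguished basis of derivations. -/
inductive QTerm : Type
  | mul (q : ℤ) (b b' : GB1)
  | der (q : ℤ) (i : Fin 3) (b : GB1)
  | lin (q : ℤ) (b : GB1)
  | struct (i : Fin 3) (μ : Fin 4)

/-- The terms of the Hamiltonian constraint. -/
def zeroTerms (i : Fin 3) : List QTerm :=
  [.der 1 i (.rotJ i), .der (-1) i (.rotK i), .der 1 (i + 1) (.rotJ (i + 1)),
   .der (-1) (i + 1) (.rotK (i + 1)), .der 1 (i + 2) (.rotJ (i + 2)),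
   .der (-1) (i + 2) (.rotK (i + 2)), .mul 1 (.asym i) (.asym i),
   .mul 1 (.asym (i + 1)) (.asym (i + 1)), .mul 1 (.asym (i + 2)) (.asym (i + 2)),
   .mul 1 (.conf i) (.rotJ i), .mul (-1) (.conf i) (.rotK i),
   .mul 1 (.conf (i + 1)) (.rotJ (i + 1)), .mul (-1) (.conf (i + 1)) (.rotK (i + 1)),
   .mul 1 (.conf (i + 2)) (.rotJ (i + 2)), .mul (-1) (.conf (i + 2)) (.rotK (i + 2)),
   .mul (-1) (.curv i) (.curv i), .mul 2 (.curv i) (.curv (i + 1)),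
   .mul 2 (.curv i) (.curv (i + 2)), .mul (-1) (.curv (i + 1)) (.curv (i + 1)),
   .mul 2 (.curv (i + 1)) (.curv (i + 2)), .mul (-1) (.curv (i + 2)) (.curv (i + 2)),
   .mul 1 (.diag i) (.diag (i + 1)), .mul 1 (.diag i) (.diag (i + 2)),
   .mul 1 (.diag (i + 1)) (.diag (i + 2)), .mul (-3) (.scalar 0) (.scalar 0),
   .mul (-1) (.rotJ i) (.rotJ i), .mul 1 (.rotJ i) (.rotK i),
   .mul (-1) (.rotJ (i + 1)) (.rotJ (i + 1)), .mul 1 (.rotJ (i + 1)) (.rotK (i + 1)),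
   .mul (-1) (.rotJ (i + 2)) (.rotJ (i + 2)), .mul 1 (.rotJ (i + 2)) (.rotK (i + 2)),
   .mul (-1) (.rotK i) (.rotK i), .mul (-1) (.rotK (i + 1)) (.rotK (i + 1)),
   .mul (-1) (.rotK (i + 2)) (.rotK (i + 2)),
   .mul (-3) (.scalar (sp i)) (.scalar (sp i)),
   .mul (-3) (.scalar (sp (i + 1))) (.scalar (sp (i + 1))),
   .mul (-3) (.scalar (sp (i + 2))) (.scalar (sp (i + 2))), .mul (-1) (.sym i) (.sym i),
   .mul (-1) (.sym (i + 1)) (.sym (i + 1)), .mul (-1) (.sym (i + 2)) (.sym (i + 2))]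

/-- The terms of the divergence in the scalar wave equation. -/
def divTerms (i : Fin 3) : List QTerm :=
  [.der (-1) i (.scalar (sp i)),
   .der (-1) (i + 1) (.scalar (sp (i + 1))), .der (-1) (i + 2) (.scalar (sp (i + 2))),
   .mul 1 (.rotJ i) (.scalar (sp i)), .mul 1 (.rotJ (i + 1)) (.scalar (sp (i + 1))),
   .mul 1 (.rotJ (i + 2)) (.scalar (sp (i + 2))), .mul (-1) (.rotK i) (.scalar (sp i)),
   .mul (-1) (.rotK (i + 1)) (.scalar (sp (i + 1))),
   .mul (-1) (.rotK (i + 2)) (.scalar (sp (i + 2)))]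

/-- The terms of the evolution equation of the derivatives of the scalar field. -/
def waveTerms (i : Fin 3) : List QTerm :=
  [.der (-1) i (.scalar 0), .mul 1 (.asym (i + 1)) (.scalar (sp (i + 2))),
   .mul (-1) (.asym (i + 2)) (.scalar (sp (i + 1))),
   .mul 1 (.diag (i + 1)) (.scalar (sp i)), .mul 1 (.diag (i + 2)) (.scalar (sp i)),
   .mul (-1) (.scalar (sp (i + 1))) (.sym (i + 2)),
   .mul (-1) (.scalar (sp (i + 2))) (.sym (i + 1))]

/-- The coordinates of `½[x,x]` for gauged `x`, up to the terms that are linear in `∂₀`. -/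
def quad : B2 → List QTerm
  | .inl .zero => zeroTerms 0
  | .inl .top =>
      [.der (-2) 0 (.asym 0), .der (-2) 1 (.asym 1),
       .der (-2) 2 (.asym 2), .mul (-4) (.asym 0) (.conf 0),
       .mul 2 (.asym 0) (.rotJ 0), .mul (-2) (.asym 0) (.rotK 0),
       .mul (-4) (.asym 1) (.conf 1), .mul 2 (.asym 1) (.rotJ 1),
       .mul (-2) (.asym 1) (.rotK 1), .mul (-4) (.asym 2) (.conf 2),
       .mul 2 (.asym 2) (.rotJ 2), .mul (-2) (.asym 2) (.rotK 2)]
  | .inl (.mix i) =>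
      [.der 1 i (.diag (i + 1)), .der 1 i (.diag (i + 2)),
       .der (-1) (i + 1) (.asym (i + 2)), .der (-1) (i + 1) (.sym (i + 2)),
       .der 1 (i + 2) (.asym (i + 1)), .der (-1) (i + 2) (.sym (i + 1)),
       .mul (-2) (.asym i) (.curv i), .mul (-1) (.asym (i + 1)) (.conf (i + 2)),
       .mul 1 (.asym (i + 1)) (.rotK (i + 2)), .mul 1 (.asym (i + 2)) (.conf (i + 1)),
       .mul 1 (.asym (i + 2)) (.rotJ (i + 1)), .mul 1 (.conf i) (.diag (i + 1)),
       .mul 1 (.conf i) (.diag (i + 2)), .mul (-1) (.conf (i + 1)) (.sym (i + 2)),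
       .mul (-1) (.conf (i + 2)) (.sym (i + 1)), .mul (-2) (.curv (i + 1)) (.sym i),
       .mul 2 (.curv (i + 2)) (.sym i), .mul 1 (.diag i) (.rotJ i),
       .mul (-1) (.diag i) (.rotK i), .mul (-1) (.diag (i + 1)) (.rotJ i),
       .mul 1 (.diag (i + 2)) (.rotK i), .mul (-6) (.scalar 0) (.scalar (sp i)),
       .mul 1 (.rotJ (i + 1)) (.sym (i + 2)), .mul 2 (.rotJ (i + 2)) (.sym (i + 1)),
       .mul (-2) (.rotK (i + 1)) (.sym (i + 2)), .mul (-1) (.rotK (i + 2)) (.sym (i + 1))]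
  | .inl (.sym i) =>
      [.der (-2) i (.curv i), .der 1 (i + 1) (.rotJ (i + 2)),
       .der 1 (i + 2) (.rotK (i + 1)), .mul 2 (.asym i) (.diag i),
       .mul 2 (.asym (i + 1)) (.sym (i + 2)), .mul 2 (.asym (i + 2)) (.sym (i + 1)),
       .mul (-2) (.conf i) (.curv i), .mul 1 (.conf (i + 1)) (.rotJ (i + 2)),
       .mul 1 (.conf (i + 2)) (.rotK (i + 1)), .mul 2 (.curv i) (.rotJ i),
       .mul (-2) (.curv i) (.rotK i), .mul (-1) (.rotJ (i + 1)) (.rotJ (i + 2)),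
       .mul 1 (.rotK (i + 1)) (.rotK (i + 2))]
  | .inl (.asym i) =>
      [.der (-1) (i + 1) (.conf (i + 2)), .der 1 (i + 2) (.conf (i + 1)),
       .mul (-2) (.asym i) (.diag i), .mul (-2) (.asym i) (.diag (i + 1)),
       .mul (-2) (.asym i) (.diag (i + 2)), .mul (-2) (.conf i) (.curv i),
       .mul 1 (.conf (i + 1)) (.rotK (i + 2)), .mul 1 (.conf (i + 2)) (.rotJ (i + 1))]
  | .inl (.scalar i) =>
      [.der 1 (i + 1) (.scalar (sp (i + 2))), .der (-1) (i + 2) (.scalar (sp (i + 1))),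
       .mul 2 (.asym i) (.scalar 0), .mul 1 (.conf (i + 1)) (.scalar (sp (i + 2))),
       .mul (-1) (.conf (i + 2)) (.scalar (sp (i + 1))), .mul 2 (.curv i) (.scalar (sp i)),
       .mul (-1) (.rotJ (i + 1)) (.scalar (sp (i + 2))),
       .mul (-1) (.rotK (i + 2)) (.scalar (sp (i + 1)))]
  | .inr (.diag i) =>
      [.der (-1) i (.conf i), .der (-1) i (.rotJ i), .der 1 i (.rotK i),
       .der 1 (i + 1) (.rotK (i + 1)), .der (-1) (i + 2) (.rotJ (i + 2)),
       .mul (-1) (.conf i) (.rotJ i), .mul 1 (.conf i) (.rotK i),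
       .mul (-2) (.curv i) (.curv i), .mul 2 (.curv (i + 1)) (.curv (i + 1)),
       .mul (-4) (.curv (i + 1)) (.curv (i + 2)), .mul 2 (.curv (i + 2)) (.curv (i + 2)),
       .mul 1 (.rotJ i) (.rotJ i), .mul (-1) (.rotJ (i + 1)) (.rotK (i + 1)),
       .mul 1 (.rotJ (i + 2)) (.rotJ (i + 2)), .mul (-1) (.rotJ (i + 2)) (.rotK (i + 2)),
       .mul 1 (.rotK i) (.rotK i), .mul 1 (.rotK (i + 1)) (.rotK (i + 1)),
       .mul 6 (.scalar (sp i)) (.scalar (sp i))]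
  | .inr (.curv i) =>
      [.der 1 (i + 1) (.asym (i + 1)), .der 1 (i + 1) (.sym (i + 1)),
       .der 1 (i + 2) (.asym (i + 2)), .der (-1) (i + 2) (.sym (i + 2)),
       .mul (-1) (.asym (i + 1)) (.rotJ (i + 1)), .mul (-1) (.asym (i + 1)) (.rotK (i + 1)),
       .mul 1 (.asym (i + 2)) (.rotJ (i + 2)), .mul 1 (.asym (i + 2)) (.rotK (i + 2)),
       .mul 4 (.curv i) (.diag i), .mul (-1) (.rotJ (i + 1)) (.sym (i + 1)),
       .mul (-1) (.rotJ (i + 2)) (.sym (i + 2)), .mul (-1) (.rotK (i + 1)) (.sym (i + 1)),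
       .mul (-1) (.rotK (i + 2)) (.sym (i + 2))]
  | .inr (.conf i) =>
      [.der (-1) i (.diag i), .der (-1) i (.diag (i + 1)), .der (-1) i (.diag (i + 2)),
       .mul 1 (.asym (i + 1)) (.conf (i + 2)), .mul (-1) (.asym (i + 2)) (.conf (i + 1)),
       .mul 1 (.conf i) (.diag (i + 1)), .mul 1 (.conf i) (.diag (i + 2)),
       .mul (-1) (.conf (i + 1)) (.sym (i + 2)), .mul (-1) (.conf (i + 2)) (.sym (i + 1))]
  | .inr (.sym i) =>
      [.der (-2) i (.curv (i + 1)), .der 2 i (.curv (i + 2)),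
       .der (-1) (i + 1) (.conf (i + 2)), .der (-1) (i + 1) (.rotJ (i + 2)),
       .der (-1) (i + 2) (.conf (i + 1)), .der 1 (i + 2) (.rotK (i + 1)),
       .mul (-1) (.conf (i + 1)) (.rotJ (i + 2)), .mul 1 (.conf (i + 1)) (.rotK (i + 2)),
       .mul (-1) (.conf (i + 2)) (.rotJ (i + 1)), .mul 1 (.conf (i + 2)) (.rotK (i + 1)),
       .mul (-2) (.curv i) (.rotJ i), .mul (-2) (.curv i) (.rotK i),
       .mul 4 (.curv (i + 1)) (.rotJ i), .mul 4 (.curv (i + 2)) (.rotK i),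
       .mul (-1) (.rotJ (i + 1)) (.rotJ (i + 2)), .mul (-2) (.rotJ (i + 2)) (.rotK (i + 1)),
       .mul (-1) (.rotK (i + 1)) (.rotK (i + 2)),
       .mul 12 (.scalar (sp (i + 1))) (.scalar (sp (i + 2)))]
  | .inr (.asym i) =>
      [.mul 4 (.asym i) (.diag i), .mul 2 (.asym i) (.diag (i + 1)),
       .mul 2 (.asym i) (.diag (i + 2)), .mul 2 (.asym (i + 1)) (.sym (i + 2)),
       .mul 2 (.asym (i + 2)) (.sym (i + 1))]
  | .inr (.rotJ i) =>
      [.der (-1) i (.diag (i + 1)), .der 1 (i + 1) (.asym (i + 2)),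
       .der 1 (i + 1) (.sym (i + 2)), .mul (-2) (.asym i) (.curv (i + 1)),
       .mul 2 (.asym i) (.curv (i + 2)), .mul (-1) (.asym (i + 1)) (.rotK (i + 2)),
       .mul 1 (.asym (i + 2)) (.rotK (i + 1)), .mul (-2) (.curv (i + 1)) (.sym i),
       .mul (-2) (.curv (i + 2)) (.sym i), .mul 1 (.diag (i + 1)) (.rotJ i),
       .mul 1 (.diag (i + 2)) (.rotJ i), .mul 1 (.rotK (i + 1)) (.sym (i + 2)),
       .mul 1 (.rotK (i + 2)) (.sym (i + 1))]
  | .inr (.rotK i) =>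
      [.der 1 i (.diag (i + 2)), .der 1 (i + 2) (.asym (i + 1)),
       .der (-1) (i + 2) (.sym (i + 1)), .mul (-2) (.asym i) (.curv (i + 1)),
       .mul 2 (.asym i) (.curv (i + 2)), .mul (-1) (.asym (i + 1)) (.rotJ (i + 2)),
       .mul 1 (.asym (i + 2)) (.rotJ (i + 1)), .mul (-2) (.curv (i + 1)) (.sym i),
       .mul (-2) (.curv (i + 2)) (.sym i), .mul 1 (.diag (i + 1)) (.rotK i),
       .mul 1 (.diag (i + 2)) (.rotK i), .mul 1 (.rotJ (i + 1)) (.sym (i + 2)),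
       .mul 1 (.rotJ (i + 2)) (.sym (i + 1))]
  | .inr (.scalar m) => Fin.cases (divTerms 0) waveTerms m
  | .inr (.frame i μ) =>
      [.mul 1 (.diag (i + 1)) (.frame i μ), .mul 1 (.diag (i + 2)) (.frame i μ),
       .mul (-1) (.asym (i + 2)) (.frame (i + 1) μ), .mul (-1) (.sym (i + 2)) (.frame (i + 1) μ),
       .mul 1 (.asym (i + 1)) (.frame (i + 2) μ), .mul (-1) (.sym (i + 1)) (.frame (i + 2) μ)]
  | .inl (.frame i μ) =>
      (if μ = 0 then [.lin 2 (.asym i)] else []) ++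
      [.struct i μ, .der 1 (i + 1) (.frame (i + 2) μ), .der (-1) (i + 2) (.frame (i + 1) μ),
       .mul 2 (.curv i) (.frame i μ), .mul (-1) (.conf (i + 2)) (.frame (i + 1) μ),
       .mul (-1) (.rotK (i + 2)) (.frame (i + 1) μ), .mul 1 (.conf (i + 1)) (.frame (i + 2) μ),
       .mul (-1) (.rotJ (i + 1)) (.frame (i + 2) μ)]

/-- The factors in the definition of `coord` of the basis elements in the image of `θ₀`. -/
def mult : GB1 → ℤ
  | .curv _ => 2
  | .sym _ => 2
  | .asym _ => 2
  | _ => 1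

section Eval

/-- The value of a term, polarized: `f` and `g` enter linearly, and `E` stands for the frame. -/
def QTerm.eval (E : Fin 3 → Derivation ℝ R R) (C : Fin 4 → Fin 4 → Fin 4 → R) (t : R)
    (f g : GB1 → R) : QTerm → R
  | mul q b b' => q * f b * g b'
  | der q i b => q * E i (g b)
  | lin q b => q * t * g b
  | struct i μ => ∑ ν, ∑ κ, C ν κ μ * f (.frame (i + 1) ν) * g (.frame (i + 2) κ)

/-- The value of an expression. -/
def quadEval (E : Fin 3 → Derivation ℝ R R) (C : Fin 4 → Fin 4 → Fin 4 → R) (t : R)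
    (f g : GB1 → R) (c : B2) : R := ((quad c).map (QTerm.eval E C t f g)).sum

variable (e)

/-- The spatial frame that is part of a gauged element. -/
def frameDer (f : GB1 → R) (i : Fin 3) : Derivation ℝ R R := ∑ μ, f (.frame i μ) • e μ

/-- The gauged element `t θ₀∂₀ + ∑ g_b b`. -/
def gauged (t : ℝ) (g : GB1 → R) : E1 R :=
  algebraMap ℝ R t • theta0Mul0 (GB0.elt e (.der 0)) + ∑ b, g b • b.elt e

/-- A conformal matrix. -/
def confMatrix (l : R) (b r : Fin 3 → R) : Matrix (Fin 4) (Fin 4) R :=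
  !![l, b 0, b 1, b 2; b 0, l, r 2, -r 1; b 1, -r 2, l, r 0; b 2, r 1, -r 0, l]

/-- A conformal derivation. -/
def confDer (l : R) (b r : Fin 3 → R) (X : Derivation ℝ R R) : Der0 R := (confMatrix l b r, X)

/-- The labels of the gauge basis in degree one as a disjoint union. -/
def GB1.equivSum : GB1 ≃ Fin 4 ⊕ Fin 3 × (Fin 4 ⊕ Fin 7) where
  toFun
    | .scalar i => .inl i
    | .frame i μ => .inr (i, .inl μ)
    | .diag i => .inr (i, .inr 0)
    | .curv i => .inr (i, .inr 1)
    | .conf i => .inr (i, .inr 2)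
    | .sym i => .inr (i, .inr 3)
    | .rotK i => .inr (i, .inr 4)
    | .rotJ i => .inr (i, .inr 5)
    | .asym i => .inr (i, .inr 6)
  invFun
    | .inl i => .scalar i
    | .inr (i, .inl μ) => .frame i μ
    | .inr (i, .inr j) => match j with
      | 0 => .diag i
      | 1 => .curv i
      | 2 => .conf i
      | 3 => .sym i
      | 4 => .rotK i
      | 5 => .rotJ i
      | 6 => .asym i
  left_inv b := by cases b <;> rfl
  right_inv := by
    rintro (i | ⟨i, μ | j⟩)
    · rfl
    · rfl
    · fin_cases j <;> rfl

theorem sum_GB1 {N : Type*} [AddCommMonoid N] (F : GB1 → N) : ∑ b, F b =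
    ∑ i, F (.scalar i) + ∑ i, (∑ μ, F (.frame i μ) + (F (.diag i) + F (.curv i) + F (.conf i) +
      F (.sym i) + F (.rotK i) + F (.rotJ i) + F (.asym i))) := by
  rw [← GB1.equivSum.symm.sum_comp F, Fintype.sum_sum_type, Fintype.sum_prod_type]
  simp only [Fintype.sum_sum_type, Fin.sum_univ_seven]
  rfl

theorem gauged_fst_apply (t : ℝ) (g : GB1 → R) (a : Fin 4) : (gauged e t g).1 a =
    algebraMap ℝ R t • th1 0 (ofDer (e 0)) a + ∑ b, g b • (b.elt e).1 a := by
  simp only [gauged, fst_add, smul_fst, fst_sum, Pi.add_apply, Finset.sum_apply, Pi.smul_apply]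
  rfl

theorem gauged_snd (t : ℝ) (g : GB1 → R) (i : Fin 4) : (gauged e t g).2 i = g (.scalar i) := by
  have : (gauged e t g).2 i = ∑ b, g b * (b.elt e).2 i := by
    simp only [gauged, snd_add, smul_snd, snd_sum, Pi.add_apply, Finset.sum_apply,
      Pi.smul_apply, theta0Mul0, Pi.zero_apply, smul_zero, zero_add, smul_eq_mul]
  rw [this, sum_GB1]
  simp [GB1.elt, theta_apply]

/-- The coefficients of the boosts. -/
def boostCoeff (g : GB1 → R) (i l : Fin 3) : R :=
  if l = i then g (.diag i) else if l = i + 1 then g (.sym (i + 2)) + g (.asym (i + 2))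
  else g (.sym (i + 1)) - g (.asym (i + 1))

/-- The coefficients of the rotations. -/
def rotCoeff (g : GB1 → R) (i l : Fin 3) : R :=
  if l = i then -g (.curv i) + g (.curv (i + 1)) + g (.curv (i + 2))
  else if l = i + 1 then g (.rotJ (i + 2)) else g (.rotK (i + 1))

theorem confMatrix_eq (l : R) (b r : Fin 3 → R) : confMatrix l b r =
    l • 1 + ∑ i, b i • (Matrix.single 0 (sp i) 1 + Matrix.single (sp i) 0 1) +
      ∑ i, r i • (Matrix.single (sp (i + 1)) (sp (i + 2)) 1 -
        Matrix.single (sp (i + 2)) (sp (i + 1)) 1) := by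
  ext p q
  fin_cases p <;> fin_cases q <;> simp [confMatrix, Fin.sum_univ_three, sp]

theorem boost_eq (i : Fin 3) :
    (boost i : Der0 R) = (Matrix.single 0 (sp i) 1 + Matrix.single (sp i) 0 1, 0) := by
  refine Prod.ext (Matrix.ext fun p q => ?_) rfl
  fin_cases i <;> simp [boost, sigma, eta, sp, sub_eq_add_neg, ← Matrix.single_neg]

theorem rot_eq (i : Fin 3) :
    (rot i : Der0 R) = (Matrix.single (sp (i + 1)) (sp (i + 2)) 1 -
        Matrix.single (sp (i + 2)) (sp (i + 1)) 1, 0) := by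
  refine Prod.ext (Matrix.ext fun p q => ?_) rfl
  fin_cases i <;> simp [rot, sigma, eta, sp]

theorem confDer_eq (l : R) (b r : Fin 3 → R) (X : Derivation ℝ R R) : confDer l b r X =
    l • sigma0 + ∑ i, b i • boost i + ∑ i, r i • rot i + ofDer X := by
  refine Prod.ext ?_ ?_
  · simp only [confDer, confMatrix_eq, sigma0, boost_eq, rot_eq, ofDer, fst_add,
      smul_fst, fst_sum, add_zero]
  · simp [confDer, sigma0, boost_eq, rot_eq, ofDer, snd_sum]

theorem gauged_zero (t : ℝ) (g : GB1 → R) : (gauged e t g).1 0 = confDer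
    (∑ i, g (.diag i)) (fun i => g (.conf i)) 0 (algebraMap ℝ R t • e 0) := by
  have hE : ofDer (algebraMap ℝ R t • e 0) = algebraMap ℝ R t • ofDer (e 0) :=
    Prod.ext (by simp [ofDer]) rfl
  rw [gauged_fst_apply, sum_GB1, confDer_eq, hE]
  simp [GB1.elt, th1, tens, theta_apply, Fin.sum_univ_three, sp]
  module

theorem gauged_sp (t : ℝ) (g : GB1 → R) (i : Fin 3) : (gauged e t g).1 (sp i) = confDer
    (g (.conf i)) (boostCoeff g i) (rotCoeff g i) (frameDer e g i) := by
  have hE : ofDer (frameDer e g i) = ∑ μ, g (.frame i μ) • ofDer (e μ) := by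
    refine Prod.ext ?_ ?_ <;> simp [ofDer, frameDer, fst_sum, snd_sum]
  rw [gauged_fst_apply, sum_GB1, confDer_eq, hE]
  fin_cases i <;>
  simp [GB1.elt, th1, tens, theta_apply, Fin.sum_univ_three, sp, boostCoeff, rotCoeff] <;> module

end Eval

section Formula

set_option maxHeartbeats 1000000 in
theorem comm_confDer (l l' : R) (b r b' r' : Fin 3 → R) (X X' : Derivation ℝ R R) :
    Der0.comm (confDer l b r X) (confDer l' b' r' X') = confDer (X l' - X' l)
      (fun i => X (b' i) - X' (b i) + (b (i + 2) * r' (i + 1) - b (i + 1) * r' (i + 2)) -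
        (b' (i + 2) * r (i + 1) - b' (i + 1) * r (i + 2)))
      (fun i => X (r' i) - X' (r i) + (b (i + 1) * b' (i + 2) - b (i + 2) * b' (i + 1)) +
        (r (i + 2) * r' (i + 1) - r (i + 1) * r' (i + 2))) ⁅X, X'⁆ := by
  refine Prod.ext (Matrix.ext fun p q => ?_) rfl
  fin_cases p <;> fin_cases q <;>
  simp [Der0.comm, confDer, confMatrix] <;> ring

theorem eta_zero : (eta 0 : R) = -1 := rfl

theorem eta_sp (i : Fin 3) : (eta (sp i) : R) = 1 := by fin_cases i <;> rfl

theorem eta_mul_self (i : Fin 4) : (eta i : R) * eta i = 1 := by fin_cases i <;> simp [eta]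

/-- The coefficients of the tensor in the bracket of `Φ¹`. -/
def phiTensor (a b : Fin 4 → R) (p q : Fin 4) : R :=
  -3 * (a p * b q + a q * b p) + (∑ c, eta c * a c * b c) * Matrix.diagonal eta p q

theorem brPhi_apply (a b : Fin 4 → R) (i p : Fin 4) : brPhi a b i p =
    ∑ q, (phiTensor a b p q * eta i) • sigma i q -
      ∑ q, (phiTensor a b i q * eta p) • sigma p q := by
  have h : brPhi a b i p = ∑ k, ∑ m, ∑ q, (if i = k then if p = m then
        (phiTensor a b m q * eta k) • sigma k q else 0 else 0) -
      ∑ k, ∑ m, ∑ q, (if p = k then if i = m then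
        (phiTensor a b m q * eta k) • sigma k q else 0 else (0 : Der0 R)) := by
    have h1 : brPhi a b = ∑ k, ∑ m, ∑ q, ((phiTensor a b m q * eta k) •
        th2 k m (sigma k q) : L2 R) := by
      refine sum_congr rfl fun k _ => ?_
      rw [sum_eq_single k]
      · simp only [Matrix.diagonal_apply_eq]; rfl
      · intro j _ hj
        simp [Matrix.diagonal_apply_ne _ hj.symm]
      · simp
    rw [h1]
    simp only [Finset.sum_apply, ← sum_sub_distrib]
    refine sum_congr rfl fun k _ => sum_congr rfl fun m _ =>
      sum_congr rfl fun q _ => ?_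
    simp only [Pi.smul_apply, th2, wedge, theta_apply]
    split_ifs <;> simp
  rw [h]
  congr 1
  · rw [sum_eq_single i (by intro k _ hk; simp [hk.symm]) (by simp),
      sum_eq_single p (by intro k _ hk; simp [hk.symm]) (by simp)]
    simp
  · rw [sum_eq_single p (by intro k _ hk; simp [hk.symm]) (by simp),
      sum_eq_single i (by intro k _ hk; simp [hk.symm]) (by simp)]
    simp

theorem sigma_entry (i q r s : Fin 4) : (sigma i q : Der0 R).1 r s =
    (if i = r ∧ q = s then eta q else 0) - if q = r ∧ i = s then eta i else 0 := by
  simp [sigma, Matrix.single_apply]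

theorem Der0.comm_swap (δ ε : Der0 R) : Der0.comm ε δ = -Der0.comm δ ε := by
  refine Prod.ext ?_ ?_
  · simp only [Der0.comm, Prod.fst_neg]; abel
  · simp only [Der0.comm, Prod.snd_neg, ← lie_skew ε.2 δ.2]

theorem brL_self_apply (x : L1 R) (a b : Fin 4) : brL x x a b =
    (2 : R) • (Der0.comm (x a) (x b) + ∑ c, ((x a).1 b c - (x b).1 a c) • x c) := by
  rw [brL_apply, Der0.comm_swap (x a) (x b), two_smul]
  abel

theorem confMatrix_zero_zero (l : R) (b r : Fin 3 → R) : confMatrix l b r 0 0 = l := rfl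

theorem confMatrix_zero_sp (l : R) (b r : Fin 3 → R) (i : Fin 3) :
    confMatrix l b r 0 (sp i) = b i := by fin_cases i <;> rfl

theorem confMatrix_sp_zero (l : R) (b r : Fin 3 → R) (i : Fin 3) :
    confMatrix l b r (sp i) 0 = b i := by fin_cases i <;> rfl

theorem confMatrix_sp_sp (l : R) (b r : Fin 3 → R) (i j : Fin 3) :
    confMatrix l b r (sp i) (sp j) =
      if j = i then l else if j = i + 1 then r (i + 2) else -r (i + 1) := by
  fin_cases i <;> fin_cases j <;> rfl

theorem sum_sp {N : Type*} [AddCommMonoid N] (f : Fin 4 → N) :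
    ∑ c, f c = f 0 + ∑ m, f (sp m) := Fin.sum_univ_succ f

theorem sum_cyclic {N : Type*} [AddCommMonoid N] (f : Fin 3 → N) (i : Fin 3) :
    ∑ c, f c = f i + f (i + 1) + f (i + 2) := by
  fin_cases i <;> simp [Fin.sum_univ_three] <;> abel

section Arith

theorem fin3_add (i : Fin 3) :
    i + 1 + 1 = i + 2 ∧ i + 1 + 2 = i ∧ i + 2 + 1 = i ∧ i + 2 + 2 = i + 1 := by decide +revert
theorem fin3_ne_add_one (i : Fin 3) : i ≠ i + 1 := by fin_cases i <;> decide
theorem fin3_ne_add_two (i : Fin 3) : i ≠ i + 2 := by fin_cases i <;> decide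
theorem fin3_add_one_ne_add_two (i : Fin 3) : i + 1 ≠ i + 2 := by fin_cases i <;> decide

end Arith

variable (e) (t : ℝ) (g : GB1 → R)

theorem gauged_half_zero_sp (k : Fin 3) : brL (gauged e t g).1 (gauged e t g).1 0 (sp k) =
    (2 : R) • (Der0.comm ((gauged e t g).1 0) ((gauged e t g).1 (sp k)) +
      (∑ i, g (.diag i)) • (gauged e t g).1 (sp k) -
      ∑ m, boostCoeff g k m • (gauged e t g).1 (sp m)) := by
  rw [brL_self_apply, add_sub_assoc]
  congr 2
  have h : ∀ m, ((gauged e t g).1 0).1 (sp k) (sp m) - ((gauged e t g).1 (sp k)).1 0 (sp m) =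
      (if m = k then ∑ i, g (.diag i) else 0) - boostCoeff g k m := by
    intro m
    simp [gauged_zero, gauged_sp, confDer, confMatrix_zero_sp, confMatrix_sp_sp]
  rw [sum_sp]
  simp only [h, sub_smul, sum_sub_distrib]
  simp [gauged_zero, gauged_sp, confDer, confMatrix_sp_zero, confMatrix_zero_zero]

theorem gauged_half_sp_sp (k : Fin 3) :
    brL (gauged e t g).1 (gauged e t g).1 (sp (k + 1)) (sp (k + 2)) =
    (2 : R) • (Der0.comm ((gauged e t g).1 (sp (k + 1))) ((gauged e t g).1 (sp (k + 2))) +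
      ((2 * g (.asym k)) • (gauged e t g).1 0 + (2 * g (.curv k)) • (gauged e t g).1 (sp k) +
      (-g (.conf (k + 2)) - g (.rotK (k + 2))) • (gauged e t g).1 (sp (k + 1)) +
      (g (.conf (k + 1)) - g (.rotJ (k + 1))) • (gauged e t g).1 (sp (k + 2)))) := by
  have h : ∀ i m l, ((gauged e t g).1 (sp i)).1 (sp m) (sp l) = if l = m then g (.conf i) else
      if l = m + 1 then rotCoeff g i (m + 2) else -rotCoeff g i (m + 1) := by
    intro i m l; simp [gauged_sp, confDer, confMatrix_sp_sp]
  have h0 : ∀ i m, ((gauged e t g).1 (sp i)).1 (sp m) 0 = boostCoeff g i m := by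
    intro i m; simp [gauged_sp, confDer, confMatrix_sp_zero]
  rw [brL_self_apply, sum_sp, sum_cyclic _ k]
  congr 2
  simp only [h, h0, boostCoeff, rotCoeff, fin3_add, fin3_ne_add_one, fin3_ne_add_two, fin3_add_one_ne_add_two,
    (fin3_ne_add_one k).symm, (fin3_ne_add_two k).symm, (fin3_add_one_ne_add_two k).symm,
    if_true, if_false]
  module

end Formula

section Formula

theorem brPhi_entry (a b : Fin 4 → R) (i p r s : Fin 4) : (brPhi a b i p).1 r s =
    eta i * ((if i = r then phiTensor a b p s * eta s else 0) -
      if i = s then phiTensor a b p r * eta i else 0) -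
    eta p * ((if p = r then phiTensor a b i s * eta s else 0) -
      if p = s then phiTensor a b i r * eta p else 0) := by
  rw [brPhi_apply, fst_sub, fst_sum, fst_sum, Matrix.sub_apply, Matrix.sum_apply, Matrix.sum_apply]
  simp only [smul_fst, Matrix.smul_apply, sigma_entry, smul_eq_mul, mul_sub,
    sum_sub_distrib, ite_and]
  congr 1 <;> congr 1 <;> split_ifs <;> simp <;> ring

theorem brPhi_snd (a b : Fin 4 → R) (i p : Fin 4) : (brPhi a b i p).2 = 0 := by
  rw [brPhi_apply, Prod.snd_sub, snd_sum, snd_sum]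
  simp [sigma]

variable (e) (t : ℝ) (g : GB1 → R)

theorem smul_apply_derivation (c : R) (X : Derivation ℝ R R) (f : R) : (c • X) f = c * X f := rfl

theorem comm_gauged_zero_sp (k : Fin 3) :
    Der0.comm ((gauged e t g).1 0) ((gauged e t g).1 (sp k)) = confDer
      (algebraMap ℝ R t * e 0 (g (.conf k)) - frameDer e g k (∑ i, g (.diag i)))
      (fun i => algebraMap ℝ R t * e 0 (boostCoeff g k i) - frameDer e g k (g (.conf i)) +
        (g (.conf (i + 2)) * rotCoeff g k (i + 1) - g (.conf (i + 1)) * rotCoeff g k (i + 2)))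
      (fun i => algebraMap ℝ R t * e 0 (rotCoeff g k i) +
        (g (.conf (i + 1)) * boostCoeff g k (i + 2) - g (.conf (i + 2)) * boostCoeff g k (i + 1)))
      (algebraMap ℝ R t • ⁅e 0, frameDer e g k⁆) := by
  have hX : ⁅algebraMap ℝ R t • e 0, frameDer e g k⁆ =
      algebraMap ℝ R t • ⁅e 0, frameDer e g k⁆ := by
    rw [algebraMap_smul, algebraMap_smul, smul_lie]
  rw [gauged_zero, gauged_sp, comm_confDer, hX]
  congr 1
  all_goals
    funext i
    simp [Algebra.smul_def]

section

variable (φ : Fin 4 → R) (k l : Fin 3)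

theorem entX_brPhi : entX k l (brPhi φ φ) =
    -phiTensor φ φ (sp k) (sp l) + if k = l then phiTensor φ φ 0 0 else 0 := by
  change (brPhi φ φ _ _).1 _ _ = _
  rw [brPhi_entry]
  fin_cases k <;> fin_cases l <;> simp [sp, eta]

theorem entZ_brPhi : entZ k l (brPhi φ φ) = -if k = l + 1 then phiTensor φ φ 0 (sp (l + 2)) else
    if k = l + 2 then -phiTensor φ φ 0 (sp (l + 1)) else 0 := by
  change (brPhi φ φ _ _).1 _ _ = _
  rw [brPhi_entry]
  fin_cases k <;> fin_cases l <;> simp [sp, eta]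

theorem entP_brPhi : entP k (brPhi φ φ) = 0 := by
  change (brPhi φ φ _ _).1 _ _ = _
  rw [brPhi_entry]
  fin_cases k <;> simp [sp]

theorem entQ_brPhi : entQ k (brPhi φ φ) = 0 := by
  change (brPhi φ φ _ _).1 _ _ = _
  rw [brPhi_entry]
  fin_cases k <;> simp [sp]

theorem entV_brPhi : entV k l (brPhi φ φ) = (if l = k + 2 then phiTensor φ φ (sp (k + 1)) 0 else 0) -
    if l = k + 1 then phiTensor φ φ (sp (k + 2)) 0 else 0 := by
  change (brPhi φ φ _ _).1 _ _ = _
  rw [brPhi_entry]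
  fin_cases k <;> fin_cases l <;> simp [sp, eta]

theorem entY_brPhi : entY k l (brPhi φ φ) =
    (if k = l then phiTensor φ φ (sp (k + 1)) (sp (k + 1)) + phiTensor φ φ (sp (k + 2)) (sp (k + 2))
      else -phiTensor φ φ (sp k) (sp l)) := by
  change (brPhi φ φ _ _).1 _ _ = _
  rw [brPhi_entry]
  fin_cases k <;> fin_cases l <;> simp [sp, eta, phiTensor] <;> ring

end

theorem entX_gauged (k l : Fin 3) : entX k l (brL (gauged e t g).1 (gauged e t g).1) =
    2 * (algebraMap ℝ R t * e 0 (boostCoeff g k l) - frameDer e g k (g (.conf l)) +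
      (g (.conf (l + 2)) * rotCoeff g k (l + 1) - g (.conf (l + 1)) * rotCoeff g k (l + 2)) +
      (∑ i, g (.diag i)) * boostCoeff g k l - ∑ m, boostCoeff g k m * boostCoeff g m l) := by
  change (brL _ _ _ _).1 _ _ = _
  rw [gauged_half_zero_sp, comm_gauged_zero_sp]
  simp only [gauged_sp, smul_fst, fst_add, fst_sub, fst_sum, Matrix.smul_apply,
    Matrix.add_apply, Matrix.sub_apply, Matrix.sum_apply, confDer, confMatrix_zero_sp, smul_eq_mul]

theorem entZ_gauged (k l : Fin 3) : entZ k l (brL (gauged e t g).1 (gauged e t g).1) =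
    2 * (algebraMap ℝ R t * e 0 (rotCoeff g k l) +
      (g (.conf (l + 1)) * boostCoeff g k (l + 2) - g (.conf (l + 2)) * boostCoeff g k (l + 1)) +
      (∑ i, g (.diag i)) * rotCoeff g k l - ∑ m, boostCoeff g k m * rotCoeff g m l) := by
  change (brL _ _ _ _).1 _ _ = _
  rw [gauged_half_zero_sp, comm_gauged_zero_sp]
  simp [gauged_sp, fst_sum, Matrix.sum_apply, confDer, confMatrix_sp_sp, fin3_add, (fin3_add_one_ne_add_two l).symm]

theorem entP_gauged (k : Fin 3) : entP k (brL (gauged e t g).1 (gauged e t g).1) =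
    2 * (algebraMap ℝ R t * e 0 (g (.conf k)) - frameDer e g k (∑ i, g (.diag i)) +
      (∑ i, g (.diag i)) * g (.conf k) - ∑ m, boostCoeff g k m * g (.conf m)) := by
  change (brL _ _ _ _).1 _ _ = _
  rw [gauged_half_zero_sp, comm_gauged_zero_sp]
  simp only [gauged_sp, smul_fst, fst_add, fst_sub, fst_sum, Matrix.smul_apply,
    Matrix.add_apply, Matrix.sub_apply, Matrix.sum_apply, confDer, confMatrix_zero_zero,
    smul_eq_mul]

theorem entQ_gauged (k : Fin 3) : entQ k (brL (gauged e t g).1 (gauged e t g).1) =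
    2 * (frameDer e g (k + 1) (g (.conf (k + 2))) - frameDer e g (k + 2) (g (.conf (k + 1))) +
      (2 * g (.asym k) * (∑ i, g (.diag i)) + 2 * g (.curv k) * g (.conf k) +
      (-g (.conf (k + 2)) - g (.rotK (k + 2))) * g (.conf (k + 1)) +
      (g (.conf (k + 1)) - g (.rotJ (k + 1))) * g (.conf (k + 2)))) := by
  change (brL _ _ _ _).1 _ _ = _
  rw [gauged_half_sp_sp, gauged_zero, gauged_sp, gauged_sp, gauged_sp, comm_confDer]
  simp only [smul_fst, fst_add, Matrix.smul_apply,
    Matrix.add_apply, confDer, confMatrix_zero_zero, smul_eq_mul]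

theorem entV_gauged (k l : Fin 3) : entV k l (brL (gauged e t g).1 (gauged e t g).1) =
    2 * (frameDer e g (k + 1) (boostCoeff g (k + 2) l) - frameDer e g (k + 2) (boostCoeff g (k + 1) l) +
      (boostCoeff g (k + 1) (l + 2) * rotCoeff g (k + 2) (l + 1) -
        boostCoeff g (k + 1) (l + 1) * rotCoeff g (k + 2) (l + 2)) -
      (boostCoeff g (k + 2) (l + 2) * rotCoeff g (k + 1) (l + 1) -
        boostCoeff g (k + 2) (l + 1) * rotCoeff g (k + 1) (l + 2)) +
      (2 * g (.asym k) * g (.conf l) + 2 * g (.curv k) * boostCoeff g k l +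
      (-g (.conf (k + 2)) - g (.rotK (k + 2))) * boostCoeff g (k + 1) l +
      (g (.conf (k + 1)) - g (.rotJ (k + 1))) * boostCoeff g (k + 2) l)) := by
  change (brL _ _ _ _).1 _ _ = _
  rw [gauged_half_sp_sp, gauged_zero, gauged_sp, gauged_sp, gauged_sp, comm_confDer]
  simp only [smul_fst, fst_add, Matrix.smul_apply,
    Matrix.add_apply, confDer, confMatrix_zero_sp, smul_eq_mul]

theorem entY_gauged (k l : Fin 3) : entY k l (brL (gauged e t g).1 (gauged e t g).1) =
    2 * (frameDer e g (k + 1) (rotCoeff g (k + 2) l) - frameDer e g (k + 2) (rotCoeff g (k + 1) l) +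
      (boostCoeff g (k + 1) (l + 1) * boostCoeff g (k + 2) (l + 2) -
        boostCoeff g (k + 1) (l + 2) * boostCoeff g (k + 2) (l + 1)) +
      (rotCoeff g (k + 1) (l + 2) * rotCoeff g (k + 2) (l + 1) -
        rotCoeff g (k + 1) (l + 1) * rotCoeff g (k + 2) (l + 2)) +
      (2 * g (.curv k) * rotCoeff g k l +
      (-g (.conf (k + 2)) - g (.rotK (k + 2))) * rotCoeff g (k + 1) l +
      (g (.conf (k + 1)) - g (.rotJ (k + 1))) * rotCoeff g (k + 2) l)) := by
  change (brL _ _ _ _).1 _ _ = _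
  rw [gauged_half_sp_sp, gauged_zero, gauged_sp, gauged_sp, gauged_sp, comm_confDer]
  simp [confDer, confMatrix_sp_sp, fin3_add, (fin3_add_one_ne_add_two l).symm]
  ring

theorem brLPhi_fst (x : L1 R) (φ : Fin 4 → R) (a b : Fin 4) :
    (brLPhi x φ).1 a b = (x a).act φ b - (x b).act φ a := by
  simp only [brLPhi, wPhi, fst_sum, Finset.sum_apply, theta_apply, ite_mul, one_mul, zero_mul,
    sum_sub_distrib, Fintype.sum_ite_eq]

theorem brLPhi_snd (x : L1 R) (φ : Fin 4 → R) :
    (brLPhi x φ).2 = -∑ i, eta i * (x i).act φ i := by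
  simp only [brLPhi, wPhi, snd_sum, theta_apply, mul_ite, ite_mul, mul_one, mul_zero, zero_mul,
    Finset.sum_ite_eq', Finset.mem_univ, if_true, sum_neg_distrib]

theorem coord_eq_coordL (c : B2) (z : E2 R) (U : L2 R) (hz : z.1 = Submodule.Quotient.mk U)
    (h : ∀ i, c ≠ .inl (.scalar i)) (h' : ∀ i, c ≠ .inr (.scalar i)) : coord c z = coordL c U := by
  have : ((I2 R).liftQ (coordL c) (I2_le_ker_coordL c)).comp (LinearMap.fst R _ _) z =
      coordL c U := by
    change (I2 R).liftQ _ (I2_le_ker_coordL c) z.1 = _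
    rw [hz]; rfl
  rcases c with c | c <;> cases c <;> first | exact this | exact absurd rfl (h _) |
    exact absurd rfl (h' _)

theorem br11_fst (x y : E1 R) :
    (br11 x y).1 = Submodule.Quotient.mk (brL x.1 y.1 + brPhi x.2 y.2) := rfl

theorem br11_snd (x y : E1 R) : (br11 x y).2 = brLPhi x.1 y.2 + brLPhi y.1 x.2 := rfl

variable (C : Fin 4 → Fin 4 → Fin 4 → R)

theorem quad_scalar_sp (i : Fin 3) : quad (.inr (.scalar (sp i))) = waveTerms i := rfl

set_option maxHeartbeats 2000000 in
theorem coord_br11_gauged_theta0 (b : GB1) (hb : ∀ i μ, b ≠ .frame i μ) :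
    coord (.inr b) (br11 (gauged e t g) (gauged e t g)) =
    2 * (mult b * algebraMap ℝ R t * e 0 (g b) +
      quadEval (frameDer e g) C (algebraMap ℝ R t) g g (.inr b)) := by
  cases b
  case frame i μ => exact absurd rfl (hb i μ)
  case scalar m =>
    cases m using Fin.cases with
    | zero =>
      change (br11 _ _).2.2 = _
      rw [br11_snd, snd_add, brLPhi_snd]
      simp only [Der0.act, Pi.add_apply, Matrix.mulVec, dotProduct, sum_sp, gauged_zero, gauged_sp,
        confDer, gauged_snd, confMatrix_zero_zero, confMatrix_sp_sp, confMatrix_zero_sp,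
        confMatrix_sp_zero, eta_zero, eta_sp, boostCoeff, rotCoeff]
      simp [Fin.sum_univ_three, quadEval, quad, divTerms, QTerm.eval, mult, sp, Algebra.smul_def]
      ring
    | succ i =>
      change (br11 _ _).2.1 0 (sp i) = 2 * (_ + quadEval _ _ _ _ _ (.inr (.scalar (sp i))))
      simp only [quadEval, quad_scalar_sp]
      rw [br11_snd, fst_add, Pi.add_apply, Pi.add_apply, brLPhi_fst]
      simp only [Der0.act, Pi.add_apply, Matrix.mulVec, dotProduct, sum_sp, gauged_zero, gauged_sp,
        confDer, gauged_snd, confMatrix_zero_zero, confMatrix_sp_sp, confMatrix_zero_sp,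
        confMatrix_sp_zero, boostCoeff]
      fin_cases i <;>
      simp [Fin.sum_univ_three, waveTerms, QTerm.eval, mult, sp, Algebra.smul_def] <;>
      ring
  all_goals
    rename_i i
    rw [coord_eq_coordL _ _ _ (br11_fst _ _) (by simp) (by simp), map_add]
    simp only [coordL, LinearMap.add_apply, LinearMap.sub_apply, entX_gauged, entY_gauged,
      entX_brPhi, entY_brPhi, entZ_gauged, entV_gauged, entZ_brPhi, entV_brPhi, entP_gauged,
      entQ_gauged, entP_brPhi, entQ_brPhi]
    simp only [boostCoeff, rotCoeff, fin3_add, fin3_ne_add_one, fin3_ne_add_two, fin3_add_one_ne_add_two,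
      (fin3_ne_add_one i).symm, (fin3_ne_add_two i).symm, (fin3_add_one_ne_add_two i).symm,
      if_true, if_false]
    fin_cases i <;>
    simp [Fin.sum_univ_three, phiTensor, gauged_snd, quadEval, quad, QTerm.eval, Fin.sum_univ_four,
      mult, eta, sp] <;>
    ring

set_option maxHeartbeats 2000000 in
theorem coord_br11_gauged (c : GB2) (hc : ∀ i μ, c ≠ .frame i μ) :
    coord (.inl c) (br11 (gauged e t g) (gauged e t g)) =
    2 * quadEval (frameDer e g) C (algebraMap ℝ R t) g g (.inl c) := by
  cases c
  case frame i μ => exact absurd rfl (hc i μ)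
  case scalar i =>
    change (br11 _ _).2.1 (sp (i + 1)) (sp (i + 2)) = _
    rw [br11_snd, fst_add, Pi.add_apply, Pi.add_apply, brLPhi_fst]
    simp only [Der0.act, Pi.add_apply, Matrix.mulVec, dotProduct, sum_sp, gauged_sp,
      confDer, gauged_snd, confMatrix_sp_sp,
      confMatrix_sp_zero, boostCoeff, rotCoeff]
    fin_cases i <;>
    simp [Fin.sum_univ_three, quadEval, quad, QTerm.eval, sp] <;>
    ring
  case zero =>
    rw [coord_eq_coordL _ _ _ (br11_fst _ _) (by simp) (by simp), map_add]
    simp only [coordL, LinearMap.add_apply, entY_gauged, entY_brPhi, boostCoeff, rotCoeff]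
    simp [phiTensor, gauged_snd, quadEval, quad, zeroTerms, QTerm.eval, Fin.sum_univ_four, eta, sp]
    ring
  case top =>
    rw [coord_eq_coordL _ _ _ (br11_fst _ _) (by simp) (by simp), map_add]
    simp only [coordL, LinearMap.add_apply, LinearMap.neg_apply, entV_gauged, entV_brPhi,
      boostCoeff, rotCoeff]
    simp [quadEval, quad, QTerm.eval]
    ring
  all_goals
    rename_i i
    rw [coord_eq_coordL _ _ _ (br11_fst _ _) (by simp) (by simp), map_add]
    simp only [coordL, LinearMap.sub_apply, LinearMap.neg_apply, entY_gauged,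
      entY_brPhi, entV_gauged, entV_brPhi, entQ_gauged, entQ_brPhi]
    try simp only [boostCoeff, rotCoeff, fin3_add, fin3_ne_add_one, fin3_ne_add_two, fin3_add_one_ne_add_two,
      (fin3_ne_add_one i).symm, (fin3_ne_add_two i).symm, (fin3_add_one_ne_add_two i).symm,
      if_true, if_false]
    fin_cases i <;>
    simp [Fin.sum_univ_three, phiTensor, gauged_snd, quadEval, quad, QTerm.eval, Fin.sum_univ_four,
      eta, sp] <;>
    ring

theorem anchor_br11_eq (a b : Fin 4) (x y : E1 R) : anchor a b (br11 x y) = (brL x.1 y.1 a b).2 := by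
  change (brL x.1 y.1 a b).2 + (brPhi x.2 y.2 a b).2 = _
  rw [brPhi_snd, add_zero]

theorem anchor_br11_gauged_zero (i : Fin 3) :
    anchor 0 (sp i) (br11 (gauged e t g) (gauged e t g)) = (2 : R) •
      (algebraMap ℝ R t • ⁅e 0, frameDer e g i⁆ + (∑ i, g (.diag i)) • frameDer e g i -
        ∑ m, boostCoeff g i m • frameDer e g m) := by
  rw [anchor_br11_eq, gauged_half_zero_sp, comm_gauged_zero_sp]
  simp only [gauged_sp, confDer, smul_snd, snd_add, Prod.snd_sub, snd_sum]

theorem anchor_br11_gauged (k : Fin 3) :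
    anchor (sp (k + 1)) (sp (k + 2)) (br11 (gauged e t g) (gauged e t g)) = (2 : R) •
      (⁅frameDer e g (k + 1), frameDer e g (k + 2)⁆ +
      ((2 * g (.asym k)) • algebraMap ℝ R t • e 0 + (2 * g (.curv k)) • frameDer e g k +
      (-g (.conf (k + 2)) - g (.rotK (k + 2))) • frameDer e g (k + 1) +
      (g (.conf (k + 1)) - g (.rotJ (k + 1))) • frameDer e g (k + 2))) := by
  rw [anchor_br11_eq, gauged_half_sp_sp]
  simp only [gauged_zero, gauged_sp, confDer, smul_snd, snd_add]
  rfl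

end Formula

section Injectivity

variable (R) in
/-- The conformal derivations. -/
def CDer : Submodule R (Der0 R) where
  carrier := {δ | ∃ l b r X, δ = confDer l b r X}
  add_mem' := by
    rintro _ _ ⟨l, b, r, X, rfl⟩ ⟨l', b', r', X', rfl⟩
    refine ⟨l + l', b + b', r + r', X + X', ?_⟩
    rw [confDer_eq, confDer_eq, confDer_eq,
      show ofDer (X + X') = ofDer X + ofDer X' from Prod.ext (by simp [ofDer]) rfl]
    simp only [Pi.add_apply, add_smul, sum_add_distrib]
    abel
  zero_mem' := ⟨0, 0, 0, 0, by simp [confDer_eq, ofDer]; rfl⟩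
  smul_mem' := by
    rintro c _ ⟨l, b, r, X, rfl⟩
    refine ⟨c * l, c • b, c • r, c • X, ?_⟩
    rw [confDer_eq, confDer_eq,
      show ofDer (c • X) = c • ofDer X from Prod.ext (by simp [ofDer]) rfl]
    simp only [Pi.smul_apply, smul_add, mul_smul, smul_sum, smul_eq_mul]

theorem confDer_mem (l : R) (b r : Fin 3 → R) (X : Derivation ℝ R R) :
    confDer l b r X ∈ CDer R := ⟨l, b, r, X, rfl⟩

theorem CDer_comm {δ ε : Der0 R} (hδ : δ ∈ CDer R) (hε : ε ∈ CDer R) :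
    Der0.comm δ ε ∈ CDer R := by
  obtain ⟨l, b, r, X, rfl⟩ := hδ
  obtain ⟨l', b', r', X', rfl⟩ := hε
  rw [comm_confDer]
  exact confDer_mem _ _ _ _

theorem sigma0_eq_confDer : (sigma0 : Der0 R) = confDer 1 0 0 0 := by
  simp [confDer_eq, ofDer]

theorem boost_eq_confDer (i : Fin 3) : (boost i : Der0 R) = confDer 0 (Pi.single i 1) 0 0 := by
  simp [confDer_eq, ofDer, Pi.single_apply]

theorem rot_eq_confDer (i : Fin 3) : (rot i : Der0 R) = confDer 0 0 (Pi.single i 1) 0 := by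
  simp [confDer_eq, ofDer, Pi.single_apply]

theorem ofDer_eq_confDer (X : Derivation ℝ R R) : ofDer X = confDer 0 0 0 X := by
  simp [confDer_eq]

theorem sigma0_mem : (sigma0 : Der0 R) ∈ CDer R := sigma0_eq_confDer (R := R) ▸ confDer_mem _ _ _ _
theorem boost_mem (i : Fin 3) : (boost i : Der0 R) ∈ CDer R :=
  boost_eq_confDer (R := R) i ▸ confDer_mem _ _ _ _
theorem rot_mem (i : Fin 3) : (rot i : Der0 R) ∈ CDer R :=
  rot_eq_confDer (R := R) i ▸ confDer_mem _ _ _ _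
theorem ofDer_mem (X : Derivation ℝ R R) : ofDer X ∈ CDer R :=
  ofDer_eq_confDer X ▸ confDer_mem _ _ _ _

theorem sigma_mem (a b : Fin 4) : (sigma a b : Der0 R) ∈ CDer R := by
  have h0 : ∀ a, (sigma a a : Der0 R) = 0 := fun a => by simp [sigma]
  have hs : ∀ a b, (sigma a b : Der0 R) = -sigma b a := fun a b => by simp [sigma]
  have h1 := boost_mem (R := R) 0
  have h2 := boost_mem (R := R) 1
  have h3 := boost_mem (R := R) 2
  have h4 := rot_mem (R := R) 0
  have h5 := rot_mem (R := R) 1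
  have h6 := rot_mem (R := R) 2
  simp only [boost, rot, sp] at h1 h2 h3 h4 h5 h6
  fin_cases a <;> fin_cases b <;> first
    | exact (h0 _).symm ▸ (CDer R).zero_mem
    | assumption
    | (rw [hs]; refine (CDer R).neg_mem ?_; assumption)

variable (R) in
/-- The elements of degree one with conformal coefficients. -/
def CE1 : Submodule R (E1 R) where
  carrier := {x | ∀ a, x.1 a ∈ CDer R}
  add_mem' := fun hx hy a => (CDer R).add_mem (hx a) (hy a)
  zero_mem' := fun _ => (CDer R).zero_mem
  smul_mem' := fun c _ hx a => (CDer R).smul_mem c (hx a)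

variable (R) in
/-- The elements of degree two that come from skew arrays with conformal coefficients. -/
def CE2 : Submodule R (E2 R) where
  carrier := {z | (∃ U : L2 R, (∀ a b, U a b ∈ CDer R) ∧ (∀ a b, U a b = -U b a) ∧
    z.1 = Submodule.Quotient.mk U) ∧ ∀ a b, z.2.1 a b = -z.2.1 b a}
  add_mem' := by
    rintro z w ⟨⟨U, hU, hU', hz⟩, h⟩ ⟨⟨V, hV, hV', hw⟩, h'⟩
    refine ⟨⟨U + V, fun a b => (CDer R).add_mem (hU a b) (hV a b), fun a b => ?_, ?_⟩, fun a b => ?_⟩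
    · change U a b + V a b = -(U b a + V b a)
      rw [hU' a b, hV' a b, neg_add]
    · rw [fst_add, hz, hw, Submodule.Quotient.mk_add]
    · change z.2.1 a b + w.2.1 a b = -(z.2.1 b a + w.2.1 b a)
      rw [h, h', neg_add]
  zero_mem' := ⟨⟨0, fun _ _ => (CDer R).zero_mem, fun _ _ => by simp, rfl⟩, fun _ _ => by simp⟩
  smul_mem' := by
    rintro c z ⟨⟨U, hU, hU', hz⟩, h⟩
    refine ⟨⟨c • U, fun a b => (CDer R).smul_mem c (hU a b), fun a b => ?_, ?_⟩, fun a b => ?_⟩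
    · change c • U a b = -(c • U b a)
      rw [hU' a b, smul_neg]
    · rw [smul_fst, hz, Submodule.Quotient.mk_smul]
    · change c * z.2.1 a b = -(c * z.2.1 b a)
      rw [h, mul_neg]

theorem br11_mem {x y : E1 R} (hx : x ∈ CE1 R) (hy : y ∈ CE1 R) : br11 x y ∈ CE2 R := by
  refine ⟨⟨_, fun a b => ?_, fun a b => ?_, br11_fst x y⟩, fun a b => ?_⟩
  · refine (CDer R).add_mem ?_ ?_
    · rw [brL_apply]
      refine (CDer R).add_mem ((CDer R).add_mem ((CDer R).sub_mem (CDer_comm (hx a) (hy b))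
        (CDer_comm (hx b) (hy a))) ?_) ?_ <;>
        exact (CDer R).sum_mem fun c _ => (CDer R).smul_mem _ (by first | exact hx c | exact hy c)
    · rw [brPhi_apply]
      exact (CDer R).sub_mem ((CDer R).sum_mem fun c _ => (CDer R).smul_mem _ (sigma_mem _ _))
        ((CDer R).sum_mem fun c _ => (CDer R).smul_mem _ (sigma_mem _ _))
  · change brL x.1 y.1 a b + brPhi x.2 y.2 a b = -(brL x.1 y.1 b a + brPhi x.2 y.2 b a)
    simp only [brL_apply, brPhi_apply, sub_smul, sum_sub_distrib]
    abel
  · change (brLPhi x.1 y.2).1 a b + (brLPhi y.1 x.2).1 a b =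
      -((brLPhi x.1 y.2).1 b a + (brLPhi y.1 x.2).1 b a)
    rw [brLPhi_fst, brLPhi_fst, brLPhi_fst, brLPhi_fst]
    ring

theorem skew_eq_zero {N : Type*} [AddCommGroup N] [Module ℝ N] (ψ : Fin 4 → Fin 4 → N)
    (hs : ∀ a b, ψ a b = -ψ b a) (h0 : ∀ i, ψ 0 (sp i) = 0)
    (h : ∀ i, ψ (sp (i + 1)) (sp (i + 2)) = 0) : ψ = 0 := by
  have hd : ∀ a, ψ a a = 0 := fun a => by
    have h2 : (2 : ℝ) • ψ a a = 0 := by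
      rw [two_smul]; nth_rw 1 [hs a a]; simp
    exact (smul_eq_zero.1 h2).resolve_left two_ne_zero
  have h01 := h0 0
  have h02 := h0 1
  have h03 := h0 2
  have h12 := h 2
  have h23 := h 0
  have h31 := h 1
  simp only [sp] at h01 h02 h03 h12 h23 h31
  funext a b
  fin_cases a <;> fin_cases b <;> first
    | exact hd _
    | assumption
    | (rw [hs]; refine neg_eq_zero.2 ?_; assumption)

theorem fst_entry_of_mem {δ : Der0 R} (hδ : δ ∈ CDer R) : δ = confDer (δ.1 0 0)
    (fun i => δ.1 0 (sp i)) (fun i => δ.1 (sp (i + 1)) (sp (i + 2))) δ.2 := by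
  obtain ⟨l, b, r, X, rfl⟩ := hδ
  simp [confDer, confMatrix_zero_zero, confMatrix_zero_sp, confMatrix_sp_sp, fin3_add, (fin3_add_one_ne_add_two _).symm]

theorem fin3_cases (k l : Fin 3) :
    k = l ∨ (∃ i, k = i + 1 ∧ l = i + 2) ∨ ∃ i, k = i + 2 ∧ l = i + 1 := by
  revert k l; decide

theorem two_cancel {a b : R} (h : 2 * a = 2 * b) : a = b := by
  have : (2 : ℝ) • a = (2 : ℝ) • b := by
    rw [Algebra.smul_def, Algebra.smul_def, map_ofNat]; exact h
  exact smul_right_injective R (two_ne_zero (α := ℝ)) this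

theorem neg_of_constraints {X Y : Fin 3 → Fin 3 → R} (hX : ∀ k l, X k l = X l k)
    (htr : Y 0 0 + Y 1 1 + Y 2 2 = 0)
    (hd : ∀ i, X i i + Y i i - (Y 0 0 + Y 1 1 + Y 2 2) = 0)
    (hs : ∀ i, X (i + 1) (i + 2) + X (i + 2) (i + 1) + (Y (i + 1) (i + 2) + Y (i + 2) (i + 1)) = 0)
    (hY : ∀ i, Y (i + 1) (i + 2) - Y (i + 2) (i + 1) = 0) (k l : Fin 3) : Y k l = -X k l := by
  rcases fin3_cases k l with rfl | ⟨i, rfl, rfl⟩ | ⟨i, rfl, rfl⟩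
  · linear_combination hd k + htr
  · exact two_cancel (by linear_combination hs i + hY i + hX (i + 1) (i + 2))
  · exact two_cancel (by linear_combination hs i - hY i - hX (i + 1) (i + 2))

theorem symm_of_cyclic {A : Type*} {X : Fin 3 → Fin 3 → A} (h : ∀ i, X (i + 1) (i + 2) = X (i + 2) (i + 1))
    (k l : Fin 3) : X k l = X l k := by
  rcases fin3_cases k l with rfl | ⟨i, rfl, rfl⟩ | ⟨i, rfl, rfl⟩
  · rfl
  · exact h i
  · exact (h i).symm

theorem eq_of_constraints {Z V : Fin 3 → Fin 3 → R} (htr : V 0 0 + V 1 1 + V 2 2 = 0)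
    (hd : ∀ i, Z (i + 1) (i + 1) + Z (i + 2) (i + 2) + V i i = 0)
    (hm : ∀ i, V (i + 2) (i + 1) = V (i + 1) (i + 2))
    (hJ : ∀ i, Z (i + 1) (i + 2) = V (i + 2) (i + 1))
    (hK : ∀ i, Z (i + 2) (i + 1) = V (i + 1) (i + 2)) :
    Z 0 0 + Z 1 1 + Z 2 2 = 0 ∧ (∀ k l, V k l = Z k l) ∧ ∀ k l, Z k l = Z l k := by
  have h0 := hd 0
  have h1 := hd 1
  have h2 := hd 2
  simp only [Fin.isValue, zero_add, Fin.reduceAdd] at h0 h1 h2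
  have tr : Z 0 0 + Z 1 1 + Z 2 2 = 0 :=
    two_cancel (by linear_combination h0 + h1 + h2 - htr)
  refine ⟨tr, fun k l => ?_, symm_of_cyclic fun i => by rw [hJ, hK, hm]⟩
  rcases fin3_cases k l with rfl | ⟨i, rfl, rfl⟩ | ⟨i, rfl, rfl⟩
  · fin_cases k
    · change V 0 0 = Z 0 0; linear_combination h0 - tr
    · change V 1 1 = Z 1 1; linear_combination h1 - tr
    · change V 2 2 = Z 2 2; linear_combination h2 - tr
  · rw [hJ, hm]
  · rw [hK, hm]

theorem eq_zero_of_coord {z : E2 R} (hz : z ∈ CE2 R) (hc : ∀ c, coord c z = 0)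
    (h0 : ∀ i, anchor 0 (sp i) z = 0) (h : ∀ i, anchor (sp (i + 1)) (sp (i + 2)) z = 0) :
    z = 0 := by
  obtain ⟨⟨U, hU, hs, hzU⟩, hψ⟩ := hz
  have hL : ∀ c : B2, (∀ i, c ≠ .inl (.scalar i)) → (∀ i, c ≠ .inr (.scalar i)) →
      coordL c U = 0 := fun c h1 h2 => by rw [← coord_eq_coordL c z U hzU h1 h2, hc]
  have hX : ∀ k, (U 0 (sp k)).2 = 0 := fun k => by
    have := h0 k
    change ((I2 R).liftQ _ (I2_le_ker_anchorL _ _) z.1) = 0 at this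
    rw [hzU] at this; exact this
  have hY : ∀ k, (U (sp (k + 1)) (sp (k + 2))).2 = 0 := fun k => by
    have := h k
    change ((I2 R).liftQ _ (I2_le_ker_anchorL _ _) z.1) = 0 at this
    rw [hzU] at this; exact this
  have e1 := fun i => hL (.inr (.asym i)) (by simp) (by simp)
  have e2 := fun i => hL (.inr (.sym i)) (by simp) (by simp)
  have e3 := fun i => hL (.inr (.diag i)) (by simp) (by simp)
  have e4 := fun i => hL (.inl (.sym i)) (by simp) (by simp)
  have e5 := hL (.inl .zero) (by simp) (by simp)
  have e6 := fun i => hL (.inl (.asym i)) (by simp) (by simp)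
  have e7 := fun i => hL (.inr (.conf i)) (by simp) (by simp)
  have f1 := fun i => hL (.inr (.curv i)) (by simp) (by simp)
  have f2 := fun i => hL (.inr (.rotJ i)) (by simp) (by simp)
  have f3 := fun i => hL (.inr (.rotK i)) (by simp) (by simp)
  have f4 := fun i => hL (.inl (.mix i)) (by simp) (by simp)
  have f5 := hL (.inl .top) (by simp) (by simp)
  simp only [coordL, LinearMap.add_apply, LinearMap.sub_apply, LinearMap.neg_apply]
    at e1 e2 e3 e4 e5 e6 e7 f1 f2 f3 f4 f5
  have hXs : ∀ k l, entX k l U = entX l k U :=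
    symm_of_cyclic fun i => by linear_combination e1 i + e6 i
  have hXY : ∀ k l, entY k l U = -entX k l U := neg_of_constraints hXs e5 e3 e2 e4
  have hXtr : entX 0 0 U + entX 1 1 U + entX 2 2 U = 0 := by
    rw [hXY, hXY, hXY] at e5; linear_combination -e5
  obtain ⟨hZtr, hVZ, hZs⟩ := eq_of_constraints (Z := fun k l => entZ k l U)
    (V := fun k l => entV k l U) (neg_eq_zero.1 f5) f1 (fun i => sub_eq_zero.1 (f4 i))
    (fun i => sub_eq_zero.1 (f2 i)) fun i => sub_eq_zero.1 (f3 i)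
  have hmem : U ∈ I2 R := by
    set V : L2 R := idealRe (fun k l => entX k l U) + idealIm (fun k l => entZ k l U) with hV
    have hVmem : V ∈ I2 R := (I2 R).add_mem (idealRe_mem _ hXs hXtr) (idealIm_mem _ hZs hZtr)
    have hsub : U - V = 0 := by
      refine skew_eq_zero _ (fun a b => ?_) (fun k => ?_) fun k => ?_
      · have : V a b = -V b a := by
          simp only [hV, idealRe, idealIm, Pi.add_apply, Finset.sum_apply, Pi.smul_apply,
            Pi.sub_apply, th2, wedge, neg_add, ← sum_neg_distrib, ← smul_neg, neg_sub, sub_smul]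
          congr 1 <;> refine sum_congr rfl fun k _ => sum_congr rfl fun l _ => ?_ <;>
            congr 1 <;> abel
        change U a b - V a b = -(U b a - V b a)
        rw [hs a b, this]; abel
      · change U 0 (sp k) - V 0 (sp k) = 0
        rw [sub_eq_zero, fst_entry_of_mem (hU 0 (sp k)), hX, confDer_eq]
        change entP k U • _ + ∑ i, entX k i U • _ + ∑ i, entZ k i U • _ + _ = _
        rw [e7]
        refine Prod.ext (Matrix.ext fun p q => ?_) ?_
        · rw [hV]
          change _ = (idealRe (fun k l => entX k l U) 0 (sp k)).1 p q +
            (idealIm (fun k l => entZ k l U) 0 (sp k)).1 p q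
          rw [idealRe_zero_sp, idealIm_zero_sp]
          simp [ofDer, fst_sum, Matrix.sum_apply]
        · have h1 : anchorL 0 (sp k) V = 0 := I2_le_ker_anchorL _ _ hVmem
          change _ = anchorL 0 (sp k) V
          rw [h1]
          simp [ofDer, snd_sum, boost_eq, rot_eq]
      · change U (sp (k + 1)) (sp (k + 2)) - V (sp (k + 1)) (sp (k + 2)) = 0
        rw [sub_eq_zero, fst_entry_of_mem (hU (sp (k + 1)) (sp (k + 2))), hY, confDer_eq]
        change entQ k U • _ + ∑ i, entV k i U • _ + ∑ i, entY k i U • _ + _ = _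
        rw [neg_eq_zero.1 (e6 k)]
        refine Prod.ext (Matrix.ext fun p q => ?_) ?_
        · rw [hV]
          change _ = (idealRe (fun k l => entX k l U) (sp (k + 1)) (sp (k + 2))).1 p q +
            (idealIm (fun k l => entZ k l U) (sp (k + 1)) (sp (k + 2))).1 p q
          rw [idealRe_sp_sp, idealIm_sp_sp]
          simp [ofDer, fst_sum, Matrix.sum_apply, hXY, hVZ]
          ring
        · have h1 : anchorL (sp (k + 1)) (sp (k + 2)) V = 0 := I2_le_ker_anchorL _ _ hVmem
          change _ = anchorL (sp (k + 1)) (sp (k + 2)) V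
          rw [h1]
          simp [ofDer, snd_sum, boost_eq, rot_eq]
    rw [sub_eq_zero.1 hsub]; exact hVmem
  refine Prod.ext ?_ (Prod.ext ?_ ?_)
  · rw [hzU]; exact (Submodule.Quotient.mk_eq_zero _).2 hmem
  · exact skew_eq_zero _ hψ (fun i => hc (.inr (.scalar (sp i)))) fun i => hc (.inl (.scalar i))
  · exact hc (.inr (.scalar 0))

end Injectivity

section Polarization

/-- A biadditive map. -/
structure Biadd {A N : Type*} [Add A] [Add N] (B : A → A → N) : Prop where
  left : ∀ x y z, B (x + y) z = B x z + B y z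
  right : ∀ x y z, B x (y + z) = B x y + B x z

theorem sum_antidiagonal_eq_of_diag {A N : Type*} [AddCommGroup A] [AddCommGroup N] [Module ℝ N]
    {B B' : A → A → N} (hB : Biadd B) (hB' : Biadd B') (h : ∀ x, B x x = B' x x)
    (x : Multi → A) (α : Multi) :
    ∑ q ∈ antidiagonal α, B (x q.1) (x q.2) =
      ∑ q ∈ antidiagonal α, B' (x q.1) (x q.2) := by
  have key : ∀ y z, B y z + B z y = B' y z + B' z y := fun y z => by
    have h1 := h (y + z)
    rw [hB.left, hB.right, hB.right, hB'.left, hB'.right, hB'.right, h y, h z] at h1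
    have h2 : B' y y + (B y z + B z y) + B' z z = B' y y + (B' y z + B' z y) + B' z z := by
      rw [show B' y y + (B y z + B z y) + B' z z = B' y y + B y z + (B z y + B' z z) by abel, h1]
      abel
    exact add_left_cancel (add_right_cancel h2)
  have sw : ∀ D : A → A → N, ∑ q ∈ antidiagonal α, D (x q.2) (x q.1) =
      ∑ q ∈ antidiagonal α, D (x q.1) (x q.2) := fun D =>
    Finset.sum_nbij' Prod.swap Prod.swap (by simp [add_comm]) (by simp [add_comm])
      (by simp) (by simp) (by simp)
  have h2 : (2 : ℝ) • ∑ q ∈ antidiagonal α, B (x q.1) (x q.2) =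
      (2 : ℝ) • ∑ q ∈ antidiagonal α, B' (x q.1) (x q.2) := by
    rw [two_smul, two_smul]
    nth_rw 2 [← sw B]
    nth_rw 2 [← sw B']
    rw [← sum_add_distrib, ← sum_add_distrib]
    exact sum_congr rfl fun q _ => key _ _
  exact smul_right_injective N (two_ne_zero (α := ℝ)) h2

end Polarization

section Form

theorem comm_add_left (δ δ' ε : Der0 R) :
    Der0.comm (δ + δ') ε = Der0.comm δ ε + Der0.comm δ' ε := by
  refine Prod.ext ?_ ?_
  · ext a b
    simp only [Der0.comm, fst_add, snd_add, add_mul, mul_add, Matrix.add_apply,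
      Matrix.sub_apply, Matrix.map_apply, Derivation.add_apply, map_add]
    ring
  · simp [Der0.comm]

theorem comm_add_right (δ ε ε' : Der0 R) :
    Der0.comm δ (ε + ε') = Der0.comm δ ε + Der0.comm δ ε' := by
  rw [Der0.comm_swap, comm_add_left, neg_add, ← Der0.comm_swap, ← Der0.comm_swap]

theorem brL_add_left (x x' y : L1 R) : brL (x + x') y = brL x y + brL x' y := by
  funext a b
  simp only [brL_apply, Pi.add_apply, comm_add_left, fst_add, Matrix.add_apply,
    sub_smul, add_smul, smul_add, sum_add_distrib, sum_sub_distrib]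
  abel

theorem brL_add_right (x y y' : L1 R) : brL x (y + y') = brL x y + brL x y' := by
  funext a b
  simp only [brL_apply, Pi.add_apply, comm_add_right, fst_add, Matrix.add_apply,
    sub_smul, add_smul, smul_add, sum_add_distrib, sum_sub_distrib]
  abel

theorem phiTensor_add_left (a a' b : Fin 4 → R) (p q : Fin 4) :
    phiTensor (a + a') b p q = phiTensor a b p q + phiTensor a' b p q := by
  simp only [phiTensor, Pi.add_apply, mul_add, add_mul, sum_add_distrib]
  ring

theorem phiTensor_add_right (a b b' : Fin 4 → R) (p q : Fin 4) :
    phiTensor a (b + b') p q = phiTensor a b p q + phiTensor a b' p q := by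
  simp only [phiTensor, Pi.add_apply, mul_add, add_mul, sum_add_distrib]
  ring

theorem brPhi_add_left (a a' b : Fin 4 → R) : brPhi (a + a') b = brPhi a b + brPhi a' b := by
  funext i j
  simp only [brPhi_apply, Pi.add_apply, phiTensor_add_left, add_mul, add_smul, sum_add_distrib]
  abel

theorem brPhi_add_right (a b b' : Fin 4 → R) : brPhi a (b + b') = brPhi a b + brPhi a b' := by
  funext i j
  simp only [brPhi_apply, Pi.add_apply, phiTensor_add_right, add_mul, add_smul, sum_add_distrib]
  abel

theorem act_add_left (δ δ' : Der0 R) (w : Fin 4 → R) : (δ + δ').act w = δ.act w + δ'.act w := by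
  funext i
  simp only [Der0.act, fst_add, snd_add, Matrix.add_mulVec, Pi.add_apply, Derivation.add_apply]
  ring

theorem act_add_right (δ : Der0 R) (w w' : Fin 4 → R) : δ.act (w + w') = δ.act w + δ.act w' := by
  funext i
  simp only [Der0.act, Matrix.mulVec_add, Pi.add_apply, map_add]
  ring

theorem brLPhi_add_left (x x' : L1 R) (φ : Fin 4 → R) :
    brLPhi (x + x') φ = brLPhi x φ + brLPhi x' φ := by
  refine Prod.ext ?_ ?_
  · funext a b
    simp only [brLPhi_fst, fst_add, Pi.add_apply, act_add_left]
    ring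
  · simp only [brLPhi_snd, snd_add, Pi.add_apply, act_add_left, mul_add, sum_add_distrib]
    ring

theorem brLPhi_add_right (x : L1 R) (φ φ' : Fin 4 → R) :
    brLPhi x (φ + φ') = brLPhi x φ + brLPhi x φ' := by
  refine Prod.ext ?_ ?_
  · funext a b
    simp only [brLPhi_fst, fst_add, Pi.add_apply, act_add_right]
    ring
  · simp only [brLPhi_snd, snd_add, Pi.add_apply, act_add_right, mul_add, sum_add_distrib]
    ring

theorem biadd_br11 : Biadd (br11 : E1 R → E1 R → E2 R) where
  left x y z := by
    refine Prod.ext ?_ ?_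
    · simp only [br11_fst, fst_add, snd_add, brL_add_left, brPhi_add_left,
        Submodule.Quotient.mk_add]
      abel
    · simp only [br11_snd, fst_add, snd_add, brLPhi_add_left, brLPhi_add_right]
      abel
  right x y z := by
    refine Prod.ext ?_ ?_
    · simp only [br11_fst, fst_add, snd_add, brL_add_right, brPhi_add_right,
        Submodule.Quotient.mk_add]
      abel
    · simp only [br11_snd, fst_add, snd_add, brLPhi_add_left, brLPhi_add_right]
      abel

variable (e C)

theorem gauged_add (x y : ℝ × (GB1 → R)) :
    gauged e (x + y).1 (x + y).2 = gauged e x.1 x.2 + gauged e y.1 y.2 := by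
  simp only [gauged, fst_add, snd_add, map_add, add_smul, Pi.add_apply, sum_add_distrib]
  abel

theorem frameDer_add (f g : GB1 → R) (i : Fin 3) :
    frameDer e (f + g) i = frameDer e f i + frameDer e g i := by
  simp only [frameDer, Pi.add_apply, add_smul, sum_add_distrib]

/-- The polarized Maurer-Cartan form, in coordinates, on gauged elements. -/
def mcForm (c : B2) (x y : ℝ × (GB1 → R)) : R :=
  Sum.elim (fun _ => 0) (fun b => mult b * algebraMap ℝ R x.1 * e 0 (y.2 b)) c +
    quadEval (frameDer e x.2) C (algebraMap ℝ R x.1) x.2 y.2 c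

theorem biadd_quadEval (c : B2) : Biadd fun x y : ℝ × (GB1 → R) =>
    quadEval (frameDer e x.2) C (algebraMap ℝ R x.1) x.2 y.2 c := by
  have hl : ∀ (T : QTerm) (x y z : ℝ × (GB1 → R)),
      T.eval (frameDer e (x + y).2) C (algebraMap ℝ R (x + y).1) (x + y).2 z.2 =
      T.eval (frameDer e x.2) C (algebraMap ℝ R x.1) x.2 z.2 +
      T.eval (frameDer e y.2) C (algebraMap ℝ R y.1) y.2 z.2 := by
    intro T x y z
    cases T <;> simp only [QTerm.eval, snd_add, fst_add, Pi.add_apply, frameDer_add,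
      Derivation.add_apply, map_add, mul_add, add_mul, sum_add_distrib]
  have hr : ∀ (T : QTerm) (x y z : ℝ × (GB1 → R)),
      T.eval (frameDer e x.2) C (algebraMap ℝ R x.1) x.2 (y + z).2 =
      T.eval (frameDer e x.2) C (algebraMap ℝ R x.1) x.2 y.2 +
      T.eval (frameDer e x.2) C (algebraMap ℝ R x.1) x.2 z.2 := by
    intro T x y z
    cases T <;> simp only [QTerm.eval, snd_add, Pi.add_apply, map_add, mul_add, sum_add_distrib]
  constructor <;> intro x y z <;> simp only [quadEval]
  · rw [← List.sum_map_add]; exact congrArg List.sum (List.map_congr_left fun T _ => hl T x y z)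
  · rw [← List.sum_map_add]; exact congrArg List.sum (List.map_congr_left fun T _ => hr T x y z)

theorem biadd_mcForm (c : B2) : Biadd (mcForm e C c) := by
  have h := biadd_quadEval e C c
  constructor <;> intro x y z <;> simp only [mcForm]
  · rw [h.left]; rcases c with c | b
    · simp
    · simp only [Sum.elim_inr, fst_add, map_add, mul_add, add_mul]; abel
  · rw [h.right]; rcases c with c | b
    · simp
    · simp only [Sum.elim_inr, snd_add, Pi.add_apply, map_add, mul_add]; abel

/-- The labels that belong to derivations. -/
def B2.IsFrame : B2 → Prop
  | .inl (.frame _ _) => True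
  | .inr (.frame _ _) => True
  | _ => False

theorem coord_br11_gauged_self (c : B2) (hc : ¬ c.IsFrame) (x : ℝ × (GB1 → R)) :
    coord c (br11 (gauged e x.1 x.2) (gauged e x.1 x.2)) = 2 * mcForm e C c x x := by
  rcases c with c | b
  · rw [coord_br11_gauged e x.1 x.2 C c (by rintro i μ rfl; exact hc trivial), mcForm]
    simp
  · rw [coord_br11_gauged_theta0 e x.1 x.2 C b (by rintro i μ rfl; exact hc trivial), mcForm]
    simp

/-- The derivation with components `h` relative to the basis `e`. -/
def derOf (h : Fin 4 → R) : Derivation ℝ R R := ∑ μ, h μ • e μ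

theorem sum_apply_derivation {ι : Type*} (s : Finset ι) (D : ι → Derivation ℝ R R) (r : R) :
    (∑ i ∈ s, D i) r = ∑ i ∈ s, D i r := by
  classical
  induction s using Finset.induction_on with
  | empty => simp
  | insert a s ha ih => rw [Finset.sum_insert ha, Finset.sum_insert ha, Derivation.add_apply, ih]

theorem derOf_apply (h : Fin 4 → R) (r : R) : derOf e h r = ∑ μ, h μ * e μ r := by
  rw [derOf, sum_apply_derivation]
  exact sum_congr rfl fun μ _ => rfl

theorem frameDer_eq (f : GB1 → R) (i : Fin 3) : frameDer e f i = derOf e fun μ => f (.frame i μ) :=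
  rfl

variable {e C}

theorem lie_derOf (h0 : ∀ μ ν, ⁅e μ, e ν⁆ = derOf e (C μ ν)) (f g : Fin 4 → R) :
    ⁅derOf e f, derOf e g⁆ = derOf e fun μ => derOf e f (g μ) - derOf e g (f μ) +
      ∑ ν, ∑ κ, C ν κ μ * f ν * g κ := by
  ext r
  have h1 : ∀ ν κ, e ν (e κ r) = e κ (e ν r) + ∑ μ, C ν κ μ * e μ r := fun ν κ => by
    rw [← derOf_apply, ← h0, commutator_apply]; ring
  rw [commutator_apply]
  simp only [derOf_apply, map_sum, leibniz, smul_eq_mul, mul_sum,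
    sum_add_distrib, add_mul, sub_mul, sum_sub_distrib, Finset.sum_mul]
  have h2 : ∑ x, ∑ i, g x * (f i * e i (e x r)) = ∑ x, ∑ i, f x * (g i * e i (e x r)) +
      ∑ x, ∑ i, ∑ j, C i j x * f i * g j * e x r := by
    rw [sum_comm]
    have : ∑ x, ∑ i, ∑ j, C i j x * f i * g j * e x r =
        ∑ i, ∑ j, ∑ x, C i j x * f i * g j * e x r := by
      rw [sum_comm]
      exact sum_congr rfl fun i _ => sum_comm
    rw [this, ← sum_add_distrib]
    refine sum_congr rfl fun ν _ => ?_
    rw [← sum_add_distrib]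
    refine sum_congr rfl fun κ _ => ?_
    rw [h1 ν κ, mul_add, mul_add, mul_sum, mul_sum]
    congr 1
    · ring
    · exact sum_congr rfl fun μ _ => by ring
  have h3 : ∀ u v : Fin 4 → R, ∑ x, ∑ i, e x r * (u i * e i (v x)) =
      ∑ x, ∑ i, u i * e i (v x) * e x r := fun u v =>
    sum_congr rfl fun x _ => sum_congr rfl fun i _ => by ring
  rw [h2, h3, h3]
  ring

theorem smul_derOf (a : R) (f : Fin 4 → R) : a • derOf e f = derOf e fun μ => a * f μ := by
  simp only [derOf, smul_sum, mul_smul]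

theorem derOf_add (f g : Fin 4 → R) : derOf e f + derOf e g = derOf e fun μ => f μ + g μ := by
  simp only [derOf, add_smul, sum_add_distrib]

theorem derOf_sub (f g : Fin 4 → R) : derOf e f - derOf e g = derOf e fun μ => f μ - g μ := by
  simp only [derOf, sub_smul, sum_sub_distrib]

theorem derOf_single (a : R) (μ : Fin 4) : a • e μ = derOf e (Pi.single μ a) := by
  simp [derOf, Pi.single_apply]

theorem lie_zero_derOf (h0 : ∀ μ, ⁅e 0, e μ⁆ = 0) (g : Fin 4 → R) :
    ⁅e 0, derOf e g⁆ = derOf e fun μ => e 0 (g μ) := by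
  ext r
  have h1 : ∀ κ, e 0 (e κ r) = e κ (e 0 r) := fun κ => by
    rw [← sub_eq_zero, ← commutator_apply, h0]; rfl
  rw [commutator_apply]
  simp only [derOf_apply, map_sum, leibniz, smul_eq_mul, h1, sum_add_distrib]
  rw [add_sub_cancel_left]
  exact sum_congr rfl fun i _ => mul_comm _ _

theorem anchor_br11_gauged_zero_self (h0 : ∀ μ, ⁅e 0, e μ⁆ = 0) (i : Fin 3) (x : ℝ × (GB1 → R)) :
    anchor 0 (sp i) (br11 (gauged e x.1 x.2) (gauged e x.1 x.2)) =
      derOf e fun μ => 2 * mcForm e C (.inr (.frame i μ)) x x := by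
  rw [anchor_br11_gauged_zero]
  simp only [frameDer_eq, lie_zero_derOf h0, Fin.sum_univ_three, smul_derOf, derOf_add, derOf_sub]
  congr 1
  funext μ
  fin_cases i <;> simp [mcForm, quadEval, quad, QTerm.eval, mult, boostCoeff] <;> ring

theorem anchor_br11_gauged_self (h0 : ∀ μ ν, ⁅e μ, e ν⁆ = derOf e (C μ ν)) (k : Fin 3)
    (x : ℝ × (GB1 → R)) :
    anchor (sp (k + 1)) (sp (k + 2)) (br11 (gauged e x.1 x.2) (gauged e x.1 x.2)) =
      derOf e fun μ => 2 * mcForm e C (.inl (.frame k μ)) x x := by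
  rw [anchor_br11_gauged]
  simp only [frameDer_eq, lie_derOf h0, derOf_single, smul_derOf, derOf_add]
  congr 1
  funext μ
  simp only [mcForm, quadEval, quad, Sum.elim_inl, List.map_append, List.sum_append]
  split_ifs with h
  · subst h; simp [QTerm.eval, frameDer_eq]; ring
  · simp [QTerm.eval, frameDer_eq, h]; ring

end Form

section Degrees

/-- The degree of a term, as an expression in the gauge coefficients. -/
def QTerm.deg : QTerm → Multi
  | mul _ b b' => b.deg + b'.deg
  | der _ i b => deg011 i + b.deg
  | lin _ b => b.deg
  | struct i _ => deg011 (i + 1) + deg011 (i + 2)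

/-- The entries of `deg011`. -/
def num011 (i j : Fin 3) : ℕ := if j = i then 0 else 1

/-- The entries of `deg211`. -/
def num211 (i j : Fin 3) : ℕ := if j = i then 2 else 1

/-- The entries of the degree. -/
def GB1.num : GB1 → Fin 3 → ℕ
  | diag _ => 0
  | curv i => fun j => if j = i then 2 else 0
  | frame i _ => num011 i
  | conf i => num011 i
  | sym i => num011 i
  | rotK i => num011 i
  | rotJ i => num011 i
  | asym i => num211 i
  | scalar i => Fin.cases 0 num011 i

/-- The entries of the degree. -/
def B2.num : B2 → Fin 3 → ℕ
  | .inl .zero => 0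
  | .inl (.mix i) => num011 i
  | .inl (.frame i _) => num211 i
  | .inl (.asym i) => num211 i
  | .inl (.sym i) => num211 i
  | .inl .top => 2
  | .inl (.scalar i) => num211 i
  | .inr b => b.num

/-- The entries of the degree. -/
def QTerm.num : QTerm → Fin 3 → ℕ
  | mul _ b b' => b.num + b'.num
  | der _ i b => num011 i + b.num
  | lin _ b => b.num
  | struct i _ => num011 (i + 1) + num011 (i + 2)

theorem deg011_apply (i j : Fin 3) : deg011 i j = num011 i j := by
  fin_cases i <;> fin_cases j <;> simp [deg011, unit, num011]

theorem deg211_apply (i j : Fin 3) : deg211 i j = num211 i j := by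
  fin_cases i <;> fin_cases j <;> simp [deg211, deg011, unit, num211]

theorem GB1.deg_apply (b : GB1) (j : Fin 3) : b.deg j = b.num j := by
  cases b <;> simp only [GB1.deg, GB1.num, deg011_apply, deg211_apply]
  · rfl
  · rename_i i; fin_cases i <;> fin_cases j <;> simp [unit]
  · rename_i i
    cases i using Fin.cases
    · rfl
    · exact deg011_apply _ _

theorem GB1.eq_zero_of_num {A : Type*} [Zero A] {g : GB1 → A} (z : ∀ b, b.num ≠ 0 → g b = 0) :
    (∀ i, g (.asym i) = 0) ∧ (∀ i, g (.sym i) = 0) ∧ (∀ i, g (.curv i) = 0) ∧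
    (∀ i, g (.conf i) = 0) ∧ (∀ i, g (.rotK i) = 0) ∧ (∀ i, g (.rotJ i) = 0) ∧
    ∀ i, g (.scalar (sp i)) = 0 := by
  refine ⟨?_, ?_, ?_, ?_, ?_, ?_, ?_⟩ <;> exact fun i => z _ (by revert i; decide)

theorem B2.deg_apply (c : B2) (j : Fin 3) : c.deg j = c.num j := by
  rcases c with c | b
  · cases c <;> simp only [B2.deg, Sum.elim_inl, GB2.deg, B2.num, deg011_apply, deg211_apply]
    · rfl
    · fin_cases j <;> simp [unit]
  · exact b.deg_apply j

theorem QTerm.deg_apply (T : QTerm) (j : Fin 3) : T.deg j = T.num j := by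
  cases T <;> simp [QTerm.deg, QTerm.num, GB1.deg_apply, deg011_apply]

set_option maxRecDepth 10000 in
theorem num_le_of_mem_quad : ∀ c : B2, ∀ T ∈ quad c, ∀ j, c.num j ≤ T.num j := by
  decide

theorem deg_le_of_mem_quad (c : B2) (T : QTerm) (h : T ∈ quad c) : c.deg ≤ T.deg := fun j => by
  rw [B2.deg_apply, QTerm.deg_apply]
  exact num_le_of_mem_quad c T h j

end Degrees

section Sums

variable (e C)

/-- The coefficients of the series `θ₀∂₀ + ∑_α ∑_b g_{α,b} b s^α`. -/
def withUnit (g : Multi → GB1 → R) (α : Multi) : ℝ × (GB1 → R) := (if α = 0 then 1 else 0, g α)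

/-- The series `θ₀∂₀ + ∑_α ∑_b g_{α,b} b s^α`. -/
def gaugedSeries (g : Multi → GB1 → R) (α : Multi) : E1 R :=
  gauged e (withUnit g α).1 (withUnit g α).2

/-- The coordinates of half the bracket of a gauged series with itself. -/
def mcSum (c : B2) (g : Multi → GB1 → R) (α : Multi) : R :=
  ∑ q ∈ antidiagonal α, mcForm e C c (withUnit g q.1) (withUnit g q.2)

theorem coord_serBr11 (c : B2) (hc : ¬ c.IsFrame) (g : Multi → GB1 → R) (α : Multi) :
    coord c (serBr11 (gaugedSeries e g) (gaugedSeries e g) α) = 2 * mcSum e C c g α := by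
  rw [serBr11, map_sum, mcSum, mul_sum]
  refine sum_antidiagonal_eq_of_diag
    (B := fun x y => coord c (br11 (gauged e x.1 x.2) (gauged e y.1 y.2)))
    (B' := fun x y => 2 * mcForm e C c x y) ⟨fun x y z => ?_, fun x y z => ?_⟩
    ⟨fun x y z => ?_, fun x y z => ?_⟩ (coord_br11_gauged_self e C c hc) (withUnit g) α
  · rw [gauged_add, biadd_br11.left, map_add]
  · rw [gauged_add, biadd_br11.right, map_add]
  · rw [(biadd_mcForm e C c).left, mul_add]
  · rw [(biadd_mcForm e C c).right, mul_add]

theorem derOf_sum {ι : Type*} (s : Finset ι) (h : ι → Fin 4 → R) :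
    ∑ i ∈ s, derOf e (h i) = derOf e fun μ => ∑ i ∈ s, h i μ := by
  simp only [derOf, sum_smul]
  exact sum_comm

variable {e C}

theorem anchor_serBr11_zero (h0 : ∀ μ, ⁅e 0, e μ⁆ = 0) (i : Fin 3) (g : Multi → GB1 → R)
    (α : Multi) : anchor 0 (sp i) (serBr11 (gaugedSeries e g) (gaugedSeries e g) α) =
      derOf e fun μ => 2 * mcSum e C (.inr (.frame i μ)) g α := by
  simp only [serBr11, map_sum, mcSum, mul_sum]
  rw [← derOf_sum]
  refine sum_antidiagonal_eq_of_diag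
    (B := fun x y => anchor 0 (sp i) (br11 (gauged e x.1 x.2) (gauged e y.1 y.2)))
    (B' := fun x y => derOf e fun μ => 2 * mcForm e C (.inr (.frame i μ)) x y)
    ⟨fun x y z => ?_, fun x y z => ?_⟩ ⟨fun x y z => ?_, fun x y z => ?_⟩
    (anchor_br11_gauged_zero_self h0 i) (withUnit g) α
  · rw [gauged_add, biadd_br11.left, map_add]
  · rw [gauged_add, biadd_br11.right, map_add]
  · simp only [(biadd_mcForm e C _).left, mul_add, derOf_add]
  · simp only [(biadd_mcForm e C _).right, mul_add, derOf_add]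

theorem anchor_serBr11 (h0 : ∀ μ ν, ⁅e μ, e ν⁆ = derOf e (C μ ν)) (k : Fin 3)
    (g : Multi → GB1 → R) (α : Multi) :
    anchor (sp (k + 1)) (sp (k + 2)) (serBr11 (gaugedSeries e g) (gaugedSeries e g) α) =
      derOf e fun μ => 2 * mcSum e C (.inl (.frame k μ)) g α := by
  simp only [serBr11, map_sum, mcSum, mul_sum]
  rw [← derOf_sum]
  refine sum_antidiagonal_eq_of_diag
    (B := fun x y => anchor (sp (k + 1)) (sp (k + 2)) (br11 (gauged e x.1 x.2) (gauged e y.1 y.2)))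
    (B' := fun x y => derOf e fun μ => 2 * mcForm e C (.inl (.frame k μ)) x y)
    ⟨fun x y z => ?_, fun x y z => ?_⟩ ⟨fun x y z => ?_, fun x y z => ?_⟩
    (anchor_br11_gauged_self h0 k) (withUnit g) α
  · rw [gauged_add, biadd_br11.left, map_add]
  · rw [gauged_add, biadd_br11.right, map_add]
  · simp only [(biadd_mcForm e C _).left, mul_add, derOf_add]
  · simp only [(biadd_mcForm e C _).right, mul_add, derOf_add]

variable (e) in
theorem gauged_mem (t : ℝ) (g : GB1 → R) : gauged e t g ∈ CE1 R := fun a => by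
  cases a using Fin.cases with
  | zero => rw [gauged_zero]; exact confDer_mem _ _ _ _
  | succ i =>
    have := gauged_sp e t g i
    rw [sp] at this
    rw [this]; exact confDer_mem _ _ _ _

variable (e) in
theorem serBr11_gaugedSeries_mem (g : Multi → GB1 → R) (α : Multi) :
    serBr11 (gaugedSeries e g) (gaugedSeries e g) α ∈ CE2 R := by
  have h : ∀ α, gaugedSeries e g α ∈ CE1 R := fun α => gauged_mem e _ _
  rw [serBr11]
  exact (CE2 R).sum_mem fun q _ => br11_mem (h q.1) (h q.2)

theorem coord_of_isFrame {c : B2} (hc : c.IsFrame) (z : E2 R) : coord c z = 0 := by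
  obtain ⟨U, hU⟩ := Submodule.Quotient.mk_surjective _ z.1
  rw [coord_eq_coordL c z U hU.symm (by rintro i rfl; exact hc) (by rintro i rfl; exact hc)]
  rcases c with c | c <;> cases c <;> first | rfl | exact hc.elim

theorem serBr11_gaugedSeries_eq_zero (h0 : ∀ μ ν, ⁅e μ, e ν⁆ = derOf e (C μ ν))
    (hC : ∀ ν, C 0 ν = 0) (g : Multi → GB1 → R) (h : ∀ c α, mcSum e C c g α = 0) :
    serBr11 (gaugedSeries e g) (gaugedSeries e g) = 0 := by
  have h00 : ∀ μ, ⁅e 0, e μ⁆ = 0 := fun μ => by rw [h0, hC]; simp [derOf]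
  funext α
  refine eq_zero_of_coord ?_ (fun c => ?_) (fun i => ?_) fun i => ?_
  · exact serBr11_gaugedSeries_mem e g α
  · by_cases hc : c.IsFrame
    · exact coord_of_isFrame hc _
    · rw [coord_serBr11 e C c hc, h, mul_zero]
  · rw [anchor_serBr11_zero (C := C) h00]; simp [h, derOf]
  · rw [anchor_serBr11 h0]; simp [h, derOf]

/-- The contribution of one term to the sum. -/
def termSum (e : Fin 4 → Derivation ℝ R R) (C : Fin 4 → Fin 4 → Fin 4 → R) (T : QTerm)
    (g : Multi → GB1 → R) (α : Multi) : R := ∑ q ∈ antidiagonal α,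
  T.eval (frameDer e (g q.1)) C (algebraMap ℝ R (withUnit g q.1).1) (g q.1) (g q.2)

theorem sum_list_sum {ι κ N : Type*} [AddCommMonoid N] (s : Finset ι) (l : List κ)
    (f : ι → κ → N) : ∑ i ∈ s, (l.map (f i)).sum = (l.map fun k => ∑ i ∈ s, f i k).sum := by
  induction l with
  | nil => simp
  | cons k l ih => simp only [map_cons, sum_cons, sum_add_distrib, ih]

theorem sum_withUnit {N : Type*} [AddCommMonoid N] (g : Multi → GB1 → R) (α : Multi)
    (F : ℝ → Multi → N) (h : ∀ β, F 0 β = 0) :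
    ∑ q ∈ antidiagonal α, F (withUnit g q.1).1 q.2 = F 1 α := by
  rw [sum_eq_single (0, α)]
  · simp [withUnit]
  · intro q hq hne
    rw [mem_antidiagonal] at hq
    have : q.1 ≠ 0 := fun h0 => hne (Prod.ext h0 (by rw [h0, zero_add] at hq; exact hq))
    simp [withUnit, this, h]
  · intro h; exact absurd (by simp) h

theorem mcSum_eq (c : B2) (g : Multi → GB1 → R) (α : Multi) : mcSum e C c g α =
    Sum.elim (fun _ => 0) (fun b => mult b * e 0 (g α b)) c +
      ((quad c).map fun T => termSum e C T g α).sum := by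
  simp only [mcSum, mcForm, sum_add_distrib]
  congr 1
  · rcases c with c | b
    · simp
    · rw [Sum.elim_inr]
      refine (sum_withUnit g α (fun t β => (mult b : R) * algebraMap ℝ R t * e 0 (g β b))
        (by simp)).trans (by simp)
  · exact sum_list_sum _ _ _

/-- A family of coefficients that defines an element of the Rees algebra. -/
def IsFiltered (g : Multi → GB1 → R) : Prop := ∀ α b, ¬ b.deg ≤ α → g α b = 0

theorem frameDer_eq_zero {g : Multi → GB1 → R} (hg : IsFiltered g) {α : Multi} {i : Fin 3}
    (h : ¬ deg011 i ≤ α) : frameDer e (g α) i = 0 := by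
  simp [frameDer, hg α (.frame i _) h]

theorem termSum_eq_zero {g : Multi → GB1 → R} (hg : IsFiltered g) {T : QTerm} {α : Multi}
    (h : ¬ T.deg ≤ α) : termSum e C T g α = 0 := by
  refine sum_eq_zero fun q hq => ?_
  rw [mem_antidiagonal] at hq
  cases T with
  | mul n b b' =>
    by_cases h1 : b.deg ≤ q.1
    · by_cases h2 : b'.deg ≤ q.2
      · exact absurd (hq ▸ add_le_add h1 h2) h
      · simp [QTerm.eval, hg _ _ h2]
    · simp [QTerm.eval, hg _ _ h1]
  | der n i b =>
    by_cases h1 : deg011 i ≤ q.1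
    · by_cases h2 : b.deg ≤ q.2
      · exact absurd (hq ▸ add_le_add h1 h2) h
      · simp [QTerm.eval, hg _ _ h2]
    · simp [QTerm.eval, frameDer_eq_zero hg h1]
  | lin n b =>
    by_cases h1 : q.1 = 0
    · have : q.2 = α := by rw [← hq, h1, zero_add]
      simp [QTerm.eval, this, hg α b h]
    · simp [QTerm.eval, withUnit, h1]
  | struct i μ =>
    by_cases h1 : deg011 (i + 1) ≤ q.1
    · by_cases h2 : deg011 (i + 2) ≤ q.2
      · exact absurd (hq ▸ add_le_add h1 h2) h
      · simp [QTerm.eval, hg _ (.frame (i + 2) _) h2]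
    · simp [QTerm.eval, hg _ (.frame (i + 1) _) h1]

theorem mcSum_eq_zero {g : Multi → GB1 → R} (hg : IsFiltered g) {c : B2} {α : Multi}
    (h : ¬ c.deg ≤ α) : mcSum e C c g α = 0 := by
  rw [mcSum_eq, List.sum_eq_zero, add_zero]
  · rcases c with c | b
    · rfl
    · rw [Sum.elim_inr, hg α b h, map_zero, mul_zero]
  · intro x hx
    obtain ⟨T, hT, rfl⟩ := List.mem_map.1 hx
    exact termSum_eq_zero hg fun h' => h ((deg_le_of_mem_quad c T hT).trans h')

end Sums

section Propagation

variable (E0 : Derivation ℝ R R) (E : Fin 3 → Derivation ℝ R R) (C : Fin 4 → Fin 4 → Fin 4 → R) (g : GB1 → R)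

theorem eq_half_smul {a b : R} (h : 2 * a + b = 0) : a = (-1 / 2 : ℝ) • b := by
  have h2 : b = -(2 * a) := by linear_combination h
  rw [h2]; algebra

theorem map_ofNat_derivation (D : Derivation ℝ R R) (n : ℕ) [n.AtLeastTwo] :
    D (ofNat(n) : R) = 0 := D.map_natCast n

/-- The torsion, which is the derivation-valued component of the constraints. -/
def torsion (i : Fin 3) (r : R) : R := E (i + 1) (E (i + 2) r) - E (i + 2) (E (i + 1) r) +
  2 * g (.asym i) * E0 r + 2 * g (.curv i) * E i r -
  (g (.conf (i + 2)) + g (.rotK (i + 2))) * E (i + 1) r +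
  (g (.conf (i + 1)) - g (.rotJ (i + 1))) * E (i + 2) r

/-- The evolution equations. -/
structure Evolution : Prop where
  coeff : ∀ b, (∀ i μ, b ≠ .frame i μ) → mult b * E0 (g b) + quadEval E C 1 g g (.inr b) = 0
  frame : ∀ i r, E0 (E i r) = E i (E0 r) - (g (.diag (i + 1)) + g (.diag (i + 2))) * E i r +
    (g (.asym (i + 2)) + g (.sym (i + 2))) * E (i + 1) r +
    (g (.sym (i + 1)) - g (.asym (i + 1))) * E (i + 2) r

variable {E0 E C g} (h : Evolution E0 E C g)

theorem zero_cyclic (i : Fin 3) : quadEval E C 1 g g (.inl .zero) =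
    ((zeroTerms i).map (QTerm.eval E C 1 g g)).sum := by
  fin_cases i <;>
  simp only [quadEval, quad, zeroTerms, QTerm.eval, map_cons, map_nil, sum_cons, sum_nil,
    Fin.isValue, Fin.zero_eta, Fin.mk_one, Fin.reduceFinMk, zero_add, Fin.reduceAdd] <;>
  ring

/-- If the torsion vanishes, the derivations commute up to lower order terms. -/
theorem comm_of_torsion (ht : ∀ i r, torsion E0 E g i r = 0) (i : Fin 3) :
    (∀ r, E (i + 2) (E (i + 1) r) = E (i + 1) (E (i + 2) r) +
      2 * g (.asym i) * E0 r + 2 * g (.curv i) * E i r -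
      (g (.conf (i + 2)) + g (.rotK (i + 2))) * E (i + 1) r +
      (g (.conf (i + 1)) - g (.rotJ (i + 1))) * E (i + 2) r) ∧
    (∀ r, E (i + 2) (E i r) = E i (E (i + 2) r) -
      2 * g (.asym (i + 1)) * E0 r - 2 * g (.curv (i + 1)) * E (i + 1) r +
      (g (.conf i) + g (.rotK i)) * E (i + 2) r -
      (g (.conf (i + 2)) - g (.rotJ (i + 2))) * E i r) ∧
    ∀ r, E (i + 1) (E i r) = E i (E (i + 1) r) +
      2 * g (.asym (i + 2)) * E0 r + 2 * g (.curv (i + 2)) * E (i + 2) r -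
      (g (.conf (i + 1)) + g (.rotK (i + 1))) * E i r +
      (g (.conf i) - g (.rotJ i)) * E (i + 1) r := by
  simp only [torsion] at ht
  have t1 := ht (i + 1)
  have t2 := ht (i + 2)
  simp only [fin3_add] at t1 t2
  exact ⟨fun r => by linear_combination -ht i r, fun r => by linear_combination t1 r,
    fun r => by linear_combination -t2 r⟩

namespace Evolution

include h

theorem eq_neg (b : GB1) (hb : mult b = 1) (hf : ∀ i μ, b ≠ .frame i μ) :
    E0 (g b) = -quadEval E C 1 g g (.inr b) := by
  have := h.coeff b hf
  rw [hb, Int.cast_one] at this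
  linear_combination this

theorem diag (i : Fin 3) : E0 (g (.diag i)) = -quadEval E C 1 g g (.inr (.diag i)) :=
  h.eq_neg _ rfl (by simp)

theorem conf (i : Fin 3) : E0 (g (.conf i)) = -quadEval E C 1 g g (.inr (.conf i)) :=
  h.eq_neg _ rfl (by simp)

theorem rotJ (i : Fin 3) : E0 (g (.rotJ i)) = -quadEval E C 1 g g (.inr (.rotJ i)) :=
  h.eq_neg _ rfl (by simp)

theorem rotK (i : Fin 3) : E0 (g (.rotK i)) = -quadEval E C 1 g g (.inr (.rotK i)) :=
  h.eq_neg _ rfl (by simp)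

theorem scalar (i : Fin 4) : E0 (g (.scalar i)) = -quadEval E C 1 g g (.inr (.scalar i)) :=
  h.eq_neg _ rfl (by simp)

theorem scalar_zero_cyclic (i : Fin 3) : E0 (g (.scalar 0)) =
    -((divTerms i).map (QTerm.eval E C 1 g g)).sum := by
  rw [h.scalar]
  fin_cases i <;>
  simp only [quadEval, quad, divTerms, QTerm.eval, Fin.cases_zero, map_cons, map_nil, sum_cons, sum_nil,
    Fin.isValue, Fin.zero_eta, Fin.mk_one, Fin.reduceFinMk, zero_add, Fin.reduceAdd] <;>
  ring

theorem scalar_sp (i : Fin 3) : E0 (g (.scalar (sp i))) =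
    -((waveTerms i).map (QTerm.eval E C 1 g g)).sum := h.scalar (sp i)

theorem curv (i : Fin 3) :
    E0 (g (.curv i)) = (-1 / 2 : ℝ) • quadEval E C 1 g g (.inr (.curv i)) :=
  eq_half_smul (by simpa [mult] using h.coeff (.curv i) (by simp))

theorem sym (i : Fin 3) :
    E0 (g (.sym i)) = (-1 / 2 : ℝ) • quadEval E C 1 g g (.inr (.sym i)) :=
  eq_half_smul (by simpa [mult] using h.coeff (.sym i) (by simp))

theorem asym (i : Fin 3) :
    E0 (g (.asym i)) = (-1 / 2 : ℝ) • quadEval E C 1 g g (.inr (.asym i)) :=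
  eq_half_smul (by simpa [mult] using h.coeff (.asym i) (by simp))

set_option maxHeartbeats 1000000 in
theorem torsion_eq (i : Fin 3) (r : R) : E0 (torsion E0 E g i r) = torsion E0 E g i (E0 r) -
    (2 * g (.diag i) + g (.diag (i + 1)) + g (.diag (i + 2))) * torsion E0 E g i r +
    (g (.asym (i + 2)) - g (.sym (i + 2))) * torsion E0 E g (i + 1) r -
    (g (.asym (i + 1)) + g (.sym (i + 1))) * torsion E0 E g (i + 2) r := by
  simp only [torsion, fin3_add,
    map_add, map_sub, leibniz, smul_eq_mul, h.frame, h.conf, h.rotK, h.rotJ, h.curv,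
    h.asym, quadEval, quad, QTerm.eval, map_cons, map_nil, sum_cons, sum_nil,
    Int.cast_neg, Int.cast_one, Int.cast_ofNat, map_ofNat_derivation]
  algebra

set_option maxRecDepth 4000 in
set_option maxHeartbeats 16000000 in
theorem vector_and_mix_eq (ht : ∀ i r, torsion E0 E g i r = 0) (i : Fin 3) :
    (∀ c : Fin 3 → GB2, c = .sym ∨ c = .asym ∨ c = .scalar → E0 (quadEval E C 1 g g (.inl (c i))) =
    -(2 * g (.diag i) + g (.diag (i + 1)) + g (.diag (i + 2))) * quadEval E C 1 g g (.inl (c i)) +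
    (g (.asym (i + 2)) - g (.sym (i + 2))) * quadEval E C 1 g g (.inl (c (i + 1))) -
    (g (.asym (i + 1)) + g (.sym (i + 1))) * quadEval E C 1 g g (.inl (c (i + 2)))) ∧
    E0 (quadEval E C 1 g g (.inl (.mix i))) =
    E i (quadEval E C 1 g g (.inl .zero)) +
    (2 * g (.curv i) - g (.curv (i + 1)) - g (.curv (i + 2))) * quadEval E C 1 g g (.inl (.sym i)) +
    (1 / 2 : ℝ) • ((-g (.conf (i + 2)) - 3 * g (.rotK (i + 2))) * quadEval E C 1 g g (.inl (.sym (i + 1))) - E (i + 2) (quadEval E C 1 g g (.inl (.sym (i + 1)))) +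
    (g (.conf (i + 1)) - 3 * g (.rotJ (i + 1))) * quadEval E C 1 g g (.inl (.sym (i + 2))) + E (i + 1) (quadEval E C 1 g g (.inl (.sym (i + 2)))) +
    (g (.conf (i + 2)) - g (.rotK (i + 2))) * quadEval E C 1 g g (.inl (.asym (i + 1))) + E (i + 2) (quadEval E C 1 g g (.inl (.asym (i + 1)))) -
    (g (.conf (i + 1)) + g (.rotJ (i + 1))) * quadEval E C 1 g g (.inl (.asym (i + 2))) - E (i + 1) (quadEval E C 1 g g (.inl (.asym (i + 2))))) -
    (g (.curv (i + 1)) + g (.curv (i + 2))) * quadEval E C 1 g g (.inl (.asym i)) - (g (.diag (i + 1)) + g (.diag (i + 2))) * quadEval E C 1 g g (.inl (.mix i)) +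
    (g (.sym (i + 2)) - g (.asym (i + 2))) * quadEval E C 1 g g (.inl (.mix (i + 1))) + (g (.asym (i + 1)) + g (.sym (i + 1))) * quadEval E C 1 g g (.inl (.mix (i + 2))) +
    6 * g (.scalar (sp (i + 2))) * quadEval E C 1 g g (.inl (.scalar (i + 1))) - 6 * g (.scalar (sp (i + 1))) * quadEval E C 1 g g (.inl (.scalar (i + 2))) := by
  obtain ⟨c0, c1, c2⟩ := comm_of_torsion ht i
  refine ⟨fun c hc => ?_, ?_⟩
  · rcases hc with rfl | rfl | rfl
    all_goals
      simp only [quadEval, quad, QTerm.eval, map_cons, map_nil, sum_cons,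
    sum_nil, Int.cast_neg, Int.cast_one, Int.cast_ofNat,
    fin3_add]
      simp only [fin3_add, map_add, map_neg,
    Derivation.map_smul, leibniz, smul_eq_mul, h.frame, h.conf, h.rotK, h.rotJ, h.curv,
    h.asym, h.sym, h.diag, h.scalar_zero_cyclic i, h.scalar_sp, quadEval, quad, divTerms, waveTerms, QTerm.eval,
    map_cons, map_nil, sum_cons, sum_nil, Int.cast_neg, Int.cast_one,
    Int.cast_ofNat, map_ofNat_derivation, Derivation.map_one_eq_zero, map_zero, c0, c1, c2]
      algebra
  rw [zero_cyclic i]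
  simp only [quadEval, quad, zeroTerms, QTerm.eval, map_cons, map_nil, sum_cons,
    sum_nil, Int.cast_neg, Int.cast_one, Int.cast_ofNat,
    fin3_add]
  simp only [fin3_add, map_add, map_neg,
    Derivation.map_smul, leibniz, smul_eq_mul, h.frame, h.conf, h.rotK, h.rotJ, h.curv,
    h.asym, h.sym, h.diag, h.scalar_zero_cyclic i, h.scalar_sp, quadEval, quad, divTerms, waveTerms, QTerm.eval,
    map_cons, map_nil, sum_cons, sum_nil, Int.cast_neg, Int.cast_one,
    Int.cast_ofNat, map_ofNat_derivation, Derivation.map_one_eq_zero, map_zero, c0, c1, c2]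
  algebra

set_option maxRecDepth 4000 in
set_option maxHeartbeats 16000000 in
theorem top_and_zero_eq (ht : ∀ i r, torsion E0 E g i r = 0) :
    (E0 (quadEval E C 1 g g (.inl .top)) =
    -(2 * (g (.diag 0) + g (.diag 1) + g (.diag 2))) * quadEval E C 1 g g (.inl .top)) ∧
    E0 (quadEval E C 1 g g (.inl .zero)) =
    g (.asym 0) * (quadEval E C 1 g g (.inl (.asym 0)) - quadEval E C 1 g g (.inl (.sym 0))) +
    (g (.rotK 0) - g (.rotJ 0)) * quadEval E C 1 g g (.inl (.mix 0)) + E 0 (quadEval E C 1 g g (.inl (.mix 0))) +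
    g (.asym 1) * (quadEval E C 1 g g (.inl (.asym 1)) - quadEval E C 1 g g (.inl (.sym 1))) +
    (g (.rotK 1) - g (.rotJ 1)) * quadEval E C 1 g g (.inl (.mix 1)) + E 1 (quadEval E C 1 g g (.inl (.mix 1))) +
    g (.asym 2) * (quadEval E C 1 g g (.inl (.asym 2)) - quadEval E C 1 g g (.inl (.sym 2))) +
    (g (.rotK 2) - g (.rotJ 2)) * quadEval E C 1 g g (.inl (.mix 2)) + E 2 (quadEval E C 1 g g (.inl (.mix 2))) := by
  have hc := comm_of_torsion ht 0
  simp only [Fin.isValue, zero_add] at hc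
  obtain ⟨c0, c1, c2⟩ := hc
  constructor
  all_goals
    simp only [quadEval, quad, zeroTerms, QTerm.eval, map_cons, map_nil, sum_cons,
    sum_nil, Int.cast_neg, Int.cast_one, Int.cast_ofNat]
    simp only [Fin.isValue, zero_add, Fin.reduceAdd, map_add, map_neg,
    Derivation.map_smul, leibniz, smul_eq_mul, h.frame, h.conf, h.rotK, h.rotJ, h.curv,
    h.asym, h.sym, h.diag, h.scalar_zero_cyclic 0, h.scalar_sp, quadEval, quad, divTerms, waveTerms, QTerm.eval,
    map_cons, map_nil, sum_cons, sum_nil, Int.cast_neg, Int.cast_one,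
    Int.cast_ofNat, map_ofNat_derivation, Derivation.map_one_eq_zero, map_zero, c0, c1, c2]
    algebra

end Evolution

end Propagation

section PowerSeries

variable (R) in
/-- Formal power series in `s₁, s₂, s₃`. -/
abbrev PS : Type _ := MvPowerSeries (Fin 3) R

theorem ps_mul_apply (f g : PS R) (α : Multi) :
    (f * g) α = ∑ q ∈ antidiagonal α, f q.1 * g q.2 := MvPowerSeries.coeff_mul _ _ _

theorem ps_add_apply (f g : PS R) (α : Multi) : (f + g) α = f α + g α := rfl

theorem ps_neg_apply (f : PS R) (α : Multi) : (-f) α = -f α := rfl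

theorem ps_sub_apply (f g : PS R) (α : Multi) : (f - g) α = f α - g α := rfl

theorem ps_smul_apply (t : ℝ) (f : PS R) (α : Multi) : (t • f) α = t • f α := rfl

theorem ps_zero_apply (α : Multi) : (0 : PS R) α = 0 := rfl

theorem ps_sum_apply {ι : Type*} (s : Finset ι) (f : ι → PS R) (α : Multi) :
    (∑ i ∈ s, f i) α = ∑ i ∈ s, f i α := map_sum (MvPowerSeries.coeff α) f s

theorem ps_C_mul_apply (c : R) (f : PS R) (α : Multi) :
    (MvPowerSeries.C c * f : PS R) α = c * f α := MvPowerSeries.coeff_C_mul _ _ _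

theorem ps_int_mul_apply (q : ℤ) (f : PS R) (α : Multi) : ((q : PS R) * f) α = q * f α := by
  rw [← zsmul_eq_mul, ← zsmul_eq_mul]; exact map_zsmul (MvPowerSeries.coeff α) q f

/-- A derivation, extended coefficientwise to formal power series. -/
def psDer (D : Derivation ℝ R R) : Derivation ℝ (PS R) (PS R) := Derivation.mk'
  { toFun := fun f α => D (f α)
    map_add' := fun f g => by
      funext α
      exact D.map_add _ _
    map_smul' := fun c f => by
      funext α
      exact D.map_smul _ _ }
  (fun f g => by
    funext α
    change D ((f * g) α) = (f * _) α + (g * _) α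
    rw [mul_comm g, ps_mul_apply, ps_mul_apply, ps_mul_apply, map_sum, ← sum_add_distrib]
    exact sum_congr rfl fun q _ => by
      change D (f q.1 * g q.2) = f q.1 * D (g q.2) + D (f q.1) * g q.2
      rw [D.leibniz, smul_eq_mul, smul_eq_mul, mul_comm (g q.2)])

variable (e C) (g : Multi → GB1 → R)

/-- The coefficients, as formal power series. -/
def psCoef (b : GB1) : PS R := fun α => g α b

/-- The distinguished derivations of formal power series. -/
def psFrame (μ : Fin 4) : Derivation ℝ (PS R) (PS R) := psDer (e μ)

/-- The structure functions as formal power series. -/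
def psStruct (ν κ μ : Fin 4) : PS R := MvPowerSeries.C (C ν κ μ)

theorem derOf_psFrame_apply (h : Fin 4 → PS R) (f : PS R) (α : Multi) :
    derOf (psFrame e) h f α = ∑ q ∈ antidiagonal α, derOf e (fun μ => h μ q.1) (f q.2) := by
  rw [derOf_apply, ps_sum_apply]
  simp only [ps_mul_apply, derOf_apply]
  exact sum_comm

theorem frameDer_psFrame_apply (i : Fin 3) (f : PS R) (α : Multi) :
    frameDer (psFrame e) (psCoef g) i f α =
      ∑ q ∈ antidiagonal α, frameDer e (g q.1) i (f q.2) :=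
  derOf_psFrame_apply e _ _ _

/-- The left hand sides of the equations as formal power series. -/
def psQuad (c : B2) : PS R :=
  quadEval (frameDer (psFrame e) (psCoef g)) (psStruct C) 1 (psCoef g) (psCoef g) c

theorem termSum_eq_coeff (T : QTerm) (α : Multi) :
    T.eval (frameDer (psFrame e) (psCoef g)) (psStruct C) 1 (psCoef g) (psCoef g) α =
      termSum e C T g α := by
  cases T with
  | mul q b b' =>
    simp only [QTerm.eval]
    rw [mul_assoc, ps_int_mul_apply, ps_mul_apply, mul_sum]
    exact sum_congr rfl fun q _ => (mul_assoc _ _ _).symm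
  | der q i b =>
    simp only [QTerm.eval]
    rw [ps_int_mul_apply, frameDer_psFrame_apply, mul_sum]
    rfl
  | lin q b =>
    simp only [QTerm.eval, termSum, mul_one, ps_int_mul_apply]
    rw [sum_withUnit g α (fun t β => (q : R) * algebraMap ℝ R t * g β b) (by simp)]
    simp [psCoef]
  | struct i μ =>
    simp only [QTerm.eval, termSum, ps_sum_apply]
    rw [sum_comm (s := antidiagonal α)]
    refine sum_congr rfl fun ν _ => ?_
    rw [sum_comm (s := antidiagonal α)]
    refine sum_congr rfl fun κ _ => ?_
    rw [mul_assoc, psStruct, ps_C_mul_apply, ps_mul_apply, mul_sum]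
    exact sum_congr rfl fun q _ => (mul_assoc _ _ _).symm

theorem psQuad_apply (c : B2) (α : Multi) :
    psQuad e C g c α = ((quad c).map fun T => termSum e C T g α).sum := by
  have h := map_list_sum (MvPowerSeries.coeff (R := R) α) ((quad c).map
    (QTerm.eval (frameDer (psFrame e) (psCoef g)) (psStruct C) 1 (psCoef g) (psCoef g)))
  refine h.trans ?_
  rw [List.map_map]
  exact congrArg List.sum (List.map_congr_left fun T _ => termSum_eq_coeff e C g T α)

theorem mcSum_eq_psQuad (c : B2) (α : Multi) : mcSum e C c g α =
    Sum.elim (fun _ => 0) (fun b => mult b * e 0 (g α b)) c + psQuad e C g c α := by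
  rw [mcSum_eq, psQuad_apply]

variable {e C g}

theorem lie_psFrame (h0 : ∀ μ ν, ⁅e μ, e ν⁆ = derOf e (C μ ν)) (μ ν : Fin 4) :
    ⁅psFrame e μ, psFrame e ν⁆ = derOf (psFrame e) (psStruct C μ ν) := by
  refine Derivation.ext fun f => funext fun α => ?_
  rw [commutator_apply, derOf_apply, ps_sum_apply]
  simp only [psStruct, ps_C_mul_apply]
  change e μ (e ν (f α)) - e ν (e μ (f α)) = ∑ κ, C μ ν κ * e κ (f α)
  rw [← commutator_apply, h0, derOf_apply]

theorem torsion_eq_derOf (h0 : ∀ μ ν, ⁅e μ, e ν⁆ = derOf e (C μ ν)) (i : Fin 3) (f : PS R) :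
    torsion (psFrame e 0) (frameDer (psFrame e) (psCoef g)) (psCoef g) i f =
      derOf (psFrame e) (fun μ => psQuad e C g (.inl (.frame i μ))) f := by
  have key : ⁅frameDer (psFrame e) (psCoef g) (i + 1), frameDer (psFrame e) (psCoef g) (i + 2)⁆ +
      ((2 * psCoef g (.asym i)) • psFrame e 0 + (2 * psCoef g (.curv i)) •
        frameDer (psFrame e) (psCoef g) i +
      (-psCoef g (.conf (i + 2)) - psCoef g (.rotK (i + 2))) •
        frameDer (psFrame e) (psCoef g) (i + 1) +
      (psCoef g (.conf (i + 1)) - psCoef g (.rotJ (i + 1))) •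
        frameDer (psFrame e) (psCoef g) (i + 2)) =
      derOf (psFrame e) (fun μ => psQuad e C g (.inl (.frame i μ))) := by
    simp only [frameDer_eq, lie_derOf (lie_psFrame h0), derOf_single, smul_derOf, derOf_add]
    congr 1
    funext μ
    simp only [psQuad, quadEval, quad, List.map_append, List.sum_append]
    split_ifs with h
    · subst h; simp [QTerm.eval, frameDer_eq]; ring
    · simp [QTerm.eval, frameDer_eq, h]; ring
  rw [← key]
  simp only [torsion, Derivation.add_apply, commutator_apply, smul_apply_derivation]
  ring

theorem evolution_of_mcSum (h0 : ∀ μ ν, ⁅e μ, e ν⁆ = derOf e (C μ ν)) (hC : ∀ ν, C 0 ν = 0)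
    (h : ∀ b α, mcSum e C (.inr b) g α = 0) :
    Evolution (psFrame e 0) (frameDer (psFrame e) (psCoef g)) (psStruct C) (psCoef g) where
  coeff b hb := by
    funext α
    rw [ps_add_apply, ps_int_mul_apply]
    refine Eq.trans ?_ (h b α)
    rw [mcSum_eq_psQuad, Sum.elim_inr]
    rfl
  frame i f := by
    have h1 : ∀ μ, ⁅psFrame e 0, psFrame e μ⁆ = 0 := fun μ => by
      rw [lie_psFrame h0]; simp [derOf, psStruct, hC]
    have h2 : ∀ μ, psFrame e 0 (psCoef g (.frame i μ)) =
        -psQuad e C g (.inr (.frame i μ)) := fun μ => by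
      funext α
      have := h (.frame i μ) α
      rw [mcSum_eq_psQuad, Sum.elim_inr] at this
      simp only [mult, Int.cast_one, one_mul] at this
      exact eq_neg_of_add_eq_zero_left this
    have h3 : psFrame e 0 (frameDer (psFrame e) (psCoef g) i f) =
        frameDer (psFrame e) (psCoef g) i (psFrame e 0 f) +
        derOf (psFrame e) (fun μ => psFrame e 0 (psCoef g (.frame i μ))) f := by
      rw [← lie_zero_derOf h1, commutator_apply]; simp only [frameDer_eq]; ring
    rw [h3]
    simp only [h2, psQuad, quadEval, quad, QTerm.eval, frameDer_eq, derOf_apply, map_cons,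
      map_nil, sum_cons, sum_nil, Fin.sum_univ_four]
    push_cast
    ring

end PowerSeries

section Vanishing

/-- The pairing of a multi-index with the Kasner exponents. -/
def dot (p : Fin 3 → R) (κ : Multi) : R := ∑ l, (κ l : R) * p l

/-- Submodules of coefficients at `s^α`, on which the evolution operators of the form
`∂₀ + κ₁p₁ + κ₂p₂ + κ₃p₃` are bijective for `κ < α`. -/
structure Weighted (e : Fin 4 → Derivation ℝ R R) (p : Fin 3 → R)
    (W : Multi → Submodule ℝ R) : Prop where
  one_mem : 1 ∈ W 0
  mul_mem : ∀ {α β f g}, f ∈ W α → g ∈ W β → f * g ∈ W (α + β)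
  der_mem : ∀ {α f} μ, f ∈ W α → e μ f ∈ W α
  unique : ∀ {α κ f}, κ ≤ α → κ ≠ α → f ∈ W α → e 0 f + dot p κ * f = 0 → f = 0
  solve : ∀ {α κ f}, κ ≤ α → κ ≠ α → f ∈ W α → ∃ y ∈ W α, e 0 y + dot p κ * y = f

variable {g : Multi → GB1 → R}

theorem int_mul_mem (W : Submodule ℝ R) (q : ℤ) {f : R} (hf : f ∈ W) : (q : R) * f ∈ W := by
  rw [← zsmul_eq_mul]; exact zsmul_mem hf q

theorem termSum_mem (hW : Weighted e p W) (hg : ∀ α b, g α b ∈ W α)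
    (hC : ∀ ν κ μ, C ν κ μ ∈ W 0) (T : QTerm) (α : Multi) : termSum e C T g α ∈ W α := by
  refine (W α).sum_mem fun q hq => ?_
  rw [mem_antidiagonal] at hq
  have hF : ∀ i f, f ∈ W q.2 → frameDer e (g q.1) i f ∈ W α := fun i f hf => by
    rw [frameDer_eq, derOf_apply]
    exact (W α).sum_mem fun μ _ => hq ▸ hW.mul_mem (hg _ _) (hW.der_mem _ hf)
  cases T with
  | mul n b b' =>
    rw [QTerm.eval, mul_assoc]
    exact int_mul_mem _ _ (hq ▸ hW.mul_mem (hg _ _) (hg _ _))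
  | der n i b => exact int_mul_mem _ _ (hF i _ (hg _ _))
  | lin n b =>
    rw [QTerm.eval, mul_assoc]
    refine int_mul_mem _ _ ?_
    by_cases h : q.1 = 0
    · rw [h, zero_add] at hq
      simp only [withUnit, h, if_true, map_one, one_mul]
      exact hq ▸ hg _ _
    · simp [withUnit, h]
  | struct i μ =>
    refine (W α).sum_mem fun ν _ => (W α).sum_mem fun κ _ => ?_
    have := hW.mul_mem (hW.mul_mem (hC ν κ μ) (hg q.1 (.frame (i + 1) ν)))
      (hg q.2 (.frame (i + 2) κ))
    rwa [zero_add, hq] at this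

theorem psQuad_mem (hW : Weighted e p W) (hg : ∀ α b, g α b ∈ W α)
    (hC : ∀ ν κ μ, C ν κ μ ∈ W 0) (c : B2) (α : Multi) : psQuad e C g c α ∈ W α := by
  rw [psQuad_apply]
  refine (W α).list_sum_mem fun x hx => ?_
  obtain ⟨T, _, rfl⟩ := List.mem_map.1 hx
  exact termSum_mem hW hg hC T α

theorem ps_mul_apply_of_low {a u : PS R} {α : Multi} (hu : ∀ β < α, u β = 0) :
    (a * u) α = a 0 * u α := by
  rw [ps_mul_apply, sum_eq_single (0, α)]
  · intro q hq hne
    rw [mem_antidiagonal] at hq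
    have h1 : q.2 ≤ α := hq ▸ le_add_self
    rcases h1.lt_or_eq with h2 | h2
    · rw [hu _ h2, mul_zero]
    · refine absurd (Prod.ext ?_ h2) hne
      rw [h2] at hq
      exact add_eq_right.1 hq
  · intro h; exact absurd (by simp) h

theorem frameDer_apply_of_low (hf : IsFiltered g) {u : PS R} {α : Multi} (hu : ∀ β < α, u β = 0)
    (i : Fin 3) : frameDer (psFrame e) (psCoef g) i u α = 0 := by
  rw [frameDer_psFrame_apply]
  refine sum_eq_zero fun q hq => ?_
  rw [mem_antidiagonal] at hq
  have h1 : q.2 ≤ α := hq ▸ le_add_self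
  rcases h1.lt_or_eq with h2 | h2
  · rw [hu _ h2, map_zero]
  · rw [h2] at hq
    rw [add_eq_right.1 hq, frameDer_eq_zero hf]
    · rfl
    · intro h
      have := h (i + 1)
      rw [deg011_apply] at this
      simp [num011] at this

theorem dot_deg211 (p : Fin 3 → R) (i : Fin 3) :
    dot p (deg211 i) = 2 * p i + p (i + 1) + p (i + 2) := by
  simp only [dot, deg211_apply, num211, Fin.sum_univ_three]
  fin_cases i <;> simp <;> ring

theorem dot_deg011 (p : Fin 3 → R) (i : Fin 3) : dot p (deg011 i) = p (i + 1) + p (i + 2) := by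
  simp only [dot, deg011_apply, num011, Fin.sum_univ_three]
  fin_cases i <;> simp <;> ring

theorem derOf_psFrame_eq_zero (he : LinearIndependent R e) {h : Fin 4 → PS R}
    (h0 : ∀ f, derOf (psFrame e) h f = 0) (μ : Fin 4) : h μ = 0 := by
  funext α
  have h1 : ∑ μ, h μ α • e μ = 0 := by
    ext r
    have := congrFun (h0 (MvPowerSeries.C r)) α
    rw [derOf_apply, ps_sum_apply] at this
    rw [sum_apply_derivation]
    refine Eq.trans (sum_congr rfl fun μ _ => ?_) this
    rw [mul_comm, ps_mul_apply, sum_eq_single (0, α)]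
    · change h μ α * e μ r = e μ (MvPowerSeries.C r 0) * h μ α
      rw [show MvPowerSeries.C r 0 = r from MvPowerSeries.coeff_zero_C r, mul_comm]
    · intro q hq hne
      rw [mem_antidiagonal] at hq
      have : q.1 ≠ 0 := fun h0 => hne (Prod.ext h0 (by rw [h0, zero_add] at hq; exact hq))
      change e μ (MvPowerSeries.C r q.1) * _ = 0
      rw [show MvPowerSeries.C r q.1 = 0 from (MvPowerSeries.coeff_C _ _).trans (if_neg this)]
      simp
    · intro h; exact absurd (by simp) h
  exact Fintype.linearIndependent_iff.1 he (fun μ => h μ α) h1 μ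

end Vanishing

section Vanishing

variable {g : Multi → GB1 → R}

theorem Weighted.eq_zero (hW : Weighted e p W) {κ α : Multi} {y : R} (hy : y ∈ W α)
    (hn : ¬ κ ≤ α → y = 0) (hl : κ = α → y = 0) (h : e 0 y + dot p κ * y = 0) : y = 0 := by
  by_cases h1 : κ ≤ α
  · by_cases h2 : κ = α
    · exact hl h2
    · exact hW.unique h1 h2 hy h
  · exact hn h1

theorem GB1.apply_zero (hf : IsFiltered g) : (∀ i, psCoef g (.asym i) 0 = 0) ∧
    (∀ i, psCoef g (.sym i) 0 = 0) ∧ (∀ i, psCoef g (.curv i) 0 = 0) ∧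
    (∀ i, psCoef g (.conf i) 0 = 0) ∧ (∀ i, psCoef g (.rotK i) 0 = 0) ∧
    (∀ i, psCoef g (.rotJ i) 0 = 0) ∧ ∀ i, psCoef g (.scalar (sp i)) 0 = 0 :=
  GB1.eq_zero_of_num (g := fun b => psCoef g b 0) fun b hb => hf 0 b fun h => hb <| funext fun j => by
    rw [← GB1.deg_apply, le_antisymm h (by simp)]; rfl

theorem psQuad_eq_zero_of_not_le (hf : IsFiltered g) (c : GB2) {α : Multi} (h : ¬ c.deg ≤ α) :
    psQuad e C g (.inl c) α = 0 := by
  have := mcSum_eq_zero (e := e) (C := C) hf (c := .inl c) h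
  rwa [mcSum_eq_psQuad, Sum.elim_inl, zero_add] at this

theorem quadEval_ps (c : B2) : quadEval (frameDer (psFrame e) (psCoef g)) (psStruct C) 1 (psCoef g)
    (psCoef g) c = psQuad e C g c := rfl

section

variable (hW : Weighted e p W) (hf : IsFiltered g) (hd : ∀ i, g 0 (.diag i) = p i)

include hW hf hd

/-- Uniqueness for the linear system that is satisfied by the constraints of degree `deg211`. -/
theorem eq_zero_of_vector_eq {u : Fin 3 → PS R} (hu : ∀ i α, u i α ∈ W α)
    (hn : ∀ i α, ¬ deg211 i ≤ α → u i α = 0) (hl : ∀ i, u i (deg211 i) = 0)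
    (h : ∀ i, psFrame e 0 (u i) =
      -(2 * psCoef g (.diag i) + psCoef g (.diag (i + 1)) + psCoef g (.diag (i + 2))) * u i +
      (psCoef g (.asym (i + 2)) - psCoef g (.sym (i + 2))) * u (i + 1) -
      (psCoef g (.asym (i + 1)) + psCoef g (.sym (i + 1))) * u (i + 2)) (i : Fin 3) : u i = 0 := by
  funext α
  induction α using WellFoundedLT.induction generalizing i with
  | ind α ih =>
  have m : ∀ (f : PS R) i, (f * u i) α = f 0 * u i α :=
    fun f i => ps_mul_apply_of_low fun β hβ => ih β hβ i
  refine hW.eq_zero (hu i α) (hn i α) (fun h => h ▸ hl i) ?_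
  have h1 := congrFun (h i) α
  change e 0 (u i α) = _ at h1
  simp only [ps_add_apply, ps_sub_apply, m, ps_neg_apply, two_mul, GB1.apply_zero hf,
    show ∀ i, psCoef g (.diag i) 0 = p i from hd] at h1
  rw [dot_deg211]
  linear_combination h1

variable (he : LinearIndependent R e)
  (h0 : ∀ μ ν, ⁅e μ, e ν⁆ = derOf e (C μ ν)) (hC : ∀ ν, C 0 ν = 0)
  (hCW : ∀ ν κ μ, C ν κ μ ∈ W 0) 
  (hg : ∀ α b, g α b ∈ W α) (hev : ∀ b α, mcSum e C (.inr b) g α = 0)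
  (hlead : ∀ c : GB2, mcSum e C (.inl c) g c.deg = 0)

include he h0 hC hCW hg hev hlead

theorem psQuad_vector_eq_zero (c : Fin 3 → GB2) (hc : ∀ i, (c i).deg = deg211 i)
    (h : ∀ i, psFrame e 0 (psQuad e C g (.inl (c i))) =
      -(2 * psCoef g (.diag i) + psCoef g (.diag (i + 1)) + psCoef g (.diag (i + 2))) *
        psQuad e C g (.inl (c i)) +
      (psCoef g (.asym (i + 2)) - psCoef g (.sym (i + 2))) * psQuad e C g (.inl (c (i + 1))) -
      (psCoef g (.asym (i + 1)) + psCoef g (.sym (i + 1))) * psQuad e C g (.inl (c (i + 2)))) :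
    ∀ i, psQuad e C g (.inl (c i)) = 0 :=
  eq_zero_of_vector_eq hW hf hd (fun i => psQuad_mem hW hg hCW _)
    (fun i α h => psQuad_eq_zero_of_not_le hf _ (by rwa [hc]))
    (fun i => by
      have := hlead (c i)
      rwa [mcSum_eq_psQuad, Sum.elim_inl, zero_add, hc] at this) h

theorem psQuad_frame_eq_zero (i : Fin 3) (μ : Fin 4) : psQuad e C g (.inl (.frame i μ)) = 0 := by
  refine psQuad_vector_eq_zero hW hf hd he h0 hC hCW hg hev hlead (fun i => .frame i μ)
    (fun i => rfl) (fun i => ?_) i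
  have h00 : ∀ μ, ⁅psFrame e 0, psFrame e μ⁆ = 0 := fun μ => by
    rw [lie_psFrame h0]; simp [derOf, psStruct, hC]
  let u : Fin 3 → Fin 4 → PS R := fun i μ => psQuad e C g (.inl (.frame i μ))
  refine sub_eq_zero.1 (derOf_psFrame_eq_zero he (h := fun μ => psFrame e 0 (u i μ) -
    (-(2 * psCoef g (.diag i) + psCoef g (.diag (i + 1)) + psCoef g (.diag (i + 2))) * u i μ +
    (psCoef g (.asym (i + 2)) - psCoef g (.sym (i + 2))) * u (i + 1) μ -
    (psCoef g (.asym (i + 1)) + psCoef g (.sym (i + 1))) * u (i + 2) μ)) (fun f => ?_) μ)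
  rw [← derOf_sub, ← lie_zero_derOf h00, ← derOf_sub, ← derOf_add, ← smul_derOf, ← smul_derOf,
    ← smul_derOf]
  have h2 := (evolution_of_mcSum h0 hC hev).torsion_eq i f
  simp only [torsion_eq_derOf h0] at h2
  simp only [Derivation.sub_apply, Derivation.add_apply, commutator_apply, smul_apply_derivation]
  linear_combination h2

theorem constraints_vanish (c : GB2) (α : Multi) : mcSum e C (.inl c) g α = 0 := by
  have hE := evolution_of_mcSum h0 hC hev
  have hfr := psQuad_frame_eq_zero hW hf hd he h0 hC hCW hg hev hlead
  have ht : ∀ i f, torsion (psFrame e 0) (frameDer (psFrame e) (psCoef g)) (psCoef g) i f = 0 :=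
    fun i f => by rw [torsion_eq_derOf h0]; simp [hfr, derOf]
  have vec := fun c hc hdeg => psQuad_vector_eq_zero hW hf hd he h0 hC hCW hg hev hlead c hdeg
    fun i => (hE.vector_and_mix_eq ht i).1 c hc
  have hs := vec .sym (.inl rfl) fun _ => rfl
  have ha := vec .asym (.inr (.inl rfl)) fun _ => rfl
  have hsc := vec .scalar (.inr (.inr rfl)) fun _ => rfl
  have hl : ∀ c, psQuad e C g (.inl c) c.deg = 0 := fun c => by
    have := hlead c
    rwa [mcSum_eq_psQuad, Sum.elim_inl, zero_add] at this
  rw [mcSum_eq_psQuad, Sum.elim_inl, zero_add]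
  have zd : ∀ i, psCoef g (.diag i) 0 = p i := hd
  induction α using WellFoundedLT.induction generalizing c with
  | ind α ih =>
  have m : ∀ (f : PS R) c, (f * psQuad e C g (.inl c)) α = f 0 * psQuad e C g (.inl c) α :=
    fun f c => ps_mul_apply_of_low fun β hβ => ih β hβ c
  have mE : ∀ i c, frameDer (psFrame e) (psCoef g) i (psQuad e C g (.inl c)) α = 0 :=
    fun i c => frameDer_apply_of_low hf (fun β hβ => ih β hβ c) i
  refine hW.eq_zero (κ := c.deg) (psQuad_mem hW hg hCW _ α)
      (fun h => psQuad_eq_zero_of_not_le hf c h) (fun h => h ▸ hl c) ?_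
  cases c with
  | frame i μ => simp [hfr, ps_zero_apply]
  | sym i => simp [hs, ps_zero_apply]
  | asym i => simp [ha, ps_zero_apply]
  | scalar i => simp [hsc, ps_zero_apply]
  | mix i =>
    have h1 := congrFun (hE.vector_and_mix_eq ht i).2 α
    simp only [quadEval_ps, hs, ha, hsc, map_zero, mul_zero, add_zero, sub_zero, smul_zero] at h1
    change e 0 (psQuad e C g (.inl (.mix i)) α) = _ at h1
    simp only [ps_add_apply, ps_sub_apply, m, mE, GB1.apply_zero hf, zd] at h1
    simp only [GB2.deg, dot_deg011]
    linear_combination h1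
  | top =>
    have h1 := congrFun (hE.top_and_zero_eq ht).1 α
    change e 0 (psQuad e C g (.inl .top) α) = _ at h1
    simp only [quadEval_ps, ps_add_apply, m, ps_neg_apply, two_mul, zd] at h1
    have : dot p (GB2.deg .top) = 2 * (p 0 + p 1 + p 2) := by
      simp only [dot, Fin.sum_univ_three, GB2.deg]
      simp [unit]
      ring
    rw [this]
    linear_combination h1
  | zero =>
    have h1 := congrFun (hE.top_and_zero_eq ht).2 α
    simp only [quadEval_ps, hs, ha, sub_zero, mul_zero, zero_add, add_zero] at h1
    change e 0 (psQuad e C g (.inl .zero) α) = _ at h1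
    simp only [ps_add_apply, ps_sub_apply, m, GB1.apply_zero hf, mE] at h1
    rw [h1]
    simp [dot, GB2.deg]

end

end Vanishing

section Recursion

/-- Well-founded recursion for a relation. -/
theorem exists_of_local {X : Type*} [Nonempty X] (P : Multi → (Multi → X) → X → Prop)
    (hloc : ∀ α g g' y, (∀ β < α, g β = g' β) → P α g y → P α g' y)
    (hex : ∀ α g, (∀ β < α, P β g (g β)) → ∃ y, P α g y) : ∃ g, ∀ α, P α g (g α) := by
  classical
  let x0 : X := Classical.arbitrary X
  let F : (α : Multi) → ((β : Multi) → β < α → X) → X := fun α r =>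
    Classical.epsilon (P α fun β => if h : β < α then r β h else x0)
  let g : Multi → X := wellFounded_lt.fix F
  have hg : ∀ α, g α = Classical.epsilon (P α fun β => if β < α then g β else x0) := fun α => by
    have := wellFounded_lt.fix_eq F α
    simpa [F, g] using this
  refine ⟨g, fun α => ?_⟩
  induction α using WellFoundedLT.induction with
  | ind α ih =>
  obtain ⟨y, hy⟩ := hex α g ih
  have h1 : ∀ β < α, g β = (fun β => if β < α then g β else x0) β := fun β hβ => by simp [hβ]
  refine hloc α _ g _ (fun β hβ => (h1 β hβ).symm) ?_
  rw [hg α]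
  exact Classical.epsilon_spec ⟨y, hloc α g _ y h1 hy⟩

end Recursion

section Linearization

variable (e C)

/-- The terms that are products or derivatives along the frame. -/
def QTerm.IsBilin : QTerm → Prop
  | mul _ _ _ => True
  | der _ _ _ => True
  | lin _ _ => False
  | struct _ _ => False

instance : DecidablePred QTerm.IsBilin := fun T => by
  cases T <;> simp only [QTerm.IsBilin] <;> infer_instance

theorem isBilin_of_mem_quad : ∀ b : GB1, ∀ T ∈ quad (.inr b), T.IsBilin := by decide

/-- The part of `termSum` that involves neither the lowest nor the highest order. -/
def lowSum (T : QTerm) (g : Multi → GB1 → R) (α : Multi) : R :=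
  ∑ q ∈ antidiagonal α with q.1 ≠ 0 ∧ q.2 ≠ 0, T.eval (frameDer e (g q.1)) 0 0 (g q.1) (g q.2)

theorem lt_of_mem_antidiagonal {α : Multi} {q : Multi × Multi} (hq : q ∈ antidiagonal α)
    (h1 : q.1 ≠ 0) (h2 : q.2 ≠ 0) : q.1 < α ∧ q.2 < α := by
  rw [mem_antidiagonal] at hq
  rw [← hq]
  exact ⟨lt_add_of_pos_right _ (pos_iff_ne_zero.2 h2), lt_add_of_pos_left _ (pos_iff_ne_zero.2 h1)⟩

theorem lowSum_congr {T : QTerm} {g g' : Multi → GB1 → R} {α : Multi}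
    (h : ∀ β < α, g β = g' β) : lowSum e T g α = lowSum e T g' α := by
  refine sum_congr rfl fun q hq => ?_
  rw [Finset.mem_filter] at hq
  obtain ⟨h1, h2⟩ := lt_of_mem_antidiagonal hq.1 hq.2.1 hq.2.2
  rw [h _ h1, h _ h2]

theorem QTerm.eval_congr {T : QTerm} (hT : T.IsBilin) (E : Fin 3 → Derivation ℝ R R)
    (C C' : Fin 4 → Fin 4 → Fin 4 → R) (t t' : R) (f g : GB1 → R) :
    T.eval E C t f g = T.eval E C' t' f g := by
  cases T <;> first | rfl | exact hT.elim

theorem sum_antidiagonal_eq_add {N : Type*} [AddCommMonoid N] {α : Multi} (hα : α ≠ 0)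
    (F : Multi × Multi → N) : ∑ q ∈ antidiagonal α, F q =
      F (0, α) + F (α, 0) + ∑ q ∈ antidiagonal α with q.1 ≠ 0 ∧ q.2 ≠ 0, F q := by
  classical
  rw [← Finset.sum_filter_add_sum_filter_not _ (fun q : Multi × Multi => q.1 ≠ 0 ∧ q.2 ≠ 0),
    add_comm]
  congr 1
  have : {q ∈ antidiagonal α | ¬ (q.1 ≠ 0 ∧ q.2 ≠ 0)} = {(0, α), (α, 0)} := by
    ext ⟨x, y⟩
    simp only [Finset.mem_filter, mem_antidiagonal, Finset.mem_insert, Finset.mem_singleton,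
      Prod.mk.injEq]
    constructor
    · rintro ⟨h, h2⟩
      by_cases hx : x = 0
      · exact Or.inl ⟨hx, by rw [← h, hx, zero_add]⟩
      · have hy : y = 0 := by_contra fun hy => h2 ⟨hx, hy⟩
        exact Or.inr ⟨by rw [← h, hy, add_zero], hy⟩
    · rintro (⟨rfl, rfl⟩ | ⟨rfl, rfl⟩) <;> simp
  rw [this, Finset.sum_pair]
  intro h
  exact hα (Prod.ext_iff.1 h).1.symm

theorem termSum_eq_add {T : QTerm} (hT : T.IsBilin) (g : Multi → GB1 → R) {α : Multi}
    (hα : α ≠ 0) : termSum e C T g α = T.eval (frameDer e (g 0)) 0 0 (g 0) (g α) +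
      T.eval (frameDer e (g α)) 0 0 (g α) (g 0) + lowSum e T g α := by
  rw [termSum, sum_antidiagonal_eq_add hα, lowSum]
  congr 1
  · congr 1 <;> exact T.eval_congr hT _ _ _ _ _ _ _
  · exact sum_congr rfl fun q _ => T.eval_congr hT _ _ _ _ _ _ _

/-- The Kasner exponents enter the evolution operator for `b` through this multi-index. -/
def GB1.nu : GB1 → Multi
  | sym _ => 0
  | b => b.deg

/-- The terms of the linearized evolution equations that couple to the frame. -/
def couple (g0 : GB1 → R) (y : GB1 → R) : GB1 → R
  | .conf i => -frameDer e y i (g0 (.diag i) + g0 (.diag (i + 1)) + g0 (.diag (i + 2)))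
  | .rotJ i => -frameDer e y i (g0 (.diag (i + 1)))
  | .rotK i => frameDer e y i (g0 (.diag (i + 2)))
  | .scalar m => Fin.cases 0 (fun i => -frameDer e y i (g0 (.scalar 0))) m
  | _ => 0

theorem dot_deg2 (p : Fin 3 → R) (i : Fin 3) : dot p (2 • unit i) = 2 * p i := by
  simp only [dot, Fin.sum_univ_three]
  fin_cases i <;> simp [unit]

theorem dot_zero (p : Fin 3 → R) : dot p 0 = 0 := by simp [dot]

theorem frameDer_of_zero {y : GB1 → R} {i : Fin 3} (h : ∀ μ, y (.frame i μ) = 0) :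
    frameDer e y i = 0 := by simp [frameDer, h]

/-- The linearization of the evolution equations. -/
theorem sum_eval_linear {g0 : GB1 → R} (h : ∀ b, b.deg ≠ 0 → g0 b = 0) (y : GB1 → R) (b : GB1) :
    ((quad (.inr b)).map fun T => T.eval (frameDer e g0) 0 0 g0 y +
      T.eval (frameDer e y) 0 0 y g0).sum =
    mult b * (dot (fun i => g0 (.diag i)) b.nu * y b) + couple e g0 y b := by
  have z : ∀ b : GB1, b.num ≠ 0 → g0 b = 0 := fun b hb =>
    h b fun h => hb (funext fun j => by rw [← GB1.deg_apply, h]; rfl)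
  have z1 := GB1.eq_zero_of_num z
  have z8 : ∀ i μ, g0 (.frame i μ) = 0 := fun i μ => z _ (by revert i μ; decide)
  have z9 : ∀ i, frameDer e g0 i = 0 := fun i => frameDer_of_zero e (z8 i)
  cases b with
  | scalar m =>
    cases m using Fin.cases with
    | zero =>
      simp [quad, divTerms, QTerm.eval, couple, GB1.nu, GB1.deg, dot_zero, z1, z8, z9]
    | succ i =>
      have e1 : GB1.nu (.scalar i.succ) = deg011 i := rfl
      have e2 := quad_scalar_sp i
      rw [sp] at e2
      simp only [e1, e2, dot_deg011]
      simp [waveTerms, QTerm.eval, couple, mult, sp, z1, z8, z9]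
      simp only [show ∀ i, g0 (.scalar (Fin.succ i)) = 0 from z1.2.2.2.2.2.2]
      ring
  | _ =>
    simp [quad, QTerm.eval, couple, mult, GB1.nu, GB1.deg, dot_zero, dot_deg011, dot_deg211,
      dot_deg2, z1, z8, z9] <;> ring

/-- The part of the evolution equations at order `α` that is determined by lower orders. -/
def source (g : Multi → GB1 → R) (α : Multi) (b : GB1) : R :=
  ((quad (.inr b)).map fun T => lowSum e T g α).sum

theorem source_congr {g g' : Multi → GB1 → R} {α : Multi} (h : ∀ β < α, g β = g' β) (b : GB1) :
    source e g α b = source e g' α b := by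
  simp only [source, lowSum_congr e h]

theorem mcSum_inr_eq {g : Multi → GB1 → R} (hf : IsFiltered g) {α : Multi} (hα : α ≠ 0) (b : GB1) :
    mcSum e C (.inr b) g α = mult b * (e 0 (g α b) + dot (fun i => g 0 (.diag i)) b.nu * g α b) +
      couple e (g 0) (g α) b + source e g α b := by
  have h1 : (quad (.inr b)).map (fun T => termSum e C T g α) = (quad (.inr b)).map fun T =>
      (T.eval (frameDer e (g 0)) 0 0 (g 0) (g α) + T.eval (frameDer e (g α)) 0 0 (g α) (g 0)) +
        lowSum e T g α :=
    List.map_congr_left fun T hT => termSum_eq_add e C (isBilin_of_mem_quad b T hT) g hα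
  rw [mcSum_eq, h1, List.sum_map_add, sum_eval_linear e fun b hb => hf 0 b fun h =>
    hb (le_antisymm h (by simp)), source, Sum.elim_inr]
  ring

/-- Weighted submodules with an additional filtration by the order of differentiation. -/
structure OrderWeighted (e : Fin 4 → Derivation ℝ R R) (p : Fin 3 → R)
    (W : Multi → ℕ → Submodule ℝ R) : Prop where
  mono : ∀ {α m n}, m ≤ n → W α m ≤ W α n
  mul_mem : ∀ {α β n f g}, f ∈ W α n → g ∈ W β n → f * g ∈ W (α + β) n
  der_mem : ∀ {α n f} μ, f ∈ W α n → e μ f ∈ W α (n + 1)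
  solve : ∀ {α κ n f}, κ ≤ α → κ ≠ α → f ∈ W α n → ∃ y ∈ W α n, e 0 y + dot p κ * y = f

variable {e C} {W : Multi → ℕ → Submodule ℝ R}

theorem frameDer_mem (hW : OrderWeighted e p W) {α β : Multi} {m n : ℕ} {y : GB1 → R} {i : Fin 3}
    (hy : ∀ μ, y (.frame i μ) ∈ W α m) {f : R} (hf : f ∈ W β n) (hm : m ≤ n + 1) :
    frameDer e y i f ∈ W (α + β) (n + 1) := by
  rw [frameDer_eq, derOf_apply]
  exact Submodule.sum_mem _ fun μ _ => hW.mul_mem (hW.mono hm (hy μ)) (hW.der_mem μ hf)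

theorem degree_pos_of_ne_zero {α : Multi} (h : α ≠ 0) : 1 ≤ α.degree := by
  rw [Nat.one_le_iff_ne_zero]
  exact fun h0 => h ((Finsupp.degree_eq_zero_iff _).1 h0)

theorem source_mem (hW : OrderWeighted e p W) {g : Multi → GB1 → R} {α : Multi}
    (hg : ∀ β < α, ∀ b, g β b ∈ W β β.degree) (b : GB1) : source e g α b ∈ W α α.degree := by
  refine list_sum_mem fun x hx => ?_
  obtain ⟨T, hT, rfl⟩ := List.mem_map.1 hx
  refine Submodule.sum_mem _ fun q hq => ?_
  rw [Finset.mem_filter] at hq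
  obtain ⟨h1, h2⟩ := lt_of_mem_antidiagonal hq.1 hq.2.1 hq.2.2
  have h3 : q.1 + q.2 = α := mem_antidiagonal.1 hq.1
  have h4 : q.1.degree + q.2.degree = α.degree := by rw [← h3, map_add]
  have h5 := degree_pos_of_ne_zero hq.2.1
  have hT := isBilin_of_mem_quad b T hT
  cases T with
  | mul n b b' =>
    rw [QTerm.eval, mul_assoc]
    have h6 : q.1.degree ≤ α.degree := by omega
    have h7 : q.2.degree ≤ α.degree := by omega
    have := hW.mul_mem (hW.mono h6 (hg _ h1 b)) (hW.mono h7 (hg _ h2 b'))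
    exact int_mul_mem _ _ (by rwa [h3] at this)
  | der n i b =>
    refine int_mul_mem _ _ ?_
    have h6 : q.1.degree ≤ α.degree := by omega
    have h7 : q.2.degree ≤ α.degree - 1 := by omega
    have h8 : α.degree - 1 + 1 = α.degree := by omega
    have := frameDer_mem hW (fun μ => hW.mono h6 (hg _ h1 (.frame i μ)))
      (hW.mono h7 (hg _ h2 b)) h8.ge
    rwa [h3, h8] at this
  | lin n b => exact hT.elim
  | struct i μ => exact hT.elim

theorem GB1.nu_le (b : GB1) : b.nu ≤ b.deg := by
  cases b <;> first | exact le_rfl | exact zero_le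

theorem couple_mem (hW : OrderWeighted e p W) {g0 y : GB1 → R} {α : Multi} (hα : α ≠ 0)
    (h0 : ∀ b, g0 b ∈ W 0 0) (hy : ∀ i μ, y (.frame i μ) ∈ W α α.degree) (b : GB1) :
    couple e g0 y b ∈ W α α.degree := by
  have h1 := degree_pos_of_ne_zero hα
  have key : ∀ i f, f ∈ W 0 0 → frameDer e y i f ∈ W α α.degree := fun i f hf => by
    have := frameDer_mem hW (hy i) (hW.mono (n := α.degree - 1) (Nat.zero_le _) hf) (by omega)
    rwa [add_zero, show α.degree - 1 + 1 = α.degree by omega] at this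
  cases b with
  | conf i => exact neg_mem (key _ _ (add_mem (add_mem (h0 _) (h0 _)) (h0 _)))
  | rotJ i => exact neg_mem (key _ _ (h0 _))
  | rotK i => exact key _ _ (h0 _)
  | scalar m =>
    cases m using Fin.cases with
    | zero => exact zero_mem _
    | succ i => exact neg_mem (key _ _ (h0 _))
  | _ => exact zero_mem _

theorem couple_congr {g0 y y' : GB1 → R} (h : ∀ i μ, y (.frame i μ) = y' (.frame i μ)) (b : GB1) :
    couple e g0 y b = couple e g0 y' b := by
  have : frameDer e y = frameDer e y' := funext fun i => by simp [frameDer, h]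
  cases b <;> simp [couple, this]

theorem mult_ne_zero (b : GB1) : (mult b : ℝ) ≠ 0 := by cases b <;> norm_num [mult]

theorem solve_mult (hW : OrderWeighted e p W) {α : Multi} {n : ℕ} {b : GB1} {f : R}
    (h1 : b.deg ≤ α) (h2 : b.deg ≠ α) (hf : f ∈ W α n) :
    ∃ y ∈ W α n, mult b * (e 0 y + dot p b.nu * y) + f = 0 := by
  obtain ⟨y, hy, h⟩ := hW.solve (b.nu_le.trans h1)
    (fun h => h2 (le_antisymm h1 (h ▸ b.nu_le))) (Submodule.smul_mem _ (-(mult b : ℝ)⁻¹) hf)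
  refine ⟨y, hy, ?_⟩
  rw [h, ← map_intCast (algebraMap ℝ R), ← Algebra.smul_def, smul_smul, mul_neg,
    mul_inv_cancel₀ (mult_ne_zero b), neg_smul, one_smul, neg_add_cancel]

/-- The evolution equations have a solution with given leading coefficients. -/
theorem exists_evolution (hW : OrderWeighted e p W) {l : GB1 → R} (hl : ∀ b, l b ∈ W b.deg b.deg.degree)
    (hp : ∀ i, l (.diag i) = p i) : ∃ g : Multi → GB1 → R, IsFiltered g ∧ (∀ b, g b.deg b = l b) ∧
      (∀ α b, g α b ∈ W α α.degree) ∧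
      ∀ (C : Fin 4 → Fin 4 → Fin 4 → R) α b, α ≠ b.deg → mcSum e C (.inr b) g α = 0 := by
  classical
  let g0 : GB1 → R := fun b => if b.deg = 0 then l b else 0
  have hg0 : ∀ b, g0 b ∈ W 0 0 := fun b => by
    by_cases h : b.deg = 0
    · have := hl b; rw [h, map_zero] at this; simpa [g0, h] using this
    · simp [g0, h]
  have hdot : (fun i => g0 (.diag i)) = p := funext fun i => by simp [g0, GB1.deg, hp]
  let P : Multi → (Multi → GB1 → R) → (GB1 → R) → Prop := fun α g y =>
    (∀ b, y b ∈ W α α.degree) ∧ (∀ b, ¬ b.deg ≤ α → y b = 0) ∧ (∀ b, b.deg = α → y b = l b) ∧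
    ∀ b, b.deg ≤ α → b.deg ≠ α →
      mult b * (e 0 (y b) + dot p b.nu * y b) + couple e g0 y b + source e g α b = 0
  obtain ⟨g, hg⟩ := exists_of_local P (fun α g g' y h hy => by
      refine ⟨hy.1, hy.2.1, hy.2.2.1, fun b h1 h2 => ?_⟩
      rw [← source_congr e h b]
      exact hy.2.2.2 b h1 h2) fun α g ih => by
    have hs := fun b => source_mem hW (fun β hβ b => (ih β hβ).1 b) b (α := α)
    have ex : ∀ y : GB1 → R, (∀ i μ, y (.frame i μ) ∈ W α α.degree) → ∀ b, ∃ x ∈ W α α.degree,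
        (¬ b.deg ≤ α → x = 0) ∧ (b.deg = α → x = l b) ∧ (b.deg ≤ α → b.deg ≠ α →
          mult b * (e 0 x + dot p b.nu * x) + (couple e g0 y b + source e g α b) = 0) := by
      intro y hy b
      by_cases h1 : b.deg ≤ α
      · by_cases h2 : b.deg = α
        · exact ⟨l b, h2 ▸ hl b, fun h => absurd h1 h, fun _ => rfl, fun _ h => absurd h2 h⟩
        · have hα : α ≠ 0 := fun h => h2 (le_antisymm h1 (h ▸ zero_le))
          obtain ⟨x, hx, h3⟩ := solve_mult hW h1 h2 (add_mem (couple_mem hW hα hg0 hy b) (hs b))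
          exact ⟨x, hx, fun h => absurd h1 h, fun h => absurd h h2, fun _ _ => h3⟩
      · exact ⟨0, zero_mem _, fun _ => rfl, fun h => absurd h.le h1, fun h => absurd h h1⟩
    choose y1 hy1 hy1z hy1l hy1e using ex 0 fun i μ => zero_mem _
    choose y2 hy2 hy2z hy2l hy2e using ex y1 fun i μ => hy1 _
    let y : GB1 → R := fun b => match b with
      | .frame i μ => y1 (.frame i μ)
      | b => y2 b
    refine ⟨y, fun b => ?_, fun b => ?_, fun b => ?_, fun b => ?_⟩
    · cases b <;> first | exact hy1 _ | exact hy2 _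
    · cases b <;> first | exact hy1z _ | exact hy2z _
    · cases b <;> first | exact hy1l _ | exact hy2l _
    · intro h1 h2
      rw [add_assoc, couple_congr (y := y) (y' := y1) (fun i μ => rfl)]
      cases b <;> first | exact hy2e _ h1 h2 | exact hy1e _ h1 h2
  have h0 : g 0 = g0 := funext fun b => by
    by_cases h : b.deg = 0
    · rw [(hg 0).2.2.1 b h]; simp [g0, h]
    · rw [(hg 0).2.1 b fun h' => h (le_antisymm h' zero_le)]; simp [g0, h]
  have hf : IsFiltered g := fun α => (hg α).2.1
  refine ⟨g, hf, fun b => (hg b.deg).2.2.1 b rfl, fun α => (hg α).1, fun C α b h => ?_⟩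
  by_cases h1 : b.deg ≤ α
  · have hα : α ≠ 0 := fun h' => h (h' ▸ le_antisymm zero_le (h' ▸ h1))
    rw [mcSum_inr_eq e C hf hα, h0, hdot]
    exact (hg α).2.2.2 b h1 (Ne.symm h)
  · exact mcSum_eq_zero hf h1

theorem eq_of_evolution_step {W : Multi → Submodule ℝ R} (hW : Weighted e p W)
    {g g' : Multi → GB1 → R} (hf : IsFiltered g) (hf' : IsFiltered g') {α : Multi} (hα : α ≠ 0)
    (hg : ∀ b, g α b ∈ W α) (hg' : ∀ b, g' α b ∈ W α) (ih : ∀ β < α, g β = g' β)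
    (hl : ∀ b, b.deg = α → g α b = g' α b) (hp : ∀ i, g 0 (.diag i) = p i)
    (h : ∀ b, mcSum e C (.inr b) g α = 0) (h' : ∀ b, mcSum e C (.inr b) g' α = 0) : g α = g' α := by
  have h00 : g 0 = g' 0 := ih 0 (pos_iff_ne_zero.2 hα)
  have hdot : (fun i => g 0 (.diag i)) = p := funext hp
  have key : ∀ b, couple e (g 0) (g α) b = couple e (g 0) (g' α) b → g α b = g' α b := by
    intro b hb
    by_cases h1 : b.deg ≤ α
    · by_cases h2 : b.deg = α
      · exact hl b h2
      · have e1 := h b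
        have e2 := h' b
        rw [mcSum_inr_eq e C hf hα, hdot, hb] at e1
        rw [mcSum_inr_eq e C hf' hα, ← h00, hdot] at e2
        rw [← source_congr e ih b] at e2
        refine sub_eq_zero.1 (hW.unique (b.nu_le.trans h1)
          (fun h => h2 (le_antisymm h1 (h ▸ b.nu_le))) (sub_mem (hg b) (hg' b)) ?_)
        have e3 : (mult b : R) * (e 0 (g α b - g' α b) + dot p b.nu * (g α b - g' α b)) = 0 := by
          rw [map_sub]; linear_combination e1 - e2
        rw [← map_intCast (algebraMap ℝ R), ← Algebra.smul_def] at e3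
        exact (smul_eq_zero_iff_right (mult_ne_zero b)).1 e3
    · rw [hf _ _ h1, hf' _ _ h1]
  have hfr : ∀ i μ, g α (.frame i μ) = g' α (.frame i μ) := fun i μ => key _ rfl
  exact funext fun b => key b (couple_congr hfr b)

theorem eq_of_evolution {W : Multi → Submodule ℝ R} (hW : Weighted e p W) {g g' : Multi → GB1 → R}
    (hf : IsFiltered g) (hf' : IsFiltered g') (hg : ∀ α b, g α b ∈ W α) (hg' : ∀ α b, g' α b ∈ W α)
    (hl : ∀ b, g b.deg b = g' b.deg b) (hp : ∀ i, g 0 (.diag i) = p i)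
    (h : ∀ α b, mcSum e C (.inr b) g α = 0) (h' : ∀ α b, mcSum e C (.inr b) g' α = 0) : g = g' := by
  funext α
  induction α using WellFoundedLT.induction with
  | ind α ih =>
  by_cases hα : α = 0
  · funext b
    by_cases hb : b.deg = 0
    · rw [hα, ← hb, hl]
    · have : ¬ b.deg ≤ α := fun h => hb (le_antisymm (hα ▸ h) zero_le)
      rw [hf _ _ this, hf' _ _ this]
  exact eq_of_evolution_step hW hf hf' hα (hg α) (hg' α) ih (fun b h => h ▸ hl b) hp (h α) (h' α)

end Linearization

section MixedPartials

variable {E F : Type*} [NormedAddCommGroup E] [NormedSpace ℝ E] [NormedAddCommGroup F] [NormedSpace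
  ℝ F] {A : Set E} {B : Set F} {u : E} {v : F}

theorem fderivWithin_left {f : E × F → ℝ} (hf : DifferentiableWithinAt ℝ f (A ×ˢ B) (u, v))
    (hA : UniqueDiffWithinAt ℝ A u) (hv : v ∈ B) (a : E) :
    fderivWithin ℝ (fun x => f (x, v)) A u a = fderivWithin ℝ f (A ×ˢ B) (u, v) (a, 0) := by
  have h1 : HasFDerivWithinAt (fun x : E => (x, v)) (ContinuousLinearMap.inl ℝ E F) A u :=
    (hasFDerivAt_prodMk_left u v).hasFDerivWithinAt
  have hm : Set.MapsTo (fun x : E => (x, v)) A (A ×ˢ B) := fun x hx => ⟨hx, hv⟩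
  have h2 := hf.hasFDerivWithinAt.comp u h1 hm
  have h3 := h2.fderivWithin hA
  exact (congrArg (fun L => L a) h3).trans rfl

theorem fderivWithin_right {f : E × F → ℝ} (hf : DifferentiableWithinAt ℝ f (A ×ˢ B) (u, v))
    (hB : UniqueDiffWithinAt ℝ B v) (hu : u ∈ A) (b : F) :
    fderivWithin ℝ (fun y => f (u, y)) B v b = fderivWithin ℝ f (A ×ˢ B) (u, v) (0, b) := by
  have h1 : HasFDerivWithinAt (fun y : F => (u, y)) (ContinuousLinearMap.inr ℝ E F) B v :=
    (hasFDerivAt_prodMk_right u v).hasFDerivWithinAt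
  have hm : Set.MapsTo (fun y : F => (u, y)) B (A ×ˢ B) := fun x hx => ⟨hu, hx⟩
  have h2 := hf.hasFDerivWithinAt.comp v h1 hm
  have h3 := h2.fderivWithin hB
  exact (congrArg (fun L => L b) h3).trans rfl

/-- Mixed partial derivatives commute, also at the boundary. -/
theorem mixed_partials {f : E × F → ℝ} (hf : ContDiffOn ℝ ∞ f (A ×ˢ B)) (hA : UniqueDiffOn ℝ A)
    (hB : UniqueDiffOn ℝ B) (hu : u ∈ A) (hv : v ∈ B)
    (hc : (u, v) ∈ closure (interior (A ×ˢ B))) (a : E) (b : F) :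
    fderivWithin ℝ (fun x => fderivWithin ℝ (fun y => f (x, y)) B v b) A u a =
      fderivWithin ℝ (fun y => fderivWithin ℝ (fun x => f (x, y)) A u a) B v b := by
  have hS := hA.prod hB
  have hd := hf.differentiableOn (by simp)
  have hd1 : DifferentiableOn ℝ (fderivWithin ℝ f (A ×ˢ B)) (A ×ˢ B) :=
    (hf.fderivWithin hS (m := ∞) (by simp)).differentiableOn (by simp)
  have hm : (u, v) ∈ A ×ˢ B := ⟨hu, hv⟩
  have key : ∀ w, DifferentiableOn ℝ (fun z => fderivWithin ℝ f (A ×ˢ B) z w) (A ×ˢ B) :=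
    fun w => hd1.clm_apply (differentiableOn_const w)
  have key2 : ∀ w w', fderivWithin ℝ (fun z => fderivWithin ℝ f (A ×ˢ B) z w) (A ×ˢ B) (u, v) w' =
      fderivWithin ℝ (fderivWithin ℝ f (A ×ˢ B)) (A ×ˢ B) (u, v) w' w := fun w w' => by
    rw [fderivWithin_clm_apply (hS _ hm) (hd1 _ hm) (differentiableWithinAt_const w)]
    simp
  have h1 : ∀ x ∈ A, fderivWithin ℝ (fun y => f (x, y)) B v b =
      fderivWithin ℝ f (A ×ˢ B) (x, v) (0, b) := fun x hx =>
    fderivWithin_right (hd _ ⟨hx, hv⟩) (hB v hv) hx b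
  have h2 : ∀ y ∈ B, fderivWithin ℝ (fun x => f (x, y)) A u a =
      fderivWithin ℝ f (A ×ˢ B) (u, y) (a, 0) := fun y hy =>
    fderivWithin_left (hd _ ⟨hu, hy⟩) (hA u hu) hy a
  rw [fderivWithin_congr h1 (h1 u hu), fderivWithin_congr h2 (h2 v hv),
    fderivWithin_left (key _ _ hm) (hA u hu) hv, fderivWithin_right (key _ _ hm) (hB v hv) hu,
    key2, key2]
  exact (hf _ hm).isSymmSndFDerivWithinAt
    (by rw [minSmoothness_of_isRCLikeNormedField]; exact WithTop.coe_le_coe.2 (le_top (a := (2 : ℕ∞)))) hS hc hm _ _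

end MixedPartials

section Chain

variable {E : Type*} [NormedAddCommGroup E] [NormedSpace ℝ E] {H : Type*} [TopologicalSpace H] {I :
  ModelWithCorners ℝ E H} {N : Type*} [TopologicalSpace N] [ChartedSpace H N] [IsManifold I ∞ N]

theorem fieldDeriv_comp (V : (x : N) → TangentSpace I x)
    (hV : ContMDiff I I.tangent ∞ (fun x => (⟨x, V x⟩ : TangentBundle I N)))
    (h F : C^∞⟮I, N; ℝ⟯) {φ φ' : ℝ → ℝ} (hφ : ∀ t, HasDerivAt φ (φ' t) t) (hF : ∀ x, F x = φ (h x))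
    (x : N) : fieldDeriv V hV F x = φ' (h x) * fieldDeriv V hV h x := by
  have h1 : HasMFDerivAt 𝓘(ℝ, ℝ) 𝓘(ℝ, ℝ) φ (h x) (ContinuousLinearMap.toSpanSingleton ℝ (φ' (h x))) :=
    (hφ (h x)).hasFDerivAt.hasMFDerivAt
  have h2 := (h1.comp x h.mdifferentiableAt.hasMFDerivAt).mfderiv
  have h3 : φ ∘ h = F := funext fun x => (hF x).symm
  rw [h3] at h2
  refine (congrArg (fun L' : E →L[ℝ] ℝ => L' (V x)) h2).trans ?_
  refine Eq.trans ?_ (mul_comm _ _)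
  rfl

end Chain

section Slices

/-- The restriction of a function to a slice of constant `τ`. -/
def slice (f : SmoothOmega M) (t : EuclideanHalfSpace 1) : SmoothM M :=
  ⟨fun y => f (t, y), f.contMDiff.comp (contMDiff_const.prodMk contMDiff_id)⟩

/-- The restriction of a function to a line `[0,∞) × {y}`. -/
def fiber (f : SmoothOmega M) (y : M) : C^∞⟮𝓡∂ 1, EuclideanHalfSpace 1; ℝ⟯ :=
  ⟨fun t => f (t, y), f.contMDiff.comp (contMDiff_id.prodMk contMDiff_const)⟩

theorem mvfderiv_slice (f : SmoothOmega M) (z : Omega M) (v : EuclideanSpace ℝ (Fin 3)) :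
    mvfderiv ((𝓡∂ 1).prod (𝓡 3)) f z ((0, v) : EuclideanSpace ℝ (Fin 1) × EuclideanSpace ℝ (Fin 3))
      = mvfderiv (𝓡 3) (slice f z.1) z.2 v := by
  have h := mfderiv_prod_eq_add_apply (f := f) (p := z)
    (v := ((0, v) : EuclideanSpace ℝ (Fin 1) × EuclideanSpace ℝ (Fin 3))) f.mdifferentiableAt
  refine Eq.trans h ?_
  refine Eq.trans (congrArg (· + _) (ContinuousLinearMap.map_zero _)) ?_
  exact zero_add _

theorem mvfderiv_fiber (f : SmoothOmega M) (z : Omega M) (v : EuclideanSpace ℝ (Fin 1)) :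
    mvfderiv ((𝓡∂ 1).prod (𝓡 3)) f z ((v, 0) : EuclideanSpace ℝ (Fin 1) × EuclideanSpace ℝ (Fin 3))
      = mvfderiv (𝓡∂ 1) (fiber f z.2) z.1 v := by
  have h := mfderiv_prod_eq_add_apply (f := f) (p := z)
    (v := ((v, 0) : EuclideanSpace ℝ (Fin 1) × EuclideanSpace ℝ (Fin 3))) f.mdifferentiableAt
  refine Eq.trans h ?_
  refine Eq.trans (congrArg (_ + ·) (ContinuousLinearMap.map_zero _)) ?_
  exact add_zero _

theorem derOmega_apply (L : SmoothFrame M) (a : Fin 3) (f : SmoothOmega M) (z : Omega M) :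
    L.derOmega a f z = L.derM a (slice f z.1) z.2 := mvfderiv_slice f z _

theorem partial0_apply (f : SmoothOmega M) (z : Omega M) : partial0 f z =
    mvfderiv (𝓡∂ 1) (fiber f z.2) z.1 (EuclideanSpace.single 0 1) := mvfderiv_fiber f z _

theorem derM_eq_fderivWithin (L : SmoothFrame M) (a : Fin 3) (f : SmoothM M) (y : M) :
    L.derM a f y = fderivWithin ℝ (f ∘ (extChartAt (𝓡 3) y).symm) (extChartAt (𝓡 3) y).target
      (extChartAt (𝓡 3) y y) (L.field a y) := by
  have h : mfderiv (𝓡 3) 𝓘(ℝ, ℝ) f y = _ := f.mdifferentiableAt.mfderiv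
  refine (congrArg (fun L' : EuclideanSpace ℝ (Fin 3) →L[ℝ] ℝ => L' (L.field a y)) h).trans ?_
  rw [fderivWithin_of_isOpen (isOpen_extChartAt_target y) (mem_extChartAt_target y)]
  simp [writtenInExtChartAt, fderivWithin_univ]
  rfl

theorem mvfderiv_half (f : C^∞⟮𝓡∂ 1, EuclideanHalfSpace 1; ℝ⟯) (t : EuclideanHalfSpace 1)
    (v : EuclideanSpace ℝ (Fin 1)) : mvfderiv (𝓡∂ 1) f t v =
      fderivWithin ℝ (f ∘ (𝓡∂ 1).symm) (Set.range (𝓡∂ 1)) t.1 v := by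
  have h : mfderiv (𝓡∂ 1) 𝓘(ℝ, ℝ) f t = _ := f.mdifferentiableAt.mfderiv
  refine (congrArg (fun L' : EuclideanSpace ℝ (Fin 1) →L[ℝ] ℝ => L' v) h).trans ?_
  rfl

theorem contDiffOn_chart (f : SmoothOmega M) (y : M) : ContDiffOn ℝ ∞
    (fun w : EuclideanSpace ℝ (Fin 1) × EuclideanSpace ℝ (Fin 3) =>
      f ((𝓡∂ 1).symm w.1, (extChartAt (𝓡 3) y).symm w.2))
    (Set.range (𝓡∂ 1) ×ˢ (extChartAt (𝓡 3) y).target) := by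
  have h := contMDiffOn_extChartAt_symm (I := (𝓡∂ 1).prod (𝓡 3)) (n := ∞)
    (((𝓡∂ 1).symm 0, y) : Omega M)
  have h2 := (f.contMDiff.comp_contMDiffOn h).contDiffOn
  rw [extChartAt_prod] at h2
  refine ContDiffOn.congr_mono h2 (fun w hw => rfl) ?_
  refine Set.prod_mono ?_ subset_rfl
  intro u hu
  rw [extChartAt_target, chartAt_self_eq]
  simpa using hu

theorem lie_partial0_derOmega (L : SmoothFrame M) (a : Fin 3) :
    ⁅(partial0 : Derivation ℝ (SmoothOmega M) (SmoothOmega M)), L.derOmega a⁆ = 0 := by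
  refine Derivation.ext fun f => ?_
  rw [commutator_apply, Derivation.zero_apply, sub_eq_zero]
  ext z
  obtain ⟨t, y⟩ := z
  have hB := isOpen_extChartAt_target (I := 𝓡 3) y
  have hy := mem_extChartAt_target (I := 𝓡 3) y
  have ht : t.1 ∈ Set.range (𝓡∂ 1) := ⟨t, rfl⟩
  have hs : ∀ t : EuclideanHalfSpace 1, (𝓡∂ 1).symm t.1 = t := (𝓡∂ 1).left_inv
  have h := mixed_partials (contDiffOn_chart f y) (𝓡∂ 1).uniqueDiffOn hB.uniqueDiffOn ht hy
    (by
      rw [interior_prod_eq, hB.interior_eq, closure_prod_eq]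
      exact ⟨(𝓡∂ 1).range_subset_closure_interior ht, subset_closure hy⟩)
    (EuclideanSpace.single 0 1) (L.field a y)
  rw [partial0_apply, mvfderiv_half, derOmega_apply, derM_eq_fderivWithin]
  refine Eq.trans ?_ (h.trans ?_)
  · congr 2
    funext u
    change L.derOmega a f ((𝓡∂ 1).symm u, y) = _
    rw [derOmega_apply, derM_eq_fderivWithin]
    rfl
  · congr 2
    funext v
    change _ = partial0 f (t, _)
    rw [partial0_apply, mvfderiv_half]
    rfl


theorem eq_pull_of_partial0_eq_zero {f : SmoothOmega M} (h : partial0 f = 0) : ∃ g, f = pull g := by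
  let t0 : EuclideanHalfSpace 1 := ⟨0, le_rfl⟩
  refine ⟨slice f t0, ?_⟩
  ext z
  obtain ⟨t, y⟩ := z
  have hs : ∀ t : EuclideanHalfSpace 1, (𝓡∂ 1).symm t.1 = t := (𝓡∂ 1).left_inv
  have hd : DifferentiableOn ℝ (fiber f y ∘ (𝓡∂ 1).symm) (Set.range (𝓡∂ 1)) := by
    have h1 : ContMDiffOn 𝓘(ℝ, EuclideanSpace ℝ (Fin 1)) 𝓘(ℝ, ℝ) ∞
      (fiber f y ∘ (𝓡∂ 1).symm) (Set.range (𝓡∂ 1)) :=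
      (fiber f y).contMDiff.comp_contMDiffOn (𝓡∂ 1).contMDiffOn_symm
    exact h1.contDiffOn.differentiableOn (by simp)
  have h0 : ∀ u ∈ Set.range (𝓡∂ 1),
      fderivWithin ℝ (fiber f y ∘ (𝓡∂ 1).symm) (Set.range (𝓡∂ 1)) u = 0 := by
    rintro _ ⟨t, rfl⟩
    ext v
    have h1 : partial0 f (t, y) = 0 := by rw [h]; rfl
    rw [partial0_apply, mvfderiv_half] at h1
    have h2 : v = v 0 • EuclideanSpace.single 0 1 := by
      ext i; fin_cases i; simp
    rw [h2, map_smul]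
    exact (congrArg (v 0 • ·) h1).trans (smul_zero _)
  have hc : Convex ℝ (Set.range (𝓡∂ 1)) := (𝓡∂ 1).convex_range
  have := hc.is_const_of_fderivWithin_eq_zero hd h0 (x := t.1) (y := t0.1) ⟨t, rfl⟩ ⟨t0, rfl⟩
  simp only [Function.comp, hs] at this
  exact this

theorem partial0_tauMap : partial0 (tauMap (M := M)) = 1 := by
  ext z
  rw [partial0_apply, mvfderiv_half]
  have h : ∀ u ∈ Set.range (𝓡∂ 1), (fiber (tauMap (M := M)) z.2 ∘ (𝓡∂ 1).symm) u =
      EuclideanSpace.proj (𝕜 := ℝ) (0 : Fin 1) u := fun u hu => by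
    change (𝓡∂ 1) ((𝓡∂ 1).symm u) 0 = u 0
    rw [(𝓡∂ 1).right_inv hu]
  have hz : z.1.1 ∈ Set.range (𝓡∂ 1) := ⟨z.1, rfl⟩
  rw [fderivWithin_congr h (h _ hz), ContinuousLinearMap.fderivWithin _ ((𝓡∂ 1).uniqueDiffOn _ hz)]
  simp

theorem partial0_pull (f : SmoothM M) : partial0 (pull f) = 0 := by
  ext z
  rw [partial0_apply]
  change mvfderiv (𝓡∂ 1) (fun _ => f z.2) z.1 _ = 0
  rw [mvfderiv_const]; rfl

theorem derOmega_pull (L : SmoothFrame M) (a : Fin 3) (f : SmoothM M) :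
    L.derOmega a (pull f) = pull (L.derM a f) := by
  ext z; exact derOmega_apply L a _ z

theorem derOmega_tauMap (L : SmoothFrame M) (a : Fin 3) : L.derOmega a tauMap = 0 := by
  ext z
  rw [derOmega_apply]
  have : slice (tauMap (M := M)) z.1 = algebraMap ℝ _ (tau z) := by ext y; rfl
  rw [this, Derivation.map_algebraMap]; rfl

end Slices

section Base

/-- The data from which weighted submodules are constructed: functions of the form
`w_α b τᵏ` with `b` independent of `τ`. -/
structure Base (e : Fin 4 → Derivation ℝ R R) (p : Fin 3 → R) (w : Multi → R) (t : R)
    (B : ℕ → Subalgebra ℝ R) : Prop where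
  w_add : ∀ α β, w (α + β) = w α * w β
  der_zero_t : e 0 t = 1
  der_t : ∀ i, e (sp i) t = 0
  der_zero_w : ∀ α, e 0 (w α) = -(dot p α * w α)
  der_w : ∀ i α, e (sp i) (w α) = -(t * dot (fun j => e (sp i) (p j)) α * w α)
  mono : ∀ {m n}, m ≤ n → B m ≤ B n
  der_zero : ∀ {n b}, b ∈ B n → e 0 b = 0
  der : ∀ {n b} i, b ∈ B n → e (sp i) b ∈ B (n + 1)
  p_mem : ∀ i, p i ∈ B 0
  inv : ∀ {κ α}, κ ≤ α → κ ≠ α → ∃ u ∈ B 0, u * (dot p α - dot p κ) = 1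

/-- The submodule that is spanned by the functions `w_α b τᵏ`. -/
def wspan (w : Multi → R) (t : R) (B : ℕ → Subalgebra ℝ R) (α : Multi) (n : ℕ) : Submodule ℝ R :=
  Submodule.span ℝ {x | ∃ b ∈ B n, ∃ k : ℕ, x = w α * (b * t ^ k)}

variable {w : Multi → R} {t : R} {B : ℕ → Subalgebra ℝ R}

theorem mem_wspan {α : Multi} {n : ℕ} {b : R} (hb : b ∈ B n) (k : ℕ) :
    w α * (b * t ^ k) ∈ wspan w t B α n := subset_span ⟨b, hb, k, rfl⟩

theorem dot_mem {S : Subalgebra ℝ R} {p : Fin 3 → R} (h : ∀ i, p i ∈ S) (α : Multi) :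
    dot p α ∈ S :=
  S.sum_mem fun i _ => S.mul_mem (natCast_mem S _) (h i)

theorem wspan_le {α : Multi} {n : ℕ} {S : Submodule ℝ R}
    (h : ∀ b ∈ B n, ∀ k : ℕ, w α * (b * t ^ k) ∈ S) : wspan w t B α n ≤ S := by
  refine Submodule.span_le.2 ?_
  rintro _ ⟨b, hb, k, rfl⟩
  exact h b hb k

theorem Base.orderWeighted (h : Base e p w t B) : OrderWeighted e p (wspan w t B) where
  mono hmn := wspan_le fun b hb k => mem_wspan (h.mono hmn hb) k
  mul_mem {α β n f g} hf hg := by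
    have h1 : ∀ b ∈ B n, ∀ k : ℕ, ∀ g ∈ wspan w t B β n,
        w α * (b * t ^ k) * g ∈ wspan w t B (α + β) n := fun b hb k g hg => by
      have : wspan w t B β n ≤ (wspan w t B (α + β) n).comap
          (LinearMap.mulLeft ℝ (w α * (b * t ^ k))) := wspan_le fun b' hb' k' => by
        rw [Submodule.mem_comap, LinearMap.mulLeft_apply,
          show w α * (b * t ^ k) * (w β * (b' * t ^ k')) = w (α + β) * (b * b' * t ^ (k + k')) by
            rw [h.w_add, pow_add]; ring]
        exact mem_wspan ((B n).mul_mem hb hb') _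
      exact this hg
    have : wspan w t B α n ≤ (wspan w t B (α + β) n).comap (LinearMap.mulRight ℝ g) :=
      wspan_le fun b hb k => h1 b hb k g hg
    exact this hf
  der_mem {α n f} μ hf := by
    have : wspan w t B α n ≤ (wspan w t B α (n + 1)).comap (e μ : R →ₗ[ℝ] R) :=
      wspan_le fun b hb k => by
        have hb' := h.mono (Nat.le_succ n) hb
        have ht : w α * (b * (k * t ^ (k - 1))) ∈ wspan w t B α (n + 1) := by
          rw [← mul_assoc b, mul_comm b]
          exact mem_wspan ((B _).mul_mem (natCast_mem _ _) hb') _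
        rw [Submodule.mem_comap]
        change e μ (w α * (b * t ^ k)) ∈ _
        cases μ using Fin.cases with
        | zero =>
          rw [leibniz, leibniz, leibniz_pow, h.der_zero hb, h.der_zero_t, h.der_zero_w]
          have e1 : w α • (b • k • t ^ (k - 1) • (1 : R) + t ^ k • (0 : R)) +
              (b * t ^ k) • -(dot p α * w α) = w α * (b * (k * t ^ (k - 1))) +
              w α * (-(dot p α * b) * t ^ k) := by
            simp only [smul_eq_mul, nsmul_eq_mul]; ring
          rw [e1]
          exact add_mem ht (mem_wspan (neg_mem ((B _).mul_mem
            (dot_mem (fun i => h.mono (Nat.zero_le _) (h.p_mem i)) α) hb')) _)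
        | succ i =>
          have hi : e i.succ = e (sp i) := rfl
          rw [hi, leibniz, leibniz, leibniz_pow, h.der_t, h.der_w]
          have e1 : w α • (b • k • t ^ (k - 1) • (0 : R) + t ^ k • e (sp i) b) +
              (b * t ^ k) • -(t * dot (fun j => e (sp i) (p j)) α * w α) =
              w α * (e (sp i) b * t ^ k) +
              w α * (-(dot (fun j => e (sp i) (p j)) α * b) * t ^ (k + 1)) := by
            simp only [smul_eq_mul, nsmul_eq_mul, pow_succ]; ring
          rw [e1]
          exact add_mem (mem_wspan (h.der i hb) _) (mem_wspan (neg_mem ((B _).mul_mem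
            (dot_mem (fun j => h.mono (by omega) (h.der i (h.p_mem j))) α) hb')) _)
    exact this hf
  solve {α κ n f} h1 h2 hf := by
    obtain ⟨u, hu, hu1⟩ := h.inv h1 h2
    let A : R →ₗ[ℝ] R := (e 0 : R →ₗ[ℝ] R) + LinearMap.mulLeft ℝ (dot p κ)
    have key : ∀ k : ℕ, ∀ b ∈ B n, w α * (b * t ^ k) ∈ (wspan w t B α n).map A := by
      intro k
      induction k with
      | zero =>
        intro b hb
        refine ⟨w α * (-(u * b) * t ^ 0), mem_wspan (neg_mem ((B n).mul_mem
          (h.mono (Nat.zero_le _) hu) hb)) 0, ?_⟩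
        change e 0 _ + dot p κ * _ = _
        rw [pow_zero, mul_one, mul_one, leibniz, map_neg, leibniz,
          h.der_zero hb, h.der_zero hu, h.der_zero_w]
        simp only [smul_eq_mul]
        linear_combination w α * b * hu1
      | succ k ih =>
        intro b hb
        have hub : u * b ∈ B n := (B n).mul_mem (h.mono (Nat.zero_le _) hu) hb
        obtain ⟨y, hy, hy2⟩ := ih ((k + 1 : ℕ) * (u * b)) ((B n).mul_mem (natCast_mem _ _) hub)
        refine ⟨w α * (-(u * b) * t ^ (k + 1)) + y, add_mem (mem_wspan (neg_mem hub) _) hy, ?_⟩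
        rw [map_add, hy2]
        change e 0 _ + dot p κ * _ + _ = _
        rw [leibniz, leibniz, leibniz_pow, map_neg,
          leibniz, h.der_zero hb, h.der_zero hu, h.der_zero_w, h.der_zero_t]
        simp only [smul_eq_mul, nsmul_eq_mul, Nat.add_sub_cancel]
        push_cast
        linear_combination w α * b * t ^ (k + 1) * hu1
    have : wspan w t B α n ≤ (wspan w t B α n).map A := wspan_le fun b hb k => key k b hb
    obtain ⟨y, hy, hy2⟩ := this hf
    exact ⟨y, hy, hy2⟩

end Base

section Pull

/-- `pull` as a homomorphism of algebras. -/
def pullHom : SmoothM M →ₐ[ℝ] SmoothOmega M where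
  toFun := pull
  map_one' := rfl
  map_mul' _ _ := rfl
  map_zero' := rfl
  map_add' _ _ := rfl
  commutes' _ := rfl

theorem pullHom_apply (f : SmoothM M) : pullHom f = pull f := rfl

theorem pull_injective : Function.Injective (pull (M := M)) := fun f g h => by
  ext y
  exact congrArg (fun F : SmoothOmega M => F (⟨0, le_rfl⟩, y)) h

theorem exists_inv {g : SmoothM M} (h : ∀ y, g y ≠ 0) : ∃ u : SmoothM M, u * g = 1 :=
  ⟨⟨fun y => (g y)⁻¹, g.contMDiff.inv₀ h⟩, by ext y; exact inv_mul_cancel₀ (h y)⟩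

theorem eval_sum_pull {ι : Type*} (s : Finset ι) (f : ι → SmoothM M) (y : M) :
    (∑ i ∈ s, f i) y = ∑ i ∈ s, f i y :=
  map_sum (⟨⟨⟨fun f : SmoothM M => f y, rfl⟩, fun _ _ => rfl⟩, rfl, fun _ _ => rfl⟩ :
    SmoothM M →+* ℝ) f s

theorem eval_sum_omega {ι : Type*} (s : Finset ι) (f : ι → SmoothOmega M) (z : Omega M) :
    (∑ i ∈ s, f i) z = ∑ i ∈ s, f i z :=
  map_sum (⟨⟨⟨fun f : SmoothOmega M => f z, rfl⟩, fun _ _ => rfl⟩, rfl, fun _ _ => rfl⟩ :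
    SmoothOmega M →+* ℝ) f s

theorem weight_apply (p : Fin 3 → SmoothM M) (α : Multi) (z : Omega M) :
    weight p α z = Real.exp (-((∑ i, (α i : ℝ) * p i z.2) * tau z)) := by
  change Real.exp (-((∑ i, α i • p i : SmoothM M) z.2 * tau z)) = _
  rw [eval_sum_pull]
  congr 3
  refine sum_congr rfl fun i _ => ?_
  rw [← nsmul_eq_mul]; rfl

theorem weight_zero (p : Fin 3 → SmoothM M) : weight p 0 = 1 := by
  ext z
  rw [weight_apply]
  simp

theorem weight_add (p : Fin 3 → SmoothM M) (α β : Multi) :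
    weight p (α + β) = weight p α * weight p β := by
  ext z
  change _ = weight p α z * weight p β z
  rw [weight_apply, weight_apply, weight_apply, ← Real.exp_add]
  congr 1
  simp only [Finsupp.add_apply, Nat.cast_add, add_mul, sum_add_distrib]
  ring

theorem weight_ne_zero (p : Fin 3 → SmoothM M) (α : Multi) (z : Omega M) : weight p α z ≠ 0 :=
  (Real.exp_pos _).ne'

theorem weight_mul_cancel (p : Fin 3 → SmoothM M) (α : Multi) {f g : SmoothOmega M}
    (h : weight p α * f = weight p α * g) : f = g := by
  ext z
  have : weight p α z * f z = weight p α z * g z := congrArg (fun F : SmoothOmega M => F z) h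
  exact mul_left_cancel₀ (weight_ne_zero p α z) this

theorem derivation_exp (h F : SmoothOmega M)
    (D : Derivation ℝ (SmoothOmega M) (SmoothOmega M))
    (hD : ∃ V hV, D = fieldDeriv (I := (𝓡∂ 1).prod (𝓡 3)) V hV) (hF : ∀ z, F z = Real.exp (h z)) :
    D F = F * D h := by
  obtain ⟨V, hV, rfl⟩ := hD
  ext z
  change _ = F z * _
  rw [fieldDeriv_comp V hV h F (φ := Real.exp) (φ' := Real.exp) Real.hasDerivAt_exp hF, hF]

theorem partial0_weight (p : Fin 3 → SmoothM M) (α : Multi) :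
    partial0 (weight p α) = -(pull (∑ i, α i • p i) * weight p α) := by
  have h := derivation_exp (-(pull (∑ i, α i • p i) * tauMap)) (weight p α)
    partial0 ⟨_, _, rfl⟩ fun z => rfl
  rw [h, map_neg, leibniz, partial0_pull, partial0_tauMap]
  simp only [smul_eq_mul]
  ring

theorem derOmega_weight (L : SmoothFrame M) (a : Fin 3) (p : Fin 3 → SmoothM M) (α : Multi) :
    L.derOmega a (weight p α) = -(tauMap * pull (L.derM a (∑ i, α i • p i)) * weight p α) := by
  have h := derivation_exp (-(pull (∑ i, α i • p i) * tauMap)) (weight p α)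
    (L.derOmega a) ⟨_, _, rfl⟩ fun z => rfl
  rw [h, map_neg, leibniz, derOmega_pull, derOmega_tauMap]
  simp only [smul_eq_mul]
  ring

end Pull

section FinalFrame

variable (T : FinalData L)

/-- The derivations `∂₀, D₁, D₂, D₃` of `C^∞(Ω)`. -/
def FinalData.der : Fin 4 → Derivation ℝ (SmoothOmega M) (SmoothOmega M) :=
  Fin.cons partial0 fun i => ∑ a, pull (T.d i a) • L.derOmega a

theorem FinalData.der_zero : T.der 0 = partial0 := rfl

theorem FinalData.der_sp (i : Fin 3) : T.der (sp i) = ∑ a, pull (T.d i a) • L.derOmega a := rfl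

theorem FinalData.der_apply (i : Fin 3) (f : SmoothOmega M) (z : Omega M) :
    T.der (sp i) f z = T.D i (slice f z.1) z.2 := by
  rw [T.der_sp, sum_apply_derivation, eval_sum_omega, FinalData.D, vecM, sum_apply_derivation,
    eval_sum_pull]
  refine sum_congr rfl fun a _ => ?_
  rw [smul_apply_derivation, smul_apply_derivation]
  change T.d i a z.2 * L.derOmega a f z = T.d i a z.2 * _
  rw [derOmega_apply]

theorem FinalData.slice_der (i : Fin 3) (f : SmoothOmega M) (t : EuclideanHalfSpace 1) :
    slice (T.der (sp i) f) t = T.D i (slice f t) := by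
  ext y; exact T.der_apply i f (t, y)

theorem FinalData.der_pull (i : Fin 3) (f : SmoothM M) : T.der (sp i) (pull f) = pull (T.D i f) := by
  ext z; exact T.der_apply i _ z

theorem FinalData.der_tauMap (i : Fin 3) : T.der (sp i) tauMap = 0 := by
  rw [T.der_sp, sum_apply_derivation]
  simp [derOmega_tauMap]

theorem FinalData.der_weight (i : Fin 3) (p : Fin 3 → SmoothM M) (α : Multi) :
    T.der (sp i) (weight p α) = -(tauMap * pull (T.D i (∑ i, α i • p i)) * weight p α) := by
  rw [T.der_sp, sum_apply_derivation, FinalData.D, vecM, sum_apply_derivation, ← pullHom_apply,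
    map_sum, mul_sum, Finset.sum_mul, ← sum_neg_distrib]
  refine sum_congr rfl fun a _ => ?_
  rw [smul_apply_derivation, derOmega_weight, smul_apply_derivation, map_mul]
  simp only [pullHom_apply]
  ring

/-- The structure functions of `∂₀, D₁, D₂, D₃`. -/
def FinalData.struct : Fin 4 → Fin 4 → Fin 4 → SmoothOmega M :=
  Fin.cons 0 fun i => Fin.cons 0 fun j => Fin.cons 0 fun k => pull (T.c i j k)

theorem FinalData.lie_zero_der (μ : Fin 4) : ⁅T.der 0, T.der μ⁆ = 0 := by
  cases μ using Fin.cases with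
  | zero => exact lie_self _
  | succ i =>
    refine Derivation.ext fun f => ?_
    rw [commutator_apply]
    change T.der 0 (T.der (sp i) f) - T.der (sp i) (T.der 0 f) = 0
    rw [T.der_sp, T.der_zero, sum_apply_derivation, sum_apply_derivation, map_sum,
      ← sum_sub_distrib]
    refine sum_eq_zero fun a _ => ?_
    rw [smul_apply_derivation, smul_apply_derivation, leibniz, partial0_pull]
    have h := congrArg (fun D => D f) (lie_partial0_derOmega L a)
    simp only [commutator_apply, Derivation.zero_apply] at h
    simp only [smul_eq_mul]
    linear_combination pull (T.d i a) * h

theorem FinalData.lie_der (μ ν : Fin 4) : ⁅T.der μ, T.der ν⁆ = derOf T.der (T.struct μ ν) := by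
  cases μ using Fin.cases with
  | zero =>
    rw [T.lie_zero_der]
    simp [derOf, FinalData.struct]
  | succ i =>
    cases ν using Fin.cases with
    | zero =>
      rw [← lie_skew, T.lie_zero_der]
      simp [derOf, FinalData.struct]
    | succ j =>
      refine Derivation.ext fun f => ?_
      ext z
      rw [commutator_apply]
      change T.der (sp i) (T.der (sp j) f) z - T.der (sp j) (T.der (sp i) f) z = _
      rw [T.der_apply, T.der_apply, T.slice_der, T.slice_der]
      have h := congrArg (fun D => D (slice f z.1) z.2) (T.bracket i j)
      simp only [commutator_apply] at h
      refine Eq.trans h ?_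
      rw [sum_apply_derivation, eval_sum_pull, derOf_apply, eval_sum_omega,
        Fin.sum_univ_succ (n := 3)]
      simp only [FinalData.struct, Fin.cons_succ, Fin.cons_zero, zero_mul]
      refine Eq.trans ?_ (zero_add _).symm
      refine sum_congr rfl fun k _ => ?_
      change T.c i j k z.2 * _ = T.c i j k z.2 * T.der (sp k) f z
      rw [T.der_apply]; rfl

theorem FinalData.struct_zero (ν : Fin 4) : T.struct 0 ν = 0 := rfl

end FinalFrame

section Dot

theorem dot_sub (p : Fin 3 → R) {κ α : Multi} (h : κ ≤ α) :
    dot p α - dot p κ = dot p (α - κ) := by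
  simp only [dot, ← sum_sub_distrib, ← sub_mul]
  refine sum_congr rfl fun l _ => ?_
  rw [Finsupp.tsub_apply, Nat.cast_sub (h l)]

theorem dot_apply (p : Fin 3 → SmoothM M) (κ : Multi) (y : M) :
    dot p κ y = ∑ i, (κ i : ℝ) * p i y := by
  rw [dot, eval_sum_pull]
  refine sum_congr rfl fun l _ => ?_
  rw [← nsmul_eq_mul, ← nsmul_eq_mul]; rfl

theorem dot_pos {p : Fin 3 → SmoothM M} (hp : ∀ i y, 0 < p i y) {κ : Multi} (h : κ ≠ 0) (y : M) :
    0 < dot p κ y := by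
  rw [dot_apply]
  obtain ⟨i, hi⟩ := Finsupp.ne_iff.1 h
  refine Finset.sum_pos' (fun j _ => mul_nonneg (Nat.cast_nonneg _) (hp j y).le)
    ⟨i, Finset.mem_univ _, mul_pos (Nat.cast_pos.2 (Nat.pos_of_ne_zero hi)) (hp i y)⟩

theorem sum_nsmul_eq_dot (p : Fin 3 → R) (κ : Multi) :
    ∑ i, κ i • p i = dot p κ := by simp [dot]

theorem pull_dot (p : Fin 3 → SmoothM M) (κ : Multi) :
    pull (dot p κ) = dot (fun i => pull (p i)) κ := by
  rw [← pullHom_apply, dot, map_sum]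
  simp only [map_mul, map_natCast]
  rfl

theorem derivation_dot (D : Derivation ℝ R R)
    (p : Fin 3 → R) (κ : Multi) : D (dot p κ) = dot (fun i => D (p i)) κ := by
  simp only [dot, map_sum, leibniz, Derivation.map_natCast, smul_eq_mul, mul_zero, add_zero]

end Dot

section Poly

/-- The function on `Ω` that is given by a polynomial in `τ`. -/
def tauEval (q : Polynomial (SmoothM M)) : SmoothOmega M :=
  Polynomial.eval₂ (pullHom : SmoothM M →ₐ[ℝ] SmoothOmega M).toRingHom tauMap q

theorem mem_polyTau {f : SmoothOmega M} : f ∈ polyTau (M := M) ↔ ∃ q, f = tauEval q := by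
  simp only [tauEval, eval₂_eq_sum]
  rfl

theorem tauEval_add (q r : Polynomial (SmoothM M)) : tauEval (q + r) = tauEval q + tauEval r :=
  Polynomial.eval₂_add _ _

theorem tauEval_mul (q r : Polynomial (SmoothM M)) : tauEval (q * r) = tauEval q * tauEval r :=
  Polynomial.eval₂_mul _ _

theorem tauEval_C (g : SmoothM M) : tauEval (Polynomial.C g) = pull g := Polynomial.eval₂_C _ _

theorem tauEval_X : tauEval X = tauMap (M := M) := Polynomial.eval₂_X _ _

theorem tauEval_X_pow (n : ℕ) : tauEval (X ^ n : Polynomial (SmoothM M)) = tauMap ^ n := by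
  rw [← tauEval_X]; exact eval₂_pow _ _ _

theorem tauEval_zero : tauEval (0 : Polynomial (SmoothM M)) = 0 := Polynomial.eval₂_zero _ _

/-- The evaluation at a point. -/
def evalAt (y : M) : SmoothM M →+* ℝ where
  toFun f := f y
  map_one' := rfl
  map_mul' _ _ := rfl
  map_zero' := rfl
  map_add' _ _ := rfl

theorem tauEval_apply (q : Polynomial (SmoothM M)) (z : Omega M) :
    tauEval q z = (q.map (evalAt z.2)).eval (tau z) := by
  induction q using induction_on' with
  | add q r hq hr =>
    rw [tauEval_add, Polynomial.map_add, Polynomial.eval_add, ← hq, ← hr]; rfl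
  | monomial n a =>
    rw [← C_mul_X_pow_eq_monomial, tauEval_mul, tauEval_C, tauEval_X_pow]
    simp only [Polynomial.map_mul, map_C, Polynomial.map_pow, map_X,
      Polynomial.eval_mul, Polynomial.eval_C, Polynomial.eval_pow, Polynomial.eval_X]
    change a z.2 * (tauMap ^ n : SmoothOmega M) z = _
    rw [ContMDiffMap.coe_pow]; rfl

theorem tauEval_injective : Function.Injective (tauEval (M := M)) := by
  intro q r h
  ext k y
  have hy : q.map (evalAt y) = r.map (evalAt y) := by
    refine Polynomial.eq_of_infinite_eval_eq _ _ ((Set.Ici_infinite (0 : ℝ)).mono fun t ht => ?_)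
    have := congrArg (fun F : SmoothOmega M => F (⟨EuclideanSpace.single 0 t, by simpa using ht⟩, y)) h
    simp only [tauEval_apply] at this
    simpa [tau] using this
  have := congrArg (fun P => P.coeff k) hy
  simp only [Polynomial.coeff_map] at this
  exact this

theorem partial0_tauEval (q : Polynomial (SmoothM M)) :
    partial0 (tauEval q) = tauEval (derivative q) := by
  induction q using induction_on' with
  | add q r hq hr => rw [tauEval_add, map_add, hq, hr, Polynomial.derivative_add, tauEval_add]
  | monomial n a =>
    rw [Polynomial.derivative_monomial, ← C_mul_X_pow_eq_monomial,
      ← C_mul_X_pow_eq_monomial, tauEval_mul, tauEval_mul, tauEval_C, tauEval_C]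
    rw [tauEval_X_pow, tauEval_X_pow, leibniz, leibniz_pow, partial0_pull, partial0_tauMap,
      ← pullHom_apply, ← pullHom_apply, map_mul, map_natCast]
    simp only [smul_eq_mul, nsmul_eq_mul]
    ring

/-- A polynomial in `τ` that solves `∂₀u = cu` with `c` without zeros is zero. -/
theorem eq_zero_of_derivative_eq {c : SmoothM M} (hc : ∀ y, c y ≠ 0) {q : Polynomial (SmoothM M)}
    (h : derivative q = Polynomial.C c * q) : q = 0 := by
  by_contra hq
  obtain ⟨u, hu⟩ := exists_inv hc
  have h1 := congrArg (fun P => P.coeff q.natDegree) h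
  simp only [Polynomial.coeff_derivative, coeff_C_mul] at h1
  rw [Polynomial.coeff_eq_zero_of_natDegree_lt (Nat.lt_succ_self _), zero_mul] at h1
  have h2 : u * (c * q.coeff q.natDegree) = 0 := by rw [← h1, mul_zero]
  rw [← mul_assoc, hu, one_mul] at h2
  exact hq (Polynomial.leadingCoeff_eq_zero.1 h2)

end Poly

section Bases

theorem FinalData.base (T : FinalData L) (hp : ∀ i y, 0 < T.p i y) :
    Base T.der (fun i => pull (T.p i)) (weight T.p) tauMap fun _ => pullHom.range where
  w_add := weight_add _
  der_zero_t := partial0_tauMap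
  der_t := T.der_tauMap
  der_zero_w α := by rw [T.der_zero, partial0_weight, sum_nsmul_eq_dot, pull_dot]
  der_w i α := by
    rw [T.der_weight, sum_nsmul_eq_dot, ← T.der_pull, pull_dot, derivation_dot]
  mono _ := le_rfl
  der_zero := by rintro n _ ⟨f, rfl⟩; exact partial0_pull f
  der := by rintro n _ i ⟨f, rfl⟩; exact ⟨T.D i f, (T.der_pull i f).symm⟩
  p_mem i := ⟨T.p i, rfl⟩
  inv {κ α} h1 h2 := by
    obtain ⟨u, hu⟩ := exists_inv fun y => (dot_pos hp (κ := α - κ)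
      (fun h => h2 (le_antisymm h1 (tsub_eq_zero_iff_le.1 h))) y).ne'
    refine ⟨pull u, ⟨u, rfl⟩, ?_⟩
    rw [dot_sub _ h1, ← pull_dot, ← pullHom_apply, ← pullHom_apply, ← map_mul, hu, map_one]

/-- The functions of the form `w_α u` with `u` polynomial in `τ`. -/
def polyWeight (p : Fin 3 → SmoothM M) (α : Multi) : Submodule ℝ (SmoothOmega M) :=
  wspan (weight p) tauMap (fun _ => pullHom.range) α 0

theorem mem_polyWeight {p : Fin 3 → SmoothM M} {α : Multi} {f : SmoothOmega M} :
    f ∈ polyWeight p α ↔ ∃ q, f = weight p α * tauEval q := by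
  constructor
  · intro h
    induction h using span_induction with
    | mem x h =>
      obtain ⟨_, ⟨g, rfl⟩, k, rfl⟩ := h
      refine ⟨Polynomial.C g * X ^ k, ?_⟩
      rw [tauEval_mul, tauEval_C, tauEval_X_pow]; rfl
    | zero => exact ⟨0, by rw [tauEval_zero, mul_zero]⟩
    | add f g _ _ hf hg =>
      obtain ⟨q, rfl⟩ := hf
      obtain ⟨r, rfl⟩ := hg
      exact ⟨q + r, by rw [tauEval_add, mul_add]⟩
    | smul c f _ hf =>
      obtain ⟨q, rfl⟩ := hf
      refine ⟨Polynomial.C (algebraMap ℝ _ c) * q, ?_⟩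
      rw [tauEval_mul, tauEval_C, ← pullHom_apply, AlgHom.commutes, Algebra.smul_def]
      ring
  · rintro ⟨q, rfl⟩
    rw [tauEval, eval₂_eq_sum, Polynomial.sum, mul_sum]
    exact Submodule.sum_mem _ fun k _ => mem_wspan (t := tauMap) (B := fun _ => pullHom.range)
      ⟨q.coeff k, rfl⟩ k

theorem FinalData.weighted (T : FinalData L) (hp : ∀ i y, 0 < T.p i y) :
    Weighted T.der (fun i => pull (T.p i)) (polyWeight T.p) where
  one_mem := mem_polyWeight.2 ⟨1, by
    rw [weight_zero, one_mul, ← Polynomial.C_1, tauEval_C]; rfl⟩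
  mul_mem hf hg := (T.base hp).orderWeighted.mul_mem hf hg
  der_mem μ hf := (T.base hp).orderWeighted.der_mem μ hf
  solve h1 h2 hf := (T.base hp).orderWeighted.solve h1 h2 hf
  unique {α κ f} h1 h2 hf h := by
    obtain ⟨q, rfl⟩ := mem_polyWeight.1 hf
    rw [T.der_zero, leibniz, partial0_weight, partial0_tauEval, sum_nsmul_eq_dot, pull_dot] at h
    simp only [smul_eq_mul] at h
    have h3 := dot_sub (fun i => pull (T.p i)) h1
    have h4 : weight T.p α * tauEval (derivative q) =
        weight T.p α * tauEval (Polynomial.C (dot T.p (α - κ)) * q) := by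
      rw [tauEval_mul, tauEval_C, pull_dot, ← h3]
      linear_combination h
    have h5 := tauEval_injective (weight_mul_cancel T.p α h4)
    rw [eq_zero_of_derivative_eq (fun y => (dot_pos hp
      (fun h => h2 (le_antisymm h1 (tsub_eq_zero_iff_le.1 h))) y).ne') h5, tauEval_zero, mul_zero]

theorem FinalData.struct_mem (T : FinalData L) (ν κ μ : Fin 4) :
    T.struct ν κ μ ∈ polyWeight T.p 0 := by
  have h : ∀ g, pull g ∈ polyWeight T.p 0 := fun g =>
    mem_polyWeight.2 ⟨Polynomial.C g, by rw [weight_zero, one_mul, tauEval_C]⟩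
  cases ν using Fin.cases with
  | zero => exact zero_mem _
  | succ i =>
    cases κ using Fin.cases with
    | zero => exact zero_mem _
    | succ j =>
      cases μ using Fin.cases with
      | zero => exact zero_mem _
      | succ k => exact h _

end Bases

section Jets

variable (L)

/-- Tuples with positive Kasner exponents. -/
abbrev PosData : Type _ := {T : FinalData L // ∀ i y, 0 < T.p i y}

variable {L}

/-- The value of a jet variable, as a function on `M`. -/
def Jet.fn (T : PosData L) : Jet → SmoothM M
  | frame w i a => T.1.iter w (T.1.d i a)
  | .p w i => T.1.iter w (T.1.p i)
  | .p0 w => T.1.iter w T.1.p0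
  | .zeta w => T.1.iter w T.1.zeta
  | .chi w => T.1.iter w T.1.chi
  | .c w i j k => T.1.iter w (T.1.c i j k)
  | .inv _ hn => (exists_inv fun y => (dot_pos T.2 hn y).ne').choose

theorem Jet.fn_inv (T : PosData L) {n : Multi} (hn : n ≠ 0) :
    Jet.fn T (.inv n hn) * dot T.1.p n = 1 :=
  (exists_inv fun y => (dot_pos T.2 hn y).ne').choose_spec

theorem Jet.fn_apply (T : PosData L) (j : Jet) (y : M) : j.fn T y = j.value T.1 y := by
  cases j with
  | inv n hn =>
    have h : Jet.fn T (.inv n hn) y * dot T.1.p n y = 1 :=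
      congrArg (fun F : SmoothM M => F y) (Jet.fn_inv T hn)
    rw [Jet.value, ← dot_apply]
    exact eq_inv_of_mul_eq_one_left h
  | _ => rfl

variable (L)

/-- Families of functions on `Ω` that are parametrized by tuples. -/
abbrev Family : Type _ := PosData L → SmoothOmega M

variable {L}

/-- A derivation on families. -/
def Family.der (μ : Fin 4) : Derivation ℝ (Family L) (Family L) := Derivation.mk'
  { toFun := fun f T => T.1.der μ (f T)
    map_add' := fun f g => funext fun T => (T.1.der μ).map_add _ _
    map_smul' := fun c f => funext fun T => (T.1.der μ).map_smul _ _ }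
  (fun f g => funext fun T => (T.1.der μ).leibniz _ _)

theorem Family.der_apply (μ : Fin 4) (f : Family L) (T : PosData L) :
    Family.der μ f T = T.1.der μ (f T) := rfl

/-- The function associated to a jet variable, as a family. -/
def Jet.family (j : Jet) : Family L := fun T => pull (j.fn T)

variable (L) in
/-- The families that are universal polynomials of a given order. -/
def Family.univ (n : ℕ) : Subalgebra ℝ (Family L) :=
  Algebra.adjoin ℝ (Jet.family '' {j | j.order ≤ n})

theorem Jet.family_mem {j : Jet} {n : ℕ} (h : j.order ≤ n) : (j.family : Family L) ∈ Family.univ L n :=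
  Algebra.subset_adjoin ⟨j, h, rfl⟩

/-- The exponents, as families. -/
def Family.expo (i : Fin 3) : Family L := (Jet.p [] i).family

theorem Family.dot_apply (κ : Multi) (T : PosData L) :
    dot Family.expo κ T = dot (fun i => pull (T.1.p i)) κ := by
  simp only [dot, Finset.sum_apply, Pi.mul_apply]
  rfl

theorem Family.inv_mul {n : Multi} (hn : n ≠ 0) :
    ((Jet.inv n hn).family : Family L) * dot Family.expo n = 1 := by
  funext T
  rw [Pi.mul_apply, Family.dot_apply, ← pull_dot, Jet.family, ← pullHom_apply, ← pullHom_apply,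
    ← map_mul, Jet.fn_inv, map_one]; rfl

theorem Family.mono {m n : ℕ} (h : m ≤ n) : Family.univ L m ≤ Family.univ L n :=
  Algebra.adjoin_mono (Set.image_mono fun _ hj => le_trans hj h)

theorem Family.der_family_mem (i : Fin 3) (j : Jet) :
    Family.der (sp i) (j.family : Family L) ∈ Family.univ L (j.order + 1) := by
  have key : ∀ j' : Jet, j'.order ≤ j.order + 1 → (∀ T : PosData L, T.1.D i (j.fn T) = j'.fn T) →
      Family.der (sp i) (j.family : Family L) ∈ Family.univ L (j.order + 1) := fun j' h h' => by
    have : Family.der (sp i) (j.family : Family L) = j'.family := funext fun T => by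
      rw [Family.der_apply, Jet.family, T.1.der_pull, h', Jet.family]
    rw [this]
    exact Jet.family_mem h
  cases j with
  | frame w i' a => exact key (.frame (i :: w) i' a) le_rfl fun T => rfl
  | p w i' => exact key (.p (i :: w) i') le_rfl fun T => rfl
  | p0 w => exact key (.p0 (i :: w)) le_rfl fun T => rfl
  | zeta w => exact key (.zeta (i :: w)) le_rfl fun T => rfl
  | chi w => exact key (.chi (i :: w)) le_rfl fun T => rfl
  | c w i' j' k => exact key (.c (i :: w) i' j' k) le_rfl fun T => rfl
  | inv n hn =>
    have h1 := congrArg (Family.der (sp i)) (Family.inv_mul (L := L) hn)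
    rw [leibniz, Derivation.map_one_eq_zero] at h1
    simp only [smul_eq_mul] at h1
    have h2 := Family.inv_mul (L := L) hn
    have h3 : Family.der (sp i) ((Jet.inv n hn).family : Family L) = -((Jet.inv n hn).family *
        (Jet.inv n hn).family * Family.der (sp i) (dot Family.expo n)) := by
      linear_combination ((Jet.inv n hn).family : Family L) * h1 -
        Family.der (sp i) ((Jet.inv n hn).family : Family L) * h2
    rw [h3, derivation_dot]
    refine neg_mem (mul_mem (mul_mem ?_ ?_) (dot_mem (fun l => ?_) n))
    · exact Jet.family_mem (Nat.zero_le _)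
    · exact Jet.family_mem (Nat.zero_le _)
    · have : Family.der (sp i) (Family.expo l : Family L) = (Jet.p [i] l).family := funext fun T => by
        rw [Family.der_apply, Family.expo, Jet.family, T.1.der_pull]; rfl
      rw [this]
      exact Jet.family_mem le_rfl

variable (L) in
theorem Family.base : Base (Family.der (L := L)) Family.expo (fun α T => weight T.1.p α)
    (fun _ => tauMap) (Family.univ L) where
  w_add α β := funext fun T => weight_add _ α β
  der_zero_t := funext fun T => partial0_tauMap
  der_t i := funext fun T => T.1.der_tauMap i
  der_zero_w α := funext fun T => by
    rw [Pi.neg_apply, Pi.mul_apply, Family.dot_apply]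
    exact (T.1.base T.2).der_zero_w α
  der_w i α := funext fun T => by
    refine ((T.1.base T.2).der_w i α).trans ?_
    simp only [Pi.neg_apply, Pi.mul_apply, dot, Finset.sum_apply]
    rfl
  mono := Family.mono
  der_zero := by
    intro n b hb
    induction hb using Algebra.adjoin_induction with
    | mem x h =>
      obtain ⟨j, _, rfl⟩ := h
      exact funext fun T => partial0_pull _
    | algebraMap r => exact Derivation.map_algebraMap _ r
    | add x y _ _ hx hy => rw [map_add, hx, hy, add_zero]
    | mul x y _ _ hx hy => rw [leibniz, hx, hy, smul_zero, smul_zero, add_zero]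
  der := by
    intro n b i hb
    induction hb using Algebra.adjoin_induction with
    | mem x h =>
      obtain ⟨j, hj, rfl⟩ := h
      exact Family.mono (Nat.succ_le_succ hj) (Family.der_family_mem i j)
    | algebraMap r => rw [Derivation.map_algebraMap]; exact zero_mem _
    | add x y _ _ hx hy => rw [map_add]; exact add_mem hx hy
    | mul x y hx' hy' hx hy =>
      rw [leibniz]
      exact add_mem (mul_mem (Family.mono (Nat.le_succ n) hx') hy)
        (mul_mem (Family.mono (Nat.le_succ n) hy') hx)
  p_mem i := Jet.family_mem le_rfl
  inv {κ α} h1 h2 := by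
    refine ⟨(Jet.inv (α - κ) fun h => h2 (le_antisymm h1 (tsub_eq_zero_iff_le.1 h))).family,
      Jet.family_mem le_rfl, ?_⟩
    rw [dot_sub _ h1, Family.inv_mul]

variable (L) in
/-- The families of the form `w_α u` with `u` polynomial in `τ` and coefficients of a given order. -/
def Family.Wt (α : Multi) (n : ℕ) : Submodule ℝ (Family L) :=
  wspan (fun α T => weight T.1.p α) (fun _ => tauMap) (Family.univ L) α n

/-- A polynomial in jet variables, as a function on `M`. -/
def Jet.polyFn (T : PosData L) : MvPolynomial Jet ℝ →ₐ[ℝ] SmoothM M := MvPolynomial.aeval (Jet.fn T)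

theorem Jet.polyFn_apply (T : PosData L) (P : MvPolynomial Jet ℝ) (y : M) :
    Jet.polyFn T P y = MvPolynomial.eval (Jet.value T.1 y) P := by
  have : (evalAt y).comp (Jet.polyFn T).toRingHom = MvPolynomial.eval (Jet.value T.1 y) := by
    refine MvPolynomial.ringHom_ext (fun r => ?_) fun j => ?_
    · simp only [Jet.polyFn, RingHom.comp_apply, MvPolynomial.eval_C]
      change (MvPolynomial.aeval (Jet.fn T) (MvPolynomial.C r)) y = r
      rw [MvPolynomial.aeval_C]; rfl
    · simp only [Jet.polyFn, RingHom.comp_apply, MvPolynomial.eval_X]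
      change (MvPolynomial.aeval (Jet.fn T) (MvPolynomial.X j)) y = _
      rw [MvPolynomial.aeval_X, Jet.fn_apply]
  exact congrArg (fun F => F P) this

theorem Family.exists_of_mem_univ {n : ℕ} {b : Family L} (hb : b ∈ Family.univ L n) :
    ∃ P ∈ MvPolynomial.supported ℝ {v : Jet | v.order ≤ n}, ∀ T, b T = pull (Jet.polyFn T P) := by
  induction hb using Algebra.adjoin_induction with
  | mem x h =>
    obtain ⟨j, hj, rfl⟩ := h
    exact ⟨MvPolynomial.X j, Algebra.subset_adjoin ⟨j, hj, rfl⟩, fun T => by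
      rw [Jet.polyFn, MvPolynomial.aeval_X]; rfl⟩
  | algebraMap r => exact ⟨algebraMap ℝ _ r, Subalgebra.algebraMap_mem _ r, fun T => by
      rw [AlgHom.commutes]; rfl⟩
  | add x y _ _ hx hy =>
    obtain ⟨P, hP, hP'⟩ := hx
    obtain ⟨Q, hQ, hQ'⟩ := hy
    exact ⟨P + Q, add_mem hP hQ, fun T => by rw [map_add, Pi.add_apply, hP', hQ']; rfl⟩
  | mul x y _ _ hx hy =>
    obtain ⟨P, hP, hP'⟩ := hx
    obtain ⟨Q, hQ, hQ'⟩ := hy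
    exact ⟨P * Q, mul_mem hP hQ, fun T => by rw [map_mul, Pi.mul_apply, hP', hQ']; rfl⟩

theorem Family.exists_of_mem_W {α : Multi} {n : ℕ} {f : Family L} (hf : f ∈ Family.Wt L α n) :
    ∃ Q : Polynomial (MvPolynomial Jet ℝ),
      (∀ k, Q.coeff k ∈ MvPolynomial.supported ℝ {v : Jet | v.order ≤ n}) ∧
      ∀ T, f T = weight T.1.p α * tauEval (Q.map (Jet.polyFn T).toRingHom) := by
  induction hf using span_induction with
  | mem x h =>
    obtain ⟨b, hb, k, rfl⟩ := h
    obtain ⟨P, hP, hP'⟩ := Family.exists_of_mem_univ hb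
    refine ⟨Polynomial.C P * X ^ k, fun l => ?_, fun T => ?_⟩
    · rw [Polynomial.coeff_C_mul_X_pow]
      split_ifs
      · exact hP
      · exact zero_mem _
    · rw [Pi.mul_apply, Pi.mul_apply, hP', Polynomial.map_mul, map_C, Polynomial.map_pow,
        map_X, tauEval_mul, tauEval_C, tauEval_X_pow]; rfl
  | zero => exact ⟨0, fun _ => by simp, fun T => by
      rw [Polynomial.map_zero, tauEval_zero, mul_zero]; rfl⟩
  | add f g _ _ hf hg =>
    obtain ⟨P, hP, hP'⟩ := hf
    obtain ⟨Q, hQ, hQ'⟩ := hg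
    exact ⟨P + Q, fun k => by rw [Polynomial.coeff_add]; exact add_mem (hP k) (hQ k), fun T => by
      rw [Polynomial.map_add, tauEval_add, Pi.add_apply, hP', hQ', mul_add]⟩
  | smul c f _ hf =>
    obtain ⟨P, hP, hP'⟩ := hf
    refine ⟨Polynomial.C (algebraMap ℝ _ c) * P, fun k => ?_, fun T => ?_⟩
    · rw [coeff_C_mul]
      exact mul_mem (Subalgebra.algebraMap_mem _ c) (hP k)
    · rw [Polynomial.map_mul, map_C, tauEval_mul, tauEval_C, Pi.smul_apply, hP', Algebra.smul_def]
      have : pull ((Jet.polyFn T).toRingHom (algebraMap ℝ _ c)) = algebraMap ℝ (SmoothOmega M) c := by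
        rw [AlgHom.toRingHom_eq_coe, RingHom.coe_coe, AlgHom.commutes]; rfl
      rw [this]
      ring

end Jets

section FiltGeneral

variable {R : Type*} [CommRing R] {E : Type*} [AddCommGroup E] [Module R E] {ι : Type*} [Fintype ι]
  {deg : ι → Multi} {elt : ι → E}

theorem mem_filt_iff {α : Multi} {z : E} : z ∈ filt deg elt R α ↔
    ∃ f : ι → R, (∀ b, ¬ deg b ≤ α → f b = 0) ∧ z = ∑ b, f b • elt b := by
  classical
  constructor
  · intro h
    have hle : filt deg elt R α ≤
        Submodule.span R (Set.range fun b : {b // deg b ≤ α} => elt b) := by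
      refine iSup₂_le fun β hβ => Submodule.span_mono ?_
      rintro _ ⟨b, rfl, rfl⟩
      exact ⟨⟨b, hβ⟩, rfl⟩
    obtain ⟨f, hf⟩ := (mem_span_range_iff_exists_fun R).1 (hle h)
    refine ⟨fun b => if h : deg b ≤ α then f ⟨b, h⟩ else 0, fun b hb => by simp [hb], ?_⟩
    rw [← hf]
    refine Fintype.sum_of_injective Subtype.val Subtype.val_injective _ _ (fun b hb => ?_)
      fun b => by simp [b.2]
    have : ¬ deg b ≤ α := by simpa using hb
    simp [this]
  · rintro ⟨f, hf, rfl⟩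
    refine Submodule.sum_mem _ fun b _ => ?_
    by_cases hb : deg b ≤ α
    · refine Submodule.smul_mem _ _ ?_
      have : grPiece deg elt R (deg b) ≤ filt deg elt R α :=
        le_iSup₂_of_le (deg b) hb le_rfl
      exact this (subset_span ⟨b, rfl, rfl⟩)
    · rw [hf b hb, zero_smul]; exact zero_mem _

theorem mem_rees {x : Multi → E} :
    x ∈ rees deg elt R ↔ ∀ α, x α ∈ filt deg elt R α := by
  simp [rees, Submodule.mem_pi]

theorem exists_of_mem_sRees {x : Multi → E} (h : x ∈ sRees deg elt R) :
    ∃ y : Fin 3 → Multi → E, (∀ i, y i ∈ rees deg elt R) ∧ x = ∑ i, sMul R i (y i) := by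
  rw [sRees, Submodule.mem_iSup_iff_exists_finsupp] at h
  obtain ⟨f, hf, rfl⟩ := h
  choose y hy hy2 using fun i => (Submodule.mem_map.1 (hf i))
  refine ⟨y, hy, ?_⟩
  rw [Finsupp.sum_fintype _ _ fun _ => rfl]
  exact sum_congr rfl fun i _ => (hy2 i).symm

theorem not_le_sub_unit {d : Multi} {i : Fin 3} (h : d i ≠ 0) : ¬ d ≤ d - unit i := fun h' => by
  have := h' i
  simp [unit] at this
  omega

/-- A functional that sees only basis elements of degree at least `d` vanishes on the
coefficient at `s^d` of a multiple of `s`. -/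
theorem functional_sRees {N : Type*} [AddCommGroup N] [Module R N] (ψ : E →ₗ[R] N) {d : Multi}
    (hψ : ∀ b, ¬ d ≤ deg b → ψ (elt b) = 0) {x : Multi → E} (h : x ∈ sRees deg elt R) :
    ψ (x d) = 0 := by
  obtain ⟨y, hy, rfl⟩ := exists_of_mem_sRees h
  rw [Finset.sum_apply, map_sum]
  refine sum_eq_zero fun i _ => ?_
  change ψ (if d i = 0 then 0 else y i (d - unit i)) = 0
  split_ifs with hi
  · exact map_zero _
  · obtain ⟨f, hf, h2⟩ := mem_filt_iff.1 (mem_rees.1 (hy i) (d - unit i))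
    rw [h2, map_sum]
    refine sum_eq_zero fun b _ => ?_
    rw [map_smul]
    by_cases hb : deg b ≤ d - unit i
    · rw [hψ b fun h' => not_le_sub_unit hi (h'.trans hb), smul_zero]
    · rw [hf b hb, zero_smul]

/-- The leading coefficients of a multiple of `s` are zero. -/
theorem leading_sRees (hE : LinearIndependent R elt) {x : Multi → E} (h : x ∈ sRees deg elt R)
    {f : ι → R} {b : ι} (hf : x (deg b) = ∑ b, f b • elt b) : f b = 0 := by
  obtain ⟨y, hy, rfl⟩ := exists_of_mem_sRees h
  have key : ∀ i, ∃ g : ι → R, g b = 0 ∧ sMul R i (y i) (deg b) = ∑ b, g b • elt b := fun i => by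
    change ∃ g : ι → R, g b = 0 ∧ (if deg b i = 0 then 0 else y i (deg b - unit i)) = _
    split_ifs with hi
    · exact ⟨0, rfl, by simp⟩
    · obtain ⟨g, hg, h2⟩ := mem_filt_iff.1 (mem_rees.1 (hy i) (deg b - unit i))
      exact ⟨g, hg b (not_le_sub_unit hi), h2⟩
  choose g hg hg2 using key
  rw [Finset.sum_apply] at hf
  simp only [hg2] at hf
  rw [sum_comm] at hf
  simp only [← sum_smul] at hf
  have h3 := Fintype.linearIndependent_iff.1 hE (fun b => ∑ i, g i b - f b) (by
    simp only [sub_smul, sum_sub_distrib, hf, sub_self]) b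
  rw [← sub_eq_zero.1 h3]
  exact sum_eq_zero fun i _ => hg i

/-- A direction in which the multi-index can be lowered. -/
theorem exists_lt_of_lt {d α : Multi} (h : d ≤ α) (hne : d ≠ α) : ∃ i, d i < α i := by
  by_contra! hc
  exact hne (le_antisymm h hc)

theorem le_sub_unit {d α : Multi} {i : Fin 3} (h : d ≤ α) (hi : d i < α i) : d ≤ α - unit i := by
  intro j
  have := h j
  by_cases hj : j = i
  · subst hj; simp [unit]; omega
  · simp [unit, Ne.symm hj]; exact this

/-- A series whose leading coefficients vanish, as a combination of multiples of `sᵢ`. -/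
theorem exists_decomposition (f : Multi → ι → R) (hf : ∀ α b, ¬ deg b ≤ α → f α b = 0)
    (hl : ∀ b, f (deg b) b = 0) : ∃ h : Fin 3 → Multi → ι → R,
      (∀ i β b, h i β b = f (β + unit i) b ∨ h i β b = 0) ∧
      (∀ i β b, ¬ deg b ≤ β → h i β b = 0) ∧
      ∀ α b, f α b = ∑ i, if α i = 0 then 0 else h i (α - unit i) b := by
  classical
  let ch : Multi → ι → Option (Fin 3) := fun α b =>
    if h : deg b ≤ α ∧ deg b ≠ α then some (exists_lt_of_lt h.1 h.2).choose else none
  have hch : ∀ α b i, ch α b = some i → deg b ≤ α ∧ deg b i < α i := fun α b i h => by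
    simp only [ch] at h
    split_ifs at h with h1
    · have h2 := (exists_lt_of_lt h1.1 h1.2).choose_spec
      rw [Option.some.inj h] at h2
      exact ⟨h1.1, h2⟩
  have hadd : ∀ (α : Multi) i, α i ≠ 0 → α - unit i + unit i = α := fun α i h =>
    tsub_add_cancel_of_le (Finsupp.single_le_iff.2 (Nat.one_le_iff_ne_zero.2 h))
  refine ⟨fun i β b => if ch (β + unit i) b = some i then f (β + unit i) b else 0,
    fun i β b => ?_, fun i β b hb => ?_, fun α b => ?_⟩
  · dsimp only
    split_ifs
    · exact Or.inl rfl
    · exact Or.inr rfl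
  · dsimp only
    split_ifs with h
    · obtain ⟨h1, h2⟩ := hch _ _ _ h
      refine absurd ?_ hb
      have := le_sub_unit h1 h2
      rwa [add_tsub_cancel_right] at this
    · rfl
  · have h1 : ∀ i, (if α i = 0 then (0 : R) else
        if ch (α - unit i + unit i) b = some i then f (α - unit i + unit i) b else 0) =
        if ch α b = some i then f α b else 0 := fun i => by
      split_ifs with h2 h3 h3 h4 h5
      · have := (hch _ _ _ h3).2; omega
      · rfl
      · rw [hadd α i h2]
      · rw [hadd α i h2] at h3; exact absurd h3 h4
      · rw [hadd α i h2] at h3; exact absurd h5 h3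
      · rfl
    simp only [h1]
    by_cases h2 : deg b ≤ α ∧ deg b ≠ α
    · have h3 : ch α b = some (exists_lt_of_lt h2.1 h2.2).choose := by simp [ch, h2]
      rw [h3]
      simp
    · have h3 : ch α b = none := by simp only [ch]; rw [dif_neg h2]
      rw [h3]
      simp only [reduceCtorEq, if_false, Finset.sum_const_zero]
      by_cases h4 : deg b ≤ α
      · have h5 : deg b = α := by_contra fun h5 => h2 ⟨h4, h5⟩
        rw [← h5, hl]
      · exact hf α b h4

theorem mem_sRees_of_leading (f : Multi → ι → R) (hf : ∀ α b, ¬ deg b ≤ α → f α b = 0)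
    (hl : ∀ b, f (deg b) b = 0) : (fun α => ∑ b, f α b • elt b) ∈ sRees deg elt R := by
  obtain ⟨h, -, h2, h3⟩ := exists_decomposition f hf hl
  have : (fun α => ∑ b, f α b • elt b) = ∑ i, sMul R i (fun β => ∑ b, h i β b • elt b) := by
    funext α
    rw [Finset.sum_apply]
    change _ = ∑ i, if α i = 0 then 0 else ∑ b, h i (α - unit i) b • elt b
    simp only [h3 α, sum_smul]
    rw [sum_comm]
    refine sum_congr rfl fun i _ => ?_
    split_ifs <;> simp
  rw [this]
  refine Submodule.sum_mem _ fun i _ => Submodule.mem_iSup_of_mem i ⟨_, ?_, rfl⟩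
  exact mem_rees.2 fun β => mem_filt_iff.2 ⟨h i β, h2 i β, rfl⟩

/-- Weighted coefficients. -/
theorem mem_reesBar_of_coeff {C : Set R} {wt : Multi → R} (f : Multi → ι → R)
    (hf : ∀ α b, ¬ deg b ≤ α → f α b = 0) (h0 : (0 : R) ∈ C)
    (hC : ∀ α b, ∃ c ∈ C, f α b = wt α * c) (hw : ∀ α, IsUnit (wt α)) :
    (fun α => ∑ b, f α b • elt b) ∈ reesBar deg elt C wt := by
  intro α
  choose c hc hc2 using hC α
  refine ⟨∑ b, c b • elt b, mem_filt_iff.2 ⟨c, fun b hb => ?_, rfl⟩, ⟨Finset.univ, c, hc, rfl⟩, ?_⟩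
  · have := hf α b hb
    rw [hc2 b] at this
    exact (hw α).mul_right_eq_zero.1 this
  · simp only [hc2, mul_smul, smul_sum]

theorem mem_sReesBar_of_coeff {C : Set R} {wt : Multi → R} (f : Multi → ι → R)
    (hf : ∀ α b, ¬ deg b ≤ α → f α b = 0) (hl : ∀ b, f (deg b) b = 0) (h0 : (0 : R) ∈ C)
    (hC : ∀ α b, ∃ c ∈ C, f α b = wt α * c) (hw : ∀ α, IsUnit (wt α))
    (hadd : ∀ α β, wt (α + β) = wt α * wt β) :
    (fun α => ∑ b, f α b • elt b) ∈ sReesBar deg elt C wt := by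
  obtain ⟨h, h1, h2, h3⟩ := exists_decomposition f hf hl
  choose u hu using hw
  refine ⟨fun i β => ∑ b, ((u (unit i))⁻¹.1 * h i β b) • elt b, fun i => ?_, ?_⟩
  · refine mem_reesBar_of_coeff _ (fun β b hb => by rw [h2 i β b hb, mul_zero]) h0
      (fun β b => ?_) fun α => ⟨u α, hu α⟩
    rcases h1 i β b with h4 | h4
    · obtain ⟨c, hc, hc2⟩ := hC (β + unit i) b
      refine ⟨c, hc, ?_⟩
      rw [h4, hc2, hadd, ← hu (unit i)]
      have := (u (unit i)).inv_mul
      linear_combination wt β * c * this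
    · exact ⟨0, h0, by rw [h4, mul_zero, mul_zero]⟩
  · funext α
    rw [Finset.sum_apply]
    change _ = ∑ i, wt (unit i) •
      (if α i = 0 then (0 : E) else ∑ b, ((u (unit i))⁻¹.1 * h i (α - unit i) b) • elt b)
    simp only [h3 α, sum_smul]
    rw [sum_comm]
    refine sum_congr rfl fun i _ => ?_
    split_ifs
    · simp
    · rw [smul_sum]
      refine sum_congr rfl fun b _ => ?_
      rw [smul_smul, ← mul_assoc, ← hu (unit i), Units.mul_inv, one_mul]

theorem exists_of_mem_reesBar {C : Set R} {wt : Multi → R} (hE : LinearIndependent R elt)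
    {x : Multi → E} (h : x ∈ reesBar deg elt C wt) (h0 : (0 : R) ∈ C) : ∃ f : Multi → ι → R,
      (∀ α b, ¬ deg b ≤ α → f α b = 0) ∧ (∀ α b, ∃ c ∈ C, f α b = wt α * c) ∧
      ∀ α, x α = ∑ b, f α b • elt b := by
  classical
  have key : ∀ α, ∃ c : ι → R, (∀ b, c b ∈ C) ∧ (∀ b, ¬ deg b ≤ α → c b = 0) ∧
      x α = wt α • ∑ b, c b • elt b := fun α => by
    obtain ⟨y, hy, ⟨s, c, hc, h1⟩, h2⟩ := h α
    obtain ⟨f, hf, h3⟩ := mem_filt_iff.1 hy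
    have h4 : y = ∑ b, (if b ∈ s then c b else 0) • elt b := by
      rw [h1]; simp [ite_smul, Finset.sum_ite_mem]
    have h5 := Fintype.linearIndependent_iff.1 hE
      (fun b => f b - if b ∈ s then c b else 0) (by
        simp only [sub_smul, sum_sub_distrib]
        rw [← h4, ← h3, sub_self])
    refine ⟨f, fun b => ?_, hf, by rw [h2, h3]⟩
    rw [sub_eq_zero.1 (h5 b)]
    split_ifs
    · exact hc b
    · exact h0
  choose c hc hf hx using key
  exact ⟨fun α b => wt α * c α b, fun α b hb => by simp [hf α b hb],
    fun α b => ⟨_, hc α b, rfl⟩, fun α => by rw [hx, smul_sum]; simp only [smul_smul]⟩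

end FiltGeneral

section Independence

variable (e)

theorem confDer_inj {l l' : R} {b b' r r' : Fin 3 → R} {X X' : Derivation ℝ R R} :
    confDer l b r X = confDer l' b' r' X' ↔ l = l' ∧ b = b' ∧ r = r' ∧ X = X' := by
  constructor
  · intro h
    have h1 := congrArg Prod.fst h
    refine ⟨congrFun (congrFun h1 0) 0, funext fun i => ?_, funext fun i => ?_,
      congrArg Prod.snd h⟩
    · have := congrFun (congrFun h1 0) (sp i)
      simpa only [confDer, confMatrix_zero_sp] using this
    · have := congrFun (congrFun h1 (sp (i + 1))) (sp (i + 2))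
      simpa [confDer, confMatrix_sp_sp, fin3_add, (fin3_add_one_ne_add_two i).symm] using this
  · rintro ⟨rfl, rfl, rfl, rfl⟩; rfl

theorem confDer_add (l l' : R) (b b' r r' : Fin 3 → R) (X X' : Derivation ℝ R R) :
    confDer l b r X + confDer l' b' r' X' = confDer (l + l') (b + b') (r + r') (X + X') := by
  rw [confDer_eq, confDer_eq, confDer_eq,
    show ofDer (X + X') = ofDer X + ofDer X' from Prod.ext (by simp [ofDer]) rfl]
  simp only [Pi.add_apply, add_smul, sum_add_distrib]
  abel

theorem confDer_smul (c l : R) (b r : Fin 3 → R) (X : Derivation ℝ R R) :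
    c • confDer l b r X = confDer (c * l) (fun i => c * b i) (fun i => c * r i) (c • X) := by
  rw [confDer_eq, confDer_eq, show ofDer (c • X) = c • ofDer X from Prod.ext (by simp [ofDer]) rfl]
  simp only [smul_add, mul_smul, smul_sum]

/-- The labels in degree zero as a disjoint union. -/
def GB0.equivSum : GB0 ≃ Fin 4 ⊕ Unit ⊕ Fin 3 ⊕ Fin 3 where
  toFun
    | .der μ => .inl μ
    | .conf => .inr (.inl ())
    | .boost i => .inr (.inr (.inl i))
    | .rot i => .inr (.inr (.inr i))
  invFun
    | .inl μ => .der μ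
    | .inr (.inl _) => .conf
    | .inr (.inr (.inl i)) => .boost i
    | .inr (.inr (.inr i)) => .rot i
  left_inv b := by cases b <;> rfl
  right_inv := by rintro (i | i | i | i) <;> rfl

theorem sum_GB0 {N : Type*} [AddCommMonoid N] (F : GB0 → N) : ∑ b, F b =
    ∑ μ, F (.der μ) + (F .conf + (∑ i, F (.boost i) + ∑ i, F (.rot i))) := by
  rw [← GB0.equivSum.symm.sum_comp F]
  simp only [Fintype.sum_sum_type, Finset.univ_unique, Finset.sum_singleton]
  rfl

theorem sum_GB0_elt (f : GB0 → R) : ∑ b, f b • b.elt e = confDer (f .conf) (fun i => f (.boost i))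
    (fun i => f (.rot i)) (derOf e fun μ => f (.der μ)) := by
  have h : ofDer (derOf e fun μ => f (.der μ)) = ∑ μ, f (.der μ) • ofDer (e μ) := by
    refine Prod.ext ?_ ?_ <;> simp [ofDer, derOf, fst_sum, snd_sum]
  rw [sum_GB0, confDer_eq, h]
  simp only [GB0.elt]
  abel

theorem atOne_eq (f : B1 → R) : atOne e f = gauged e 0 (fun b => f (.inl b)) +
    theta0Mul0 (∑ b : GB0, f (.inr b) • b.elt e) := by
  rw [atOne, Fintype.sum_sum_type, gauged, map_zero, zero_smul, zero_add]
  congr 1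
  refine Prod.ext ?_ ?_
  · rw [fst_sum]
    funext a
    rw [Finset.sum_apply]
    change ∑ b, f (.inr b) • (theta 0 a : R) • b.elt e = (theta 0 a : R) • _
    rw [smul_sum]
    exact sum_congr rfl fun b _ => smul_comm _ _ _
  · rw [snd_sum]
    refine sum_eq_zero fun b _ => ?_
    change f (.inr b) • (0 : Fin 4 → R) = 0
    rw [smul_zero]

theorem atOne_zero (f : B1 → R) : (atOne e f).1 0 = confDer
    (∑ i, f (.inl (.diag i)) + f (.inr .conf)) (fun i => f (.inl (.conf i)) + f (.inr (.boost i)))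
    (fun i => f (.inr (.rot i))) (derOf e fun μ => f (.inr (.der μ))) := by
  rw [atOne_eq, fst_add, Pi.add_apply, gauged_zero, map_zero, zero_smul]
  change _ + (theta 0 0 : R) • _ = _
  rw [sum_GB0_elt, theta_apply, if_pos rfl, one_smul, confDer_add, zero_add, zero_add]
  rfl

theorem atOne_sp (f : B1 → R) (i : Fin 3) : (atOne e f).1 (sp i) = confDer (f (.inl (.conf i)))
    (boostCoeff (fun b => f (.inl b)) i) (rotCoeff (fun b => f (.inl b)) i)
    (frameDer e (fun b => f (.inl b)) i) := by
  rw [atOne_eq, fst_add, Pi.add_apply, gauged_sp]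
  change _ + (theta 0 (sp i) : R) • _ = _
  rw [theta_apply, if_neg (show sp i ≠ 0 from Fin.succ_ne_zero i), zero_smul, add_zero]

theorem atOne_snd (f : B1 → R) (i : Fin 4) : (atOne e f).2 i = f (.inl (.scalar i)) := by
  rw [atOne_eq, snd_add, Pi.add_apply, gauged_snd]
  exact add_zero _

theorem linearIndependent_B1 (he : LinearIndependent R e) :
    LinearIndependent R (B1.elt e) := by
  rw [Fintype.linearIndependent_iff]
  intro f hf
  change atOne e f = 0 at hf
  have hz : (0 : Der0 R) = confDer 0 0 0 0 := by simp [confDer_eq, ofDer]; rfl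
  have h0 := atOne_zero e f
  have h1 := atOne_sp e f
  have h2 := atOne_snd e f
  rw [hf] at h0 h2
  simp only [hf] at h1
  obtain ⟨a1, a2, a3, a4⟩ := confDer_inj.1 ((show (0 : Der0 R) = (0 : E1 R).1 0 from rfl).trans h0 |>.symm.trans hz)
  have h1 := fun i => confDer_inj.1
    (((show (0 : Der0 R) = (0 : E1 R).1 (sp i) from rfl).trans (h1 i)).symm.trans hz)
  have bc := fun i => congrFun (h1 i).2.1
  have rc := fun i => congrFun (h1 i).2.2.1
  have two : ∀ x : R, x + x = 0 → x = 0 := fun x hx => by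
    rw [← two_smul ℝ] at hx
    exact (smul_eq_zero_iff_right two_ne_zero).1 hx
  have d : ∀ i, f (.inl (.diag i)) = 0 := fun i => by
    have := bc i i; simpa [boostCoeff] using this
  have c : ∀ i, f (.inl (.conf i)) = 0 := fun i => (h1 i).1
  have as : ∀ i, f (.inl (.sym i)) = 0 ∧ f (.inl (.asym i)) = 0 := fun i => by
    have u := bc (i + 1) (i + 2)
    have v := bc (i + 2) (i + 1)
    simp only [boostCoeff, fin3_add, (fin3_add_one_ne_add_two i).symm, fin3_add_one_ne_add_two i,
      (fin3_ne_add_one _).symm, if_true, if_false, Pi.zero_apply] at u v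
    constructor <;> refine two _ ?_
    · linear_combination u + v
    · linear_combination u - v
  have cu : ∀ i, f (.inl (.curv i)) = 0 := fun i => by
    have u := rc 0 0
    have v := rc 1 1
    have w := rc 2 2
    simp [rotCoeff] at u v w
    fin_cases i <;> refine two _ ?_
    · change f (.inl (.curv 0)) + f (.inl (.curv 0)) = 0
      linear_combination v + w
    · change f (.inl (.curv 1)) + f (.inl (.curv 1)) = 0
      linear_combination u + w
    · change f (.inl (.curv 2)) + f (.inl (.curv 2)) = 0
      linear_combination u + v
  intro b
  rcases b with b | b
  · cases b with
    | diag i => exact d i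
    | curv i => exact cu i
    | frame i μ => exact Fintype.linearIndependent_iff.1 he _ (h1 i).2.2.2 μ
    | conf i => exact c i
    | sym i => exact (as i).1
    | rotK i =>
      have := rc (i + 2) (i + 1)
      simpa [rotCoeff, fin3_add, fin3_add_one_ne_add_two i,
        fin3_ne_add_one, (fin3_ne_add_one i).symm] using this
    | rotJ i =>
      have := rc (i + 1) (i + 2)
      simpa [rotCoeff, fin3_add, (fin3_add_one_ne_add_two i).symm] using this
    | asym i => exact (as i).2
    | scalar i => exact (h2 i).symm
  · cases b with
    | der μ => exact Fintype.linearIndependent_iff.1 he _ a4 μ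
    | conf => simpa [d] using a1
    | boost i => have := congrFun a2 i; simpa [c] using this
    | rot i => exact congrFun a3 i

end Independence

section Coordinates

variable (e)

/-- The coefficients of `θᵢθⱼ`. -/
def wedgeEntry (i j a b : Fin 4) : ℤ :=
  (if a = i ∧ b = j then 1 else 0) - if a = j ∧ b = i then 1 else 0

/-- The matrix entries of `σ_{ij}`. -/
def sigmaEntry (i j r s : Fin 4) : ℤ :=
  (if i = r ∧ j = s then (if j = 0 then -1 else 1) else 0) -
    if j = r ∧ i = s then (if i = 0 then -1 else 1) else 0

def idEntry (r s : Fin 4) : ℤ := if r = s then 1 else 0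

def boostEntry (l : Fin 3) : Fin 4 → Fin 4 → ℤ := sigmaEntry 0 (sp l)

def rotEntry (l : Fin 3) : Fin 4 → Fin 4 → ℤ := sigmaEntry (sp (l + 1)) (sp (l + 2))

/-- The matrix entries of the basis elements of degree one. -/
def GB1.entry (a p q : Fin 4) : GB1 → ℤ
  | diag i => (if a = 0 then idEntry p q else 0) + if a = sp i then boostEntry i p q else 0
  | curv i => -(if a = sp i then rotEntry i p q else 0) +
      (if a = sp (i + 1) then rotEntry (i + 1) p q else 0) +
      if a = sp (i + 2) then rotEntry (i + 2) p q else 0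
  | frame _ _ => 0
  | conf i => (if a = 0 then boostEntry i p q else 0) + if a = sp i then idEntry p q else 0
  | sym i => (if a = sp (i + 1) then boostEntry (i + 2) p q else 0) +
      if a = sp (i + 2) then boostEntry (i + 1) p q else 0
  | rotK i => if a = sp (i + 2) then rotEntry (i + 1) p q else 0
  | rotJ i => if a = sp (i + 1) then rotEntry (i + 2) p q else 0
  | asym i => (if a = sp (i + 1) then boostEntry (i + 2) p q else 0) -
      if a = sp (i + 2) then boostEntry (i + 1) p q else 0
  | scalar _ => 0

/-- The matrix entries of the basis elements of degree two. -/
def B2.entry (a b p q : Fin 4) : B2 → ℤ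
  | .inl .zero => (wedgeEntry (sp (0 + 1)) (sp (0 + 2)) a b * rotEntry 0 p q +
        2 * (wedgeEntry 0 (sp 0) a b * boostEntry 0 p q)) +
      (wedgeEntry (sp (1 + 1)) (sp (1 + 2)) a b * rotEntry 1 p q +
        2 * (wedgeEntry 0 (sp 1) a b * boostEntry 1 p q)) +
      (wedgeEntry (sp (2 + 1)) (sp (2 + 2)) a b * rotEntry 2 p q +
        2 * (wedgeEntry 0 (sp 2) a b * boostEntry 2 p q))
  | .inl (.mix i) => wedgeEntry 0 (sp (i + 1)) a b * rotEntry (i + 2) p q +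
      wedgeEntry (sp i) (sp (i + 1)) a b * boostEntry (i + 1) p q
  | .inl (.frame _ _) => 0
  | .inl (.asym i) => wedgeEntry 0 (sp (i + 1)) a b * boostEntry (i + 2) p q -
      wedgeEntry 0 (sp (i + 2)) a b * boostEntry (i + 1) p q -
      2 * (wedgeEntry (sp (i + 1)) (sp (i + 2)) a b * idEntry p q)
  | .inl (.sym i) => wedgeEntry 0 (sp (i + 1)) a b * boostEntry (i + 2) p q +
      wedgeEntry 0 (sp (i + 2)) a b * boostEntry (i + 1) p q -
      2 * (wedgeEntry (sp i) (sp (i + 1)) a b * rotEntry (i + 1) p q)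
  | .inl .top => (wedgeEntry 0 (sp 0) a b * rotEntry 0 p q -
        2 * (wedgeEntry (sp (0 + 1)) (sp (0 + 2)) a b * boostEntry 0 p q)) +
      (wedgeEntry 0 (sp 1) a b * rotEntry 1 p q -
        2 * (wedgeEntry (sp (1 + 1)) (sp (1 + 2)) a b * boostEntry 1 p q)) +
      (wedgeEntry 0 (sp 2) a b * rotEntry 2 p q -
        2 * (wedgeEntry (sp (2 + 1)) (sp (2 + 2)) a b * boostEntry 2 p q))
  | .inl (.scalar _) => 0
  | .inr c => (if a = 0 then GB1.entry b p q c else 0) - if b = 0 then GB1.entry a p q c else 0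

/-- The integers that correspond to `coordL`, for basis elements. -/
def B2.coordEntry (c b : B2) : ℤ :=
  let X k l := b.entry 0 (sp k) 0 (sp l)
  let Z k l := b.entry 0 (sp k) (sp (l + 1)) (sp (l + 2))
  let Y k l := b.entry (sp (k + 1)) (sp (k + 2)) (sp (l + 1)) (sp (l + 2))
  let V k l := b.entry (sp (k + 1)) (sp (k + 2)) 0 (sp l)
  let P k := b.entry 0 (sp k) 0 0
  let Q k := b.entry (sp (k + 1)) (sp (k + 2)) 0 0
  match c with
  | .inl .zero => Y 0 0 + Y 1 1 + Y 2 2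
  | .inl .top => -(V 0 0 + V 1 1 + V 2 2)
  | .inl (.mix i) => V (i + 2) (i + 1) - V (i + 1) (i + 2)
  | .inl (.sym i) => Y (i + 1) (i + 2) - Y (i + 2) (i + 1)
  | .inl (.asym i) => -Q i
  | .inr (.diag i) => X i i + Y i i - (Y 0 0 + Y 1 1 + Y 2 2)
  | .inr (.curv i) => Z (i + 1) (i + 1) + Z (i + 2) (i + 2) + V i i
  | .inr (.conf i) => P i
  | .inr (.sym i) => X (i + 1) (i + 2) + X (i + 2) (i + 1) + (Y (i + 1) (i + 2) + Y (i + 2) (i + 1))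
  | .inr (.asym i) => X (i + 1) (i + 2) - X (i + 2) (i + 1) + Q i
  | .inr (.rotJ i) => Z (i + 1) (i + 2) - V (i + 2) (i + 1)
  | .inr (.rotK i) => Z (i + 2) (i + 1) - V (i + 1) (i + 2)
  | _ => 0

set_option maxRecDepth 100000 in
theorem coordEntry_eq_zero : ∀ c b : B2, (∃ j, b.num j < c.num j) → c.coordEntry b = 0 := by
  decide +kernel

theorem entry_th2 (i j a b p q : Fin 4) (δ : Der0 R) :
    entry a b p q (th2 i j δ) = wedgeEntry i j a b * δ.1 p q := by
  change ((theta i a * theta j b - theta i b * theta j a : R) • δ).1 p q = _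
  rw [smul_fst, Matrix.smul_apply, smul_eq_mul]
  congr 1
  simp only [theta_apply, wedgeEntry]
  split_ifs <;> simp_all

theorem sigma_eq_sigmaEntry (i j p q : Fin 4) : (sigma i j : Der0 R).1 p q = sigmaEntry i j p q := by
  have h : ∀ i, (eta i : R) = ((if i = 0 then -1 else 1 : ℤ) : R) := fun i => by
    fin_cases i <;> simp [eta]
  rw [sigma_entry, sigmaEntry, h, h]
  push_cast
  rfl

theorem boost_eq_boostEntry (l : Fin 3) (p q : Fin 4) :
    (boost l : Der0 R).1 p q = boostEntry l p q := sigma_eq_sigmaEntry _ _ _ _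

theorem rot_eq_rotEntry (l : Fin 3) (p q : Fin 4) :
    (rot l : Der0 R).1 p q = rotEntry l p q := sigma_eq_sigmaEntry _ _ _ _

theorem sigma0_eq_idEntry (p q : Fin 4) : (sigma0 : Der0 R).1 p q = idEntry p q := by
  simp [sigma0, idEntry, Matrix.one_apply]

theorem GB1.elt_entry (b : GB1) (a p q : Fin 4) :
    ((b.elt e).1 a).1 p q = GB1.entry a p q b := by
  have h : ∀ i (δ : Der0 R), ((th1 i δ) a).1 p q = if a = i then δ.1 p q else 0 := fun i δ => by
    change ((theta i a : R) • δ).1 p q = _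
    rw [smul_fst, Matrix.smul_apply, smul_eq_mul, theta_apply]
    simp
  cases b <;> simp only [GB1.elt, GB1.entry, Pi.add_apply, Pi.sub_apply, Pi.neg_apply, fst_add,
    fst_sub, Prod.fst_neg, Matrix.add_apply, Matrix.sub_apply, Matrix.neg_apply, h,
    boost_eq_boostEntry, rot_eq_rotEntry, sigma0_eq_idEntry] <;> push_cast <;> first | rfl | simp [ofDer]

/-- A representative of a basis element of degree two. -/
def B2.rep : B2 → L2 R
  | .inl b => (b.preElt e).1
  | .inr b => ∑ i, th2 0 i ((b.elt e).1 i)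

theorem B2.elt_fst (b : B2) : (b.elt e).1 = Submodule.Quotient.mk (b.rep e) := by
  cases b <;> rfl

set_option maxRecDepth 4000 in
theorem B2.entry_rep (b : B2) (a a' p q : Fin 4) :
    BKL.entry a a' p q (b.rep e) = B2.entry a a' p q b := by
  rcases b with b | b
  · cases b <;> simp only [B2.rep, GB2.preElt, B2.entry, map_add, map_sub, map_smul,
      entry_th2, boost_eq_boostEntry, rot_eq_rotEntry, sigma0_eq_idEntry, Fin.sum_univ_three,
      smul_eq_mul] <;> push_cast <;> first | rfl | simp [ofDer]
  · simp only [B2.rep, B2.entry, map_sum, entry_th2, GB1.elt_entry]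
    rw [sum_congr rfl fun i _ => show ((wedgeEntry 0 i a a' : ℤ) : R) * _ =
      (if a' = i then (if a = 0 then ((GB1.entry i p q b : ℤ) : R) else 0) else 0) -
      (if a = i then (if a' = 0 then ((GB1.entry i p q b : ℤ) : R) else 0) else 0) by
        simp only [wedgeEntry]
        push_cast
        rw [sub_mul]
        congr 1
        · by_cases h1 : a = 0 <;> by_cases h2 : a' = i <;> simp [h1, h2]
        · by_cases h1 : a' = 0 <;> by_cases h2 : a = i <;> simp [h1, h2]]
    rw [sum_sub_distrib, Finset.sum_ite_eq, Finset.sum_ite_eq]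
    simp

theorem coordL_rep (c b : B2) : coordL c (b.rep e) = B2.coordEntry c b := by
  rcases c with c | c <;> cases c <;> simp only [coordL, B2.coordEntry, LinearMap.add_apply,
    LinearMap.sub_apply, LinearMap.neg_apply, LinearMap.zero_apply, entX, entY, entZ, entV, entP,
    entQ, B2.entry_rep] <;> push_cast <;> rfl

theorem GB1.elt_snd (b : GB1) (h : ∀ i, b ≠ .scalar i) : (b.elt e).2 = 0 := by
  cases b <;> first | rfl | exact absurd rfl (h _)

theorem coord_scalar_elt (i : Fin 3) (b : B2) (h : b ≠ .inl (.scalar i)) :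
    coord (.inl (.scalar i)) (b.elt e) = 0 := by
  change (b.elt e).2.1 (sp (i + 1)) (sp (i + 2)) = 0
  rcases b with b | b
  · cases b with
    | scalar j =>
      have hj : j ≠ i := fun hj => h (hj ▸ rfl)
      change (theta (sp (j + 1)) (sp (i + 1)) * theta (sp (j + 2)) (sp (i + 2)) -
        theta (sp (j + 1)) (sp (i + 2)) * theta (sp (j + 2)) (sp (i + 1)) : R) = 0
      simp only [theta_apply]
      revert hj
      fin_cases i <;> fin_cases j <;> simp [sp]
    | _ => rfl
  · change (theta 0 (sp (i + 1)) * _ - theta 0 (sp (i + 2)) * _ : R) = 0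
    simp [theta_apply, sp]

theorem coord_theta0_scalar_elt (i : Fin 3) (b : B2) (h : b ≠ .inr (.scalar (sp i))) :
    coord (.inr (.scalar (sp i))) (b.elt e) = 0 := by
  change (b.elt e).2.1 0 (sp i) = 0
  rcases b with b | b
  · cases b with
    | scalar j =>
      change (theta (sp (j + 1)) 0 * theta (sp (j + 2)) (sp i) -
        theta (sp (j + 1)) (sp i) * theta (sp (j + 2)) 0 : R) = 0
      simp [theta_apply, sp, (Fin.succ_ne_zero _).symm]
    | _ => rfl
  · change (theta 0 0 * (b.elt e).2 (sp i) - theta 0 (sp i) * _ : R) = 0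
    by_cases hb : ∃ j, b = .scalar j
    · obtain ⟨j, rfl⟩ := hb
      have hj : sp i ≠ j := fun hj => h (hj ▸ rfl)
      rw [theta_apply, theta_apply, if_neg (show sp i ≠ 0 from Fin.succ_ne_zero i)]
      change _ * theta j (sp i) - _ = 0
      rw [theta_apply, if_neg hj]
      simp
    · rw [GB1.elt_snd e b fun j hj => hb ⟨j, hj⟩]
      simp [theta_apply, sp]

/-- The coordinates do not see basis elements whose degree is not bounded from below. -/
theorem coord_elt_eq_zero (c b : B2) (h : ¬ c.deg ≤ b.deg) : coord c (b.elt e) = 0 := by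
  have hn : ∃ j, b.num j < c.num j := by
    by_contra! hn
    exact h fun j => by rw [B2.deg_apply, B2.deg_apply]; exact hn j
  by_cases hs : ∃ i, c = .inl (.scalar i)
  · obtain ⟨i, rfl⟩ := hs
    exact coord_scalar_elt e i b fun hb => h (hb ▸ le_rfl)
  by_cases hs' : ∃ i, c = .inr (.scalar i)
  · obtain ⟨i, rfl⟩ := hs'
    cases i using Fin.cases with
    | zero => exact absurd (show (0 : Multi) ≤ _ from zero_le) h
    | succ i => exact coord_theta0_scalar_elt e i b fun hb => h (hb ▸ le_rfl)
  · rw [coord_eq_coordL c _ _ (b.elt_fst e) (fun i hi => hs ⟨i, hi⟩) (fun i hi => hs' ⟨i, hi⟩),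
      coordL_rep, coordEntry_eq_zero c b hn, Int.cast_zero]

theorem anchor_elt (a a' : Fin 4) (b : B2) :
    anchor a a' (b.elt e) = anchorL a a' (b.rep e) := by
  change (I2 R).liftQ (anchorL a a') (I2_le_ker_anchorL a a') (b.elt e).1 = _
  rw [b.elt_fst]; rfl

theorem anchorL_theta0 (b : GB1) (a a' : Fin 4) : anchorL a a' (B2.rep e (.inr b)) =
    (if a = 0 then ((b.elt e).1 a').2 else 0) - if a' = 0 then ((b.elt e).1 a).2 else 0 := by
  change anchorL a a' (∑ i, th2 0 i ((b.elt e).1 i)) = _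
  rw [map_sum]
  simp only [anchorL_th2, theta_apply, sub_smul, sum_sub_distrib]
  congr 1
  · rw [sum_eq_single a' (fun i _ hi => by simp [hi.symm]) (by simp)]; simp
  · rw [sum_eq_single a (fun i _ hi => by simp [hi.symm]) (by simp)]; simp

theorem GB1.elt_anchor (b : GB1) (a : Fin 4) (h : ∀ i μ, b = .frame i μ → a ≠ sp i) :
    ((b.elt e).1 a).2 = 0 := by
  cases b with
  | frame i μ =>
    change (theta (sp i) a : R) • e μ = 0
    rw [theta_apply, if_neg (h i μ rfl), zero_smul]
  | _ => simp [GB1.elt, th1, tens, sigma0, boost, rot, sigma]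

theorem anchor_zero_elt (i : Fin 3) (b : B2) (h : ∀ μ, b ≠ .inr (.frame i μ)) :
    anchor 0 (sp i) (b.elt e) = 0 := by
  rw [anchor_elt]
  rcases b with b | b
  · cases b with
    | frame j μ =>
      change anchorL 0 (sp i) (th2 (sp (j + 1)) (sp (j + 2)) (ofDer (e μ))) = 0
      simp [anchorL_th2, theta_apply, sp, (Fin.succ_ne_zero _).symm]
    | scalar j => exact map_zero _
    | _ => simp [B2.rep, GB2.preElt, anchorL_th2, boost, rot, sigma, sigma0]
  · rw [anchorL_theta0, GB1.elt_anchor e b 0 (fun i μ _ => (Fin.succ_ne_zero i).symm)]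
    rw [GB1.elt_anchor e b (sp i) (fun j μ hb hj => h μ (by rw [hb, Fin.succ_injective _ hj]))]
    simp

theorem anchor_sp_elt (i : Fin 3) (b : B2) (h : ∀ μ, b ≠ .inl (.frame i μ)) :
    anchor (sp (i + 1)) (sp (i + 2)) (b.elt e) = 0 := by
  rw [anchor_elt]
  rcases b with b | b
  · cases b with
    | frame j μ =>
      have hj : j ≠ i := fun hj => h μ (hj ▸ rfl)
      change anchorL (sp (i + 1)) (sp (i + 2)) (th2 (sp (j + 1)) (sp (j + 2)) (ofDer (e μ))) = 0
      rw [anchorL_th2]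
      simp only [theta_apply]
      revert hj
      fin_cases i <;> fin_cases j <;> simp [sp]
    | scalar j => exact map_zero _
    | _ => simp [B2.rep, GB2.preElt, anchorL_th2, boost, rot, sigma, sigma0]
  · rw [anchorL_theta0]
    simp [sp]

end Coordinates

section Leading

variable {e' : Fin 4 → Derivation ℝ R R}

/-- The Maurer-Cartan equations for leading coefficients.  The frames that enter the grading and the
equations may be different. -/
theorem mcSum_leading (he : LinearIndependent R e) (h0 : ∀ μ ν, ⁅e μ, e ν⁆ = derOf e (C μ ν))
    (hC : ∀ ν, C 0 ν = 0) {g : Multi → GB1 → R}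
    (h : serBr11 (gaugedSeries e g) (gaugedSeries e g) ∈ sRees B2.deg (B2.elt e') R) (c : B2) :
    mcSum e C c g c.deg = 0 := by
  have h00 : ∀ μ, ⁅e 0, e μ⁆ = 0 := fun μ => by rw [h0, hC]; simp [derOf]
  have two : ∀ x : R, 2 * x = 0 → x = 0 := fun x hx => by
    rw [two_mul, ← two_smul ℝ] at hx
    exact (smul_eq_zero_iff_right two_ne_zero).1 hx
  by_cases hc : c.IsFrame
  · rcases c with c | c <;> cases c <;> try exact hc.elim
    · rename_i i μ
      have := functional_sRees (anchor (sp (i + 1)) (sp (i + 2))) (d := deg211 i)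
        (fun b hb => anchor_sp_elt e' i b fun μ hb' => hb (hb' ▸ le_rfl)) h
      rw [anchor_serBr11 (C := C) h0] at this
      exact two _ (Fintype.linearIndependent_iff.1 he _ this μ)
    · rename_i i μ
      have := functional_sRees (anchor 0 (sp i)) (d := deg011 i)
        (fun b hb => anchor_zero_elt e' i b fun μ hb' => hb (hb' ▸ le_rfl)) h
      rw [anchor_serBr11_zero (C := C) h00] at this
      exact two _ (Fintype.linearIndependent_iff.1 he _ this μ)
  · have := functional_sRees (coord c) (fun b hb => coord_elt_eq_zero e' c b hb) h
    rw [coord_serBr11 e C c hc] at this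
    exact two _ this

end Leading

section Coefficients

variable (e)

/-- The coefficients of a gauged series with respect to the full basis. -/
def fullCoef (g : Multi → GB1 → R) (α : Multi) : B1 → R :=
  Sum.elim (g α) fun b => if b = .der 0 ∧ α = 0 then 1 else 0

theorem gaugedSeries_eq (g : Multi → GB1 → R) (α : Multi) :
    gaugedSeries e g α = ∑ b, fullCoef g α b • b.elt e := by
  rw [gaugedSeries, gauged, Fintype.sum_sum_type, add_comm]
  congr 1
  rw [sum_eq_single (.der 0) (fun b _ hb => by simp [fullCoef, hb]) (by simp)]
  by_cases h : α = 0 <;> simp [fullCoef, withUnit, h, B1.elt]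

theorem fullCoef_eq_zero {g : Multi → GB1 → R} (hg : IsFiltered g) (α : Multi) (b : B1)
    (h : ¬ b.deg ≤ α) : fullCoef g α b = 0 := by
  rcases b with b | b
  · exact hg α b h
  · rw [fullCoef, Sum.elim_inr, if_neg]
    rintro ⟨rfl, -⟩
    exact h zero_le

theorem gaugedSeries_mem {g : Multi → GB1 → R} (hg : IsFiltered g) : gaugedSeries e g ∈ P1 e :=
  mem_rees.2 fun α => mem_filt_iff.2 ⟨_, fullCoef_eq_zero hg α, gaugedSeries_eq e g α⟩

theorem series_eq (f : B1 → R) (α : Multi) :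
    series e f α = ∑ b : B1, (if b.deg = α then f b else 0) • b.elt e := by
  rw [series]
  refine sum_congr rfl fun b _ => ?_
  split_ifs <;> simp

theorem toA_eq_iff {x y : Multi → E1 R} :
    toA e x = toA e y ↔ x - y ∈ sRees B1.deg (B1.elt e) R := by
  simp only [toA, Submodule.mkQ_apply]
  exact Submodule.Quotient.eq _

theorem toA_eq_ofCoeff {u : Multi → E1 R} {c : Multi → B1 → R} (hc : ∀ α b, ¬ b.deg ≤ α → c α b = 0)
    (hu : ∀ α, u α = ∑ b, c α b • b.elt e) : toA e u = ofCoeff e fun b => c b.deg b := by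
  rw [ofCoeff, toA_eq_iff]
  have : u - series e (fun b => c b.deg b) = fun α => ∑ b : B1,
      (c α b - if b.deg = α then c b.deg b else 0) • b.elt e := by
    funext α
    rw [Pi.sub_apply, hu, series_eq, ← sum_sub_distrib]
    simp only [sub_smul]
  rw [this]
  refine mem_sRees_of_leading (deg := B1.deg) (elt := B1.elt e)
    (fun α b => c α b - if b.deg = α then c b.deg b else 0) (fun α b h => ?_) fun b => by simp
  rw [hc α b h, if_neg fun h' => h h'.le, sub_zero]

theorem ofCoeff_injective (hE : LinearIndependent R (B1.elt e)) {f f' : B1 → R}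
    (h : ofCoeff e f = ofCoeff e f') : f = f' := by
  rw [ofCoeff, ofCoeff, toA_eq_iff] at h
  funext b
  have := leading_sRees hE h (b := b)
    (f := fun b' => (if b'.deg = b.deg then f b' else 0) - if b'.deg = b.deg then f' b' else 0) (by
      rw [Pi.sub_apply, series_eq, series_eq, ← sum_sub_distrib]
      simp only [sub_smul])
  simpa [sub_eq_zero] using this

theorem frameOf_atOne_zero (f : B1 → R) :
    frameOf (atOne e f) 0 = derOf e fun μ => f (.inr (.der μ)) := by
  rw [frameOf, atOne_zero]; rfl

theorem frameOf_atOne_sp (f : B1 → R) (i : Fin 3) :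
    frameOf (atOne e f) (sp i) = frameDer e (fun b => f (.inl b)) i := by
  rw [frameOf, atOne_sp]; rfl

theorem linearIndependent_of_nondegenerate {f : B1 → R} (h : Nondegenerate (atOne e f)) :
    LinearIndependent R e := by
  classical
  obtain ⟨h1, h2⟩ := h
  have hspan : ⊤ ≤ Submodule.span R (Set.range e) := by
    rw [← h2, span_le]
    rintro _ ⟨i, rfl⟩
    have hd : ∀ g : Fin 4 → R, derOf e g ∈ Submodule.span R (Set.range e) := fun g =>
      Submodule.sum_mem _ fun μ _ => Submodule.smul_mem _ _ (subset_span ⟨μ, rfl⟩)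
    cases i using Fin.cases with
    | zero =>
      rw [SetLike.mem_coe, frameOf_atOne_zero]
      exact hd _
    | succ i =>
      rw [SetLike.mem_coe, show i.succ = sp i from rfl, frameOf_atOne_sp, frameDer_eq]
      exact hd _
  let b : Module.Basis (Fin 4) R (Derivation ℝ R R) := .mk h1 h2.ge
  let φ : Derivation ℝ R R →ₗ[R] Derivation ℝ R R := b.constr R e
  have hφ : Function.Surjective φ := by
    rw [← LinearMap.range_eq_top, Module.Basis.constr_range]
    exact top_le_iff.1 hspan
  have : Module.Finite R (Derivation ℝ R R) := Module.Finite.of_basis b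
  have hinj := OrzechProperty.injective_of_surjective_endomorphism φ hφ
  have h3 := b.linearIndependent.map' φ (LinearMap.ker_eq_bot.2 hinj)
  have h4 : φ ∘ b = e := funext fun i => b.constr_basis R e i
  rwa [h4] at h3

end Coefficients

section Frames

variable (T : FinalData L)

/-- The components of the frame of a tuple. -/
def FinalData.mat : Matrix (Fin 3) (Fin 3) (SmoothM M) := Matrix.of T.d

theorem isUnit_det {A : Matrix (Fin 3) (Fin 3) (SmoothM M)}
    (h : ∀ x, (Matrix.of fun i a => A i a x).det ≠ 0) : IsUnit A.det := by
  obtain ⟨u, hu⟩ := exists_inv (g := A.det) fun y => by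
    have := (evalAt y).map_det A
    change A.det y = _ at this
    rw [this]
    exact h y
  exact IsUnit.of_mul_eq_one u (by rwa [mul_comm])

theorem FinalData.isUnit_mat : IsUnit T.mat.det := isUnit_det T.frame

theorem FinalData.derM_eq (a : Fin 3) : L.derM a = ∑ i, T.mat⁻¹ a i • T.D i := by
  simp only [FinalData.D, vecM, smul_sum, smul_smul]
  rw [sum_comm]
  simp only [← sum_smul]
  have h : ∀ b, ∑ i, T.mat⁻¹ a i * T.d i b = (1 : Matrix (Fin 3) (Fin 3) (SmoothM M)) a b := fun b => by
    rw [← Matrix.nonsing_inv_mul _ T.isUnit_mat]; rfl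
  simp only [h, Matrix.one_apply, ite_smul, one_smul, zero_smul, Finset.sum_ite_eq, Finset.mem_univ,
    if_true]

theorem lie_mem_span {ι : Type*}
    {D : ι → Derivation ℝ R R} (h : ∀ i j, ⁅D i, D j⁆ ∈ Submodule.span R (Set.range D))
    {X Y : Derivation ℝ R R} (hX : X ∈ Submodule.span R (Set.range D))
    (hY : Y ∈ Submodule.span R (Set.range D)) : ⁅X, Y⁆ ∈ Submodule.span R (Set.range D) := by
  have hsmul : ∀ (a : R) (X Y : Derivation ℝ R R), ⁅X, a • Y⁆ = X a • Y + a • ⁅X, Y⁆ := by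
    intro a X Y
    ext r
    simp only [commutator_apply, Derivation.add_apply, smul_apply_derivation, leibniz, smul_eq_mul]
    ring
  have key : ∀ i, ∀ Y ∈ Submodule.span R (Set.range D),
      ⁅D i, Y⁆ ∈ Submodule.span R (Set.range D) := fun i Y hY => by
    induction hY using span_induction with
    | mem x hx => obtain ⟨j, rfl⟩ := hx; exact h i j
    | zero => rw [lie_zero]; exact zero_mem _
    | add x y _ _ hx hy => rw [lie_add]; exact add_mem hx hy
    | smul a x hx' hx =>
      rw [hsmul]
      exact add_mem (Submodule.smul_mem _ _ hx') (Submodule.smul_mem _ _ hx)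
  induction hX using span_induction with
  | mem x hx => obtain ⟨j, rfl⟩ := hx; exact key j Y hY
  | zero => rw [zero_lie]; exact zero_mem _
  | add x y _ _ hx hy => rw [add_lie]; exact add_mem hx hy
  | smul a x hx' hx =>
    rw [← lie_skew, hsmul, neg_add]
    refine add_mem (neg_mem (Submodule.smul_mem _ _ hx')) ?_
    rw [← smul_neg, lie_skew]
    exact Submodule.smul_mem _ _ hx

/-- The tuple with the distinguished frame instead of the given one. -/
theorem FinalData.exists_standard : ∃ T' : FinalData L, T'.p = T.p ∧ T'.der = L.der := by
  classical
  have h1 : ∀ a, L.derM a ∈ Submodule.span (SmoothM M) (Set.range T.D) := fun a => by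
    rw [T.derM_eq]
    exact Submodule.sum_mem _ fun i _ => Submodule.smul_mem _ _ (subset_span ⟨i, rfl⟩)
  have h2 : ∀ i j, ⁅T.D i, T.D j⁆ ∈ Submodule.span (SmoothM M) (Set.range T.D) := fun i j => by
    have := T.bracket i j
    change ⁅T.D i, T.D j⁆ = _ at this
    rw [this]
    exact Submodule.sum_mem _ fun k _ => Submodule.smul_mem _ _ (subset_span ⟨k, rfl⟩)
  have h3 : Submodule.span (SmoothM M) (Set.range T.D) ≤
      Submodule.span (SmoothM M) (Set.range L.derM) := by
    rw [span_le]
    rintro _ ⟨i, rfl⟩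
    rw [FinalData.D, vecM]
    exact Submodule.sum_mem _ fun a _ => Submodule.smul_mem _ _ (subset_span ⟨a, rfl⟩)
  choose c hc using fun a b => (mem_span_range_iff_exists_fun (SmoothM M)).1
    (h3 (lie_mem_span h2 (h1 a) (h1 b)))
  have h4 : ∀ a, vecM L (fun b => if a = b then 1 else 0) = L.derM a := fun a => by simp [vecM]
  refine ⟨{ T with
    d := fun a b => if a = b then 1 else 0
    c := c
    frame := fun x => ?_
    bracket := fun a b => by simp only [h4, hc] }, rfl, ?_⟩
  · have : (Matrix.of fun i a : Fin 3 => (if i = a then (1 : SmoothM M) else 0) x) = 1 := by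
      ext i a
      rw [Matrix.of_apply, Matrix.one_apply]
      split_ifs <;> rfl
    rw [this, Matrix.det_one]
    exact one_ne_zero
  · funext μ
    cases μ using Fin.cases with
    | zero => rfl
    | succ a =>
      change ∑ b, pull (if a = b then (1 : SmoothM M) else 0) • L.derOmega b = L.derOmega a
      rw [sum_eq_single a (fun b _ hb => by rw [if_neg hb.symm]; exact zero_smul _ _) (by simp),
        if_pos rfl]
      exact one_smul _ _

theorem FinalData.linearIndependent (h : LinearIndependent (SmoothOmega M) L.der) :
    LinearIndependent (SmoothOmega M) T.der := by
  rw [Fintype.linearIndependent_iff] at h ⊢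
  intro c hc
  have key : ∑ μ, (Fin.cons (c 0) fun a => ∑ i : Fin 3, c i.succ * pull (T.d i a) :
      Fin 4 → SmoothOmega M) μ • L.der μ = 0 := by
    rw [← hc, Fin.sum_univ_succ (n := 3), Fin.sum_univ_succ (n := 3)]
    congr 1
    simp only [Fin.cons_succ, sum_smul, mul_smul]
    rw [sum_comm]
    refine sum_congr rfl fun i _ => ?_
    change _ = c i.succ • ∑ a, pull (T.d i a) • L.derOmega a
    rw [smul_sum]
    rfl
  have h1 := h _ key
  have h2 : IsUnit (T.mat.map pull).det := by
    have := T.isUnit_mat.map (pullHom : SmoothM M →ₐ[ℝ] SmoothOmega M)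
    rwa [AlgHom.map_det] at this
  have h3 : Matrix.vecMul (fun i : Fin 3 => c i.succ) (T.mat.map pull) = 0 :=
    funext fun a => h1 a.succ
  have h4 : (fun i : Fin 3 => c i.succ) = 0 := by
    have := congrArg (fun v => Matrix.vecMul v (T.mat.map pull)⁻¹) h3
    simp only [Matrix.vecMul_vecMul, Matrix.mul_nonsing_inv _ h2, Matrix.vecMul_one,
      Matrix.zero_vecMul] at this
    exact this
  intro μ
  cases μ using Fin.cases with
  | zero => exact h1 0
  | succ i => exact congrFun h4 i

/-- The passage from coefficients relative to the frame of a tuple to coefficients relative to the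
distinguished frame. -/
def FinalData.toL (g : GB1 → SmoothOmega M) : GB1 → SmoothOmega M
  | .frame i μ => Fin.cases (g (.frame i 0)) (fun a => ∑ j : Fin 3, pull (T.d j a) * g (.frame i j.succ)) μ
  | b => g b

theorem gauged_eq_of {e e' : Fin 4 → Derivation ℝ R R}
    {t : ℝ} {g g' : GB1 → R} (h0 : e 0 = e' 0) (h : ∀ b, (∀ i μ, b ≠ .frame i μ) → g b = g' b)
    (hF : ∀ i, frameDer e g i = frameDer e' g' i) : gauged e t g = gauged e' t g' := by
  have hb : boostCoeff g = boostCoeff g' := by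
    funext i l; simp [boostCoeff, h]
  have hr : rotCoeff g = rotCoeff g' := by
    funext i l; simp [rotCoeff, h]
  refine Prod.ext (funext fun a => ?_) (funext fun i => ?_)
  · cases a using Fin.cases with
    | zero => rw [gauged_zero, gauged_zero, h0]; simp [h]
    | succ i =>
      have := gauged_sp e t g i
      have h2 := gauged_sp e' t g' i
      rw [sp] at this h2
      rw [this, h2, hb, hr, hF, h _ (by simp)]
  · rw [gauged_snd, gauged_snd, h _ (by simp)]

theorem FinalData.gauged_toL (t : ℝ) (g : GB1 → SmoothOmega M) :
    gauged T.der t g = gauged L.der t (T.toL g) := by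
  refine gauged_eq_of rfl (fun b hb => ?_) fun i => ?_
  · cases b <;> first | rfl | exact absurd rfl (hb _ _)
  · rw [frameDer, frameDer, Fin.sum_univ_succ (n := 3), Fin.sum_univ_succ (n := 3)]
    congr 1
    change ∑ j : Fin 3, g (.frame i j.succ) • ∑ a, pull (T.d j a) • L.derOmega a =
      ∑ a : Fin 3, (∑ j : Fin 3, pull (T.d j a) * g (.frame i j.succ)) • L.derOmega a
    simp only [smul_sum, sum_smul, smul_smul]
    rw [sum_comm]
    simp only [mul_comm]

theorem FinalData.isFiltered_toL {g : Multi → GB1 → SmoothOmega M} (h : IsFiltered g) :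
    IsFiltered fun α => T.toL (g α) := fun α b hb => by
  cases b with
  | frame i μ =>
    cases μ using Fin.cases with
    | zero => exact h α _ hb
    | succ a =>
      change ∑ j : Fin 3, pull (T.d j a) * g α (.frame i j.succ) = 0
      exact sum_eq_zero fun j _ => by rw [h α (.frame i j.succ) hb, mul_zero]
  | _ => exact h α _ hb

theorem pull_mem_polyWeight (p : Fin 3 → SmoothM M) (f : SmoothM M) : pull f ∈ polyWeight p 0 :=
  mem_polyWeight.2 ⟨Polynomial.C f, by rw [weight_zero, one_mul, tauEval_C]⟩

theorem FinalData.toL_mem (hp : ∀ i y, 0 < T.p i y) {α : Multi} {g : GB1 → SmoothOmega M}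
    (h : ∀ b, g b ∈ polyWeight T.p α) (b : GB1) : T.toL g b ∈ polyWeight T.p α := by
  cases b with
  | frame i μ =>
    cases μ using Fin.cases with
    | zero => exact h _
    | succ a =>
      change ∑ j : Fin 3, pull (T.d j a) * g (.frame i j.succ) ∈ _
      refine Submodule.sum_mem _ fun j _ => ?_
      have := (T.weighted hp).mul_mem (pull_mem_polyWeight T.p (T.d j a)) (h (.frame i j.succ))
      rwa [zero_add] at this
  | _ => exact h _

/-- The leading coefficients of the element that belongs to a tuple, relative to the frame of the
tuple. -/
def FinalData.lead : GB1 → SmoothOmega M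
  | .frame i μ => Fin.cases 0 (fun j => if i = j then weight T.p (deg011 i) else 0) μ
  | b => T.coeff (.inl b)

theorem FinalData.toL_lead (b : GB1) : T.toL T.lead b = T.coeff (.inl b) := by
  cases b with
  | frame i μ =>
    cases μ using Fin.cases with
    | zero => rfl
    | succ a =>
      change ∑ j : Fin 3, pull (T.d j a) * (if i = j then weight T.p (deg011 i) else 0) =
        weight T.p (deg011 i) * pull (T.d i a)
      simp [mul_comm]
  | _ => rfl

end Frames

section Parity

theorem Biadd.zsmul {A N : Type*} [AddCommGroup A] [AddCommGroup N] {B : A → A → N} (h : Biadd B)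
    (m n : ℤ) (x y : A) : B (m • x) (n • y) = (m * n) • B x y := by
  have h1 : ∀ z, B (m • x) z = m • B x z := fun z =>
    map_zsmul (AddMonoidHom.mk' (fun x => B x z) fun x y => h.left x y z) m x
  have h2 : B x (n • y) = n • B x y := map_zsmul (AddMonoidHom.mk' (B x) (h.right x)) n y
  rw [h1, h2, mul_smul]

variable (e)

/-- The sign that is associated to the parity of a multi-index. -/
def paritySign (α : Multi) : ℤ := (-1) ^ α.degree

theorem paritySign_add (α β : Multi) : paritySign (α + β) = paritySign α * paritySign β := by
  rw [paritySign, map_add, pow_add]; rfl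

theorem gaugedSeries_paritySign (g : Multi → GB1 → R) (α : Multi) :
    gaugedSeries e (fun α b => paritySign α • g α b) α = paritySign α • gaugedSeries e g α := by
  simp only [gaugedSeries, gauged, withUnit, smul_add, smul_sum, smul_assoc]
  congr 1
  by_cases h : α = 0
  · simp [h, paritySign]
  · simp [h]

theorem serBr11_paritySign (g : Multi → GB1 → R) (α : Multi) :
    serBr11 (gaugedSeries e fun α b => paritySign α • g α b)
      (gaugedSeries e fun α b => paritySign α • g α b) α =
      paritySign α • serBr11 (gaugedSeries e g) (gaugedSeries e g) α := by
  rw [serBr11, serBr11, smul_sum]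
  refine sum_congr rfl fun q hq => ?_
  rw [gaugedSeries_paritySign, gaugedSeries_paritySign]
  refine (Biadd.zsmul biadd_br11 _ _ _ _).trans ?_
  rw [← paritySign_add, mem_antidiagonal.1 hq]

theorem GB1.even_degree (b : GB1) : Even b.deg.degree := by
  rw [Finsupp.degree_eq_sum]
  simp only [GB1.deg_apply]
  revert b
  decide

end Parity

section Solutions

theorem linearIndependent_of_mem {x : (Multi → E1 (SmoothOmega M)) ⧸
    sRees B1.deg (B1.elt L.der) (SmoothOmega M)} (hx : x ∈ MCGaugedPos L) :
    LinearIndependent (SmoothOmega M) L.der := by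
  obtain ⟨⟨⟨-, f, -, hf⟩, -⟩, -⟩ := hx
  exact linearIndependent_of_nondegenerate _ hf

theorem FinalData.pos_of_leading (T : FinalData L) (hT : T.leading ∈ MCGaugedPos L) (i : Fin 3)
    (y : M) : 0 < T.p i y := by
  have hB := linearIndependent_B1 _ (linearIndependent_of_mem hT)
  obtain ⟨-, f, hf, hpos⟩ := hT
  rw [← ofCoeff_injective _ hB hf] at hpos
  exact hpos i (⟨0, le_rfl⟩, y)

/-- The coefficients of the element that belongs to a tuple. -/
theorem FinalData.coeff_eq (T : FinalData L) (b : B1) : T.coeff b =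
    Sum.elim (fun b => T.coeff (.inl b)) (fun b => if b = .der 0 then 1 else 0) b := by
  rcases b with b | b
  · rfl
  · cases b <;> simp [FinalData.coeff]

theorem toA_gaugedSeries (T : FinalData L) {g : Multi → GB1 → SmoothOmega M} (hf : IsFiltered g)
    (hl : ∀ b, g b.deg b = T.coeff (.inl b)) : toA L.der (gaugedSeries L.der g) = T.leading := by
  rw [toA_eq_ofCoeff L.der (fullCoef_eq_zero hf) (gaugedSeries_eq L.der g), FinalData.leading]
  congr 1
  funext b
  rw [T.coeff_eq]
  rcases b with b | b
  · exact hl b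
  · change (if b = .der 0 ∧ b.deg = 0 then (1 : SmoothOmega M) else 0) = _
    by_cases hb : b = .der 0
    · subst hb; simp [GB0.deg]
    · simp [hb]

theorem isUnit_weight (p : Fin 3 → SmoothM M) (α : Multi) : IsUnit (weight p α) := by
  have h1 : weight p α * expNeg (-∑ i, α i • p i) = 1 := by
    ext z
    change Real.exp _ * Real.exp _ = 1
    rw [← Real.exp_add, Real.exp_eq_one_iff]
    have : (-∑ i, α i • p i : SmoothM M) z.2 = -((∑ i, α i • p i : SmoothM M) z.2) := rfl
    rw [this]
    ring
  exact IsUnit.of_mul_eq_one _ h1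

theorem mem_Pp1 {p : Fin 3 → SmoothM M} {g : Multi → GB1 → SmoothOmega M} (hf : IsFiltered g)
    (hg : ∀ α b, g α b ∈ polyWeight p α) : gaugedSeries L.der g ∈ Pp1 L p := by
  have h0 : (0 : SmoothOmega M) ∈ polyTau (M := M) := mem_polyTau.2 ⟨0, tauEval_zero.symm⟩
  have : gaugedSeries L.der g = fun α => ∑ b, fullCoef g α b • b.elt L.der :=
    funext fun α => gaugedSeries_eq _ _ _
  rw [this]
  refine mem_reesBar_of_coeff (deg := B1.deg) (elt := B1.elt L.der) (fullCoef g)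
    (fullCoef_eq_zero hf) h0 (fun α b => ?_) fun α => ?_
  · rcases b with b | b
    · obtain ⟨q, hq⟩ := mem_polyWeight.1 (hg α b)
      exact ⟨_, mem_polyTau.2 ⟨q, rfl⟩, hq⟩
    · rw [fullCoef, Sum.elim_inr]
      split_ifs with h
      · refine ⟨1, mem_polyTau.2 ⟨1, ?_⟩, by rw [h.2, weight_zero, one_mul]⟩
        rw [← Polynomial.C_1, tauEval_C]; rfl
      · exact ⟨0, h0, by rw [mul_zero]⟩
  · exact isUnit_weight p α

theorem mc_of_mcSum {e : Fin 4 → Derivation ℝ R R}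
    {C : Fin 4 → Fin 4 → Fin 4 → R} (he : LinearIndependent R e)
    (h0 : ∀ μ ν, ⁅e μ, e ν⁆ = derOf e (C μ ν)) (hC : ∀ ν, C 0 ν = 0) {g : Multi → GB1 → R}
    {α : Multi} (h : serBr11 (gaugedSeries e g) (gaugedSeries e g) α = 0) (c : B2) :
    mcSum e C c g α = 0 := by
  have h00 : ∀ μ, ⁅e 0, e μ⁆ = 0 := fun μ => by rw [h0, hC]; simp [derOf]
  have two : ∀ x : R, 2 * x = 0 → x = 0 := fun x hx => by
    rw [two_mul, ← two_smul ℝ] at hx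
    exact (smul_eq_zero_iff_right two_ne_zero).1 hx
  by_cases hc : c.IsFrame
  · rcases c with c | c <;> cases c <;> try exact hc.elim
    · rename_i i μ
      have := anchor_serBr11 (C := C) h0 i g α
      rw [h, map_zero] at this
      exact two _ (Fintype.linearIndependent_iff.1 he _ this.symm μ)
    · rename_i i μ
      have := anchor_serBr11_zero (C := C) h00 i g α
      rw [h, map_zero] at this
      exact two _ (Fintype.linearIndependent_iff.1 he _ this.symm μ)
  · have := coord_serBr11 e C c hc g α
    rw [h, map_zero] at this
    exact two _ this.symm

/-- Gauged solutions are determined by their leading coefficients. -/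
theorem FinalData.eq_of_gauged (T : FinalData L) (hp : ∀ i y, 0 < T.p i y)
    (he : LinearIndependent (SmoothOmega M) L.der)
    {g g' : Multi → GB1 → SmoothOmega M} (hf : IsFiltered g) (hf' : IsFiltered g')
    (hg : ∀ α b, g α b ∈ polyWeight T.p α) (hg' : ∀ α b, g' α b ∈ polyWeight T.p α)
    (hl : ∀ b, g b.deg b = T.coeff (.inl b)) (hl' : ∀ b, g' b.deg b = T.coeff (.inl b))
    (h : serBr11 (gaugedSeries L.der g) (gaugedSeries L.der g) = 0)
    (h' : serBr11 (gaugedSeries L.der g') (gaugedSeries L.der g') = 0) : g = g' := by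
  obtain ⟨T', hT', hd⟩ := T.exists_standard
  have h0 : ∀ μ ν, ⁅L.der μ, L.der ν⁆ = derOf L.der (T'.struct μ ν) := fun μ ν => by
    rw [← hd]; exact T'.lie_der μ ν
  have hW := T'.weighted (hT' ▸ hp)
  rw [hd, hT'] at hW
  exact eq_of_evolution (C := T'.struct) hW hf hf' hg hg' (fun b => (hl b).trans (hl' b).symm)
    (fun i => hl (.diag i)) (fun α b => mc_of_mcSum he h0 T'.struct_zero (congrFun h α) _)
    (fun α b => mc_of_mcSum he h0 T'.struct_zero (congrFun h' α) _)

theorem FinalData.eq_zero_of_odd (T : FinalData L) (hp : ∀ i y, 0 < T.p i y)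
    (he : LinearIndependent (SmoothOmega M) L.der)
    {g : Multi → GB1 → SmoothOmega M} (hf : IsFiltered g)
    (hg : ∀ α b, g α b ∈ polyWeight T.p α) (hl : ∀ b, g b.deg b = T.coeff (.inl b))
    (h : serBr11 (gaugedSeries L.der g) (gaugedSeries L.der g) = 0) {α : Multi}
    (hα : Odd α.degree) : g α = 0 := by
  have key := T.eq_of_gauged hp he (g' := fun α b => paritySign α • g α b) hf
    (fun α b hb => by
      change paritySign α • g α b = 0
      rw [hf α b hb, smul_zero]) hg (fun α b => zsmul_mem (hg α b) _) hl
    (fun b => by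
      change paritySign b.deg • g b.deg b = _
      rw [paritySign, b.even_degree.neg_one_pow, one_smul, hl]) h (funext fun α => by
      rw [serBr11_paritySign, h, Pi.zero_apply, smul_zero])
  funext b
  have h1 : g α b = paritySign α • g α b := congrFun (congrFun key α) b
  rw [paritySign, hα.neg_one_pow, neg_smul, one_smul, eq_neg_iff_add_eq_zero, ← two_smul ℝ] at h1
  exact (smul_eq_zero_iff_right two_ne_zero).1 h1

/-- The evolution equations imply the Maurer-Cartan equations. -/
theorem FinalData.mc_of_evolution (T : FinalData L) (hT : T.leading ∈ MCGaugedPos L)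
    {g : Multi → GB1 → SmoothOmega M} (hf : IsFiltered g)
    (hg : ∀ α b, g α b ∈ polyWeight T.p α) (hl : ∀ b, g b.deg b = T.lead b)
    (hev : ∀ α b, α ≠ b.deg → mcSum T.der T.struct (.inr b) g α = 0) :
    toA L.der (gaugedSeries L.der fun α => T.toL (g α)) = T.leading ∧
    serBr11 (gaugedSeries L.der fun α => T.toL (g α))
      (gaugedSeries L.der fun α => T.toL (g α)) = 0 := by
  have heq : (gaugedSeries L.der fun α => T.toL (g α)) = gaugedSeries T.der g :=
    funext fun α => (T.gauged_toL _ _).symm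
  have hp := T.pos_of_leading hT
  have he := T.linearIndependent (linearIndependent_of_mem hT)
  have hfL := T.isFiltered_toL hf
  have h1 : toA L.der (gaugedSeries L.der fun α => T.toL (g α)) = T.leading :=
    toA_gaugedSeries T hfL fun b => by
      rw [← T.toL_lead]
      cases b with
      | frame i μ =>
        have : ∀ μ, g (deg011 i) (.frame i μ) = T.lead (.frame i μ) := fun μ => hl (.frame i μ)
        simp only [FinalData.toL, GB1.deg, this]
      | _ => exact hl _
  refine ⟨h1, ?_⟩
  have h2 := hT.1.1.1.1.2 _ (gaugedSeries_mem L.der hfL) h1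
  rw [heq] at h2 ⊢
  have h3 := mcSum_leading he T.lie_der T.struct_zero h2
  have h4 : ∀ b α, mcSum T.der T.struct (.inr b) g α = 0 := fun b α => by
    by_cases hb : α = b.deg
    · rw [hb]; exact h3 (.inr b)
    · exact hev α b hb
  refine serBr11_gaugedSeries_eq_zero T.lie_der T.struct_zero g fun c α => ?_
  rcases c with c | c
  · exact constraints_vanish (T.weighted hp) hf (fun i => hl (.diag i)) he T.lie_der T.struct_zero
      T.struct_mem hg h4 (fun c => h3 (.inl c)) c α
  · exact h4 c α

end Solutions

section Universal

theorem mem_of_forall_eq {f g : Family L} {S : Submodule ℝ (Family L)} (h : f ∈ S)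
    (he : ∀ T, f T = g T) : g ∈ S :=
  funext he ▸ h

theorem Family.mem_W {α : Multi} {n : ℕ} {b : Family L} (hb : b ∈ Family.univ L n) (k : ℕ) :
    (fun T => weight T.1.p α * (b T * tauMap ^ k)) ∈ Family.Wt L α n :=
  subset_span ⟨b, hb, k, rfl⟩

theorem Family.mem_W_zero {α : Multi} {n : ℕ} {b : Family L} (hb : b ∈ Family.univ L n) :
    (fun T => weight T.1.p α * b T) ∈ Family.Wt L α n := by
  simpa using Family.mem_W (α := α) hb 0

theorem Family.mem_W_one {α : Multi} {n : ℕ} {b : Family L} (hb : b ∈ Family.univ L n) :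
    (fun T => weight T.1.p α * (tauMap * b T)) ∈ Family.Wt L α n := by
  simpa [mul_comm] using Family.mem_W (α := α) hb 1

theorem degree_deg011 (i : Fin 3) : (deg011 i).degree = 2 := by
  rw [Finsupp.degree_eq_sum]
  simp only [deg011_apply]
  revert i; decide

theorem Family.lead_mem (b : GB1) : (fun T : PosData L => T.1.lead b) ∈
    Family.Wt L b.deg b.deg.degree := by
  have hj : ∀ (j : Jet) {n : ℕ}, j.order ≤ n → (j.family : Family L) ∈ Family.univ L n :=
    fun j n h => Jet.family_mem h
  have h2 : ∀ i, (deg011 i).degree = 2 := degree_deg011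
  cases b with
  | diag i =>
    have := Family.mem_W_zero (α := 0) (hj (.p [] i) (n := 0) le_rfl)
    change _ ∈ Family.Wt L 0 (0 : Multi).degree
    rw [map_zero]
    refine mem_of_forall_eq this fun T => ?_
    rw [weight_zero, one_mul]; rfl
  | curv i =>
    have := Family.mem_W_zero (α := 2 • unit i) (hj (.c [] (i + 1) (i + 2) i)
      (n := (2 • unit i).degree) (Nat.zero_le _))
    exact neg_mem (Submodule.smul_mem _ (1 / 2 : ℝ) this)
  | frame i μ =>
    cases μ using Fin.cases with
    | zero => exact zero_mem _
    | succ j =>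
      by_cases h : i = j
      · have := Family.mem_W_zero (α := deg011 i) (one_mem (Family.univ L (deg011 i).degree))
        refine mem_of_forall_eq this fun T => ?_
        change _ = if i = j then weight T.1.p (deg011 i) else 0
        rw [if_pos h]
        exact mul_one _
      · refine mem_of_forall_eq (zero_mem _) fun T => ?_
        change _ = if i = j then weight T.1.p (deg011 i) else 0
        rw [if_neg h]; rfl
  | conf i =>
    have a := Family.mem_W_zero (α := deg011 i) (hj (.zeta [i]) (n := 2) (by simp [Jet.order]))
    have b := Family.mem_W_one (α := deg011 i) (sum_mem fun l (_ : l ∈ Finset.univ) =>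
      hj (.p [i] l) (n := 2) (by simp [Jet.order]))
    change _ ∈ Family.Wt L (deg011 i) (deg011 i).degree
    rw [h2]
    refine mem_of_forall_eq (sub_mem b a) fun T => ?_
    change _ * (_ * (∑ l, (Jet.p [i] l).family) T) - _ = -(weight T.1.p (deg011 i) *
      (pull (T.1.D i T.1.zeta) - tauMap * pull (T.1.D i (∑ l, T.1.p l))))
    rw [Finset.sum_apply, map_sum, ← pullHom_apply (T.1.D i T.1.zeta), ← pullHom_apply, map_sum]
    change weight T.1.p (deg011 i) * (tauMap * ∑ l, pull (T.1.D i (T.1.p l))) -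
      weight T.1.p (deg011 i) * pull (T.1.D i T.1.zeta) = -(weight T.1.p (deg011 i) *
      (pull (T.1.D i T.1.zeta) - tauMap * ∑ l, pull (T.1.D i (T.1.p l))))
    ring
  | sym i => exact zero_mem _
  | rotK i =>
    have a := Family.mem_W_zero (α := deg011 i) (hj (.zeta [i]) (n := 2) (by simp [Jet.order]))
    have b := Family.mem_W_zero (α := deg011 i) (hj (.c [] (i + 2) i (i + 2)) (n := 2) (by simp [Jet.order]))
    have c := Family.mem_W_one (α := deg011 i) (hj (.p [i] (i + 2)) (n := 2) (by simp [Jet.order]))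
    change _ ∈ Family.Wt L (deg011 i) (deg011 i).degree
    rw [h2]
    refine mem_of_forall_eq (sub_mem (add_mem a b) c) fun T => ?_
    change weight T.1.p (deg011 i) * pull (T.1.D i T.1.zeta) + weight T.1.p (deg011 i) *
      pull (T.1.c (i + 2) i (i + 2)) - weight T.1.p (deg011 i) * (tauMap * pull (T.1.D i (T.1.p (i + 2)))) =
      weight T.1.p (deg011 i) * (pull (T.1.D i T.1.zeta) + pull (T.1.c (i + 2) i (i + 2)) -
        tauMap * pull (T.1.D i (T.1.p (i + 2))))
    ring
  | rotJ i =>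
    have a := Family.mem_W_zero (α := deg011 i) (hj (.zeta [i]) (n := 2) (by simp [Jet.order]))
    have b := Family.mem_W_zero (α := deg011 i) (hj (.c [] i (i + 1) (i + 1)) (n := 2) (by simp [Jet.order]))
    have c := Family.mem_W_one (α := deg011 i) (hj (.p [i] (i + 1)) (n := 2) (by simp [Jet.order]))
    change _ ∈ Family.Wt L (deg011 i) (deg011 i).degree
    rw [h2]
    refine mem_of_forall_eq (sub_mem (add_mem b c) a) fun T => ?_
    change weight T.1.p (deg011 i) * pull (T.1.c i (i + 1) (i + 1)) + weight T.1.p (deg011 i) *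
      (tauMap * pull (T.1.D i (T.1.p (i + 1)))) - weight T.1.p (deg011 i) * pull (T.1.D i T.1.zeta) =
      -(weight T.1.p (deg011 i) * (pull (T.1.D i T.1.zeta) - pull (T.1.c i (i + 1) (i + 1)) -
        tauMap * pull (T.1.D i (T.1.p (i + 1)))))
    ring
  | asym i => exact zero_mem _
  | scalar m =>
    cases m using Fin.cases with
    | zero =>
      have := Family.mem_W_zero (α := 0) (hj (.p0 []) (n := 0) le_rfl)
      change _ ∈ Family.Wt L 0 (0 : Multi).degree
      rw [map_zero]
      refine mem_of_forall_eq this fun T => ?_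
      rw [weight_zero, one_mul]; rfl
    | succ i =>
      have a := Family.mem_W_zero (α := deg011 i) (hj (.chi [i]) (n := 2) (by simp [Jet.order]))
      have b := Family.mem_W_one (α := deg011 i) (hj (.p0 [i]) (n := 2) (by simp [Jet.order]))
      change _ ∈ Family.Wt L (deg011 i) (deg011 i).degree
      rw [h2]
      refine mem_of_forall_eq (add_mem a b) fun T => ?_
      change weight T.1.p (deg011 i) * pull (T.1.D i T.1.chi) +
        weight T.1.p (deg011 i) * (tauMap * pull (T.1.D i T.1.p0)) =
        weight T.1.p (deg011 i) * (pull (T.1.D i T.1.chi) + tauMap * pull (T.1.D i T.1.p0))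
      ring

theorem Family.frameDer_apply (f : GB1 → Family L) (i : Fin 3) (h : Family L) (T : PosData L) :
    frameDer Family.der f i h T = frameDer T.1.der (fun b => f b T) i (h T) := by
  rw [frameDer_eq, frameDer_eq, derOf_apply, derOf_apply, Finset.sum_apply]
  rfl

theorem Family.mcSum_apply (C : Fin 4 → Fin 4 → Fin 4 → Family L) (g : Multi → GB1 → Family L)
    (b : GB1) (α : Multi) (T : PosData L) (C' : Fin 4 → Fin 4 → Fin 4 → SmoothOmega M) :
    mcSum Family.der C (.inr b) g α T = mcSum T.1.der C' (.inr b) (fun α b => g α b T) α := by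
  rw [mcSum_eq, mcSum_eq, Pi.add_apply]
  congr 1
  · have h := map_list_sum (Pi.evalAddMonoidHom (fun _ : PosData L => SmoothOmega M) T)
      ((quad (.inr b)).map fun t => termSum Family.der C t g α)
    refine h.trans ?_
    rw [List.map_map]
    refine congrArg List.sum (List.map_congr_left fun t ht => ?_)
    change termSum Family.der C t g α T = _
    rw [termSum, termSum, Finset.sum_apply]
    refine sum_congr rfl fun q _ => ?_
    have ht := isBilin_of_mem_quad b t ht
    cases t with
    | mul n b b' => rfl
    | der n i b =>
      simp only [QTerm.eval, Pi.mul_apply, Family.frameDer_apply]; rfl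
    | lin n b => exact ht.elim
    | struct i μ => exact ht.elim

variable (L) in
/-- Universal solutions of the evolution equations. -/
theorem exists_universal : ∃ g : Multi → GB1 → Family L,
    (∀ T, IsFiltered fun α b => g α b T) ∧ (∀ α b, g α b ∈ Family.Wt L α α.degree) ∧
    (∀ b T, g b.deg b T = T.1.lead b) ∧
    ∀ T α b, α ≠ b.deg → mcSum T.1.der T.1.struct (.inr b) (fun α b => g α b T) α = 0 := by
  obtain ⟨g, h1, h2, h3, h4⟩ := exists_evolution (Family.base L).orderWeighted
    (l := fun b T => T.1.lead b) Family.lead_mem fun i => rfl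
  refine ⟨g, fun T α b hb => congrFun (h1 α b hb) T, h3, fun b T => congrFun (h2 b) T,
    fun T α b hb => ?_⟩
  rw [← Family.mcSum_apply 0 g b α T]
  exact congrFun (h4 0 α b hb) T

/-- The polynomials for the coefficients relative to the distinguished frame. -/
def toLPoly (Q : GB1 → Polynomial (MvPolynomial Jet ℝ)) : GB1 → Polynomial (MvPolynomial Jet ℝ)
  | .frame i μ => Fin.cases (Q (.frame i 0)) (fun a => ∑ j : Fin 3,
      Polynomial.C (MvPolynomial.X (Jet.frame [] j a)) * Q (.frame i j.succ)) μ
  | b => Q b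

theorem toLPoly_coeff_mem {Q : GB1 → Polynomial (MvPolynomial Jet ℝ)} {n : ℕ}
    (h : ∀ b k, (Q b).coeff k ∈ MvPolynomial.supported ℝ {v : Jet | v.order ≤ n}) (b : GB1) (k : ℕ) :
    (toLPoly Q b).coeff k ∈ MvPolynomial.supported ℝ {v : Jet | v.order ≤ n} := by
  cases b with
  | frame i μ =>
    cases μ using Fin.cases with
    | zero => exact h _ _
    | succ a =>
      change (∑ j : Fin 3, Polynomial.C (MvPolynomial.X (Jet.frame [] j a)) *
        Q (.frame i j.succ)).coeff k ∈ _
      rw [Polynomial.finset_sum_coeff]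
      refine sum_mem fun j _ => ?_
      rw [coeff_C_mul]
      exact mul_mem (Algebra.subset_adjoin ⟨_, Nat.zero_le _, rfl⟩) (h _ _)
  | _ => exact h _ _

theorem toL_eq_weight_mul {T : PosData L} {α : Multi} {g : GB1 → SmoothOmega M}
    {Q : GB1 → Polynomial (MvPolynomial Jet ℝ)}
    (h : ∀ b, g b = weight T.1.p α * tauEval ((Q b).map (Jet.polyFn T).toRingHom)) (b : GB1) :
    T.1.toL g b = weight T.1.p α * tauEval ((toLPoly Q b).map (Jet.polyFn T).toRingHom) := by
  cases b with
  | frame i μ =>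
    cases μ using Fin.cases with
    | zero => exact h _
    | succ a =>
      change ∑ j : Fin 3, pull (T.1.d j a) * g (.frame i j.succ) = weight T.1.p α *
        tauEval ((∑ j : Fin 3, Polynomial.C (MvPolynomial.X (Jet.frame [] j a)) *
          Q (.frame i j.succ)).map (Jet.polyFn T).toRingHom)
      simp only [Fin.sum_univ_three, Polynomial.map_add, Polynomial.map_mul, map_C,
        tauEval_add, tauEval_mul, tauEval_C, h]
      have : ∀ j, (Jet.polyFn T).toRingHom (MvPolynomial.X (Jet.frame [] j a)) = T.1.d j a :=
        fun j => MvPolynomial.aeval_X _ _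
      simp only [this]
      ring
  | _ => exact h _

end Universal

section FormalMap

theorem FinalData.coeff_injective {T T' : FinalData L} (hT : T.leading ∈ MCGaugedPos L)
    (h : T'.leading = T.leading) : T'.coeff = T.coeff :=
  ofCoeff_injective _ (linearIndependent_B1 _ (linearIndependent_of_mem hT)) h

theorem FinalData.p_eq {T T' : FinalData L} (hT : T.leading ∈ MCGaugedPos L)
    (h : T'.leading = T.leading) : T'.p = T.p :=
  funext fun i => pull_injective (congrFun (coeff_injective hT h) (.inl (.diag i)))


/-- The map that sends leading terms to formal solutions. -/
theorem exists_formalMap (hA : ∀ x ∈ MCGaugedPos L, ∃ T : FinalData L, T.leading = x) :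
    ∃ (S : MCGaugedPos L → MCP L.der) (Q : Multi → GB1 → Polynomial (MvPolynomial Jet ℝ)),
      (∀ α b k, (Q α b).coeff k ∈ MvPolynomial.supported ℝ {v | v.order ≤ α.degree}) ∧
      ∀ x : MCGaugedPos L, toA L.der (S x).1 = x.1 ∧
        ∀ T : FinalData L, T.leading = x.1 →
          (S x).1 ∈ MCPp L T.p ∧
          (∀ α : Multi, α ≠ 0 → ∃ f : GB1 → SmoothOmega M,
            (∀ b, ¬ b.deg ≤ α → f b = 0) ∧
            (S x).1 α = weight T.p α • ∑ b, f b • b.elt L.der ∧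
            ∀ b z, f b z =
              ((Q α b).map (MvPolynomial.eval (Jet.value T z.2))).eval (tau z)) ∧
          ∀ α : Multi, Odd α.degree → (S x).1 α = 0 := by
  obtain ⟨g, hf, hW, hl, hev⟩ := exists_universal L
  choose Q hQ hQ' using fun α b => Family.exists_of_mem_W (hW α b)
  have hw : ∀ (T : PosData L) α b, g α b T ∈ polyWeight T.1.p α := fun T α b =>
    mem_polyWeight.2 ⟨_, hQ' α b T⟩
  have hmc := fun (T : PosData L) (hT : T.1.leading ∈ MCGaugedPos L) =>
    T.1.mc_of_evolution hT (hf T) (hw T) (fun b => hl b T) (hev T)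
  let h : PosData L → Multi → GB1 → SmoothOmega M := fun T α => T.1.toL fun b => g α b T
  have hh : ∀ T, IsFiltered (h T) := fun T => T.1.isFiltered_toL (hf T)
  have hhw : ∀ (T : PosData L) α b, h T α b ∈ polyWeight T.1.p α := fun T α =>
    T.1.toL_mem T.2 (hw T α)
  have hhl : ∀ (T : PosData L) b, h T b.deg b = T.1.coeff (.inl b) := fun T b => by
    rw [← T.1.toL_lead]
    cases b with
    | frame i μ =>
      have : ∀ μ, g (deg011 i) (.frame i μ) T = T.1.lead (.frame i μ) := fun μ => hl (.frame i μ) T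
      simp only [h, FinalData.toL, GB1.deg, this]
    | _ => exact hl _ T
  choose T₀ hT₀ using hA
  have hpos : ∀ (x : MCGaugedPos L) (T : FinalData L), T.leading = x.1 → T.leading ∈ MCGaugedPos L :=
    fun x T hT => hT ▸ x.2
  let P₀ : MCGaugedPos L → PosData L := fun x =>
    ⟨T₀ x.1 x.2, FinalData.pos_of_leading _ (hpos x _ (hT₀ x.1 x.2))⟩
  have hP₀ : ∀ x, (P₀ x).1.leading = x.1 := fun x => hT₀ x.1 x.2
  have hm₁ : ∀ x, toA L.der (gaugedSeries L.der (h (P₀ x))) = x.1 := fun x => by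
    rw [← hP₀ x]; exact (hmc (P₀ x) (hpos x _ (hP₀ x))).1
  have hm₀ : ∀ x, serBr11 (gaugedSeries L.der (h (P₀ x))) (gaugedSeries L.der (h (P₀ x))) = 0 :=
    fun x => (hmc (P₀ x) (hpos x _ (hP₀ x))).2
  refine ⟨fun x => ⟨gaugedSeries L.der (h (P₀ x)), gaugedSeries_mem _ (hh _),
    hm₀ x⟩, fun α => toLPoly (Q α), fun α b k =>
    toLPoly_coeff_mem (fun b k => hQ α b k) b k, fun x =>
    ⟨hm₁ x, fun T hT => ?_⟩⟩
  have hTm := hpos x T hT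
  have he := linearIndependent_of_mem hTm
  let P : PosData L := ⟨T, T.pos_of_leading hTm⟩
  have hc := FinalData.coeff_injective hTm ((hP₀ x).trans hT.symm)
  have hp := FinalData.p_eq hTm ((hP₀ x).trans hT.symm)
  have heq : h (P₀ x) = h P := T.eq_of_gauged P.2 he (hh _) (hh _)
    (fun α b => by rw [← hp]; exact hhw (P₀ x) α b) (hhw P)
    (fun b => (hhl (P₀ x) b).trans (congrFun hc _)) (hhl P) (hmc _ (hpos x _ (hP₀ x))).2 (hmc P hTm).2
  have h2 := (hmc P hTm).2
  simp only [heq]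
  refine ⟨⟨mem_Pp1 (hh P) (hhw P), gaugedSeries_mem _ (hh P), h2⟩, fun α hα => ?_, fun α hα => ?_⟩
  · have hE : ∀ b, h P α b = weight T.p α *
        tauEval ((toLPoly (Q α) b).map (Jet.polyFn P).toRingHom) :=
      toL_eq_weight_mul fun b => hQ' α b P
    refine ⟨fun b => tauEval ((toLPoly (Q α) b).map (Jet.polyFn P).toRingHom), fun b hb => ?_, ?_,
      fun b z => ?_⟩
    · refine weight_mul_cancel T.p α ?_
      rw [← hE, hh P α b hb, mul_zero]
    · rw [gaugedSeries_eq, Fintype.sum_sum_type, smul_sum]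
      have : ∑ b : GB0, fullCoef (h P) α (.inr b) • B1.elt L.der (.inr b) = 0 :=
        sum_eq_zero fun b _ => by simp [fullCoef, hα]
      rw [this, add_zero]
      exact sum_congr rfl fun b _ => by rw [smul_smul, ← hE]; rfl
    · rw [tauEval_apply, Polynomial.map_map]
      congr 2
      exact RingHom.ext fun q => Jet.polyFn_apply P q z.2
  · have h0 : α ≠ 0 := fun h => by simp [h] at hα
    have := T.eq_zero_of_odd P.2 he (hh P) (hhw P) (hhl P) h2 hα
    rw [gaugedSeries_eq, sum_eq_zero]
    rintro (b | b) -
    · change h P α b • _ = 0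
      rw [this, Pi.zero_apply, zero_smul]
    · simp [fullCoef, h0]

end FormalMap

section Leading

/-- The family of coefficients that is concentrated in the degrees of the basis elements. -/
def concentrated (f : GB1 → R) (α : Multi) (b : GB1) : R := if b.deg = α then f b else 0

theorem concentrated_deg (f : GB1 → R) (b : GB1) : concentrated f b.deg b = f b := if_pos rfl

theorem isFiltered_concentrated (f : GB1 → R) : IsFiltered (concentrated f) := fun _ _ hb =>
  if_neg fun h => hb h.le

theorem sum_antidiagonal_concentrated {N : Type*} [AddCommMonoid N] (F : Multi → Multi → N)
    {β γ α : Multi} (h : ∀ q : Multi × Multi, q ≠ (β, γ) → F q.1 q.2 = 0) :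
    ∑ q ∈ antidiagonal α, F q.1 q.2 = if β + γ = α then F β γ else 0 := by
  split_ifs with hα
  · exact sum_eq_single (β, γ) (fun q _ hq => h q hq) fun hq =>
      (hq (mem_antidiagonal.2 hα)).elim
  · exact sum_eq_zero fun q hq => h q fun hq' =>
      hα (by rw [← mem_antidiagonal.1 hq, hq'])

theorem frameDer_concentrated (f : GB1 → R) (i : Fin 3) (α : Multi) :
    frameDer e (concentrated f α) i = if deg011 i = α then frameDer e f i else 0 := by
  have (μ : Fin 4) : concentrated f α (.frame i μ) = if deg011 i = α then f (.frame i μ) else 0 := rfl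
  simp only [frameDer, this]
  split_ifs <;> simp

theorem termSum_concentrated (f : GB1 → R) (T : QTerm) (α : Multi) :
    termSum e C T (concentrated f) α =
      if T.deg = α then T.eval (frameDer e f) C 1 f f else 0 := by
  have key : ∀ (β γ : Multi) (q : Multi × Multi), q ≠ (β, γ) → β ≠ q.1 ∨ γ ≠ q.2 := by
    rintro β γ ⟨q1, q2⟩ h
    by_contra! h'
    exact h (by rw [h'.1, h'.2])
  cases T with
  | mul n b b' =>
    refine (sum_antidiagonal_concentrated (fun β γ => n * concentrated f β b * concentrated f γ b')
      (β := b.deg) (γ := b'.deg) fun q hq => ?_).trans ?_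
    · rcases key _ _ q hq with h | h <;> simp [concentrated, h]
    · rw [concentrated_deg, concentrated_deg]; rfl
  | der n i b =>
    refine (sum_antidiagonal_concentrated (fun β γ => n * frameDer e (concentrated f β) i
      (concentrated f γ b)) (β := deg011 i) (γ := b.deg) fun q hq => ?_).trans ?_
    · rcases key _ _ q hq with h | h
      · rw [frameDer_concentrated, if_neg h, Derivation.zero_apply, mul_zero]
      · rw [concentrated, if_neg h, (frameDer e _ i).map_zero, mul_zero]
    · rw [concentrated_deg, frameDer_concentrated, if_pos rfl]; rfl
  | lin n b =>
    refine (sum_antidiagonal_concentrated (fun β γ => n * algebraMap ℝ R (withUnit (concentrated f) β).1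
      * concentrated f γ b) (β := 0) (γ := b.deg) fun q hq => ?_).trans ?_
    · rcases key _ _ q hq with h | h
      · simp [withUnit, h.symm]
      · simp [concentrated, h]
    · rw [concentrated_deg, zero_add]
      simp [QTerm.deg, QTerm.eval, withUnit]
  | struct i μ =>
    refine (sum_antidiagonal_concentrated (fun β γ => ∑ ν, ∑ κ, C ν κ μ *
      concentrated f β (.frame (i + 1) ν) * concentrated f γ (.frame (i + 2) κ))
      (β := deg011 (i + 1)) (γ := deg011 (i + 2)) fun q hq => ?_).trans ?_
    · rcases key _ _ q hq with h | h <;> simp [concentrated, GB1.deg, h]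
    · simp only [concentrated, GB1.deg, if_true]; rfl

variable (e C) in
theorem mcSum_concentrated (f : GB1 → R) (c : B2) (α : Multi) : mcSum e C c (concentrated f) α =
    Sum.elim (fun _ => 0) (fun b => mult b * e 0 (concentrated f α b)) c +
      ((quad c).map fun T => if T.deg = α then T.eval (frameDer e f) C 1 f f else 0).sum := by
  simp only [mcSum_eq, termSum_concentrated]

theorem deg011_ne_zero (i : Fin 3) : deg011 i ≠ 0 := fun h => by
  simpa [degree_deg011] using congrArg Finsupp.degree h

theorem deg011_add (i : Fin 3) : deg011 (i + 1) + deg011 (i + 2) = deg211 i := by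
  ext l
  rw [Finsupp.add_apply, deg011_apply, deg011_apply, deg211_apply]
  revert i l; decide

variable {f : GB1 → R} (h : ∀ c, mcSum e C c (concentrated f) c.deg = 0)

include h

theorem leading_diag (i : Fin 3) : e 0 (f (.diag i)) = 0 := by
  have := h (.inr (.diag i))
  rw [mcSum_concentrated] at this
  simpa [quad, zeroTerms, divTerms, waveTerms, QTerm.deg, GB1.deg, B2.deg, mult, concentrated, deg011_ne_zero, unit, sp] using this

theorem leading_scalar : e 0 (f (.scalar 0)) = 0 := by
  have := h (.inr (.scalar 0))
  rw [mcSum_concentrated] at this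
  simpa [quad, zeroTerms, divTerms, waveTerms, QTerm.deg, GB1.deg, B2.deg, mult, concentrated, deg011_ne_zero, unit, sp] using this

theorem leading_frame (hs : ∀ i, f (.sym i) = 0) (ha : ∀ i, f (.asym i) = 0) (i : Fin 3) (μ : Fin 4) :
    e 0 (f (.frame i μ)) + (f (.diag (i + 1)) + f (.diag (i + 2))) * f (.frame i μ) = 0 := by
  have := h (.inr (.frame i μ))
  rw [mcSum_concentrated] at this
  simpa [quad, zeroTerms, divTerms, waveTerms, QTerm.deg, GB1.deg, B2.deg, mult, concentrated, QTerm.eval, hs, ha, add_mul] using this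

theorem leading_torsion (h0 : ∀ μ ν, ⁅e μ, e ν⁆ = derOf e (C μ ν)) (ha : ∀ i, f (.asym i) = 0)
    (i : Fin 3) : ⁅frameDer e f (i + 1), frameDer e f (i + 2)⁆ =
      (f (.conf (i + 2)) + f (.rotK (i + 2))) • frameDer e f (i + 1) -
      (f (.conf (i + 1)) - f (.rotJ (i + 1))) • frameDer e f (i + 2) -
      (2 * f (.curv i)) • frameDer e f i := by
  rw [frameDer_eq, frameDer_eq, lie_derOf h0]
  ext r
  simp only [Derivation.sub_apply, smul_apply_derivation, frameDer_eq, derOf_apply, mul_sum,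
    ← sum_sub_distrib]
  refine sum_congr rfl fun μ _ => ?_
  have : mcSum e C (.inl (.frame i μ)) (concentrated f) (deg211 i) = 0 := h _
  rw [mcSum_concentrated] at this
  have h1 := deg011_add i
  have h2 := (add_comm _ _).trans (deg011_add i)
  have h3 : 2 • unit i + deg011 i = deg211 i := rfl
  have h4 : (if μ = 0 then [QTerm.lin 2 (.asym i)] else []).map (fun T =>
      if T.deg = deg211 i then T.eval (frameDer e f) C 1 f f else 0) =
      if μ = 0 then [(0 : R)] else [] := by
    split_ifs <;> simp [QTerm.eval, ha]
  simp only [quad, Sum.elim_inl, List.map_append, List.sum_append, h4] at this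
  have h5 : (if μ = 0 then [(0 : R)] else []).sum = 0 := by split_ifs <;> simp
  rw [h5] at this
  simp only [map_cons, map_nil, sum_cons, sum_nil, QTerm.deg, GB1.deg, h1, h2,
    h3, if_true, QTerm.eval, frameDer_eq, derOf_apply] at this
  rw [sum_sub_distrib]
  push_cast at this
  linear_combination (e μ r) * this

end Leading

theorem trace_confDer (l : R) (b r : Fin 3 → R)
    (X : Derivation ℝ R R) : algebraMap ℝ R (1 / 4) * (confDer l b r X).1.trace = l := by
  have h : (confDer l b r X).1.trace = 4 * l := by
    simp [confDer, confMatrix, Matrix.trace, Fin.sum_univ_four]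
    ring
  have h4 : (4 : R) = algebraMap ℝ R 4 := (map_ofNat _ 4).symm
  rw [h, h4, ← mul_assoc, ← map_mul]
  norm_num

section LeadingTuple

theorem weight_neg_mul (p : Fin 3 → SmoothM M) (κ : Multi) : weight p κ * weight (-p) κ = 1 := by
  ext z
  change weight p κ z * weight (-p) κ z = 1
  rw [weight_apply, weight_apply, ← Real.exp_add, Real.exp_eq_one_iff]
  have : ∀ i, (-p) i z.2 = -p i z.2 := fun i => rfl
  simp only [this, mul_neg, sum_neg_distrib]
  ring

theorem eq_weight_mul_pull {p : Fin 3 → SmoothM M} {κ : Multi} {F : SmoothOmega M}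
    (h : partial0 F + dot (fun i => pull (p i)) κ * F = 0) : ∃ d, F = weight p κ * pull d := by
  have hd : pull (∑ i, κ i • (-p) i) = -dot (fun i => pull (p i)) κ := by
    rw [← pull_dot, ← pullHom_apply, ← pullHom_apply, ← map_neg, dot, ← sum_neg_distrib]
    congr 1
    refine sum_congr rfl fun i _ => ?_
    rw [nsmul_eq_mul, Pi.neg_apply, mul_neg]
  obtain ⟨d, hd⟩ := eq_pull_of_partial0_eq_zero (f := weight (-p) κ * F) (by
    rw [leibniz, partial0_weight, hd, smul_eq_mul, smul_eq_mul]
    linear_combination weight (-p) κ * h)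
  exact ⟨d, by rw [← hd, ← mul_assoc, weight_neg_mul, one_mul]⟩

theorem eq_tauMap_mul_add_pull {F : SmoothOmega M} {P : SmoothM M} (h : partial0 F = pull P) :
    ∃ ζ, F = tauMap * pull P + pull ζ := by
  obtain ⟨ζ, hζ⟩ := eq_pull_of_partial0_eq_zero (f := F - tauMap * pull P) (by
    rw [map_sub, h, leibniz, partial0_pull, partial0_tauMap]; simp)
  exact ⟨ζ, by rw [← hζ]; ring⟩

theorem derM_mem_span {d : Fin 3 → Fin 3 → SmoothM M}
    (hd : ∀ x, (Matrix.of fun i a => d i a x).det ≠ 0) (a : Fin 3) :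
    L.derM a ∈ Submodule.span (SmoothM M) (Set.range fun i => vecM L (d i)) := by
  have hu := isUnit_det (A := Matrix.of d) hd
  have h : ∀ b, ∑ i, (Matrix.of d)⁻¹ a i * d i b = (1 : Matrix (Fin 3) (Fin 3) (SmoothM M)) a b :=
    fun b => by rw [← Matrix.nonsing_inv_mul _ hu]; rfl
  have h' : L.derM a = ∑ i, (Matrix.of d)⁻¹ a i • vecM L (d i) := by
    simp only [vecM, smul_sum, smul_smul]
    rw [sum_comm]
    simp only [← sum_smul, h]
    simp [Matrix.one_apply]
  rw [h']
  exact Submodule.sum_mem _ fun i _ => Submodule.smul_mem _ _ (subset_span ⟨i, rfl⟩)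

theorem lie_derM_mem_span (hs : Submodule.span (SmoothOmega M) (Set.range L.der) = ⊤) (a b : Fin 3) :
    ⁅L.derM a, L.derM b⁆ ∈ Submodule.span (SmoothM M) (Set.range L.derM) := by
  obtain ⟨c, hc⟩ := (mem_span_range_iff_exists_fun (SmoothOmega M)).1
    (hs ▸ Submodule.mem_top (x := ⁅L.derOmega a, L.derOmega b⁆))
  obtain ⟨t⟩ : Nonempty (EuclideanHalfSpace 1) := ⟨⟨0, le_rfl⟩⟩
  refine (mem_span_range_iff_exists_fun (SmoothM M)).2
    ⟨fun l => slice (c l.succ) t, ?_⟩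
  ext φ y
  have h := congrArg (fun D : Derivation ℝ (SmoothOmega M) (SmoothOmega M) =>
    D (pull φ) (t, y)) hc
  simp only [sum_apply_derivation, smul_apply_derivation, Fin.sum_univ_succ (n := 3),
    Derivation.add_apply, commutator_apply, derOmega_pull] at h
  rw [sum_apply_derivation, commutator_apply]
  have h0 : L.der 0 (pull φ) = 0 := partial0_pull φ
  have h1 : ∀ l : Fin 3, L.der l.succ (pull φ) = pull (L.derM l φ) := fun l => derOmega_pull L l φ
  simp only [h0, h1, mul_zero, zero_add] at h
  rw [eval_sum_omega] at h
  rw [eval_sum_pull]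
  exact h

/-- Every frame has structure functions. -/
theorem exists_tuple (hs : Submodule.span (SmoothOmega M) (Set.range L.der) = ⊤)
    {d : Fin 3 → Fin 3 → SmoothM M} (hd : ∀ x, (Matrix.of fun i a => d i a x).det ≠ 0)
    (p : Fin 3 → SmoothM M) (p0 ζ χ : SmoothM M) : ∃ T : FinalData L,
      T.d = d ∧ T.p = p ∧ T.p0 = p0 ∧ T.zeta = ζ ∧ T.chi = χ := by
  have h1 : Submodule.span (SmoothM M) (Set.range L.derM) ≤
      Submodule.span (SmoothM M) (Set.range fun i => vecM L (d i)) :=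
    Submodule.span_le.2 (by rintro _ ⟨a, rfl⟩; exact derM_mem_span hd a)
  have h2 : ∀ i, vecM L (d i) ∈ Submodule.span (SmoothM M) (Set.range L.derM) := fun i =>
    Submodule.sum_mem _ fun a _ => Submodule.smul_mem _ _ (subset_span ⟨a, rfl⟩)
  choose c hc using fun i j => (mem_span_range_iff_exists_fun (SmoothM M)).1
    (h1 (lie_mem_span (lie_derM_mem_span hs) (h2 i) (h2 j)))
  exact ⟨⟨d, p, p0, ζ, χ, c, hd, fun i j => (hc i j).symm⟩, rfl, rfl, rfl, rfl, rfl⟩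

/-- The components of the torsion equation for a frame `wᵢ Dᵢ`. -/
theorem FinalData.torsion (T : FinalData L) (he : LinearIndependent (SmoothOmega M) L.der)
    {i : Fin 3} {w : Fin 3 → SmoothOmega M} {A B N : SmoothOmega M}
    (h : ⁅w (i + 1) • T.der (sp (i + 1)), w (i + 2) • T.der (sp (i + 2))⁆ =
      A • w (i + 1) • T.der (sp (i + 1)) - B • w (i + 2) • T.der (sp (i + 2)) -
        N • w i • T.der (sp i)) :
    w (i + 1) * w (i + 2) * pull (T.c (i + 1) (i + 2) i) = -(N * w i) ∧
    w (i + 1) * w (i + 2) * pull (T.c (i + 1) (i + 2) (i + 1)) -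
      w (i + 2) * T.der (sp (i + 2)) (w (i + 1)) = A * w (i + 1) ∧
    w (i + 1) * w (i + 2) * pull (T.c (i + 1) (i + 2) (i + 2)) +
      w (i + 1) * T.der (sp (i + 1)) (w (i + 2)) = -(B * w (i + 2)) := by
  have hl : ⁅w (i + 1) • T.der (sp (i + 1)), w (i + 2) • T.der (sp (i + 2))⁆ =
      (w (i + 1) * w (i + 2)) • ⁅T.der (sp (i + 1)), T.der (sp (i + 2))⁆ +
      (w (i + 1) * T.der (sp (i + 1)) (w (i + 2))) • T.der (sp (i + 2)) -
      (w (i + 2) * T.der (sp (i + 2)) (w (i + 1))) • T.der (sp (i + 1)) := by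
    ext1 r
    simp only [commutator_apply, Derivation.sub_apply, Derivation.add_apply,
      smul_apply_derivation, leibniz, smul_eq_mul]
    ring
  have hs : ∀ l, T.struct (sp (i + 1)) (sp (i + 2)) (sp l) = pull (T.c (i + 1) (i + 2) l) :=
    fun l => rfl
  have hs0 : T.struct (sp (i + 1)) (sp (i + 2)) 0 = 0 := rfl
  have hsum : ∀ F : Fin 3 → Derivation ℝ (SmoothOmega M) (SmoothOmega M),
      ∑ l, F l = F i + F (i + 1) + F (i + 2) := fun F => by
    rw [Fin.sum_univ_three]; fin_cases i <;> simp <;> abel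
  rw [hl, T.lie_der, derOf, Fin.sum_univ_succ (n := 3)] at h
  change (w (i + 1) * w (i + 2)) • (T.struct (sp (i + 1)) (sp (i + 2)) 0 • T.der 0 +
    ∑ l : Fin 3, T.struct (sp (i + 1)) (sp (i + 2)) (sp l) • T.der (sp l)) + _ - _ = _ at h
  rw [hs0, zero_smul, zero_add, hsum] at h
  simp only [hs] at h
  have key : ∀ x y z : SmoothOmega M, x • T.der (sp i) + y • T.der (sp (i + 1)) +
      z • T.der (sp (i + 2)) = 0 → x = 0 ∧ y = 0 ∧ z = 0 := fun x y z hxyz => by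
    have := Fintype.linearIndependent_iff.1
      ((T.linearIndependent he).comp (fun l : Fin 3 => sp l) (Fin.succ_injective 3))
      (fun l => if l = i then x else if l = i + 1 then y else z) (by
        rw [hsum, ← hxyz]; fin_cases i <;> simp [Function.comp_apply])
    refine ⟨by simpa using this i, ?_, ?_⟩
    · have := this (i + 1); revert this; fin_cases i <;> simp
    · have := this (i + 2); revert this; fin_cases i <;> simp
  obtain ⟨h1, h2, h3⟩ := key (w (i + 1) * w (i + 2) * pull (T.c (i + 1) (i + 2) i) + N * w i)
    (w (i + 1) * w (i + 2) * pull (T.c (i + 1) (i + 2) (i + 1)) -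
      w (i + 2) * T.der (sp (i + 2)) (w (i + 1)) - A * w (i + 1))
    (w (i + 1) * w (i + 2) * pull (T.c (i + 1) (i + 2) (i + 2)) +
      w (i + 1) * T.der (sp (i + 1)) (w (i + 2)) + B * w (i + 2)) (by
    rw [← sub_eq_zero] at h
    refine Eq.trans ?_ h
    module)
  exact ⟨by linear_combination h1, by linear_combination h2, by linear_combination h3⟩

end LeadingTuple

theorem exists_of_exactVia_snd {e : Fin 4 → Derivation ℝ R R} {f : B1 → R} (h : ExactVia (atOne e f) (atOne e f).2) :
    ∃ F : R, ∀ i (D : Derivation ℝ R R), frameOf (atOne e f) i = D → D F = f (.inl (.scalar i)) := by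
  obtain ⟨F, hF⟩ := h
  exact ⟨F, fun i D h1 => by rw [← h1, hF, atOne_snd]⟩

theorem exists_of_exactVia_confPart {e : Fin 4 → Derivation ℝ R R} {f : B1 → R} (h : ExactVia (atOne e f) (confPart (atOne e f))) :
    ∃ F : R, (∀ D : Derivation ℝ R R, frameOf (atOne e f) 0 = D →
      D F = ∑ i, f (.inl (.diag i)) + f (.inr .conf)) ∧
    ∀ i (D : Derivation ℝ R R), frameOf (atOne e f) (sp i) = D → D F = f (.inl (.conf i)) := by
  obtain ⟨F, hF⟩ := h
  exact ⟨F, fun D h1 => by rw [← h1, hF, confPart, atOne_zero, trace_confDer],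
    fun i D h1 => by rw [← h1, hF, confPart, atOne_sp, trace_confDer]⟩

section LeadingTerms

theorem derOf_injective {e : Fin 4 → Derivation ℝ R R}
    (he : LinearIndependent R e) {h h' : Fin 4 → R} (heq : derOf e h = derOf e h') : h = h' := by
  rw [← sub_eq_zero, derOf_sub] at heq
  exact funext fun μ => sub_eq_zero.1 (Fintype.linearIndependent_iff.1 he _ heq μ)

theorem frame_det_ne_zero (he : LinearIndependent (SmoothOmega M) L.der)
    {d : Fin 3 → Fin 3 → SmoothM M} {w : Fin 3 → SmoothOmega M}
    {E : Fin 4 → Derivation ℝ (SmoothOmega M) (SmoothOmega M)}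
    (hs : Submodule.span (SmoothOmega M) (Set.range E) = ⊤) (h0 : E 0 = L.der 0)
    (hE : ∀ i, E (sp i) = derOf L.der (Fin.cons 0 fun a => w i * pull (d i a))) (y : M) :
    (Matrix.of fun i a => d i a y).det ≠ 0 := by
  choose c hc using fun a : Fin 3 => (mem_span_range_iff_exists_fun (SmoothOmega M)).1
    (hs ▸ Submodule.mem_top (x := L.der (sp a)))
  obtain ⟨t⟩ : Nonempty (EuclideanHalfSpace 1) := ⟨⟨0, le_rfl⟩⟩
  have key : ∀ a b, ∑ i : Fin 3, c a (sp i) * w i * pull (d i b) = if a = b then 1 else 0 := by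
    intro a b
    have h := hc a
    rw [Fin.sum_univ_succ (n := 3), h0] at h
    change c a 0 • L.der 0 + ∑ i : Fin 3, c a (sp i) • E (sp i) = _ at h
    have hsm : ∀ (r : SmoothOmega M) h, r • derOf L.der h = derOf L.der fun μ => r * h μ :=
      fun r h => by simp only [derOf, smul_sum, smul_smul]
    simp only [hE, hsm, derOf_sum] at h
    rw [derOf_single, derOf_add, ← one_smul (SmoothOmega M) (L.der (sp a)), derOf_single] at h
    have := congrFun (derOf_injective he h) (sp b)
    rw [Pi.single_eq_of_ne (show sp b ≠ 0 from Fin.succ_ne_zero b), zero_add, Pi.single_apply] at this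
    simp only [sp, Fin.succ_inj, Fin.cons_succ, eq_comm (a := b)] at this
    rw [← this]
    exact sum_congr rfl fun i _ => mul_assoc _ _ _
  refine Matrix.det_ne_zero_of_left_inverse (B := Matrix.of fun a i => c a (sp i) (t, y) * w i (t, y)) ?_
  ext a b
  have : (∑ i : Fin 3, c a (sp i) * w i * pull (d i b)) (t, y) =
      (if a = b then (1 : SmoothOmega M) else 0) (t, y) := by rw [key a b]
  rw [eval_sum_omega] at this
  rw [Matrix.mul_apply, Matrix.one_apply]
  refine Eq.trans this ?_
  split_ifs <;> rfl

theorem deg011_add' (i : Fin 3) : deg011 (i + 1) + deg011 (i + 2) = 2 • unit i + deg011 i :=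
  deg011_add i

theorem pull_D_sum (T : FinalData L) (i : Fin 3) (κ : Multi) :
    T.D i (∑ l, κ l • T.p l) = dot (fun l => T.D i (T.p l)) κ := by
  rw [map_sum, dot]
  exact sum_congr rfl fun l _ => by rw [map_nsmul, nsmul_eq_mul]

/-- Gauged Maurer-Cartan elements of the associated graded algebra are given by tuples. -/
theorem exists_leading_eq : ∀ x ∈ MCGaugedPos L, ∃ T : FinalData L, T.leading = x := by
  intro x hx
  have he := linearIndependent_of_mem hx
  have hB := linearIndependent_B1 _ he
  obtain ⟨⟨⟨⟨hmc, f, rfl, hf1, hf0⟩, f', hf', hnd⟩, f'', hf'', hex1, hex2⟩, -⟩ := hx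
  obtain rfl := ofCoeff_injective _ hB hf'
  obtain rfl := ofCoeff_injective _ hB hf''
  have hr : ∀ b, f (.inr b) = if b = .der 0 then 1 else 0 := fun b => by
    split_ifs with hb
    · rw [hb, hf1]
    · exact hf0 _ (fun h => hb (Sum.inr_injective h)) fun h => h
  let g : GB1 → SmoothOmega M := fun b => f (.inl b)
  have hsym : ∀ i, g (.sym i) = 0 := fun i => hf0 _ (by simp) fun h => h
  have hasym : ∀ i, g (.asym i) = 0 := fun i => hf0 _ (by simp) fun h => h
  have hfr : ∀ i, g (.frame i 0) = 0 := fun i => hf0 _ (by simp) fun h => h rfl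
  have hE0 : frameOf (atOne L.der f) 0 = L.der 0 := by
    rw [frameOf_atOne_zero, ← one_smul (SmoothOmega M) (L.der 0), derOf_single]
    congr 1
    funext μ
    rw [hr, Pi.single_apply]
    simp
  have hspan : Submodule.span (SmoothOmega M) (Set.range L.der) = ⊤ := by
    rw [eq_top_iff, ← hnd.2, span_le]
    rintro _ ⟨i, rfl⟩
    have hmem : ∀ h, derOf L.der h ∈ Submodule.span (SmoothOmega M) (Set.range L.der) := fun h =>
      Submodule.sum_mem _ fun μ _ => Submodule.smul_mem _ _ (subset_span ⟨μ, rfl⟩)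
    cases i using Fin.cases with
    | zero => rw [frameOf_atOne_zero]; exact hmem _
    | succ i => exact (frameOf_atOne_sp L.der f i).symm ▸ hmem _
  choose C₀ hC₀ using fun μ ν => (mem_span_range_iff_exists_fun (SmoothOmega M)).1
    (hspan ▸ Submodule.mem_top (x := ⁅L.der μ, L.der ν⁆))
  let C : Fin 4 → Fin 4 → Fin 4 → SmoothOmega M := fun μ ν => if μ = 0 then 0 else C₀ μ ν
  have h0 : ∀ μ ν, ⁅L.der μ, L.der ν⁆ = derOf L.der (C μ ν) := fun μ ν => by
    by_cases hμ : μ = 0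
    · have : ⁅(partial0 : Derivation ℝ (SmoothOmega M) (SmoothOmega M)), L.der ν⁆ = 0 := by
        cases ν using Fin.cases with
        | zero => exact lie_self _
        | succ a => exact lie_partial0_derOmega L a
      rw [hμ]
      exact this.trans (by simp [C, derOf])
    · rw [← hC₀, derOf]; simp only [C, if_neg hμ]
  have hu : toA L.der (gaugedSeries L.der (concentrated g)) = ofCoeff L.der f := by
    rw [toA_eq_ofCoeff L.der (fullCoef_eq_zero (isFiltered_concentrated g)) (gaugedSeries_eq _ _)]
    congr 1
    funext b
    rcases b with b | b
    · exact concentrated_deg g b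
    · rw [hr]
      change (if b = .der 0 ∧ b.deg = 0 then (1 : SmoothOmega M) else 0) = _
      by_cases hb : b = .der 0
      · subst hb; simp [GB0.deg]
      · simp [hb]
  have hlead : ∀ c, mcSum L.der C c (concentrated g) c.deg = 0 :=
    mcSum_leading he h0 (fun ν => if_pos rfl)
      (hmc.2 _ (gaugedSeries_mem _ (isFiltered_concentrated g)) hu)
  choose p hp using fun i => eq_pull_of_partial0_eq_zero (leading_diag hlead i)
  obtain ⟨p0, hp0⟩ := eq_pull_of_partial0_eq_zero (leading_scalar hlead)
  choose d hd using fun i (a : Fin 3) => eq_weight_mul_pull (p := p) (κ := deg011 i)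
    (F := g (.frame i (sp a))) (by
      rw [dot_deg011, ← hp, ← hp]; exact leading_frame hlead hsym hasym i _)
  have hE : ∀ i, frameOf (atOne L.der f) (sp i) =
      derOf L.der (Fin.cons 0 fun a => weight p (deg011 i) * pull (d i a)) := fun i => by
    rw [frameOf_atOne_sp, frameDer_eq]
    congr 1
    funext μ
    cases μ using Fin.cases with
    | zero => exact hfr i
    | succ a => exact hd i a
  obtain ⟨F, hF₀, hF⟩ := exists_of_exactVia_confPart hex1
  obtain ⟨G, hG⟩ := exists_of_exactVia_snd hex2
  obtain ⟨ζ, hζ⟩ := eq_tauMap_mul_add_pull (F := F) (P := ∑ i, p i) (by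
    have h1 := hF₀ _ hE0
    rw [hr, if_neg (by simp), add_zero] at h1
    rw [← pullHom_apply, map_sum]
    exact h1.trans (sum_congr rfl fun i _ => hp i))
  obtain ⟨χ, hχ⟩ := eq_tauMap_mul_add_pull (F := G) (P := p0) (by
    exact (hG 0 _ hE0).trans hp0)
  obtain ⟨T, rfl, rfl, rfl, hTζ, rfl⟩ := exists_tuple hspan
    (frame_det_ne_zero he hnd.2 hE0 hE) p p0 (-ζ) χ
  have hD : ∀ i, frameOf (atOne L.der f) (sp i) = weight T.p (deg011 i) • T.der (sp i) := fun i => by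
    rw [hE, derOf, Fin.sum_univ_succ (n := 3), T.der_sp, smul_sum]
    simp only [Fin.cons_zero, zero_smul, zero_add, Fin.cons_succ, mul_smul]
    rfl
  have hDF : ∀ i (P φ : SmoothM M), (weight T.p (deg011 i) • T.der (sp i)) (tauMap * pull P + pull φ) =
      weight T.p (deg011 i) * (tauMap * pull (T.D i P) + pull (T.D i φ)) := fun i P φ => by
    rw [smul_apply_derivation, map_add, leibniz, T.der_tauMap, T.der_pull, T.der_pull]
    simp only [smul_eq_mul, mul_zero, add_zero]
  have hzeta : ∀ i, pull (T.D i T.zeta) = -pull (T.D i ζ) := fun i => by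
    rw [hTζ, map_neg]; exact map_neg pullHom _
  have hcf : ∀ i, g (.conf i) = -(weight T.p (deg011 i) *
      (pull (T.D i T.zeta) - tauMap * pull (T.D i (∑ l, T.p l)))) := fun i => by
    have := hF i _ (hD i)
    rw [hζ, hDF] at this
    refine this.symm.trans ?_
    rw [hzeta]; ring
  have htor : ∀ i, _ := fun i => T.torsion he (i := i) (w := fun i => weight T.p (deg011 i))
    (A := g (.conf (i + 2)) + g (.rotK (i + 2))) (B := g (.conf (i + 1)) - g (.rotJ (i + 1)))
    (N := 2 * g (.curv i)) (by
      have := leading_torsion hlead h0 hasym i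
      have hg : ∀ i, frameDer L.der g i = weight T.p (deg011 i) • T.der (sp i) := fun i => by
        rw [← hD, frameOf_atOne_sp]
      rwa [hg, hg, hg] at this)
  have hw : ∀ i (l : Fin 3), T.der (sp l) (weight T.p (deg011 i)) = -(tauMap *
      (pull (T.D l (T.p (i + 1))) + pull (T.D l (T.p (i + 2)))) * weight T.p (deg011 i)) :=
    fun i l => by rw [T.der_weight, pull_D_sum, pull_dot, dot_deg011]
  have hS : ∀ i, pull (T.D i (∑ l, T.p l)) =
      pull (T.D i (T.p i)) + pull (T.D i (T.p (i + 1))) + pull (T.D i (T.p (i + 2))) := fun i => by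
    rw [map_sum, ← pullHom_apply, map_sum, Fin.sum_univ_three]
    fin_cases i <;> simp [pullHom_apply] <;> ring
  refine ⟨T, ?_⟩
  rw [FinalData.leading]
  congr 1
  funext b
  rcases b with b | b
  · cases b with
    | diag i => exact (hp i).symm
    | curv i =>
      have h1 := (htor i).1
      rw [← weight_add, deg011_add', weight_add] at h1
      refine (neg_eq_iff_eq_neg.2 (weight_mul_cancel T.p (deg011 i) ?_))
      have h2 : (1 / 2 : ℝ) • (2 * g (.curv i)) = g (.curv i) := by
        rw [two_mul, ← two_smul ℝ, smul_smul]; norm_num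
      change _ = weight T.p (deg011 i) * -g (.curv i)
      rw [← h2, mul_smul_comm, ← smul_neg, mul_smul_comm]
      congr 1
      linear_combination h1
    | frame i μ =>
      cases μ using Fin.cases with
      | zero => exact (hfr i).symm
      | succ a => exact (hd i a).symm
    | conf i => exact (hcf i).symm
    | sym i => exact (hsym i).symm
    | asym i => exact (hasym i).symm
    | rotK i =>
      obtain ⟨-, h1, -⟩ := htor (i + 1)
      rw [hw] at h1
      simp only [fin3_add] at h1
      rw [hcf, hS] at h1
      refine weight_mul_cancel T.p (deg011 (i + 2)) ?_
      change _ * (weight T.p (deg011 i) * (pull (T.D i T.zeta) + pull (T.c (i + 2) i (i + 2)) -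
        tauMap * pull (T.D i (T.p (i + 2))))) = _ * g (.rotK i)
      linear_combination h1
    | rotJ i =>
      obtain ⟨-, -, h1⟩ := htor (i + 2)
      rw [hw] at h1
      simp only [fin3_add] at h1
      rw [hcf, hS] at h1
      refine weight_mul_cancel T.p (deg011 (i + 1)) ?_
      change _ * -(weight T.p (deg011 i) * (pull (T.D i T.zeta) - pull (T.c i (i + 1) (i + 1)) -
        tauMap * pull (T.D i (T.p (i + 1))))) = _ * g (.rotJ i)
      linear_combination h1
    | scalar m =>
      cases m using Fin.cases with
      | zero => exact hp0.symm
      | succ i =>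
        have := hG (sp i) _ (hD i)
        rw [hχ, hDF] at this
        refine Eq.trans ?_ this
        change weight T.p (deg011 i) * (pull (T.D i T.chi) + tauMap * pull (T.D i T.p0)) = _
        rw [add_comm]
  · rw [hr]
    cases b <;> simp [FinalData.coeff]

end LeadingTerms

section Invariance

/-- The action of a derivation of degree zero on arrays of degree one. -/
def actL1 (δ : Der0 R) (x : L1 R) : L1 R := fun a => Der0.comm δ (x a) + ∑ j, δ.1 a j • x j

/-- The action of a derivation of degree zero on arrays of degree two. -/
def actL2 (δ : Der0 R) (U : L2 R) : L2 R := fun a b =>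
  Der0.comm δ (U a b) + (∑ j, δ.1 a j • U j b + ∑ j, δ.1 b j • U a j)

theorem br01_eq (δ : E0 R) (x : E1 R) : br01 δ x = (actL1 δ x.1, δ.act x.2) := by
  refine Prod.ext (funext fun a => ?_) rfl
  change (∑ j, (th1 j (Der0.comm δ (x.1 j)) + tens (δ.act (theta j)) (x.1 j))) a = _
  simp only [Finset.sum_apply, Pi.add_apply, sum_add_distrib, th1, tens, theta_apply,
    act_theta, actL1]
  simp

theorem comm_smul_right (δ ε : Der0 R) (r : R) :
    Der0.comm δ (r • ε) = r • Der0.comm δ ε + δ.2 r • ε := by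
  refine Prod.ext (Matrix.ext fun p q => ?_) (Derivation.ext fun f => ?_)
  · simp [Der0.comm, Matrix.mul_apply]
    simp only [mul_sub, mul_add, mul_sum, mul_comm]
    ring
  · simp [Der0.comm, commutator_apply]

theorem comm_smul_left (δ ε : Der0 R) (r : R) :
    Der0.comm (r • δ) ε = r • Der0.comm δ ε - ε.2 r • δ := by
  rw [Der0.comm_swap, comm_smul_right, Der0.comm_swap ε δ, smul_neg]
  abel

theorem comm_zero_right (δ : Der0 R) : Der0.comm δ 0 = 0 := by
  have := comm_add_right δ 0 0
  rwa [add_zero, left_eq_add] at this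

theorem comm_neg_right (δ ε : Der0 R) : Der0.comm δ (-ε) = -Der0.comm δ ε := by
  rw [eq_neg_iff_add_eq_zero, ← comm_add_right, neg_add_cancel, comm_zero_right]

theorem comm_sum_right {ι : Type*} (s : Finset ι) (δ : Der0 R) (ε : ι → Der0 R) :
    Der0.comm δ (∑ i ∈ s, ε i) = ∑ i ∈ s, Der0.comm δ (ε i) :=
  map_sum (AddMonoidHom.mk' (Der0.comm δ) (comm_add_right δ)) ε s

theorem comm_sum_left {ι : Type*} (s : Finset ι) (δ : Der0 R) (ε : ι → Der0 R) :
    Der0.comm (∑ i ∈ s, ε i) δ = ∑ i ∈ s, Der0.comm (ε i) δ := by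
  simp only [Der0.comm_swap δ, comm_sum_right, sum_neg_distrib]

theorem act_comm (δ ε : Der0 R) (w : Fin 4 → R) :
    (Der0.comm δ ε).act w = δ.act (ε.act w) - ε.act (δ.act w) := by
  funext i
  simp [Der0.act, Der0.comm, Matrix.mulVec, dotProduct, Fin.sum_univ_four, Matrix.mul_apply,
    commutator_apply]
  ring

theorem comm_jacobi (δ ε ξ : Der0 R) : Der0.comm δ (Der0.comm ε ξ) =
    Der0.comm (Der0.comm δ ε) ξ + Der0.comm ε (Der0.comm δ ξ) := by
  refine Prod.ext (Matrix.ext fun p q => ?_) ?_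
  · simp [Der0.comm, Fin.sum_univ_four, Matrix.mul_apply, commutator_apply]
    ring
  · exact leibniz_lie δ.2 ε.2 ξ.2

theorem actL2_add (δ : Der0 R) (U V : L2 R) : actL2 δ (U + V) = actL2 δ U + actL2 δ V := by
  funext a b
  simp only [actL2, Pi.add_apply, comm_add_right, smul_add, sum_add_distrib]
  abel

theorem actL2_smul (δ : Der0 R) (r : R) (U : L2 R) :
    actL2 δ (r • U) = r • actL2 δ U + δ.2 r • U := by
  funext a b
  simp only [actL2, Pi.smul_apply, Pi.add_apply, comm_smul_right, smul_add, smul_sum, smul_comm r]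
  abel

theorem actL2_swap (δ : Der0 R) (U : L2 R) (a b : Fin 4) :
    actL2 δ (fun a b => U b a) a b = actL2 δ U b a := by
  simp only [actL2]
  abel

set_option maxHeartbeats 800000 in
theorem actL2_brL (δ : Der0 R) (x y : L1 R) :
    actL2 δ (brL x y) = brL (actL1 δ x) y + brL x (actL1 δ y) := by
  let t : L1 R → L1 R → L2 R := fun x y a b => Der0.comm (x a) (y b)
  let n : L1 R → L1 R → L2 R := fun x y a b => ∑ c, (x a).1 b c • y c
  have ht : ∀ x y a b, t (actL1 δ x) y a b + t x (actL1 δ y) a b = actL2 δ (t x y) a b +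
      (∑ j, (x a).2 (δ.1 b j) • y j - ∑ j, (y b).2 (δ.1 a j) • x j) := fun x y a b => by
    simp only [t, actL1, actL2, comm_add_left, comm_add_right, comm_sum_left, comm_sum_right,
      comm_smul_left, comm_smul_right, comm_jacobi δ, sum_add_distrib,
      sum_sub_distrib]
    abel
  have hn : ∀ x y a b, n (actL1 δ x) y a b + n x (actL1 δ y) a b = actL2 δ (n x y) a b -
      ∑ c, (x a).2 (δ.1 b c) • y c := fun x y a b => by
    have hc : ∀ c, (Der0.comm δ (x a)).1 b c = ∑ d, δ.1 b d * (x a).1 d c -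
        ∑ d, (x a).1 b d * δ.1 d c + δ.2 ((x a).1 b c) - (x a).2 (δ.1 b c) := fun c => by
      simp [Der0.comm, Matrix.mul_apply]
    simp only [n, actL1, actL2, comm_add_right, comm_smul_right, fst_add, Matrix.add_apply,
      smul_fst, Matrix.smul_apply, smul_eq_mul, hc,
      Fin.sum_univ_four]
    module
  have hb : ∀ x y : L1 R, brL x y = fun a b => t x y a b - t x y b a + (n x y a b - n x y b a) +
      (n y x a b - n y x b a) := fun x y => by
    funext a b
    simp only [brL_apply, t, n, sub_smul, sum_sub_distrib]
  have hsub : ∀ U V : L2 R, actL2 δ (U - V) = actL2 δ U - actL2 δ V := fun U V =>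
    map_sub (AddMonoidHom.mk' (actL2 δ) (actL2_add δ)) U V
  have h2 : brL x y = t x y - (fun a b => t x y b a) + (n x y - fun a b => n x y b a) +
      (n y x - fun a b => n y x b a) := hb x y
  funext a b
  rw [h2, actL2_add, actL2_add, hsub, hsub, hsub, hb, hb]
  simp only [Pi.add_apply, Pi.sub_apply, actL2_swap]
  have e1 := ht x y a b
  have e2 := ht x y b a
  have e3 := hn x y a b
  have e4 := hn x y b a
  have e5 := hn y x a b
  have e6 := hn y x b a
  linear_combination (norm := module) e2 + e4 + e6 - e1 - e3 - e5

theorem idealRe_apply_zero_sp (S : Fin 3 → Fin 3 → R) (k : Fin 3) :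
    idealRe S 0 (sp k) = confDer 0 (S k) 0 0 := by
  fin_cases k <;> simp [sp, idealRe, th2, wedge, theta, Fin.sum_univ_three, confDer_eq, ofDer]

theorem idealRe_apply_sp_sp (S : Fin 3 → Fin 3 → R) (k : Fin 3) :
    idealRe S (sp (k + 1)) (sp (k + 2)) = confDer 0 0 (fun l => -S k l) 0 := by
  fin_cases k <;> simp [sp, idealRe, th2, wedge, theta, Fin.sum_univ_three, confDer_eq, ofDer] <;>
    rw [Prod.mk_zero_zero] <;> abel

theorem idealIm_apply_zero_sp (S : Fin 3 → Fin 3 → R) (k : Fin 3) :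
    idealIm S 0 (sp k) = confDer 0 0 (S k) 0 := by
  fin_cases k <;> simp [sp, idealIm, th2, wedge, theta, Fin.sum_univ_three, confDer_eq, ofDer]

theorem idealIm_apply_sp_sp (S : Fin 3 → Fin 3 → R) (k : Fin 3) :
    idealIm S (sp (k + 1)) (sp (k + 2)) = confDer 0 (S k) 0 0 := by
  fin_cases k <;> simp [sp, idealIm, th2, wedge, theta, Fin.sum_univ_three, confDer_eq, ofDer]

theorem wedge_skew (w w' : Fin 4 → R) (δ : Der0 R) (a b : Fin 4) :
    wedge w w' δ a b = -wedge w w' δ b a := by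
  simp only [wedge, ← neg_smul, neg_sub]

theorem idealRe_skew (S : Fin 3 → Fin 3 → R) (a b : Fin 4) :
    idealRe S a b = -idealRe S b a := by
  simp only [idealRe, Finset.sum_apply, Pi.smul_apply, Pi.sub_apply, th2, ← sum_neg_distrib]
  refine sum_congr rfl fun k _ => sum_congr rfl fun l _ => ?_
  rw [wedge_skew, wedge_skew _ _ _ a b]
  module

theorem idealIm_skew (S : Fin 3 → Fin 3 → R) (a b : Fin 4) :
    idealIm S a b = -idealIm S b a := by
  simp only [idealIm, Finset.sum_apply, Pi.smul_apply, Pi.add_apply, th2, ← sum_neg_distrib]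
  refine sum_congr rfl fun k _ => sum_congr rfl fun l _ => ?_
  rw [wedge_skew, wedge_skew _ _ _ a b]
  module

theorem actL2_skew (δ : Der0 R) {U : L2 R} (hU : ∀ a b, U a b = -U b a) (a b : Fin 4) :
    actL2 δ U a b = -actL2 δ U b a := by
  have h : ∀ j, U j b = -U b j ∧ U a j = -U j a := fun j => ⟨hU _ _, hU _ _⟩
  simp only [actL2, fun j => (h j).1, fun j => (h j).2, comm_neg_right, smul_neg, sum_neg_distrib]
  abel

/-- The symmetrization of the cross products of `v` with the rows. -/
def crossSym (v : Fin 3 → R) (S : Fin 3 → Fin 3 → R) (k l : Fin 3) : R :=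
  (v (l + 1) * S k (l + 2) - v (l + 2) * S k (l + 1)) +
    (v (k + 1) * S l (k + 2) - v (k + 2) * S l (k + 1))

theorem skew_self {N : Type*} [AddCommGroup N] [Module ℝ N] {U : Fin 4 → Fin 4 → N}
    (hU : ∀ a b, U a b = -U b a) (a : Fin 4) : U a a = 0 := by
  have h : (2 : ℝ) • U a a = 0 := by rw [two_smul]; nth_rw 1 [hU a a]; simp
  exact (smul_eq_zero.1 h).resolve_left two_ne_zero

theorem actL2_zero_sp {U : L2 R} (hU : ∀ a b, U a b = -U b a) (l : R) (b r : Fin 3 → R)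
    (X : Derivation ℝ R R) (k : Fin 3) : actL2 (confDer l b r X) U 0 (sp k) =
      Der0.comm (confDer l b r X) (U 0 (sp k)) + ((2 * l) • U 0 (sp k) +
        (b (k + 2) • U (sp (k + 1 + 1)) (sp (k + 1 + 2)) +
          -b (k + 1) • U (sp (k + 2 + 1)) (sp (k + 2 + 2)) +
        (r (k + 2) • U 0 (sp (k + 1)) + -r (k + 1) • U 0 (sp (k + 2))))) := by
  simp only [actL2, sum_sp, sum_cyclic _ k, confDer, confMatrix_zero_zero, confMatrix_zero_sp,
    confMatrix_sp_sp, confMatrix_sp_zero, fin3_add, (fin3_ne_add_one k).symm, (fin3_ne_add_two k).symm, fin3_ne_add_one,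
    (fin3_add_one_ne_add_two k).symm, if_true, if_false, skew_self hU, hU (sp (k + 1)) (sp k)]
  module

theorem actL2_sp_sp {U : L2 R} (hU : ∀ a b, U a b = -U b a) (l : R) (b r : Fin 3 → R)
    (X : Derivation ℝ R R) (k : Fin 3) : actL2 (confDer l b r X) U (sp (k + 1)) (sp (k + 2)) =
      Der0.comm (confDer l b r X) (U (sp (k + 1)) (sp (k + 2))) +
        ((2 * l) • U (sp (k + 1)) (sp (k + 2)) +
        (b (k + 1) • U 0 (sp (k + 2)) + -b (k + 2) • U 0 (sp (k + 1)) +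
        (r (k + 2) • U (sp (k + 1 + 1)) (sp (k + 1 + 2)) +
          -r (k + 1) • U (sp (k + 2 + 1)) (sp (k + 2 + 2))))) := by
  simp only [actL2, sum_sp, sum_cyclic _ k, confDer,
    confMatrix_sp_sp, confMatrix_sp_zero, fin3_add, fin3_ne_add_one, (fin3_ne_add_one k).symm, fin3_ne_add_two,
    (fin3_ne_add_two k).symm, (fin3_add_one_ne_add_two k).symm, fin3_add_one_ne_add_two,
    if_true, if_false, skew_self hU, hU (sp (k + 1)) (sp k), hU (sp (k + 1)) 0,
    hU (sp k) (sp (k + 2))]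
  module

section

variable {S : Fin 3 → Fin 3 → R} (hS : ∀ a b, S a b = S b a) (htr : S 0 0 + S 1 1 + S 2 2 = 0) (l :
  R) (b r : Fin 3 → R) (X : Derivation ℝ R R)

include hS htr

set_option maxHeartbeats 1000000 in
theorem actL2_idealRe : actL2 (confDer l b r X) (idealRe S) =
    idealRe (fun k m => X (S k m) + 2 * l * S k m - crossSym r S k m) +
      idealIm (crossSym b S) := by
  have h2 : S 2 2 = -S 0 0 - S 1 1 := by linear_combination htr
  refine sub_eq_zero.1 (skew_eq_zero _ (fun i j => ?_) (fun i => ?_) fun i => ?_)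
  · simp only [Pi.sub_apply, Pi.add_apply]
    rw [actL2_skew _ (idealRe_skew S), idealRe_skew _ i j, idealIm_skew _ i j]
    abel
  all_goals
    simp only [Pi.sub_apply, Pi.add_apply, actL2_zero_sp (idealRe_skew S),
      actL2_sp_sp (idealRe_skew S), idealRe_apply_zero_sp, idealRe_apply_sp_sp,
      idealIm_apply_zero_sp, idealIm_apply_sp_sp, comm_confDer, confDer_smul, confDer_add]
    rw [sub_eq_zero, confDer_inj]
    refine ⟨by simp, funext fun m => ?_, funext fun m => ?_, by simp⟩ <;>
    fin_cases i <;> fin_cases m <;> simp [crossSym, h2, hS 1 0, hS 2 0, hS 2 1] <;> try ring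

set_option maxHeartbeats 1000000 in
theorem actL2_idealIm : actL2 (confDer l b r X) (idealIm S) =
    idealIm (fun k m => X (S k m) + 2 * l * S k m - crossSym r S k m) +
      idealRe (fun k m => -crossSym b S k m) := by
  have h2 : S 2 2 = -S 0 0 - S 1 1 := by linear_combination htr
  refine sub_eq_zero.1 (skew_eq_zero _ (fun i j => ?_) (fun i => ?_) fun i => ?_)
  · simp only [Pi.sub_apply, Pi.add_apply]
    rw [actL2_skew _ (idealIm_skew S), idealRe_skew _ i j, idealIm_skew _ i j]
    abel
  all_goals
    simp only [Pi.sub_apply, Pi.add_apply, actL2_zero_sp (idealIm_skew S),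
      actL2_sp_sp (idealIm_skew S), idealRe_apply_zero_sp, idealRe_apply_sp_sp,
      idealIm_apply_zero_sp, idealIm_apply_sp_sp, comm_confDer, confDer_smul, confDer_add]
    rw [sub_eq_zero, confDer_inj]
    refine ⟨by simp, funext fun m => ?_, funext fun m => ?_, by simp⟩ <;>
    fin_cases i <;> fin_cases m <;> simp [crossSym, h2, hS 1 0, hS 2 0, hS 2 1] <;> try ring

theorem crossSym_trace (v : Fin 3 → R) :
    crossSym v S 0 0 + crossSym v S 1 1 + crossSym v S 2 2 = 0 := by
  simp [crossSym, hS 1 0, hS 2 0, hS 2 1]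
  ring

end

theorem crossSym_symm (v : Fin 3 → R) (S : Fin 3 → Fin 3 → R) (k l : Fin 3) :
    crossSym v S k l = crossSym v S l k := add_comm _ _

theorem actL2_mem {δ : Der0 R} (hδ : δ ∈ CDer R) {U : L2 R} (hU : U ∈ I2 R) :
    actL2 δ U ∈ I2 R := by
  obtain ⟨l, b, r, X, rfl⟩ := hδ
  induction hU using span_induction with
  | zero =>
    have := actL2_smul (confDer l b r X) 0 0
    rw [zero_smul, zero_smul, map_zero, zero_smul, add_zero] at this
    rw [this]; exact zero_mem _
  | add U V _ _ hU hV => rw [actL2_add]; exact add_mem hU hV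
  | smul c U hU h =>
    rw [actL2_smul]
    exact add_mem (Submodule.smul_mem _ _ h) (Submodule.smul_mem _ _ hU)
  | mem U hU =>
    obtain ⟨S, hS, htr, rfl⟩ := hU
    have htr' : S 0 0 + S 1 1 + S 2 2 = 0 := by
      simpa [Matrix.trace, Fin.sum_univ_three] using htr
    rw [I2_generator_eq]
    have key : ∀ S : Fin 3 → Fin 3 → R, (∀ a b, S a b = S b a) → S 0 0 + S 1 1 + S 2 2 = 0 →
        actL2 (confDer l b r X) (idealRe S) ∈ I2 R ∧
          actL2 (confDer l b r X) (idealIm S) ∈ I2 R := fun S hS htr => by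
      have h1 := congrArg X htr
      rw [map_add, map_add, map_zero] at h1
      have h2 : ∀ k m, X (S k m) + 2 * l * S k m - crossSym r S k m =
          X (S m k) + 2 * l * S m k - crossSym r S m k := fun k m => by
        rw [hS k m, crossSym_symm r S k m]
      have h3 := crossSym_trace hS htr r
      have h4 := crossSym_trace hS htr b
      rw [actL2_idealRe hS htr, actL2_idealIm hS htr]
      exact ⟨add_mem (idealRe_mem _ h2 (by linear_combination h1 + 2 * l * htr - h3))
          (idealIm_mem _ (crossSym_symm b S) h4),
        add_mem (idealIm_mem _ h2 (by linear_combination h1 + 2 * l * htr - h3))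
          (idealRe_mem _ (fun k m => by rw [crossSym_symm b S k m]) (by linear_combination -h4))⟩
    rw [sub_eq_add_neg, ← neg_one_smul R (idealIm _), actL2_add, actL2_smul,
      (confDer l b r X).2.map_neg, Derivation.map_one_eq_zero, neg_zero, zero_smul, add_zero]
    refine add_mem (key _ (fun a b => by rw [hS.apply]) ?_).1
      (Submodule.smul_mem _ _ (key _ (fun a b => by rw [hS.apply]) ?_).2)
    · rw [← map_add, ← map_add, ← Complex.add_re, ← Complex.add_re, htr']; simp
    · rw [← map_add, ← map_add, ← Complex.add_im, ← Complex.add_im, htr']; simp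

end Invariance

section Covariance

theorem der_eta (X : Derivation ℝ R R) (i : Fin 4) : X (eta i) = 0 := by
  fin_cases i <;> simp [eta]

theorem conformal {δ : Der0 R} (hδ : δ ∈ CDer R) (i j : Fin 4) :
    eta i * δ.1 i j + eta j * δ.1 j i = if i = j then 2 * δ.1 0 0 * eta i else 0 := by
  obtain ⟨l, b, r, X, rfl⟩ := hδ
  fin_cases i <;> fin_cases j <;> simp [confDer, confMatrix, eta] <;> ring

theorem conformal_mul {δ : Der0 R} (hδ : δ ∈ CDer R) (i j : Fin 4) :
    δ.1 i j * eta j + δ.1 j i * eta i = if i = j then 2 * δ.1 0 0 * eta i else 0 := by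
  obtain ⟨l, b, r, X, rfl⟩ := hδ
  fin_cases i <;> fin_cases j <;> simp [confDer, confMatrix, eta] <;> ring

theorem act_apply (δ : Der0 R) (w : Fin 4 → R) (c : Fin 4) :
    δ.act w c = ∑ j, δ.1 c j * w j + δ.2 (w c) := rfl

theorem sum_conformal {δ : Der0 R} (hδ : δ ∈ CDer R) (V : Fin 4 → Fin 4 → R) :
    ∑ c, ∑ d, V c d * (eta c * δ.1 c d + eta d * δ.1 d c) =
      2 * δ.1 0 0 * ∑ c, eta c * V c c := by
  simp only [conformal hδ, mul_ite, mul_zero, Finset.sum_ite_eq, Finset.mem_univ, if_true, mul_sum]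
  exact sum_congr rfl fun c _ => by ring

theorem comm_sigma {δ : Der0 R} (hδ : δ ∈ CDer R) (i q : Fin 4) :
    Der0.comm δ ((eta i : R) • sigma i q) = ∑ k, δ.1 k q • (eta i : R) • sigma i k -
      ∑ k, δ.1 i k • (eta k : R) • sigma k q := by
  have hm : ∀ i q s t, (sigma i q : Der0 R).1 s t =
      (if s = i then if t = q then eta q else 0 else 0) -
        if s = q then if t = i then eta i else 0 else 0 := fun i q s t => by
    rw [sigma_entry, ite_and, ite_and]
    simp only [eq_comm]
  refine Prod.ext (Matrix.ext fun s t => ?_) ?_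
  · have h1 := conformal hδ t q
    have h2 := conformal_mul hδ s i
    have e1 := eta_mul_self (R := R) i
    have e2 := eta_mul_self (R := R) t
    have hz : (sigma i q : Der0 R).2 = 0 := rfl
    obtain ⟨B, hB⟩ : ∃ B : Prop → R, ∀ (P : Prop) [Decidable P] (a : R),
        (if P then a else 0) = B P * a := by
      classical
      refine ⟨fun P => if P then 1 else 0, fun P _ a => ?_⟩
      by_cases hP : P <;> simp [hP]
    have g1 : B (s = i) * eta s = B (s = i) * eta i := by
      rw [← hB, ← hB]; split_ifs with h <;> simp [h]
    have g2 : B (t = q) * eta t = B (t = q) * eta q := by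
      rw [← hB, ← hB]; split_ifs with h <;> simp [h]
    simp only [Der0.comm, smul_fst, smul_snd, fst_sub, fst_sum, Matrix.sub_apply,
      Matrix.add_apply, Matrix.smul_apply, Matrix.sum_apply, Matrix.mul_apply, Matrix.map_apply,
      smul_eq_mul, hm, mul_sub, mul_ite, ite_mul, sub_mul, mul_zero, zero_mul, sum_sub_distrib,
      Finset.sum_ite_eq, Finset.sum_ite_eq', Finset.mem_univ, if_true, apply_ite δ.2, map_sub,
      map_zero, leibniz, der_eta, smul_zero, Finset.sum_ite_irrel, Finset.sum_const_zero,
      add_zero, ite_self, sub_zero, hz, Derivation.zero_apply]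
    simp only [hB] at h1 h2 ⊢
    linear_combination B (t = q) * eta q * h2 - B (s = i) * eta i * h1 +
      B (s = q) * δ.1 i t * (e1 - e2) + 2 * δ.1 0 0 * B (t = q) * eta q * g1 -
      2 * δ.1 0 0 * B (s = i) * eta i * g2
  · simp [Der0.comm, sigma, Fin.sum_univ_four]

/-- The action of a derivation of degree zero on tensors in `W ⊗ W`. -/
def actT (δ : Der0 R) (t : Fin 4 → Fin 4 → R) (p q : Fin 4) : R :=
  δ.2 (t p q) + (∑ j, δ.1 p j * t j q + ∑ j, δ.1 q j * t p j)

theorem actT_phiTensor {δ : Der0 R} (hδ : δ ∈ CDer R) (a b : Fin 4 → R) (p q : Fin 4) :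
    actT δ (phiTensor a b) p q = phiTensor (δ.act a) b p q + phiTensor a (δ.act b) p q := by
  have h := conformal_mul hδ p q
  have hd : ∀ p q, (Matrix.diagonal eta : Matrix (Fin 4) (Fin 4) R) p q = if p = q then eta p else 0 :=
    fun p q => Matrix.diagonal_apply _ _ _
  have hs : ∑ c, eta c * δ.act a c * b c + ∑ c, eta c * a c * δ.act b c =
      δ.2 (∑ c, eta c * a c * b c) + 2 * δ.1 0 0 * ∑ c, eta c * a c * b c := by
    have key := sum_conformal hδ fun i j => b i * a j
    simp only [act_apply, Fin.sum_univ_four, leibniz, map_add, der_eta, smul_eq_mul]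
      at key ⊢
    linear_combination key
  have h1 : ∑ j, δ.1 p j * (Matrix.diagonal eta : Matrix (Fin 4) (Fin 4) R) j q = δ.1 p q * eta q := by
    simp [hd]
  have h2 : ∑ j, δ.1 q j * (Matrix.diagonal eta : Matrix (Fin 4) (Fin 4) R) p j = δ.1 q p * eta p := by
    simp [hd]
  have h3 : (2 * δ.1 0 0) * (Matrix.diagonal eta : Matrix (Fin 4) (Fin 4) R) p q =
      δ.1 p q * eta q + δ.1 q p * eta p := by rw [h, hd]; simp
  have h4 : δ.2 ((Matrix.diagonal eta : Matrix (Fin 4) (Fin 4) R) p q) = 0 := by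
    rw [hd]; split_ifs <;> simp [der_eta]
  have h5 : δ.2 (-3 : R) = 0 := by simpa using δ.2.map_intCast (-3)
  simp only [actT, phiTensor]
  generalize ∑ c, eta c * δ.act a c * b c = s1 at *
  generalize ∑ c, eta c * a c * δ.act b c = s2 at *
  generalize ∑ c, eta c * a c * b c = s at *
  simp only [map_add, leibniz, smul_eq_mul, act_apply, h4, h5, Fin.sum_univ_four] at h1 h2 ⊢
  linear_combination s * h1 + s * h2 - s * h3 -
    (Matrix.diagonal eta : Matrix (Fin 4) (Fin 4) R) p q * hs

theorem actL2_brPhi {δ : Der0 R} (hδ : δ ∈ CDer R) (a b : Fin 4 → R) :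
    actL2 δ (brPhi a b) = brPhi (δ.act a) b + brPhi a (δ.act b) := by
  let h : (Fin 4 → Fin 4 → R) → L2 R := fun t i p => ∑ q, t p q • (eta i : R) • sigma i q
  have hh : ∀ t, actL2 δ (h t) = h (actT δ t) := fun t => by
    funext i p
    simp only [h, actL2, actT, comm_add_right, comm_smul_right _ (_ • _), comm_sigma hδ,
      Fin.sum_univ_four]
    module
  have hb : ∀ a b : Fin 4 → R, brPhi a b =
      h (phiTensor a b) - fun i p => h (phiTensor a b) p i := fun a b => by
    funext i p
    simp only [brPhi_apply, h, Pi.sub_apply, smul_smul]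
  have hadd : ∀ t t', h (fun p q => t p q + t' p q) = h t + h t' := fun t t' => by
    funext i p
    simp only [h, Pi.add_apply, add_smul, sum_add_distrib]
  have hsub : ∀ U V : L2 R, actL2 δ (U - V) = actL2 δ U - actL2 δ V := fun U V =>
    map_sub (AddMonoidHom.mk' (actL2 δ) (actL2_add δ)) U V
  have ht : actT δ (phiTensor a b) = fun p q => phiTensor (δ.act a) b p q + phiTensor a (δ.act b) p q :=
    funext fun p => funext fun q => actT_phiTensor hδ a b p q
  rw [hb, hsub, hh, ht, hadd, hb, hb]
  funext i p
  have := congrFun (congrFun (hh (phiTensor a b)) p) i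
  rw [ht, hadd] at this
  simp only [Pi.sub_apply, Pi.add_apply, actL2_swap, this]
  abel

theorem act_actL1 (δ : Der0 R) (x : L1 R) (φ : Fin 4 → R) (a b : Fin 4) :
    (actL1 δ x a).act φ b = δ.act ((x a).act φ) b - (x a).act (δ.act φ) b +
      ∑ j, δ.1 a j * (x j).act φ b := by
  rw [← Pi.sub_apply, ← act_comm]
  simp [actL1, Der0.act, Matrix.mulVec, dotProduct, Fin.sum_univ_four]
  ring

theorem brLPhi_cov_fst (δ : Der0 R) (x : L1 R) (φ : Fin 4 → R) :
    actT δ (brLPhi x φ).1 = (brLPhi (actL1 δ x) φ).1 + (brLPhi x (δ.act φ)).1 := by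
  funext a b
  simp only [actT, Pi.add_apply, brLPhi_fst, act_actL1]
  simp only [act_apply δ ((x _).act φ), map_sub, mul_sub, sum_sub_distrib]
  ring

theorem brLPhi_cov_snd {δ : Der0 R} (hδ : δ ∈ CDer R) (x : L1 R) (φ : Fin 4 → R) :
    δ.2 (brLPhi x φ).2 + 2 * δ.1 0 0 * (brLPhi x φ).2 =
      (brLPhi (actL1 δ x) φ).2 + (brLPhi x (δ.act φ)).2 := by
  have key := sum_conformal hδ fun i j => (x i).act φ j
  simp only [brLPhi_snd, act_actL1, act_apply δ ((x _).act φ)]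
  simp only [Fin.sum_univ_four, map_add, map_neg, leibniz, der_eta, smul_eq_mul] at key ⊢
  linear_combination key

/-- Elements of degree two, before taking the quotient by the ideal. -/
abbrev PreE2 (R : Type*) [CommRing R] [Algebra ℝ R] : Type _ :=
  L2 R × (Fin 4 → Fin 4 → R) × R

/-- The bracket of two elements of degree one, before taking the quotient by the ideal. -/
def preBr (x y : E1 R) : PreE2 R :=
  (brL x.1 y.1 + brPhi x.2 y.2, brLPhi x.1 y.2 + brLPhi y.1 x.2)

/-- The action of a derivation on elements of degree two. -/
def act2 (δ : Der0 R) (z : PreE2 R) : PreE2 R :=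
  (actL2 δ z.1, actT δ z.2.1, δ.2 z.2.2 + 2 * δ.1 0 0 * z.2.2)

theorem act2_preBr {δ : Der0 R} (hδ : δ ∈ CDer R) (x y : E1 R) :
    act2 δ (preBr x y) = preBr (br01 δ x) y + preBr x (br01 δ y) := by
  simp only [br01_eq]
  refine Prod.ext ?_ (Prod.ext (funext fun p => funext fun q => ?_) ?_)
  · simp only [act2, preBr, actL2_add, actL2_brL, actL2_brPhi hδ, fst_add]
    abel
  · have h1 := congrFun (congrFun (brLPhi_cov_fst δ x.1 y.2) p) q
    have h2 := congrFun (congrFun (brLPhi_cov_fst δ y.1 x.2) p) q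
    simp only [act2, preBr, actT, fst_add, snd_add, Pi.add_apply, map_add, mul_add,
      sum_add_distrib] at h1 h2 ⊢
    linear_combination h1 + h2
  · have h1 := brLPhi_cov_snd hδ x.1 y.2
    have h2 := brLPhi_cov_snd hδ y.1 x.2
    simp only [act2, preBr, snd_add, map_add] at h1 h2 ⊢
    linear_combination h1 + h2

variable (R) in
/-- The elements of degree two that vanish in the quotient. -/
def nullE2 : AddSubgroup (PreE2 R) where
  carrier := {z | z.1 ∈ I2 R ∧ z.2 = 0}
  add_mem' h h' := ⟨add_mem h.1 h'.1, by rw [snd_add, h.2, h'.2, add_zero]⟩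
  zero_mem' := ⟨zero_mem _, rfl⟩
  neg_mem' h := ⟨neg_mem h.1, by rw [Prod.snd_neg, h.2, neg_zero]⟩

theorem act2_mem {δ : Der0 R} (hδ : δ ∈ CDer R) {z : PreE2 R} (hz : z ∈ nullE2 R) :
    act2 δ z ∈ nullE2 R := by
  obtain ⟨h1, h2⟩ := hz
  refine ⟨actL2_mem hδ h1, ?_⟩
  simp only [act2, h2]
  exact Prod.ext (funext fun p => funext fun q => by simp [actT]) (by simp)

theorem smul_mem_nullE2 (t : ℝ) {z : PreE2 R} (hz : z ∈ nullE2 R) : t • z ∈ nullE2 R := by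
  rw [← algebraMap_smul R t z]
  exact ⟨(I2 R).smul_mem _ hz.1, by rw [smul_snd, hz.2, smul_zero]⟩

/-- The quotient map in degree two. -/
def toE2 : PreE2 R →+ E2 R where
  toFun z := (Submodule.Quotient.mk z.1, z.2)
  map_zero' := rfl
  map_add' _ _ := rfl

theorem toE2_eq_zero {z : PreE2 R} : toE2 z = 0 ↔ z ∈ nullE2 R := by
  rw [Prod.ext_iff]
  exact and_congr (Submodule.Quotient.mk_eq_zero _) Iff.rfl

theorem act2_add_right (δ : Der0 R) (z w : PreE2 R) : act2 δ (z + w) = act2 δ z + act2 δ w := by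
  refine Prod.ext (actL2_add _ _ _) (Prod.ext (funext fun p => funext fun q => ?_) ?_)
  · simp only [act2, actT, fst_add, snd_add, Pi.add_apply, map_add, mul_add, sum_add_distrib]
    ring
  · simp only [act2, snd_add, map_add]
    ring

theorem biadd_preBr : Biadd (preBr : E1 R → E1 R → PreE2 R) where
  left x y z := by
    refine Prod.ext ?_ ?_ <;>
    simp only [preBr, fst_add, snd_add, brL_add_left, brPhi_add_left, brLPhi_add_left,
      brLPhi_add_right] <;> abel
  right x y z := by
    refine Prod.ext ?_ ?_ <;>
    simp only [preBr, fst_add, snd_add, brL_add_right, brPhi_add_right, brLPhi_add_left,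
      brLPhi_add_right] <;> abel

end Covariance

section Exponential

theorem sum_antidiagonal_assoc {N : Type*} [AddCommMonoid N] (F : Multi → Multi → Multi → N)
    (α : Multi) : ∑ q ∈ antidiagonal α, ∑ r ∈ antidiagonal q.2, F q.1 r.1 r.2 =
      ∑ q ∈ antidiagonal α, ∑ r ∈ antidiagonal q.1, F r.1 r.2 q.2 := by
  rw [Finset.sum_sigma', Finset.sum_sigma']
  refine Finset.sum_nbij' (fun x => ⟨(x.1.1 + x.2.1, x.2.2), (x.1.1, x.2.1)⟩)
    (fun x => ⟨(x.2.1, x.2.2 + x.1.2), (x.2.2, x.1.2)⟩) ?_ ?_ ?_ ?_ ?_ <;>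
  · rintro ⟨⟨i, j⟩, ⟨k, l⟩⟩ h
    simp only [Finset.mem_sigma, mem_antidiagonal] at h
    obtain ⟨rfl, rfl⟩ := h
    simp [add_assoc]

theorem sum_antidiagonal_comm {N : Type*} [AddCommMonoid N] (F : Multi → Multi → Multi → N)
    (α : Multi) : ∑ q ∈ antidiagonal α, ∑ r ∈ antidiagonal q.2, F q.1 r.1 r.2 =
      ∑ q ∈ antidiagonal α, ∑ r ∈ antidiagonal q.2, F r.1 q.1 r.2 := by
  rw [sum_antidiagonal_assoc, sum_antidiagonal_assoc fun a b c => F b a c]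
  exact sum_congr rfl fun q _ => Finset.sum_nbij' Prod.swap Prod.swap
    (by simp [add_comm]) (by simp [add_comm]) (by simp) (by simp) (by simp)

/-- The bracket of formal power series, before taking the quotient by the ideal. -/
def serPre (x y : Multi → E1 R) : Multi → PreE2 R :=
  fun α => ∑ q ∈ antidiagonal α, preBr (x q.1) (y q.2)

/-- The action of formal power series of degree zero in degree two. -/
def serAct2 (a : Multi → E0 R) (z : Multi → PreE2 R) : Multi → PreE2 R :=
  fun α => ∑ q ∈ antidiagonal α, act2 (a q.1) (z q.2)

theorem serBr11_eq (x y : Multi → E1 R) (α : Multi) : serBr11 x y α = toE2 (serPre x y α) := by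
  rw [serPre, map_sum]; rfl

theorem map_sum_of_add {A B ι : Type*} [AddCommGroup A] [AddCommGroup B] {f : A → B}
    (hf : ∀ x y, f (x + y) = f x + f y) (s : Finset ι) (x : ι → A) :
    f (∑ i ∈ s, x i) = ∑ i ∈ s, f (x i) := map_sum (AddMonoidHom.mk' f hf) x s

variable {a : Multi → E0 R} (ha : ∀ α, a α ∈ CDer R)

include ha in
theorem serAct2_serPre (x y : Multi → E1 R) :
    serAct2 a (serPre x y) = serPre (serBr01 a x) y + serPre x (serBr01 a y) := by
  funext α
  have h : serAct2 a (serPre x y) α = ∑ q ∈ antidiagonal α, ∑ r ∈ antidiagonal q.2,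
      (preBr (br01 (a q.1) (x r.1)) (y r.2) + preBr (x r.1) (br01 (a q.1) (y r.2))) :=
    sum_congr rfl fun q _ => by
      rw [serPre, map_sum_of_add (f := act2 (a q.1)) (act2_add_right _)]
      exact sum_congr rfl fun r _ => act2_preBr (ha _) _ _
  rw [h]
  simp only [sum_add_distrib]
  rw [sum_antidiagonal_assoc fun p r s => preBr (br01 (a p) (x r)) (y s),
    sum_antidiagonal_comm fun p r s => preBr (x r) (br01 (a p) (y s))]
  refine congrArg₂ _ (sum_congr rfl fun q _ => ?_) (sum_congr rfl fun q _ => ?_)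
  · exact (map_sum_of_add (f := fun z => preBr z (y q.2)) (fun z w => biadd_preBr.left z w _) _ _).symm
  · exact (map_sum_of_add (f := fun z => preBr (x q.1) z) (fun z w => biadd_preBr.right _ z w) _ _).symm

theorem serAct2_add (z w : Multi → PreE2 R) :
    serAct2 a (z + w) = serAct2 a z + serAct2 a w := funext fun α => by
  simp only [serAct2, Pi.add_apply, act2_add_right, sum_add_distrib]

include ha in
theorem iterate_serAct2 (x : Multi → E1 R) (n : ℕ) : (serAct2 a)^[n] (serPre x x) =
    ∑ ij ∈ antidiagonal n,
      n.choose ij.1 • serPre ((serBr01 a)^[ij.1] x) ((serBr01 a)^[ij.2] x) := by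
  induction n with
  | zero => simp
  | succ n ih =>
    rw [Finset.sum_antidiagonal_choose_succ_nsmul
      (fun i j => serPre ((serBr01 a)^[i] x) ((serBr01 a)^[j] x)) n, Function.iterate_succ_apply', ih]
    have h := map_sum (AddMonoidHom.mk' (serAct2 a) serAct2_add)
      (fun ij : ℕ × ℕ => n.choose ij.1 • serPre ((serBr01 a)^[ij.1] x) ((serBr01 a)^[ij.2] x))
      (antidiagonal n)
    refine h.trans ?_
    simp only [map_nsmul, AddMonoidHom.mk'_apply, serAct2_serPre ha, smul_add,
      sum_add_distrib, Function.iterate_succ_apply']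
    rw [add_comm]
    congr 1
    exact sum_congr rfl fun q hq => by
      rw [← mem_antidiagonal.1 hq, Nat.choose_symm_add]

theorem iterate_eq_zero (h0 : a 0 = 0) (x : Multi → E1 R) (k : ℕ) (α : Multi) (h : α.degree < k) :
    (serBr01 a)^[k] x α = 0 := by
  induction k generalizing α with
  | zero => exact absurd h (Nat.not_lt_zero _)
  | succ k ih =>
    rw [Function.iterate_succ_apply']
    refine sum_eq_zero fun q hq => ?_
    have h1 := mem_antidiagonal.1 hq
    by_cases h2 : q.1 = 0
    · rw [h2, h0, br01_eq]
      exact Prod.ext (funext fun i => by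
        simp only [actL1, Prod.fst_zero, Matrix.zero_apply, zero_smul, Finset.sum_const_zero, add_zero]
        rw [Der0.comm_swap, comm_zero_right, neg_zero]; rfl) (by
        funext i; simp [act_apply])
    · have h3 : q.2.degree < k := by
        have h4 := congrArg Finsupp.degree h1
        rw [map_add] at h4
        have h5 : q.1.degree ≠ 0 := fun h => h2 ((Finsupp.degree_eq_zero_iff _).1 h)
        omega
      rw [ih _ h3, br01_eq]
      exact Prod.ext (funext fun i => by simp [actL1, comm_zero_right]) (by
        funext i; simp [act_apply])

theorem gaugeAct_eq_range (h0 : a 0 = 0) (x : Multi → E1 R) {α : Multi} {n : ℕ} (h : α.degree ≤ n) :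
    gaugeAct a x α = ∑ k ∈ Finset.range (n + 1), (k.factorial : ℝ)⁻¹ • (serBr01 a)^[k] x α := by
  simp only [gaugeAct, algebraMap_smul]
  refine Finset.sum_subset (Finset.range_mono (by omega)) fun k _ hk => ?_
  rw [iterate_eq_zero h0 _ _ _ (by simpa using hk), smul_zero]

theorem preBr_sum_left (s : Finset ℕ) (x : ℕ → E1 R) (y : E1 R) :
    preBr (∑ k ∈ s, x k) y = ∑ k ∈ s, preBr (x k) y :=
  map_sum_of_add (f := fun z => preBr z y) (fun z w => biadd_preBr.left z w y) s x

theorem preBr_sum_right (s : Finset ℕ) (x : E1 R) (y : ℕ → E1 R) :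
    preBr x (∑ k ∈ s, y k) = ∑ k ∈ s, preBr x (y k) :=
  map_sum_of_add (f := preBr x) (biadd_preBr.right x) s y

theorem preBr_inv_smul_left (n : ℕ) (z w : E1 R) :
    preBr ((n : ℝ)⁻¹ • z) w = (n : ℝ)⁻¹ • preBr z w :=
  map_inv_natCast_smul (AddMonoidHom.mk' (fun z => preBr z w)
    fun z z' => biadd_preBr.left z z' w) ℝ ℝ n z

theorem preBr_inv_smul_right (n : ℕ) (z w : E1 R) :
    preBr z ((n : ℝ)⁻¹ • w) = (n : ℝ)⁻¹ • preBr z w :=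
  map_inv_natCast_smul (AddMonoidHom.mk' (preBr z) (biadd_preBr.right z)) ℝ ℝ n w

include ha in
set_option maxHeartbeats 1000000 in
/-- Gauge transformations preserve the Maurer-Cartan equation. -/
theorem serBr11_gaugeAct (h0 : a 0 = 0) {x : Multi → E1 R} (hx : serBr11 x x = 0) :
    serBr11 (gaugeAct a x) (gaugeAct a x) = 0 := by
  funext α
  rw [serBr11_eq, Pi.zero_apply, toE2_eq_zero]
  have hx' : ∀ n β, (serAct2 a)^[n] (serPre x x) β ∈ nullE2 R := fun n => by
    induction n with
    | zero => exact fun β => toE2_eq_zero.1 ((serBr11_eq x x β).symm.trans (congrFun hx β))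
    | succ n ih =>
      intro β
      rw [Function.iterate_succ_apply']
      exact sum_mem fun q _ => act2_mem (ha _) (ih _)
  let f : ℕ → ℕ → PreE2 R := fun k l => ((k.factorial : ℝ)⁻¹ * (l.factorial : ℝ)⁻¹) •
    serPre ((serBr01 a)^[k] x) ((serBr01 a)^[l] x) α
  have h1 : serPre (gaugeAct a x) (gaugeAct a x) α =
      ∑ k ∈ Finset.range (α.degree + 1), ∑ l ∈ Finset.range (α.degree + 1), f k l := by
    simp only [f, serPre, smul_sum]
    rw [sum_congr rfl fun k _ => sum_comm, sum_comm]
    refine sum_congr rfl fun q hq => ?_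
    have h4 := congrArg Finsupp.degree (mem_antidiagonal.1 hq)
    rw [map_add] at h4
    rw [gaugeAct_eq_range h0 x (show q.1.degree ≤ α.degree by omega),
      gaugeAct_eq_range h0 x (show q.2.degree ≤ α.degree by omega), preBr_sum_left]
    refine sum_congr rfl fun k _ => ?_
    rw [preBr_sum_right]
    refine sum_congr rfl fun l _ => ?_
    rw [mul_smul, preBr_inv_smul_left, preBr_inv_smul_right]
  have hf : ∀ k l, α.degree < k + l → f k l = 0 := fun k l hkl => by
    refine (congrArg _ (sum_eq_zero fun q hq => ?_)).trans (smul_zero _)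
    have h4 := congrArg Finsupp.degree (mem_antidiagonal.1 hq)
    rw [map_add] at h4
    have z1 : ∀ z : E1 R, preBr 0 z = 0 := fun z =>
      (AddMonoidHom.mk' (fun w => preBr w z) fun w w' => biadd_preBr.left w w' z).map_zero
    have z2 : ∀ z : E1 R, preBr z 0 = 0 := fun z =>
      (AddMonoidHom.mk' (preBr z) (biadd_preBr.right z)).map_zero
    by_cases hk : q.1.degree < k
    · rw [iterate_eq_zero h0 _ _ _ hk, z1]
    · rw [iterate_eq_zero h0 _ l _ (by omega), z2]
  have h2 : ∑ k ∈ Finset.range (α.degree + 1), ∑ l ∈ Finset.range (α.degree + 1), f k l =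
      ∑ n ∈ Finset.range (α.degree + 1), (n.factorial : ℝ)⁻¹ • (serAct2 a)^[n] (serPre x x) α := by
    rw [sum_congr rfl fun k hk => (Finset.sum_subset (Finset.range_mono (Nat.sub_le _ k))
      fun l _ hl => hf k l (by simp only [Finset.mem_range] at hk hl; omega)).symm,
      ← Finset.sum_range_diag_flip]
    refine sum_congr rfl fun n _ => ?_
    rw [iterate_serAct2 ha, ← Finset.Nat.sum_antidiagonal_eq_sum_range_succ f, Finset.sum_apply,
      smul_sum]
    refine sum_congr rfl fun q hq => ?_
    rw [Pi.smul_apply, ← Nat.cast_smul_eq_nsmul ℝ, smul_smul]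
    refine congrArg (· • serPre ((serBr01 a)^[q.1] x) ((serBr01 a)^[q.2] x) α) ?_
    have hc := congrArg (Nat.cast (R := ℝ)) (Nat.choose_mul_factorial_mul_factorial
      (Nat.le_add_right q.1 q.2))
    rw [Nat.add_sub_cancel_left] at hc
    rw [← mem_antidiagonal.1 hq]
    have h5 := fun m => Nat.cast_ne_zero (R := ℝ).2 (Nat.factorial_ne_zero m)
    push_cast at hc
    have e1 := h5 q.1
    have e2 := h5 q.2
    have e3 := h5 (q.1 + q.2)
    field_simp
    linear_combination -hc
  rw [h1, h2]
  exact sum_mem fun n _ => smul_mem_nullE2 _ (hx' n α)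

end Exponential

section Parity

/-- The two indices that are odd with respect to a spatial direction. -/
def oddIdx (l : Fin 3) (a : Fin 4) : Bool := a == sp (l + 1) || a == sp (l + 2)

/-- Elements of even parity. -/
structure EvenX (l : Fin 3) (x : E1 R) : Prop where
  mat : ∀ a b c, (oddIdx l a ^^ (oddIdx l b ^^ oddIdx l c)) = true → (x.1 a).1 b c = 0
  der : ∀ a, oddIdx l a = true → (x.1 a).2 = 0
  phi : ∀ c, oddIdx l c = true → x.2 c = 0

/-- Elements whose odd part is symmetric. -/
def SymX (l : Fin 3) (x : E1 R) : Prop := ∀ a b c, oddIdx l a = true → oddIdx l b = true →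
  oddIdx l c = false → (x.1 a).1 b c = (x.1 b).1 a c

/-- Derivations of even parity. -/
def EvenD (l : Fin 3) (δ : Der0 R) : Prop :=
  ∀ b c, (oddIdx l b ^^ oddIdx l c) = true → δ.1 b c = 0

theorem actL1_entry (δ : Der0 R) (x : L1 R) (a b c : Fin 4) : (actL1 δ x a).1 b c =
    ∑ d, δ.1 b d * (x a).1 d c - ∑ d, (x a).1 b d * δ.1 d c + δ.2 ((x a).1 b c) -
      (x a).2 (δ.1 b c) + ∑ d, δ.1 a d * (x d).1 b c := by
  simp [actL1, Der0.comm, Matrix.mul_apply, Matrix.sum_apply, fst_sum]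

theorem actL1_der (δ : Der0 R) (x : L1 R) (a : Fin 4) :
    (actL1 δ x a).2 = ⁅δ.2, (x a).2⁆ + ∑ d, δ.1 a d • (x d).2 := by
  simp [actL1, Der0.comm, snd_sum]

variable {l : Fin 3} {δ : Der0 R} {x : E1 R}

theorem xor_helper : ∀ {A B C D : Bool}, (A ^^ (B ^^ C)) = true →
    (¬ (B ^^ D) = true → (A ^^ (D ^^ C)) = true) ∧ (¬ (D ^^ C) = true → (A ^^ (B ^^ D)) = true) ∧
      (¬ (A ^^ D) = true → (D ^^ (B ^^ C)) = true) := by decide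

theorem EvenX.br01 (hx : EvenX l x) (hδ : EvenD l δ) : EvenX l (br01 δ x) := by
  rw [br01_eq]
  refine ⟨fun a b c h => ?_, fun a h => ?_, fun c h => ?_⟩
  · have h1 : ∀ d, δ.1 b d * (x.1 a).1 d c = 0 := fun d => by
      by_cases hd : (oddIdx l b ^^ oddIdx l d) = true
      · rw [hδ _ _ hd, zero_mul]
      · rw [hx.mat a d c ((xor_helper h).1 hd), mul_zero]
    have h2 : ∀ d, (x.1 a).1 b d * δ.1 d c = 0 := fun d => by
      by_cases hd : (oddIdx l d ^^ oddIdx l c) = true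
      · rw [hδ _ _ hd, mul_zero]
      · rw [hx.mat a b d ((xor_helper h).2.1 hd), zero_mul]
    have h3 : ∀ d, δ.1 a d * (x.1 d).1 b c = 0 := fun d => by
      by_cases hd : (oddIdx l a ^^ oddIdx l d) = true
      · rw [hδ _ _ hd, zero_mul]
      · rw [hx.mat d b c ((xor_helper h).2.2 hd), mul_zero]
    have h4 : (x.1 a).2 (δ.1 b c) = 0 := by
      by_cases ha : oddIdx l a = true
      · rw [hx.der a ha]; rfl
      · rw [Bool.not_eq_true] at ha
        rw [hδ b c (by rwa [ha, Bool.false_xor] at h), map_zero]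
    change (actL1 δ x.1 a).1 b c = 0
    rw [actL1_entry, hx.mat a b c h, h4]
    simp [h1, h2, h3]
  · change (actL1 δ x.1 a).2 = 0
    rw [actL1_der, hx.der a h, lie_zero, zero_add]
    refine sum_eq_zero fun d _ => ?_
    by_cases hd : oddIdx l d = true
    · rw [hx.der d hd, smul_zero]
    · rw [hδ a d (by simp [h, hd]), zero_smul]
  · change δ.act x.2 c = 0
    rw [act_apply, hx.phi c h, map_zero, add_zero]
    refine sum_eq_zero fun d _ => ?_
    by_cases hd : oddIdx l d = true
    · rw [hx.phi d hd, mul_zero]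
    · rw [hδ c d (by simp [h, hd]), zero_mul]

theorem SymX.br01 (hx : SymX l x) (hδ : EvenD l δ ∨ EvenX l x) : SymX l (br01 δ x) := by
  rw [br01_eq]
  intro a b c ha hb hc
  have h1 : ∀ a b, oddIdx l a = true → oddIdx l b = true → ∀ d,
      δ.1 b d * (x.1 a).1 d c = δ.1 b d * (x.1 d).1 a c := fun a b ha hb d => by
    by_cases hd : oddIdx l d = true
    · rw [hx a d c ha hd hc]
    · rcases hδ with hδ | he
      · rw [hδ b d (by simp [hb, hd]), zero_mul, zero_mul]
      · rw [he.mat a d c (by simp [ha, hd, hc]), he.mat d a c (by simp [ha, hd, hc])]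
  have h2 : ∀ d, (x.1 a).1 b d * δ.1 d c = (x.1 b).1 a d * δ.1 d c := fun d => by
    by_cases hd : oddIdx l d = true
    · rcases hδ with hδ | he
      · rw [hδ d c (by simp [hd, hc]), mul_zero, mul_zero]
      · rw [he.mat a b d (by simp [ha, hb, hd]), he.mat b a d (by simp [ha, hb, hd])]
    · rw [hx a b d ha hb (by simpa using hd)]
  have h3 : ∀ a b, oddIdx l a = true → oddIdx l b = true → (x.1 a).2 (δ.1 b c) = 0 :=
    fun a b ha hb => by
    rcases hδ with hδ | he
    · rw [hδ b c (by simp [hb, hc]), map_zero]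
    · rw [he.der a ha]; rfl
  change (actL1 δ x.1 a).1 b c = (actL1 δ x.1 b).1 a c
  simp only [actL1_entry, h3 a b ha hb, h3 b a hb ha, h1 a b ha hb, h1 b a hb ha, h2,
    hx a b c ha hb hc]
  ring

/-- The filtration in terms of parity. -/
def InF (κ : Multi) (x : E1 R) : Prop := ∀ l, (κ l = 0 → EvenX l x) ∧ (κ l ≤ 1 → SymX l x)

theorem InF.br01 {κ κ' : Multi} (hx : InF κ x)
    (hδ : ∀ l, κ' l = 0 → EvenD l δ) : InF (κ' + κ) (br01 δ x) := fun l => by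
  rw [Finsupp.add_apply]
  refine ⟨fun h => ((hx l).1 (by omega)).br01 (hδ l (by omega)), fun h => ?_⟩
  refine ((hx l).2 (by omega)).br01 ?_
  by_cases h0 : κ' l = 0
  · exact .inl (hδ l h0)
  · exact .inr ((hx l).1 (by omega))

end Parity

section Coefficients

variable (e)

/-- The coefficients of an element of degree one, in terms of its entries and the components of
its derivations. -/
def coefX (x : E1 R) (h : Fin 4 → Fin 4 → R) : B1 → R
  | .inl (.diag i) => (x.1 (sp i)).1 0 (sp i)
  | .inl (.curv i) => (1 / 2 : ℝ) • ((x.1 (sp (i + 1))).1 (sp (i + 2)) (sp i) -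
      (x.1 (sp (i + 2))).1 (sp (i + 1)) (sp i))
  | .inl (.frame i μ) => h (sp i) μ
  | .inl (.conf i) => (x.1 (sp i)).1 0 0
  | .inl (.sym i) => (1 / 2 : ℝ) • ((x.1 (sp (i + 1))).1 (sp (i + 2)) 0 +
      (x.1 (sp (i + 2))).1 (sp (i + 1)) 0)
  | .inl (.rotK i) => (x.1 (sp (i + 2))).1 (sp (i + 2)) (sp i)
  | .inl (.rotJ i) => (x.1 (sp (i + 1))).1 (sp i) (sp (i + 1))
  | .inl (.asym i) => (1 / 2 : ℝ) • ((x.1 (sp (i + 1))).1 (sp (i + 2)) 0 -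
      (x.1 (sp (i + 2))).1 (sp (i + 1)) 0)
  | .inl (.scalar c) => x.2 c
  | .inr .conf => (x.1 0).1 0 0 - ∑ i, (x.1 (sp i)).1 0 (sp i)
  | .inr (.boost i) => (x.1 0).1 0 (sp i) - (x.1 (sp i)).1 0 0
  | .inr (.rot i) => (x.1 0).1 (sp (i + 1)) (sp (i + 2))
  | .inr (.der μ) => h 0 μ

theorem eq_sum_coefX {x : E1 R} (hx : x ∈ CE1 R) {h : Fin 4 → Fin 4 → R}
    (hh : ∀ a, (x.1 a).2 = derOf e (h a)) : x = ∑ b, coefX x h b • b.elt e := by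
  change x = atOne e (coefX x h)
  choose l b r X hX using hx
  have hX' : ∀ a, X a = derOf e (h a) := fun a => by rw [← hh, hX]; rfl
  have h0 : x.1 0 = (atOne e (coefX x h)).1 0 := by
    rw [atOne_zero, hX, confDer_inj]
    refine ⟨?_, funext fun i => ?_, funext fun i => ?_, hX' 0⟩
    · simp [coefX, hX, confDer, confMatrix_zero_zero, confMatrix_zero_sp]
    · simp [coefX, hX, confDer, confMatrix_zero_zero, confMatrix_zero_sp]
    · simp [coefX, hX, confDer, confMatrix_sp_sp, fin3_add, (fin3_add_one_ne_add_two i).symm]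
  have hs : ∀ i, x.1 (sp i) = (atOne e (coefX x h)).1 (sp i) := fun i => by
    rw [atOne_sp, hX, confDer_inj]
    refine ⟨?_, funext fun m => ?_, funext fun m => ?_, by rw [hX', frameDer_eq]; rfl⟩
    · simp [coefX, hX, confDer, confMatrix_zero_zero]
    · fin_cases i <;> fin_cases m <;> simp [boostCoeff, coefX, hX, confDer, confMatrix_zero_sp,
        confMatrix_sp_zero] <;> module
    · fin_cases i <;> fin_cases m <;> simp [rotCoeff, coefX, hX, confDer, confMatrix_sp_sp] <;> module
  have hp : ∀ c, x.2 c = (atOne e (coefX x h)).2 c := fun c => by rw [atOne_snd]; rfl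
  generalize atOne e (coefX x h) = y at h0 hs hp
  exact Prod.ext (funext fun a => Fin.cases h0 hs a) (funext hp)

end Coefficients

section Supported

/-- The matrix entries of the basis elements of degree zero. -/
def GB0.entry (p q : Fin 4) : GB0 → ℤ
  | der _ => 0
  | conf => idEntry p q
  | boost i => boostEntry i p q
  | rot i => rotEntry i p q

/-- The entries of the degree. -/
def GB0.num : GB0 → Fin 3 → ℕ
  | der _ => 0
  | conf => 0
  | boost i => num011 i
  | rot i => num011 i

/-- The matrix entries of the basis elements of degree one. -/
def B1.entry (a p q : Fin 4) : B1 → ℤ :=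
  Sum.elim (GB1.entry a p q) fun b => if a = 0 then b.entry p q else 0

/-- The entries of the degree. -/
def B1.num : B1 → Fin 3 → ℕ := Sum.elim GB1.num GB0.num

theorem GB0.deg_apply (b : GB0) (l : Fin 3) : b.deg l = b.num l := by
  cases b <;> simp only [GB0.deg, GB0.num, deg011_apply] <;> rfl

theorem B1.deg_apply (b : B1) (l : Fin 3) : b.deg l = b.num l := by
  cases b with
  | inl b => exact b.deg_apply l
  | inr b => exact b.deg_apply l

set_option maxRecDepth 100000 in
theorem GB0.entry_even : ∀ (b : GB0) l p q, b.num l = 0 → (oddIdx l p ^^ oddIdx l q) = true →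
    b.entry p q = 0 := by decide +kernel

set_option maxRecDepth 100000 in
theorem B1.entry_even : ∀ (b : B1) l a p q, b.num l = 0 →
    (oddIdx l a ^^ (oddIdx l p ^^ oddIdx l q)) = true → b.entry a p q = 0 := by decide +kernel

set_option maxRecDepth 100000 in
theorem B1.entry_symm : ∀ (b : B1) l a p q, b.num l ≤ 1 → oddIdx l a = true → oddIdx l p = true →
    oddIdx l q = false → b.entry a p q = b.entry p a q := by decide +kernel

variable (e)

theorem GB0.elt_entry (b : GB0) (p q : Fin 4) : (b.elt e).1 p q = b.entry p q := by
  cases b <;> simp only [GB0.elt, GB0.entry, boost_eq_boostEntry, rot_eq_rotEntry, sigma0_eq_idEntry]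
  simp [ofDer]

theorem B1.elt_entry (b : B1) (a p q : Fin 4) : ((b.elt e).1 a).1 p q = b.entry a p q := by
  cases b with
  | inl b => exact b.elt_entry e a p q
  | inr b =>
    change ((theta 0 a : R) • b.elt e).1 p q = _
    rw [smul_fst, Matrix.smul_apply, smul_eq_mul, theta_apply, GB0.elt_entry]
    simp [B1.entry]

theorem GB0.elt_mem_CDer (b : GB0) : b.elt e ∈ CDer R := by
  cases b
  · exact ofDer_mem _
  · exact sigma0_mem
  · exact boost_mem _
  · exact rot_mem _

theorem atOne_single (b : B1) (f : R) : atOne e (Pi.single b f) = f • b.elt e := by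
  rw [atOne, sum_eq_single b (fun c _ h => by rw [Pi.single_eq_of_ne h, zero_smul])
    (by simp), Pi.single_eq_same]

variable {e}

variable (e W) in
/-- Elements in the filtration with entries in a given space of functions. -/
structure Good (κ β : Multi) (x : E1 R) : Prop where
  mem : x ∈ CE1 R
  inF : InF κ x
  mat : ∀ a b c, (x.1 a).1 b c ∈ W β
  phi : ∀ c, x.2 c ∈ W β
  der : ∃ h : Fin 4 → Fin 4 → R, (∀ a, (x.1 a).2 = derOf e (h a)) ∧ ∀ a μ, h a μ ∈ W β

variable (e W) in
/-- Linear combinations of the basis elements whose degrees are in a given set, with coefficients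
in a given space of functions. -/
def Supp (S : Set Multi) (β : Multi) (x : E1 R) : Prop :=
  ∃ f : B1 → R, (∀ b, f b ∈ W β) ∧ (∀ b, b.deg ∉ S → f b = 0) ∧ x = ∑ b, f b • b.elt e

theorem Supp.add {S : Set Multi} {β : Multi} {x y : E1 R} (hx : Supp e W S β x)
    (hy : Supp e W S β y) : Supp e W S β (x + y) := by
  obtain ⟨f, hf, hf', rfl⟩ := hx
  obtain ⟨g, hg, hg', rfl⟩ := hy
  refine ⟨f + g, fun b => add_mem (hf b) (hg b), fun b hb => ?_, ?_⟩
  · rw [Pi.add_apply, hf' b hb, hg' b hb, add_zero]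
  · simp only [Pi.add_apply, add_smul, sum_add_distrib]

theorem Supp.smul {S : Set Multi} {β : Multi} {x : E1 R} (t : ℝ) (hx : Supp e W S β x) :
    Supp e W S β (t • x) := by
  obtain ⟨f, hf, hf', rfl⟩ := hx
  refine ⟨t • f, fun b => (W β).smul_mem t (hf b), fun b hb => ?_, ?_⟩
  · rw [Pi.smul_apply, hf' b hb, smul_zero]
  · simp only [Pi.smul_apply, smul_assoc, smul_sum]

theorem Supp.zero {S : Set Multi} {β : Multi} : Supp e W S β 0 :=
  ⟨0, fun _ => (W β).zero_mem, fun _ _ => rfl, by simp⟩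

theorem Supp.sum {S : Set Multi} {β : Multi} {ι : Type*} {s : Finset ι} {x : ι → E1 R}
    (hx : ∀ i ∈ s, Supp e W S β (x i)) : Supp e W S β (∑ i ∈ s, x i) :=
  Finset.sum_induction _ _ (fun _ _ => Supp.add) Supp.zero hx

theorem Supp.mono {S S' : Set Multi} {β : Multi} {x : E1 R} (h : S ⊆ S')
    (hx : Supp e W S β x) : Supp e W S' β x := by
  obtain ⟨f, hf, hf', rfl⟩ := hx
  exact ⟨f, hf, fun b hb => hf' b fun h' => hb (h h'), rfl⟩

theorem oddIdx_zero (l : Fin 3) : oddIdx l 0 = false := by decide +revert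

theorem oddIdx_self : ∀ l, oddIdx l (sp l) = false ∧ oddIdx l (sp (l + 1)) = true ∧
    oddIdx l (sp (l + 2)) = true := by decide

theorem oddIdx_of_ne : ∀ {l i}, l ≠ i → oddIdx l (sp i) = true ∧
    (oddIdx l (sp (i + 1)) ^^ oddIdx l (sp (i + 2))) = true ∧
    (oddIdx l (sp (i + 2)) ^^ oddIdx l (sp (i + 1))) = true := by decide

theorem coefX_eq_zero (he : LinearIndependent R e) {κ : Multi} {x : E1 R} (hx : InF κ x)
    {h : Fin 4 → Fin 4 → R} (hh : ∀ a, (x.1 a).2 = derOf e (h a)) {b : B1} (hb : ¬ b.deg ≤ κ) :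
    coefX x h b = 0 := by
  obtain ⟨l, hl⟩ : ∃ l, κ l < b.num l := by
    by_contra! h'
    exact hb fun l => (b.deg_apply l).trans_le (h' l)
  have h011 : ∀ i, κ l < num011 i l → l ≠ i ∧ EvenX l x := fun i h' => by
    unfold num011 at h'
    split_ifs at h' with h1
    · cases h'
    · exact ⟨h1, (hx l).1 (by omega)⟩
  rcases b with (i | i | ⟨i, μ⟩ | i | i | i | i | i | i) | (μ | - | i | i)
  · cases hl
  · change κ l < if l = i then 2 else 0 at hl
    split_ifs at hl with h1
    swap
    · cases hl
    subst h1
    have := (hx l).2 (by omega) (sp (l + 1)) (sp (l + 2)) (sp l) (oddIdx_self l).2.1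
      (oddIdx_self l).2.2 (oddIdx_self l).1
    simp [coefX, this]
  · obtain ⟨h1, h2⟩ := h011 i hl
    have h3 := h2.der (sp i) (by simp [oddIdx_of_ne h1])
    rw [hh, derOf] at h3
    exact Fintype.linearIndependent_iff.1 he _ h3 μ
  · obtain ⟨h1, h2⟩ := h011 i hl
    exact h2.mat _ _ _ (by simp [oddIdx_of_ne h1, oddIdx_zero])
  · obtain ⟨h1, h2⟩ := h011 i hl
    simp only [coefX]
    rw [h2.mat _ _ _ (by simp [oddIdx_of_ne h1, oddIdx_zero]), h2.mat _ _ _ (by simp [oddIdx_of_ne h1, oddIdx_zero])]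
    simp
  · obtain ⟨h1, h2⟩ := h011 i hl
    exact h2.mat _ _ _ (by simp [oddIdx_of_ne h1])
  · obtain ⟨h1, h2⟩ := h011 i hl
    exact h2.mat _ _ _ (by simp [oddIdx_of_ne h1])
  · simp only [coefX]
    by_cases h1 : l = i
    · subst h1
      have h2 : κ l < 2 := by simpa [B1.num, GB1.num, num211] using hl
      have := (hx l).2 (by omega) (sp (l + 1)) (sp (l + 2)) 0 (oddIdx_self l).2.1
        (oddIdx_self l).2.2 (oddIdx_zero l)
      simp [this]
    · have h2 : κ l < 1 := by simpa [B1.num, GB1.num, num211, h1] using hl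
      have h3 := (hx l).1 (by omega)
      rw [h3.mat _ _ _ (by simp [oddIdx_of_ne h1, oddIdx_zero]), h3.mat _ _ _ (by simp [oddIdx_of_ne h1, oddIdx_zero])]
      simp
  · cases i using Fin.cases with
    | zero => cases hl
    | succ i =>
      obtain ⟨h1, h2⟩ := h011 i hl
      exact h2.phi _ (oddIdx_of_ne h1).1
  · cases hl
  · cases hl
  · obtain ⟨h1, h2⟩ := h011 i hl
    simp only [coefX]
    rw [h2.mat _ _ _ (by simp [oddIdx_of_ne h1, oddIdx_zero]), h2.mat _ _ _ (by simp [oddIdx_of_ne h1, oddIdx_zero]), sub_zero]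
  · obtain ⟨h1, h2⟩ := h011 i hl
    exact h2.mat _ _ _ (by simp [oddIdx_of_ne h1, oddIdx_zero])

theorem Good.supp (he : LinearIndependent R e) {κ β : Multi} {x : E1 R} (hx : Good e W κ β x) :
    Supp e W (Set.Iic κ) β x := by
  obtain ⟨h, hh, hw⟩ := hx.der
  refine ⟨coefX x h, fun b => ?_, fun b hb => coefX_eq_zero he hx.inF hh hb,
    eq_sum_coefX e hx.mem hh⟩
  rcases b with (i | i | ⟨i, μ⟩ | i | i | i | i | i | i) | (μ | - | i | i) <;> simp only [coefX] <;>
    first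
    | exact hw _ _
    | exact hx.mat _ _ _
    | exact hx.phi _
    | exact (W β).smul_mem _ (add_mem (hx.mat _ _ _) (hx.mat _ _ _))
    | exact (W β).smul_mem _ (sub_mem (hx.mat _ _ _) (hx.mat _ _ _))
    | exact sub_mem (hx.mat _ _ _) (hx.mat _ _ _)
    | exact sub_mem (hx.mat _ _ _) (sum_mem fun _ _ => hx.mat _ _ _)

theorem good_smul_elt {β : Multi} {f : R} (hf : f ∈ W β) (b : B1) :
    Good e W b.deg β (f • b.elt e) := by
  have hm : ∀ a p q, ((f • b.elt e).1 a).1 p q = (b.entry a p q : R) * f := fun a p q => by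
    change f * ((b.elt e).1 a).1 p q = _
    rw [B1.elt_entry, mul_comm]
  have hw : ∀ c, Pi.single (M := fun _ => R) b f c ∈ W β := fun c => by
    rw [Pi.single_apply]; split_ifs
    exacts [hf, (W β).zero_mem]
  have h0 : ∀ l c, b.deg l = 0 → c.num l ≠ 0 → Pi.single (M := fun _ => R) b f c = 0 :=
    fun l c h1 h2 => Pi.single_eq_of_ne (fun h3 => h2 (by rw [h3, ← B1.deg_apply, h1])) _
  have hodd : ∀ l i, oddIdx l (sp i) = true → num011 i l ≠ 0 := by decide
  have hd := atOne_zero e (Pi.single b f)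
  have hs := atOne_sp e (Pi.single b f)
  have hp := atOne_snd e (Pi.single b f)
  rw [atOne_single] at hd hs hp
  refine ⟨fun a => ?_, fun l => ⟨fun h => ⟨fun a p q h' => ?_, fun a h' => ?_, fun c h' => ?_⟩,
    fun h a p q h1 h2 h3 => ?_⟩, fun a p q => hm a p q ▸ int_mul_mem _ _ hf,
    fun c => hp c ▸ hw _, Fin.cases
      (fun μ => Pi.single (M := fun _ => R) b f (.inr (.der μ)))
      fun i μ => Pi.single (M := fun _ => R) b f (.inl (.frame i μ)), fun a => ?_, fun a μ => ?_⟩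
  · cases a using Fin.cases with
    | zero => rw [hd]; exact confDer_mem _ _ _ _
    | succ i => exact (hs i).symm ▸ confDer_mem _ _ _ _
  · rw [hm, b.entry_even l a p q (b.deg_apply l ▸ h) h', Int.cast_zero, zero_mul]
  · cases a using Fin.cases with
    | zero => cases (oddIdx_zero l).symm.trans h'
    | succ i =>
      refine (congrArg Prod.snd (hs i)).trans (show frameDer e
        (fun c => Pi.single (M := fun _ => R) b f (.inl c)) i = 0 from ?_)
      rw [frameDer]
      refine sum_eq_zero fun μ _ => ?_
      rw [h0 l (.inl (.frame i μ)) h (hodd l i h'), zero_smul]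
  · cases c using Fin.cases with
    | zero => cases (oddIdx_zero l).symm.trans h'
    | succ i => exact (hp _).trans (h0 l (.inl (.scalar i.succ)) h (hodd l i h'))
  · rw [hm, hm, b.entry_symm l a p q (b.deg_apply l ▸ h) h1 h2 h3]
  · cases a using Fin.cases with
    | zero => rw [hd]; rfl
    | succ i => exact congrArg Prod.snd (hs i)
  · cases a using Fin.cases <;> exact hw _

end Supported

section Supported

theorem br01_add_right (δ : Der0 R) (x y : E1 R) : br01 δ (x + y) = br01 δ x + br01 δ y := by
  simp only [br01_eq]
  refine Prod.ext (funext fun a => ?_) (funext fun c => ?_)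
  · simp only [actL1, fst_add, Pi.add_apply, comm_add_right, smul_add, sum_add_distrib]
    abel
  · simp only [act_apply, snd_add, Pi.add_apply, mul_add, sum_add_distrib, map_add]
    ring

theorem br01_add_left (δ ε : Der0 R) (x : E1 R) : br01 (δ + ε) x = br01 δ x + br01 ε x := by
  simp only [br01_eq]
  refine Prod.ext (funext fun a => ?_) (funext fun c => ?_)
  · simp only [actL1, fst_add, Pi.add_apply, Matrix.add_apply, add_smul, sum_add_distrib]
    rw [Der0.comm_swap, comm_add_right, Der0.comm_swap (x.1 a), Der0.comm_swap (x.1 a)]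
    abel
  · simp only [act_apply, fst_add, snd_add, Pi.add_apply, Matrix.add_apply, add_mul,
      sum_add_distrib, Derivation.add_apply]
    ring

theorem br01_zero_right (δ : Der0 R) : br01 δ 0 = 0 :=
  (AddMonoidHom.mk' (br01 δ) (br01_add_right δ)).map_zero

theorem br01_zero_left (x : E1 R) : br01 0 x = 0 :=
  (AddMonoidHom.mk' (fun δ => br01 δ x) fun δ ε => br01_add_left δ ε x).map_zero

theorem br01_sum_right {ι : Type*} (s : Finset ι) (δ : Der0 R) (x : ι → E1 R) :
    br01 δ (∑ i ∈ s, x i) = ∑ i ∈ s, br01 δ (x i) :=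
  map_sum (AddMonoidHom.mk' (br01 δ) (br01_add_right δ)) x s

theorem br01_sum_left {ι : Type*} (s : Finset ι) (δ : ι → Der0 R) (x : E1 R) :
    br01 (∑ i ∈ s, δ i) x = ∑ i ∈ s, br01 (δ i) x :=
  map_sum (AddMonoidHom.mk' (fun δ => br01 δ x) fun δ ε => br01_add_left δ ε x) δ s

variable (e W) in
/-- The derivations with entries in a given space of functions. -/
def derWeight (β : Multi) : AddSubmonoid (Der0 R) where
  carrier := {δ | (∀ a b, δ.1 a b ∈ W β) ∧ ∃ h : Fin 4 → R, (∀ μ, h μ ∈ W β) ∧ δ.2 = derOf e h}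
  add_mem' := by
    rintro δ ε ⟨h1, h, h2, h3⟩ ⟨h4, k, h5, h6⟩
    exact ⟨fun a b => add_mem (h1 a b) (h4 a b), _, fun μ => add_mem (h2 μ) (h5 μ), by
      rw [snd_add, h3, h6, derOf_add]⟩
  zero_mem' := ⟨fun _ _ => zero_mem _, 0, fun _ => zero_mem _, by simp [derOf]⟩

theorem smul_mem_derWeight (hW : Weighted e p W) {γ β : Multi} {r : R} (hr : r ∈ W γ) {δ : Der0 R}
    (hδ : δ ∈ derWeight e W β) : r • δ ∈ derWeight e W (γ + β) := by
  obtain ⟨h1, h, h2, h3⟩ := hδ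
  exact ⟨fun a b => hW.mul_mem hr (h1 a b), _, fun μ => hW.mul_mem hr (h2 μ), by
    rw [smul_snd, h3, smul_derOf]⟩

theorem derOf_mem (hW : Weighted e p W) {γ β : Multi} {h : Fin 4 → R} (hh : ∀ μ, h μ ∈ W γ) {f : R}
    (hf : f ∈ W β) : derOf e h f ∈ W (γ + β) := by
  rw [derOf_apply]
  exact sum_mem fun μ _ => hW.mul_mem (hh μ) (hW.der_mem μ hf)

theorem comm_mem_derWeight (hW : Weighted e p W) (h0 : ∀ μ ν, ⁅e μ, e ν⁆ = derOf e (C μ ν))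
    (hC : ∀ ν κ μ, C ν κ μ ∈ W 0) {γ β : Multi} {δ ε : Der0 R} (hδ : δ ∈ derWeight e W γ)
    (hε : ε ∈ derWeight e W β) : Der0.comm δ ε ∈ derWeight e W (γ + β) := by
  obtain ⟨h1, h, h2, h3⟩ := hδ
  obtain ⟨h4, k, h5, h6⟩ := hε
  have hs : ∀ {f g : R}, f ∈ W γ → g ∈ W β → g * f ∈ W (γ + β) := fun hf hg => by
    rw [mul_comm]; exact hW.mul_mem hf hg
  refine ⟨fun a b => ?_, fun μ => derOf e h (k μ) - derOf e k (h μ) +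
    ∑ ν, ∑ κ, C ν κ μ * h ν * k κ, fun μ => ?_, ?_⟩
  · simp only [Der0.comm, Matrix.add_apply, Matrix.sub_apply, Matrix.mul_apply, Matrix.map_apply, h3,
      h6]
    exact sub_mem (add_mem (sub_mem (sum_mem fun d _ => hW.mul_mem (h1 _ _) (h4 _ _))
      (sum_mem fun d _ => hs (h1 _ _) (h4 _ _))) (derOf_mem hW h2 (h4 _ _)))
      (add_comm γ β ▸ derOf_mem hW h5 (h1 _ _))
  · refine add_mem (sub_mem (derOf_mem hW h2 (h5 _)) (add_comm γ β ▸ derOf_mem hW h5 (h2 _)))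
      (sum_mem fun ν _ => sum_mem fun κ _ => ?_)
    rw [mul_assoc, ← zero_add (γ + β)]
    exact hW.mul_mem (hC _ _ _) (hW.mul_mem (h2 _) (h5 _))
  · change ⁅δ.2, ε.2⁆ = _
    rw [h3, h6, lie_derOf h0]

theorem GB0.smul_elt_mem (hW : Weighted e p W) {γ : Multi} {r : R} (hr : r ∈ W γ) (b : GB0) :
    r • b.elt e ∈ derWeight e W γ := by
  have h1 : ∀ n : ℤ, (n : R) ∈ W 0 := fun n => by
    simpa using int_mul_mem (W 0) n hW.one_mem
  refine add_zero γ ▸ smul_mem_derWeight hW hr ⟨fun p q => b.elt_entry e p q ▸ h1 _, ?_⟩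
  cases b with
  | der μ =>
    refine ⟨Pi.single μ 1, fun ν => ?_, by rw [← derOf_single, one_smul]; rfl⟩
    rw [Pi.single_apply]; split_ifs
    exacts [hW.one_mem, zero_mem _]
  | _ => exact ⟨0, fun _ => zero_mem _, by simp [derOf]; rfl⟩

theorem Good.br01 (hW : Weighted e p W) (h0 : ∀ μ ν, ⁅e μ, e ν⁆ = derOf e (C μ ν))
    (hC : ∀ ν κ μ, C ν κ μ ∈ W 0) {κ β γ : Multi} {x : E1 R} (hx : Good e W κ β x) {r : R}
    (hr : r ∈ W γ) (b : GB0) : Good e W (b.deg + κ) (γ + β) (br01 (r • b.elt e) x) := by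
  obtain ⟨h, hh, hw⟩ := hx.der
  have hδ := b.smul_elt_mem hW hr
  have hx1 : ∀ a, x.1 a ∈ derWeight e W β := fun a => ⟨hx.mat a, h a, hw a, hh a⟩
  have key : ∀ a, (BKL.br01 (r • b.elt e) x).1 a ∈ derWeight e W (γ + β) := fun a => by
    rw [br01_eq]
    exact add_mem (comm_mem_derWeight hW h0 hC hδ (hx1 a))
      (sum_mem fun j _ => smul_mem_derWeight hW (hδ.1 _ _) (hx1 j))
  choose k hk1 hk2 using fun a => (key a).2
  refine ⟨fun a => ?_, hx.inF.br01 fun l hl p q hpq => ?_, fun a => (key a).1, fun c => ?_, k, hk2, hk1⟩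
  · rw [br01_eq]
    exact add_mem (CDer_comm ((CDer R).smul_mem _ (b.elt_mem_CDer e)) (hx.mem a))
      (sum_mem fun j _ => (CDer R).smul_mem _ (hx.mem j))
  · change r * (b.elt e).1 p q = 0
    rw [b.elt_entry, b.entry_even l p q (b.deg_apply l ▸ hl) hpq, Int.cast_zero, mul_zero]
  · obtain ⟨h1, g, h2, h3⟩ := hδ
    rw [br01_eq]
    change (r • b.elt e).act x.2 c ∈ _
    rw [act_apply, h3]
    exact add_mem (sum_mem fun d _ => hW.mul_mem (h1 _ _) (hx.phi _)) (derOf_mem hW h2 (hx.phi _))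

theorem Supp.br01 (hW : Weighted e p W) (h0 : ∀ μ ν, ⁅e μ, e ν⁆ = derOf e (C μ ν))
    (hC : ∀ ν κ μ, C ν κ μ ∈ W 0) (he : LinearIndependent R e) {β γ : Multi} {x : E1 R}
    (hx : Supp e W (Set.Iic β) β x) {r : GB0 → R} (hr : ∀ b, r b ∈ W γ)
    (hr0 : ∀ b, ¬ b.deg < γ → r b = 0) :
    Supp e W (Set.Iio (γ + β)) (γ + β) (br01 (∑ b, r b • b.elt e) x) := by
  obtain ⟨f, hf, hf0, rfl⟩ := hx
  rw [br01_sum_left]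
  refine Supp.sum fun b _ => ?_
  rw [br01_sum_right]
  refine Supp.sum fun c _ => ?_
  by_cases hb : b.deg < γ
  · by_cases hc : c.deg ≤ β
    · exact (((good_smul_elt (hf c) c).br01 hW h0 hC (hr b) b).supp he).mono fun κ hκ =>
        lt_of_le_of_lt hκ (add_lt_add_of_lt_of_le hb hc)
    · rw [hf0 c hc, zero_smul, br01_zero_right]; exact Supp.zero
  · rw [hr0 b hb, zero_smul, br01_zero_left]; exact Supp.zero

variable (e) in
/-- The series of degree zero with given coefficients. -/
def gauge (r : Multi → GB0 → R) : Multi → E0 R := fun α => ∑ b, r α b • b.elt e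

theorem supp_gaugeAct_sub (hW : Weighted e p W) (h0 : ∀ μ ν, ⁅e μ, e ν⁆ = derOf e (C μ ν))
    (hC : ∀ ν κ μ, C ν κ μ ∈ W 0) (he : LinearIndependent R e) {x : Multi → E1 R}
    (hx : ∀ γ, Supp e W (Set.Iic γ) γ (x γ)) {r : Multi → GB0 → R} (hr : ∀ α b, r α b ∈ W α)
    (hr0 : ∀ α b, ¬ b.deg < α → r α b = 0) (α : Multi) :
    Supp e W (Set.Iio α) α (gaugeAct (gauge e r) x α - x α) := by
  have step : ∀ y : Multi → E1 R, (∀ γ, Supp e W (Set.Iic γ) γ (y γ)) → ∀ γ,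
      Supp e W (Set.Iio γ) γ (serBr01 (gauge e r) y γ) := fun y hy γ => Supp.sum fun q hq =>
    mem_antidiagonal.1 hq ▸ (hy q.2).br01 hW h0 hC he (hr q.1) (hr0 q.1)
  have hk : ∀ k γ, Supp e W (Set.Iio γ) γ ((serBr01 (gauge e r))^[k + 1] x γ) := fun k => by
    induction k with
    | zero => exact step x hx
    | succ k ih =>
      rw [Function.iterate_succ_apply']
      exact step _ fun γ => (ih γ).mono Set.Iio_subset_Iic_self
  simp only [gaugeAct, algebraMap_smul]
  rw [Finset.sum_range_succ', Nat.factorial_zero, Nat.cast_one, inv_one, one_smul,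
    Function.iterate_zero_apply, add_sub_cancel_right]
  exact Supp.sum fun k _ => (hk k α).smul _

theorem gaugeAct_eq_add {a a' : Multi → E0 R} (h0 : a 0 = 0) (x : Multi → E1 R) {α : Multi}
    (hα : α ≠ 0) (hlt : ∀ β < α, a' β = a β) (ha' : a' α = 0) :
    gaugeAct a x α = br01 (a α) (x 0) + gaugeAct a' x α := by
  have h0' : a' 0 = 0 := (hlt 0 (pos_iff_ne_zero.2 hα)).trans h0
  have hlow : ∀ k, ∀ β < α, (serBr01 a)^[k] x β = (serBr01 a')^[k] x β := fun k => by
    induction k with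
    | zero => exact fun _ _ => rfl
    | succ k ih =>
      intro β hβ
      rw [Function.iterate_succ_apply', Function.iterate_succ_apply']
      refine sum_congr rfl fun q hq => ?_
      have h1 := mem_antidiagonal.1 hq
      rw [ih _ ((h1 ▸ le_add_self : q.2 ≤ β).trans_lt hβ), hlt _
        ((h1 ▸ le_self_add : q.1 ≤ β).trans_lt hβ)]
  have htop : ∀ k, (serBr01 a)^[k + 1] x α = br01 (a α) ((serBr01 a)^[k] x 0) +
      (serBr01 a')^[k + 1] x α := fun k => by
    rw [Function.iterate_succ_apply', Function.iterate_succ_apply']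
    have hm : ((α, 0) : Multi × Multi) ∈ antidiagonal α := mem_antidiagonal.2 (add_zero α)
    rw [serBr01, serBr01, ← Finset.add_sum_erase _ _ hm, ← Finset.add_sum_erase _ _ hm]
    simp only [ha', br01_zero_left, zero_add]
    congr 1
    refine sum_congr rfl fun q hq => ?_
    obtain ⟨h2, h3⟩ := Finset.mem_erase.1 hq
    rw [mem_antidiagonal] at h3
    have h4 : q.1 < α := lt_of_le_of_ne (h3 ▸ le_self_add) fun h => h2 (by
      refine Prod.ext h ?_
      rw [h] at h3; simpa using h3)
    rw [hlt _ h4]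
    by_cases h5 : q.1 = 0
    · rw [h5, h0, br01_zero_left, br01_zero_left]
    · rw [hlow k q.2 (lt_of_le_of_ne (h3 ▸ le_add_self) fun h => h5 (by
        rw [h] at h3; simpa using h3))]
  obtain ⟨n, hn⟩ := Nat.exists_eq_succ_of_ne_zero
    (fun h => hα ((Finsupp.degree_eq_zero_iff _).1 h) : α.degree ≠ 0)
  rw [gaugeAct_eq_range h0 x le_rfl, gaugeAct_eq_range h0' x le_rfl, Finset.sum_range_succ',
    Finset.sum_range_succ', hn, Finset.sum_range_succ', Finset.sum_range_succ']
  have hz : ∀ k, (serBr01 a)^[k + 1] x 0 = 0 := fun k => iterate_eq_zero h0 x _ _ (by simp)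
  simp only [htop, hz, br01_zero_right, zero_add, Function.iterate_zero_apply, Nat.factorial_one,
    Nat.cast_one, inv_one, one_smul, Nat.factorial_zero]
  abel

end Supported

section GaugeFixing

theorem preBr_sub_left (x y z : E1 R) : preBr (x - y) z = preBr x z - preBr y z := by
  rw [eq_sub_iff_add_eq, ← biadd_preBr.left, sub_add_cancel]

theorem preBr_sub_right (x y z : E1 R) : preBr x (y - z) = preBr x y - preBr x z := by
  rw [eq_sub_iff_add_eq, ← biadd_preBr.right, sub_add_cancel]

theorem serPre_sub {y y' : Multi → E1 R} {α : Multi} (hα : α ≠ 0) (h : ∀ β < α, y β = y' β) :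
    serPre y y α - serPre y' y' α =
      preBr (y 0) (y α - y' α) + preBr (y α - y' α) (y 0) := by
  have h00 := h 0 (pos_iff_ne_zero.2 hα)
  rw [serPre, serPre, ← sum_sub_distrib, Finset.sum_eq_add_of_mem (0, α) (α, 0)
    (mem_antidiagonal.2 (zero_add α)) (mem_antidiagonal.2 (add_zero α))
    (fun h => hα (congrArg Prod.snd h)) fun q hq hne => ?_]
  · simp only [← h00, preBr_sub_left, preBr_sub_right]
  · rw [mem_antidiagonal] at hq
    have h1 : q.1 ≠ α := fun h1 => hne.2 (Prod.ext h1 (by rw [h1] at hq; simpa using hq))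
    have h2 : q.2 ≠ α := fun h1 => hne.1 (Prod.ext (by rw [h1] at hq; simpa using hq) h1)
    rw [h _ (lt_of_le_of_ne (hq ▸ le_self_add) h1), h _ (lt_of_le_of_ne (hq ▸ le_add_self) h2),
      sub_self]

/-- A gauged perturbation of a gauged solution that preserves the Maurer-Cartan equation to first
order vanishes, if its leading coefficients vanish. -/
theorem gauged_rigid (hW : Weighted e p W) (h0 : ∀ μ ν, ⁅e μ, e ν⁆ = derOf e (C μ ν))
    (hC0 : ∀ ν, C 0 ν = 0) (he : LinearIndependent R e) {g0 h : GB1 → R}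
    (hp : ∀ i, g0 (.diag i) = p i) (hz : ∀ b, b.deg ≠ 0 → g0 b = 0) {α : Multi} (hα : α ≠ 0)
    (hh : ∀ b, h b ∈ W α) (hs : ∀ b, ¬ b.deg < α → h b = 0)
    (hB : toE2 (preBr (gauged e 1 g0) (gauged e 0 h) + preBr (gauged e 0 h) (gauged e 1 g0)) = 0) :
    h = 0 := by
  let g : Multi → GB1 → R := Pi.single 0 g0
  let g' : Multi → GB1 → R := g + Pi.single α h
  have hg0 : g 0 = g0 := Pi.single_eq_same _ _
  have hgz : ∀ β, β ≠ 0 → g β = 0 := fun β hβ => Pi.single_eq_of_ne hβ _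
  have hg'α : g' α = h := by
    change g α + Pi.single (M := fun _ => GB1 → R) α h α = h
    rw [hgz α hα, Pi.single_eq_same, zero_add]
  have hg'β : ∀ β, β ≠ α → g' β = g β := fun β hβ => by
    change g β + Pi.single (M := fun _ => GB1 → R) α h β = g β
    rw [Pi.single_eq_of_ne hβ, add_zero]
  have hf : IsFiltered g := fun β b hb => by
    by_cases h1 : β = 0
    · rw [h1, hg0, hz b fun h2 => hb (h2 ▸ zero_le)]
    · rw [hgz β h1]; rfl
  have hf' : IsFiltered g' := fun β b hb => by
    by_cases h1 : β = α
    · rw [h1, hg'α, hs b fun h2 => hb (h1 ▸ h2.le)]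
    · rw [hg'β β h1, hf β b hb]
  have hu : ∀ β, β ≠ 0 → gaugedSeries e g β = 0 := fun β hβ => by
    simp [gaugedSeries, withUnit, hβ, hgz β hβ, gauged]
  have h0s : gaugedSeries e g 0 = gauged e 1 g0 := by simp [gaugedSeries, withUnit, hg0]
  have hαs : gaugedSeries e g' α = gauged e 0 h := by simp [gaugedSeries, withUnit, hα, hg'α]
  have hlow : ∀ β < α, g β = g' β := fun β hβ => (hg'β β hβ.ne).symm
  have hlow' : ∀ β < α, gaugedSeries e g' β = gaugedSeries e g β := fun β hβ => by
    simp only [gaugedSeries, withUnit, hlow β hβ]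
  have m1 : serBr11 (gaugedSeries e g) (gaugedSeries e g) α = 0 := by
    rw [serBr11_eq, serPre, sum_eq_zero fun q hq => ?_, map_zero]
    rw [mem_antidiagonal] at hq
    have hB0 : ∀ x : E1 R, preBr x 0 = 0 ∧ preBr 0 x = 0 := fun x =>
      ⟨by simpa using preBr_sub_right x 0 0, by simpa using preBr_sub_left 0 0 x⟩
    by_cases h1 : q.1 = 0
    · rw [hu q.2 fun h2 => hα (by rw [← hq, h1, h2, add_zero]), (hB0 _).1]
    · rw [hu q.1 h1, (hB0 _).2]
  have m2 : serBr11 (gaugedSeries e g') (gaugedSeries e g') α = 0 := by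
    rw [serBr11_eq] at m1 ⊢
    have hd : gaugedSeries e g' α - gaugedSeries e g α = gauged e 0 h := by
      rw [hu α hα, hαs]; exact sub_zero _
    rw [sub_eq_iff_eq_add.1 (serPre_sub hα hlow'), hd, hlow' 0 (pos_iff_ne_zero.2 hα), h0s, map_add,
      hB, m1]
    exact add_zero 0
  have key := eq_of_evolution_step (C := C) hW hf hf' hα (fun b => by rw [hgz α hα]; exact zero_mem _)
    (fun b => hg'α ▸ hh b) hlow (fun b hb => by rw [hgz α hα, hg'α, hs b fun h1 => h1.ne hb]; rfl)
    (fun i => by rw [hg0, hp]) (fun b => mc_of_mcSum he h0 hC0 m1 _)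
    (fun b => mc_of_mcSum he h0 hC0 m2 _)
  rw [hgz α hα, hg'α] at key
  exact key.symm

theorem actL1_background {l : R} {b r P : Fin 3 → R} {X : Derivation ℝ R R} {x : L1 R}
    (hx0 : x 0 = confDer (∑ i, P i) 0 0 (e 0))
    (hxs : ∀ i, x (sp i) = confDer 0 (Pi.single i (P i)) 0 0) :
    (actL1 (confDer l b r X) x 0).1 0 0 - ∑ i, (actL1 (confDer l b r X) x (sp i)).1 0 (sp i) =
      -e 0 l ∧
    (∀ i, (actL1 (confDer l b r X) x 0).1 0 (sp i) - (actL1 (confDer l b r X) x (sp i)).1 0 0 =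
      -(e 0 (b i) + (P (i + 1) + P (i + 2)) * b i)) ∧
    (∀ i, (actL1 (confDer l b r X) x 0).1 (sp (i + 1)) (sp (i + 2)) = -e 0 (r i)) ∧
    (actL1 (confDer l b r X) x 0).2 = ⁅X, e 0⁆ + l • e 0 := by
  refine ⟨?_, fun i => ?_, fun i => ?_, ?_⟩
  · simp only [actL1_entry, sum_sp, hx0, hxs, Fin.sum_univ_three]
    simp [confDer, confMatrix, sp]
    ring
  · simp only [actL1_entry, sum_sp, hx0, hxs, Fin.sum_univ_three]
    fin_cases i <;> simp [confDer, confMatrix, sp] <;> ring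
  · simp only [actL1_entry, sum_sp, hx0, hxs, Fin.sum_univ_three]
    fin_cases i <;> simp [confDer, confMatrix, sp] <;> ring
  · rw [actL1_der, sum_sp]
    simp [hx0, hxs, confDer, confMatrix_zero_zero]

theorem coef_inr (he : LinearIndependent R e) (F : B1 → R) {h : Fin 4 → R}
    (hh : ((atOne e F).1 0).2 = derOf e h) (b : GB0) :
    F (.inr b) = coefX (atOne e F) (fun _ => h) (.inr b) := by
  rw [atOne_zero] at hh
  cases b with
  | der μ => exact congrFun (derOf_injective he (h := fun μ => F (.inr (.der μ))) hh) μ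
  | conf => simp [coefX, atOne_zero, atOne_sp, confDer, confMatrix_zero_zero, confMatrix_zero_sp, boostCoeff]
  | boost i => simp [coefX, atOne_zero, atOne_sp, confDer, confMatrix_zero_zero, confMatrix_zero_sp]
  | rot i => simp [coefX, atOne_zero, confDer, confMatrix_sp_sp, fin3_add,
      (fin3_add_one_ne_add_two i).symm]

/-- Infinitesimal gauge fixing. -/
theorem exists_gauge_step (hW : Weighted e p W) (h0 : ∀ μ ν, ⁅e μ, e ν⁆ = derOf e (C μ ν))
    (hC : ∀ ν κ μ, C ν κ μ ∈ W 0) (hC0 : ∀ ν, C 0 ν = 0) (he : LinearIndependent R e) {g0 : GB1 → R}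
    (hp : ∀ i, g0 (.diag i) = p i) (hz : ∀ b, b.deg ≠ 0 → g0 b = 0)
    (hx0 : Supp e W (Set.Iic 0) 0 (gauged e 1 g0)) {α : Multi} (hα : α ≠ 0) {z : E1 R}
    (hs : Supp e W (Set.Iio α) α z) :
    ∃ y : GB0 → R, (∀ b, y b ∈ W α) ∧ (∀ b, ¬ b.deg < α → y b = 0) ∧
      ∃ h : GB1 → R, (∀ b, h b ∈ W α) ∧ (∀ b, ¬ b.deg < α → h b = 0) ∧
        br01 (∑ b, y b • b.elt e) (gauged e 1 g0) + z = gauged e 0 h := by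
  obtain ⟨f, hf, hf0, rfl⟩ := hs
  have h00 : ∀ μ, ⁅e 0, e μ⁆ = 0 := fun μ => by rw [h0, hC0]; simp [derOf]
  have hαp : 0 < α := pos_iff_ne_zero.2 hα
  have hsol : ∀ κ κ' c, κ ≤ κ' → (¬ κ' < α → c = 0) → c ∈ W α → ∃ y ∈ W α, (¬ κ' < α → y = 0) ∧
      e 0 y + dot p κ * y = c := fun κ κ' c h1 h2 hc => by
    by_cases h3 : κ' < α
    · obtain ⟨y, hy, h4⟩ := hW.solve (h1.trans h3.le) (h1.trans_lt h3).ne hc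
      exact ⟨y, hy, fun h => absurd h3 h, h4⟩
    · exact ⟨0, zero_mem _, fun _ => rfl, by simp [h2 h3]⟩
  have hd0 : dot p 0 = 0 := by simp [dot]
  obtain ⟨l, hl, hl0, hl1⟩ := hsol 0 0 _ le_rfl (fun h => absurd hαp h) (hf (.inr .conf))
  choose X hX hX0 hX1 using fun μ => hsol 0 0 (f (.inr (.der μ)) + Pi.single (M := fun _ => R) 0 l μ)
    le_rfl (fun h => absurd hαp h) (add_mem (hf _) (by
      rw [Pi.single_apply]; split_ifs
      exacts [hl, zero_mem _]))
  choose b hb hb0 hb1 using fun i => hsol (deg011 i) (deg011 i) _ le_rfl (hf0 (.inr (.boost i)))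
    (hf _)
  choose r hr hr0 hr1 using fun i => hsol 0 (deg011 i) _ zero_le (hf0 (.inr (.rot i))) (hf _)
  let y : GB0 → R := fun c => match c with
    | .der μ => X μ
    | .conf => l
    | .boost i => b i
    | .rot i => r i
  have hy : ∀ c, y c ∈ W α := fun c => by
    cases c
    exacts [hX _, hl, hb _, hr _]
  have hy0 : ∀ c, ¬ c.deg < α → y c = 0 := fun c hc => by
    cases c
    exacts [hX0 _ hc, hl0 hc, hb0 _ hc, hr0 _ hc]
  have hsum : ∑ c, y c • c.elt e = confDer l b r (derOf e X) := sum_GB0_elt e y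
  obtain ⟨F, hF, hF0, hF1⟩ := hx0.br01 hW h0 hC he hy hy0
  rw [add_zero] at hF hF0
  change _ = atOne e F at hF1
  refine ⟨y, hy, hy0, fun c => F (.inl c) + f (.inl c), fun c => add_mem (hF _) (hf _), fun c hc =>
    (congrArg₂ _ (hF0 (.inl c) hc) (hf0 (.inl c) hc)).trans (add_zero 0), ?_⟩
  have hg1 : (gauged e 1 g0).1 0 = confDer (∑ i, p i) 0 0 (e 0) := by
    rw [gauged_zero, map_one, one_smul]
    congr 1
    · simp only [hp]
    · exact funext fun i => hz _ (deg011_ne_zero i)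
  have hg2 : ∀ i, (gauged e 1 g0).1 (sp i) = confDer 0 (Pi.single i (p i)) 0 0 := fun i => by
    have hn : ∀ c j, c.num j ≠ 0 → g0 c = 0 := fun c j h =>
      hz c fun h0 => h (by rw [← GB1.deg_apply, h0]; rfl)
    have h1 : ∀ i : Fin 3, num011 i (i + 1) ≠ 0 ∧ num211 i i ≠ 0 := by decide
    have hc : ∀ i, g0 (.curv i) = 0 := fun i => hn _ i (by simp [GB1.num])
    rw [gauged_sp, confDer_inj]
    refine ⟨hn (.conf i) (i + 1) (h1 i).1, funext fun m => ?_, funext fun m => ?_, ?_⟩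
    · simp only [boostCoeff, Pi.single_apply, hn (.sym _) (_ + 1) (h1 _).1, hn (.asym _) _ (h1 _).2, hp]
      simp
    · simp only [rotCoeff, hc, hn (.rotK _) (_ + 1) (h1 _).1, hn (.rotJ _) (_ + 1) (h1 _).1]
      simp
    · simp only [frameDer, hn (.frame i _) (i + 1) (h1 i).1]
      simp
  obtain ⟨h1, h2, h3, h4⟩ := actL1_background (l := l) (b := b) (r := r) (X := derOf e X) hg1 hg2
  have hz1 : (atOne e F).1 = actL1 (confDer l b r (derOf e X)) (gauged e 1 g0).1 := by
    rw [← hF1, hsum, br01_eq]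
  have h5 : ((atOne e F).1 0).2 = derOf e fun μ => -e 0 (X μ) + Pi.single (M := fun _ => R) 0 l μ := by
    rw [hz1, h4, ← lie_skew, lie_zero_derOf h00, derOf_single, ← neg_one_smul R, smul_derOf, derOf_add]
    simp
  have key : ∀ c, F (.inr c) + f (.inr c) = 0 := fun c => by
    rw [coef_inr he F h5]
    cases c with
    | der μ =>
      have := hX1 μ
      rw [hd0] at this
      simp only [coefX]
      linear_combination -this
    | conf =>
      rw [hd0] at hl1
      simp only [coefX, hz1]
      linear_combination h1 - hl1
    | boost i =>
      have := hb1 i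
      rw [dot_deg011] at this
      simp only [coefX, hz1]
      linear_combination h2 i - this
    | rot i =>
      have := hr1 i
      rw [hd0] at this
      simp only [coefX, hz1]
      linear_combination h3 i - this
  have h6 : atOne e F + atOne e f = atOne e fun c => F c + f c := by
    simp only [atOne, add_smul, sum_add_distrib]
  have h7 : ∑ b, f b • B1.elt e b = atOne e f := rfl
  have h8 : theta0Mul0 (0 : E0 R) = 0 := Prod.ext (funext fun a => smul_zero _) rfl
  rw [hF1, h7, h6, atOne_eq]
  simp only [key, zero_smul, Finset.sum_const_zero, h8]
  generalize gauged e 0 _ = v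
  exact add_zero v

end GaugeFixing

section GaugeUniqueness

/-- Formal solutions with the same leading coefficients differ by a gauge transformation. -/
theorem exists_gaugeAct_eq_of_weighted (hW : Weighted e p W)
    (h0 : ∀ μ ν, ⁅e μ, e ν⁆ = derOf e (C μ ν)) (hC : ∀ ν κ μ, C ν κ μ ∈ W 0) (hC0 : ∀ ν, C 0 ν = 0)
    (he : LinearIndependent R e) {g0 : GB1 → R} (hp : ∀ i, g0 (.diag i) = p i)
    (hz : ∀ b, b.deg ≠ 0 → g0 b = 0) {x x' : Multi → E1 R} {f f' : Multi → B1 → R}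
    (hf : ∀ α b, ¬ b.deg ≤ α → f α b = 0) (hf' : ∀ α b, ¬ b.deg ≤ α → f' α b = 0)
    (hfW : ∀ α b, f α b ∈ W α) (hfW' : ∀ α b, f' α b ∈ W α)
    (hx : ∀ α, x α = ∑ b, f α b • b.elt e) (hx' : ∀ α, x' α = ∑ b, f' α b • b.elt e)
    (hl : ∀ b, f b.deg b = f' b.deg b) (hx0 : x 0 = gauged e 1 g0)
    (hmc : serBr11 x x = 0) (hmc' : serBr11 x' x' = 0) :
    ∃ r : Multi → GB0 → R, (∀ α b, r α b ∈ W α) ∧ (∀ α b, ¬ b.deg < α → r α b = 0) ∧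
      x' = gaugeAct (gauge e r) x := by
  have hS : ∀ α, Supp e W (Set.Iic α) α (x α) := fun α => ⟨f α, hfW α, hf α, hx α⟩
  have hdiff : ∀ α, Supp e W (Set.Iio α) α (x α - x' α) := fun α => by
    refine ⟨fun b => f α b - f' α b, fun b => sub_mem (hfW α b) (hfW' α b), fun b hb => ?_, ?_⟩
    · by_cases h1 : b.deg ≤ α
      · have h2 : b.deg = α := by_contra fun h2 => hb (lt_of_le_of_ne h1 h2)
        exact sub_eq_zero.2 (h2 ▸ hl b)
      · exact sub_eq_zero.2 ((hf α b h1).trans (hf' α b h1).symm)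
    · simp only [hx, hx', sub_smul, sum_sub_distrib]
  have h00 : x 0 = x' 0 := by
    obtain ⟨h, -, h1, h2⟩ := hdiff 0
    rw [← sub_eq_zero, h2]
    exact sum_eq_zero fun b _ => by rw [h1 b (not_lt_zero : ¬ b.deg < 0), zero_smul]
  let trunc : Multi → (Multi → GB0 → R) → Multi → GB0 → R := fun α r β => if β < α then r β else 0
  obtain ⟨r, hr⟩ := exists_of_local (X := GB0 → R) (fun α r y => (∀ b, y b ∈ W α) ∧
    (∀ b, ¬ b.deg < α → y b = 0) ∧ (α ≠ 0 → ∃ h : GB1 → R, (∀ b, h b ∈ W α) ∧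
      (∀ b, ¬ b.deg < α → h b = 0) ∧ br01 (∑ b, y b • b.elt e) (gauged e 1 g0) +
        (gaugeAct (gauge e (trunc α r)) x α - x' α) = gauged e 0 h))
    (fun α r r' y h => by
      have : trunc α r = trunc α r' := funext fun β => by
        simp only [trunc]; split_ifs with h1
        exacts [h β h1, rfl]
      rw [this]; exact id)
    (fun α r h => by
      by_cases hα : α = 0
      · exact ⟨0, fun _ => zero_mem _, fun _ _ => rfl, fun h => absurd hα h⟩
      have h1 : ∀ β b, trunc α r β b ∈ W β := fun β b => by
        simp only [trunc]; split_ifs with h1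
        exacts [(h β h1).1 b, zero_mem _]
      have h2 : ∀ β b, ¬ b.deg < β → trunc α r β b = 0 := fun β b hb => by
        simp only [trunc]; split_ifs with h1
        exacts [(h β h1).2.1 b hb, rfl]
      have h3 := (supp_gaugeAct_sub hW h0 hC he hS h1 h2 α).add (hdiff α)
      rw [sub_add_sub_cancel] at h3
      obtain ⟨y, hy, hy0, h4⟩ := exists_gauge_step hW h0 hC hC0 he hp hz (hx0 ▸ hS 0) hα h3
      exact ⟨y, hy, hy0, fun _ => h4⟩)
  refine ⟨r, fun α => (hr α).1, fun α => (hr α).2.1, ?_⟩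
  have ha0 : gauge e r 0 = 0 :=
    sum_eq_zero fun b _ => by rw [(hr 0).2.1 b not_lt_zero, zero_smul]
  have hmy := serBr11_gaugeAct (a := gauge e r)
    (fun α => sum_mem fun b _ => (CDer R).smul_mem _ (b.elt_mem_CDer e)) ha0 hmc
  have hy0 : gaugeAct (gauge e r) x 0 = x 0 := by
    rw [gaugeAct_eq_range (n := 0) ha0 x (by simp)]
    simp
  symm
  funext α
  induction α using WellFoundedLT.induction with
  | ind α ih =>
  by_cases hα : α = 0
  · rw [hα, hy0, h00]
  obtain ⟨h, hh, hh0, h1⟩ := (hr α).2.2 hα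
  have h2 := gaugeAct_eq_add (a' := gauge e (trunc α r)) ha0 x hα
    (fun β hβ => by simp only [gauge, trunc, if_pos hβ])
    (by simp only [gauge, trunc, lt_irrefl, if_false, Pi.zero_apply, zero_smul, Finset.sum_const_zero])
  have h3 : gaugeAct (gauge e r) x α - x' α = gauged e 0 h := by
    have hg : ∑ b, r α b • GB0.elt e b = gauge e r α := rfl
    rw [hg] at h1
    rw [h2, hx0]
    generalize br01 (gauge e r α) (gauged e 1 g0) = u at h1 ⊢
    generalize gaugeAct (gauge e (trunc α r)) x α = v at h1 ⊢
    rw [add_sub_assoc, h1]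
  have h4 := congrArg toE2 (serPre_sub hα ih)
  rw [map_sub, ← serBr11_eq, ← serBr11_eq, hmy, hmc', h3, hy0, hx0] at h4
  have h5 := gauged_rigid hW h0 hC0 he hp hz hα hh hh0 (h4.symm.trans (sub_zero 0))
  have h6 : gauged e 0 (0 : GB1 → R) = 0 := by simp [gauged]
  rw [← sub_eq_zero, h3, h5, h6]

end GaugeUniqueness

section Smooth

theorem exists_gaugeAct_eq {T : FinalData L} (hT : T.leading ∈ MCGaugedPos L)
    {γ γ' : Multi → E1 (SmoothOmega M)} (hγ : γ ∈ MCPp L T.p) (hγ' : γ' ∈ MCPp L T.p)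
    (h : toA L.der γ = T.leading) (h' : toA L.der γ' = T.leading) :
    ∃ a ∈ sPp0 L T.p, γ' = gaugeAct a γ := by
  have he := linearIndependent_of_mem hT
  have hB := linearIndependent_B1 _ he
  obtain ⟨T', hT', hd⟩ := T.exists_standard
  have h0 : ∀ μ ν, ⁅L.der μ, L.der ν⁆ = derOf L.der (T'.struct μ ν) := fun μ ν => by
    rw [← hd]; exact T'.lie_der μ ν
  have hW := T'.weighted (hT' ▸ T.pos_of_leading hT)
  rw [hd, hT'] at hW
  have hp0 : (0 : SmoothOmega M) ∈ polyTau (M := M) := mem_polyTau.2 ⟨0, tauEval_zero.symm⟩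
  have hw : ∀ {f : SmoothOmega M} {α}, (∃ c ∈ polyTau, f = weight T.p α * c) ↔
      f ∈ polyWeight T.p α := fun {f α} => by
    rw [mem_polyWeight]
    constructor
    · rintro ⟨c, hc, rfl⟩
      obtain ⟨q, rfl⟩ := mem_polyTau.1 hc
      exact ⟨q, rfl⟩
    · rintro ⟨q, rfl⟩
      exact ⟨_, mem_polyTau.2 ⟨q, rfl⟩, rfl⟩
  obtain ⟨f, hf, hfc, hfx⟩ := exists_of_mem_reesBar hB hγ.1 hp0
  obtain ⟨f', hf', hfc', hfx'⟩ := exists_of_mem_reesBar hB hγ'.1 hp0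
  have hl : ∀ b : B1, f b.deg b = T.coeff b :=
    congrFun (ofCoeff_injective _ hB ((toA_eq_ofCoeff _ hf hfx).symm.trans h))
  have hl' : ∀ b : B1, f' b.deg b = T.coeff b :=
    congrFun (ofCoeff_injective _ hB ((toA_eq_ofCoeff _ hf' hfx').symm.trans h'))
  have hz : ∀ b : B1, b.deg ≠ 0 → f 0 b = 0 := fun b hb =>
    hf 0 b fun h => hb (le_antisymm h zero_le)
  have hx0 : γ 0 = gauged L.der 1 fun b => f 0 (.inl b) := by
    have h1 : ∀ b : GB0, f 0 (.inr b) = if b = .der 0 then 1 else 0 := fun b => by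
      by_cases hb : b.deg = 0
      · have h2 := hl (.inr b)
        rw [T.coeff_eq] at h2
        change f b.deg _ = _ at h2
        rw [hb] at h2
        exact h2
      · rw [hz (.inr b) hb, if_neg fun h : b = .der 0 => hb (h ▸ rfl)]
    have h2 := atOne_eq L.der (f 0)
    simp only [h1, ite_smul, one_smul, zero_smul, Finset.sum_ite_eq', Finset.mem_univ, if_true] at h2
    rw [hfx]
    refine h2.trans ?_
    simp only [gauged, map_zero, zero_smul, zero_add, map_one, one_smul]
    exact add_comm _ _
  obtain ⟨r, hr, hr0, h1⟩ := exists_gaugeAct_eq_of_weighted (C := T'.struct)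
    (p := fun i => pull (T.p i)) hW h0 (hT' ▸ T'.struct_mem) T'.struct_zero he
    (fun i => hl (.inl (.diag i))) (fun b hb => hz (.inl b) hb) hf hf'
    (fun α b => hw.1 (hfc α b)) (fun α b => hw.1 (hfc' α b)) hfx hfx'
    (fun b => (hl b).trans (hl' b).symm) hx0 hγ.2.2 hγ'.2.2
  exact ⟨_, mem_sReesBar_of_coeff r (fun α b hb => hr0 α b fun h => hb h.le)
    (fun b => hr0 _ b (lt_irrefl _)) hp0 (fun α b => hw.2 (hr α b)) (isUnit_weight T.p)
    (weight_add T.p), h1⟩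

end Smooth

end BKL

end

open BKL in
theorem theorem3 {M : Type*} [TopologicalSpace M] [ChartedSpace (EuclideanSpace ℝ (Fin 3)) M]
    [IsManifold (𝓡 3) ∞ M] [CompactSpace M] [T2Space M] (L : SmoothFrame M) :
    -- every element is given by a tuple
    (∀ x ∈ MCGaugedPos L, ∃ T : FinalData L, T.leading = x) ∧
    -- existence and uniqueness up to gauge in the subalgebra
    (∀ x ∈ MCGaugedPos L, ∀ T : FinalData L, T.leading = x →
      (∃ γ ∈ MCPp L T.p, toA L.der γ = x) ∧
      ∀ γ ∈ MCPp L T.p, ∀ γ' ∈ MCPp L T.p, toA L.der γ = x → toA L.der γ' = x →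
        ∃ a ∈ sPp0 L T.p, γ' = gaugeAct a γ) ∧
    -- the map to formal solutions, with universal polynomials for the coefficients
    ∃ (S : MCGaugedPos L → MCP L.der) (Q : Multi → GB1 → Polynomial (MvPolynomial Jet ℝ)),
      (∀ α b k, (Q α b).coeff k ∈ MvPolynomial.supported ℝ {v | v.order ≤ α.degree}) ∧
      ∀ x : MCGaugedPos L, toA L.der (S x).1 = x.1 ∧
        ∀ T : FinalData L, T.leading = x.1 →
          (S x).1 ∈ MCPp L T.p ∧
          (∀ α : Multi, α ≠ 0 → ∃ f : GB1 → SmoothOmega M,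
            (∀ b, ¬ b.deg ≤ α → f b = 0) ∧
            (S x).1 α = weight T.p α • ∑ b, f b • b.elt L.der ∧
            ∀ b z, f b z =
              ((Q α b).map (MvPolynomial.eval (Jet.value T z.2))).eval (tau z)) ∧
          ∀ α : Multi, Odd α.degree → (S x).1 α = 0 := by
  refine ⟨exists_leading_eq, fun x hx T hT => ⟨?_, fun γ hγ γ' hγ' h h' => ?_⟩,
    exists_formalMap exists_leading_eq⟩
  · obtain ⟨S, Q, -, hS⟩ := exists_formalMap (exists_leading_eq (L := L))
    exact ⟨(S ⟨x, hx⟩).1, ((hS ⟨x, hx⟩).2 T hT).1, (hS ⟨x, hx⟩).1⟩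
  · exact exists_gaugeAct_eq (T := T) (hT.symm ▸ hx) hγ hγ' (h.trans hT.symm) (h'.trans hT.symm)
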